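/- Let $k$ be a commutative ring, $A$ a $k$-algebra, $H$ a Hopf $k$-algebra, all tensor products over $k$, and write $\Delta(h)=h^{(1)}\otimes h^{(2)}$. Let $(h,a)\mapsto a^h$ be a weak action of $H$ on $A$ (a $k$-bilinear map with $(ab)^h=a^{h^{(1)}}b^{h^{(2)}}$, $1^h=\epsilon(h)1$, $a^1=a$) and $f:H\otimes H\to A$ a $k$-linear map such that $E=A\#_fH$, i.e. $A\otimes H$ with the multiplication $(a\# h)(b\# l)=a\,b^{h^{(1)}}f(h^{(2)},l^{(1)})\# h^{(3)}l^{(2)}$, is associative with identity $1\#1$ (a crossed product; $f$ need not be convolution invertible). Let $M$ be an $E$-bimodule on which $k$ acts centrally. **Notation.** $\overline B=B/k$ for a $k$-algebra $B$. For $\mathbf h=h_1\otimes\cdots\otimes h_s$ and $i\le j$ write $\mathbf h_{ij}=h_i\otimes\cdots\otimes h_j$, $\mathfrak h_{ij}=h_i\cdots h_j$, and $a^{\overline{\mathbf h}}=(\cdots((a^{h_s})^{h_{s-1}})\cdots)^{h_1}$; similarly $\mathbf a_{ij}=a_i\otimes\cdots\otimes a_j$. For $\mathbf a=a_1\otimes\cdots\otimes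 a_r$ put $\mathbf a^{\overline{\mathbf h}}=a_1^{\overline{\mathbf h^{(1)}}}\otimes\cdots\otimes a_r^{\overline{\mathbf h^{(r)}}}$ (and $\mathbf a^{h}$ for $s=1$). For $l\ge 1$, $r\ge0$ define $F_r^{(l)}(\mathbf h\otimes\mathbf a)\in A^{\otimes(r+l-1)}$, for $\mathbf h\in H^{\otimes l}$, $\mathbf a\in A^{\otimes r}$, by $F^{(1)}_r(h\otimes\mathbf a)=\mathbf a^h$ (so $F^{(1)}_0=\epsilon$) and $$F^{(l+1)}_r(\mathbf h\otimes\mathbf a)=\sum_{j=1}^{l}\sum_{i=0}^{r}(-1)^{il+j}\,\mathbf a_{1i}^{\overline{\mathbf h^{(1)}}}\otimes f(h_j^{(2)},h_{j+1}^{(2)})^{\overline{\mathbf h_{1,j-1}^{(2)}}}\otimes F^{(l)}_{r-i}\bigl(\mathbf h_{1,j-1}^{(3)}\otimes h_j^{(3)}h_{j+1}^{(3)}\otimes\mathbf h_{j+2,l+1}^{(2)}\otimes\mathbf a_{i+1,r}\bigr).$$ **The complex $\widehat X^*(E,M)$.** Let $\widehat X^n=\bigoplus_{r+s=n}\operatorname{Hom}_k(\overline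 H^{\otimes s}\otimes\overline A^{\otimes r},M)$ and let $\widehat d^{\,n}:\widehat X^{n-1}\to\widehat X^{n}$ be $\sum_{r+s=n}\sum_{0\le l\le s,\ r+l>0}\widehat d_l^{\,rs}$, where $\widehat d_l^{\,rs}:\operatorname{Hom}_k(\overline H^{\otimes(s-l)}\otimes\overline A^{\otimes(r+l-1)},M)\to\operatorname{Hom}_k(\overline H^{\otimes s}\otimes\overline A^{\otimes r},M)$ sends $\varphi$ to the map whose value on $\mathbf h\otimes\mathbf a=h_1\otimes\cdots\otimes h_s\otimes a_1\otimes\cdots\otimes a_r$ is $$\widehat d_0^{\,rs}(\varphi)=a_1^{\overline{\mathbf h^{(1)}}}\varphi(\mathbf h^{(2)}\otimes\mathbf a_{2r})+\sum_{i=1}^{r-1}(-1)^i\varphi(\mathbf h\otimes\mathbf a_{1,i-1}\otimes a_ia_{i+1}\otimes\mathbf a_{i+2,r})+(-1)^r\varphi(\mathbf h\otimes\mathbf a_{1,r-1})a_r,$$ $$\begin{aligned}\widehat d_1^{\,rs}(\varphi)&=(-1)^r(1\#h_1)\varphi(\mathbf h_{2s}\otimes\mathbf a)+\sum_{i=1}^{s-1}(-1)^{r+i}f(h_i^{(1)},h_{i+1}^{(1)})^{\overline{\mathbf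 h_{1,i-1}^{(1)}}}\varphi(\mathbf h_{1,i-1}^{(2)}\otimes h_i^{(2)}h_{i+1}^{(2)}\otimes\mathbf h_{i+2,s}\otimes\mathbf a)\\&\quad+(-1)^{r+s}\varphi(\mathbf h_{1,s-1}\otimes\mathbf a^{h_s^{(1)}})(1\#h_s^{(2)}),\end{aligned}$$ $$\widehat d_l^{\,rs}(\varphi)=(-1)^{l(r+s)}\varphi\bigl(\mathbf h_{1,s-l}\otimes F^{(l)}_r(\mathbf h_{s-l+1,s}^{(1)}\otimes\mathbf a)\bigr)(1\#\mathfrak h_{s-l+1,s}^{(2)})\qquad(l\ge2).$$ **The complex $(X_*,d_*)$.** Let $X_{rs}=E\otimes\overline H^{\otimes s}\otimes\overline A^{\otimes r}\otimes E$, $X_n=\bigoplus_{r+s=n}X_{rs}$ and $d_n=\sum_{r+s=n}\sum_{0\le l\le s,\ r+l>0}d^l_{rs}$, where $d^l_{rs}:X_{rs}\to X_{r+l-1,s-l}$ are the $E$-bimodule maps determined by their values on $\mathbf x=1\otimes\mathbf h\otimes\mathbf a\otimes1$ as follows. For $r\ge1$, $$\begin{aligned}d^0_{rs}(\mathbf x)&=a_1^{\overline{\mathbf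 h^{(1)}}}\otimes\mathbf h^{(2)}\otimes\mathbf a_{2r}\otimes1+\sum_{i=1}^{r-1}(-1)^i\,1\otimes\mathbf h\otimes\mathbf a_{1,i-1}\otimes a_ia_{i+1}\otimes\mathbf a_{i+2,r}\otimes1\\&\quad+(-1)^r\,1\otimes\mathbf h\otimes\mathbf a_{1,r-1}\otimes a_r.\end{aligned}$$ For $l\ge1$: $d^1_{0s}(\mathbf x)=-\sigma^0\partial_s\mu_s(\mathbf x)$; $d^l_{0s}(\mathbf x)=-\sum_{j=1}^{l-1}\sigma^0d^{l-j}_{j-1,s-j}d^j_{0s}(\mathbf x)$ for $l>1$; and $d^l_{rs}(\mathbf x)=-\sum_{j=0}^{l-1}\sigma^0d^{l-j}_{r+j-1,s-j}d^j_{rs}(\mathbf x)$ for $r>0$. Here $Y_s=E\otimes\overline H^{\otimes s}\otimes H$, and, viewing the left factor $E$ as $A\otimes H\ni a_0\otimes h_0$ and with $\mathbf h=h_0\otimes\cdots\otimes h_{s+1}$, $$\mu_s(a_0\otimes\mathbf h_{0s}\otimes a_1\otimes h_{s+1})=a_0a_1^{\overline{\mathbf h_{0s}^{(1)}}}\otimes\mathbf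 h_{0s}^{(2)}\otimes h_{s+1}\qquad(X_{0s}\to Y_s),$$ $$\partial_s(a\otimes\mathbf h)=\sum_{i=0}^s(-1)^{i+1}a\,f(h_i^{(1)},h_{i+1}^{(1)})^{\overline{\mathbf h_{0,i-1}^{(1)}}}\otimes\mathbf h_{0,i-1}^{(2)}\otimes h_i^{(2)}h_{i+1}^{(2)}\otimes\mathbf h_{i+2,s+1}\qquad(Y_s\to Y_{s-1}),$$ and $\sigma^0:Y_s\to X_{0s}$, $\sigma^0:X_{rs}\to X_{r+1,s}$ are given by $a_0\otimes\mathbf h_{0s}\otimes h_{s+1}\mapsto a_0\otimes\mathbf h_{0s}\otimes(1\#h_{s+1})$ and $e\otimes\mathbf h\otimes\mathbf a\otimes(b\#h)\mapsto(-1)^{r+1}e\otimes\mathbf h\otimes(\mathbf a\otimes b)\otimes(1\#h)$. **Theorem.** The maps $\widehat d_l^{\,rs}$ and $d^l_{rs}$ are well defined and uniquely determined by these formulas, and $\widehat X^*(E,M)$ and $(X_*,d_*)$ are complexes. For each $n\ge0$ the map $\widehat\theta:\widehat X^n\to\operatorname{Hom}_{E^e}(X_n,M)$, $\widehat\theta(\varphi)(x\otimes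 w\otimes y)=x\,\varphi(w)\,y$, is bijective, and $\widehat\theta(\widehat d\varphi)=\widehat\theta(\varphi)\circ d$, so that $\widehat X^*(E,M)\simeq\operatorname{Hom}_{E^e}((X_*,d_*),M)$. The cohomology of $\widehat X^*(E,M)$ is the Hochschild cohomology of $E$ with coefficients in $M$: for every $n\ge0$, $$H^n(E,M)\cong H^n(\widehat X^*(E,M))$$ as $k$-modules, where $H^n(E,M)$ is the cohomology of the Hochschild complex $\operatorname{Hom}_k(E^{\otimes n},M)$, $(b\varphi)(x_1\otimes\cdots\otimes x_{n+1})=x_1\varphi(x_2\otimes\cdots\otimes x_{n+1})+\sum_{i=1}^n(-1)^i\varphi(\cdots\otimes x_ix_{i+1}\otimes\cdots)+(-1)^{n+1}\varphi(x_1\otimes\cdots\otimes x_n)x_{n+1}$. -/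

import Mathlib

open scoped TensorProduct
open TensorProduct

noncomputable section

/-! ### Tensor powers -/

namespace TP

section
variable (k : Type*) {V : Type*} [CommRing k] [AddCommGroup V] [Module k V]

/-- `v ⊗ (v₁ ⊗ ⋯ ⊗ vₙ) ↦ v ⊗ v₁ ⊗ ⋯ ⊗ vₙ`. -/
def cons (n : ℕ) : V ⊗[k] (⨂[k]^n V) ≃ₗ[k] ⨂[k]^(n + 1) V :=
  (TensorProduct.congr (PiTensorProduct.subsingletonEquiv (0 : Fin 1)).symm
    (LinearEquiv.refl k _)).trans
    ((TensorPower.mulEquiv (n := 1) (m := n)).trans (TensorPower.cast k V (Nat.add_comm 1 n)))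

/-- `(v₁ ⊗ ⋯ ⊗ vₙ) ⊗ v ↦ v₁ ⊗ ⋯ ⊗ vₙ ⊗ v`. -/
def snoc (n : ℕ) : (⨂[k]^n V) ⊗[k] V ≃ₗ[k] ⨂[k]^(n + 1) V :=
  (TensorProduct.congr (LinearEquiv.refl k _)
    (PiTensorProduct.subsingletonEquiv (0 : Fin 1)).symm).trans
    (TensorPower.mulEquiv (n := n) (m := 1))

theorem cons_tprod (n : ℕ) (v : V) (w : Fin n → V) :
    cons k n (v ⊗ₜ PiTensorProduct.tprod k w) = PiTensorProduct.tprod k (Fin.cons v w) := by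
  have h1 : (PiTensorProduct.subsingletonEquiv (R := k) (0 : Fin 1)).symm v
      = PiTensorProduct.tprod k (fun _ : Fin 1 => v) := by
    rw [LinearEquiv.symm_apply_eq]; simp
  simp only [cons, LinearEquiv.trans_apply, TensorProduct.congr_tmul, h1, LinearEquiv.refl_apply]
  rw [← TensorPower.gMul_def, TensorPower.tprod_mul_tprod, TensorPower.cast_tprod]
  congr 1
  funext i
  refine Fin.cases ?_ (fun j => ?_) i
  · have : Fin.cast (Nat.add_comm 1 n).symm (0 : Fin (n + 1)) = Fin.castAdd n (0 : Fin 1) := by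
      ext; simp
    simp [Function.comp, this, -Fin.cast_zero]
  · have : Fin.cast (Nat.add_comm 1 n).symm j.succ = Fin.natAdd 1 j := by
      ext; simp [Nat.add_comm]
    simp only [Function.comp, this, Fin.append_right, Fin.cons_succ]

theorem snoc_tprod (n : ℕ) (v : V) (w : Fin n → V) :
    snoc k n (PiTensorProduct.tprod k w ⊗ₜ v)
      = PiTensorProduct.tprod k (Fin.snoc (α := fun _ => V) w v) := by
  have h1 : (PiTensorProduct.subsingletonEquiv (R := k) (0 : Fin 1)).symm v
      = PiTensorProduct.tprod k (fun _ : Fin 1 => v) := by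
    rw [LinearEquiv.symm_apply_eq]; simp
  simp only [snoc, LinearEquiv.trans_apply, TensorProduct.congr_tmul, h1, LinearEquiv.refl_apply]
  rw [← TensorPower.gMul_def, TensorPower.tprod_mul_tprod]
  congr 1
  exact Fin.append_right_eq_snoc w (fun _ => v)

end

section
variable (k : Type*) (B : Type*) [CommRing k] [Ring B] [Algebra k B]

/-- Multiplication of two neighbouring factors:
`b₀ ⊗ ⋯ ⊗ bₙ ↦ b₀ ⊗ ⋯ ⊗ bᵢ bᵢ₊₁ ⊗ ⋯ ⊗ bₙ`; only used for `i < n`. -/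
def mulAt : (n i : ℕ) → (⨂[k]^(n + 1) B →ₗ[k] ⨂[k]^n B)
  | 0, _ => 0
  | n + 1, 0 =>
    (cons k n).toLinearMap ∘ₗ (LinearMap.mul' k B).rTensor _ ∘ₗ
      (TensorProduct.assoc k B B _).symm.toLinearMap ∘ₗ
      (cons k n).symm.toLinearMap.lTensor B ∘ₗ (cons k (n + 1)).symm.toLinearMap
  | n + 1, i + 1 =>
    (cons k n).toLinearMap ∘ₗ (mulAt n i).lTensor B ∘ₗ (cons k (n + 1)).symm.toLinearMap

/-- The quotient module `B / k·1`. -/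
def Bar : Type _ := B ⧸ LinearMap.range (Algebra.linearMap k B)

instance : AddCommGroup (Bar k B) :=
  inferInstanceAs (AddCommGroup (B ⧸ LinearMap.range (Algebra.linearMap k B)))

instance : Module k (Bar k B) :=
  inferInstanceAs (Module k (B ⧸ LinearMap.range (Algebra.linearMap k B)))

/-- The projection `B → B / k·1`. -/
def barMk : B →ₗ[k] Bar k B := (LinearMap.range (Algebra.linearMap k B)).mkQ

/-- The projection `B^{⊗ n} → (B / k)^{⊗ n}`. -/
def barPow (n : ℕ) : (⨂[k]^n B) →ₗ[k] ⨂[k]^n (Bar k B) :=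
  PiTensorProduct.map fun _ => barMk k B

end

end TP

/-! ### Free bimodules `B ⊗ V ⊗ B`, bimodule homomorphisms, cohomology, Hochschild cohomology -/

section Bimodule

variable {k : Type*} {B : Type*} [CommRing k] [Ring B] [Algebra k B]

/-- The underlying module of the `B`-bimodule `B ⊗ V ⊗ B`. -/
abbrev Env (k B V : Type*) [CommRing k] [Ring B] [Algebra k B] [AddCommGroup V] [Module k V] :
    Type _ := B ⊗[k] (V ⊗[k] B)

section
variable {V : Type*} [AddCommGroup V] [Module k V]

/-- Left multiplication by `b` on `B ⊗ V ⊗ B`. -/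
def envLeft (b : B) : Env k B V →ₗ[k] Env k B V := (LinearMap.mulLeft k b).rTensor _

/-- Right multiplication by `b` on `B ⊗ V ⊗ B`. -/
def envRight (b : B) : Env k B V →ₗ[k] Env k B V :=
  ((LinearMap.mulRight k b).lTensor V).lTensor B

/-- `b ⊗ v ↦ b ⊗ v ⊗ 1`. -/
def envL : B ⊗[k] V →ₗ[k] Env k B V := ((TensorProduct.mk k V B).flip 1).lTensor B

/-- `v ⊗ b ↦ 1 ⊗ v ⊗ b`. -/
def envR : V ⊗[k] B →ₗ[k] Env k B V := TensorProduct.mk k B (V ⊗[k] B) 1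

/-- `v ↦ 1 ⊗ v ⊗ 1`. -/
def envGen : V →ₗ[k] Env k B V := envR ∘ₗ (TensorProduct.mk k V B).flip 1

end

variable {M : Type*} [AddCommGroup M] [Module k M] [Module B M] [Module Bᵐᵒᵖ M]
  [IsScalarTower k B M] [IsScalarTower k Bᵐᵒᵖ M]

/-- The left action `(b, m) ↦ b m`, as a bilinear map. -/
def leftAct (k B M : Type*) [CommRing k] [Ring B] [Algebra k B] [AddCommGroup M] [Module k M]
    [Module B M] [IsScalarTower k B M] : B →ₗ[k] M →ₗ[k] M :=
  (Algebra.lsmul k k M).toLinearMap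

/-- The right action `(b, m) ↦ m b`, as a bilinear map. -/
def rightAct (k B M : Type*) [CommRing k] [Ring B] [Algebra k B] [AddCommGroup M] [Module k M]
    [Module Bᵐᵒᵖ M] [IsScalarTower k Bᵐᵒᵖ M] : B →ₗ[k] M →ₗ[k] M :=
  (Algebra.lsmul k k M : Bᵐᵒᵖ →ₐ[k] Module.End k M).toLinearMap ∘ₗ
    (MulOpposite.opLinearEquiv k : B ≃ₗ[k] Bᵐᵒᵖ).toLinearMap

/-- For `φ : V → M` and a `B`-bimodule `M`, the map `B ⊗ V ⊗ B → M` given by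
`b ⊗ v ⊗ b' ↦ b φ(v) b'`. -/
def bimodEval {V : Type*} [AddCommGroup V] [Module k V] (φ : V →ₗ[k] M) : Env k B V →ₗ[k] M :=
  TensorProduct.lift (leftAct k B M) ∘ₗ
    (TensorProduct.lift ((rightAct k B M).flip ∘ₗ φ)).lTensor B

theorem bimodEval_tmul {V : Type*} [AddCommGroup V] [Module k V] (φ : V →ₗ[k] M)
    (b b' : B) (v : V) :
    bimodEval φ (b ⊗ₜ[k] (v ⊗ₜ[k] b')) = b • MulOpposite.op b' • φ v := rfl

/-- `bimodEval`, as a linear map in `φ`. -/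
def bimodEvalₗ {V : Type*} [AddCommGroup V] [Module k V] :
    (V →ₗ[k] M) →ₗ[k] (Env k B V →ₗ[k] M) where
  toFun φ := bimodEval φ
  map_add' φ ψ := by
    ext b v b'
    simp [bimodEval_tmul]
  map_smul' c φ := by
    ext b v b'
    simp only [TensorProduct.AlgebraTensorModule.curry_apply, LinearMap.restrictScalars_self,
      TensorProduct.curry_apply, bimodEval_tmul, LinearMap.smul_apply, RingHom.id_apply]
    rw [show b • MulOpposite.op b' • c • φ v = leftAct k B M b (rightAct k B M b' (c • φ v)) from rfl,
      map_smul, map_smul]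
    rfl

section Cohomology

variable {C : ℕ → Type*} [∀ n, AddCommGroup (C n)] [∀ n, Module k (C n)]

/-- The coboundaries in degree `n` of a cochain complex `C⁰ → C¹ → C² → ⋯`. -/
def coboundaries (d : ∀ n, C n →ₗ[k] C (n + 1)) : (n : ℕ) → Submodule k (C n)
  | 0 => ⊥
  | n + 1 => LinearMap.range (d n)

/-- The cohomology `ker dⁿ / im dⁿ⁻¹` of a cochain complex `C⁰ → C¹ → C² → ⋯`. -/
abbrev Cohomology (d : ∀ n, C n →ₗ[k] C (n + 1)) (n : ℕ) : Type _ :=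
  LinearMap.ker (d n) ⧸ (coboundaries d n).submoduleOf (LinearMap.ker (d n))

end Cohomology

/-- `b₁ ⊗ ⋯ ⊗ bₙ₊₁ ↦ b₁ ⊗ (b₂ ⊗ ⋯ ⊗ bₙ₊₁) ⊗ 1 +
∑_{i=1}^{n} (-1)ⁱ 1 ⊗ (b₁ ⊗ ⋯ ⊗ bᵢbᵢ₊₁ ⊗ ⋯ ⊗ bₙ₊₁) ⊗ 1 + (-1)ⁿ⁺¹ 1 ⊗ (b₁ ⊗ ⋯ ⊗ bₙ) ⊗ bₙ₊₁`. -/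
def hochschildDelta (k B : Type*) [CommRing k] [Ring B] [Algebra k B] (n : ℕ) :
    (⨂[k]^(n + 1) B) →ₗ[k] Env k B (⨂[k]^n B) :=
  envL ∘ₗ (TP.cons k n).symm.toLinearMap
  + ∑ i ∈ Finset.range n, (-1 : k) ^ (i + 1) • (envGen ∘ₗ TP.mulAt k B n i)
  + (-1 : k) ^ (n + 1) • (envR ∘ₗ (TP.snoc k n).symm.toLinearMap)

/-- The Hochschild coboundary `Hom_k(B^{⊗ n}, M) → Hom_k(B^{⊗ (n+1)}, M)`,
`(bφ)(b₁ ⊗ ⋯ ⊗ bₙ₊₁) = b₁ φ(b₂ ⊗ ⋯) + ∑ (-1)ⁱ φ(⋯ ⊗ bᵢbᵢ₊₁ ⊗ ⋯) + (-1)ⁿ⁺¹ φ(b₁ ⊗ ⋯ ⊗ bₙ) bₙ₊₁`. -/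
def hochschildD (k B M : Type*) [CommRing k] [Ring B] [Algebra k B] [AddCommGroup M] [Module k M]
    [Module B M] [Module Bᵐᵒᵖ M] [IsScalarTower k B M] [IsScalarTower k Bᵐᵒᵖ M] (n : ℕ) :
    ((⨂[k]^n B) →ₗ[k] M) →ₗ[k] ((⨂[k]^(n + 1) B) →ₗ[k] M) :=
  (LinearMap.lcomp k M (hochschildDelta k B n)) ∘ₗ bimodEvalₗ

/-- The Hochschild cohomology `Hⁿ(B, M)` of the `k`-algebra `B` with coefficients in the
`B`-bimodule `M`. -/
abbrev HochschildCohomology (k B M : Type*) [CommRing k] [Ring B] [Algebra k B] [AddCommGroup M]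
    [Module k M] [Module B M] [Module Bᵐᵒᵖ M] [IsScalarTower k B M] [IsScalarTower k Bᵐᵒᵖ M]
    (n : ℕ) : Type _ :=
  Cohomology (C := fun n => (⨂[k]^n B) →ₗ[k] M) (hochschildD k B M) n

end Bimodule

/-! ### Weak actions and crossed products -/

/-- A weak action `h, a ↦ a^h = act h a` of the bialgebra `H` on the algebra `A`. -/
structure WeakAction (k A H : Type*) [CommRing k] [Ring A] [Algebra k A] [Ring H]
    [Bialgebra k H] where
  /-- `act h a = a^h` -/
  act : H →ₗ[k] A →ₗ[k] A
  /-- `(ab)^h = a^{h⁽¹⁾} b^{h⁽²⁾}` -/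
  act_mul : ∀ (h : H) (a b : A), act h (a * b) =
    LinearMap.mul' k A (TensorProduct.map (act.flip a) (act.flip b) (Coalgebra.comul (R := k) h))
  /-- `1^h = ε(h) 1` -/
  act_one : ∀ h : H, act h 1 = algebraMap k A (Coalgebra.counit (R := k) h)
  /-- `a^1 = a` -/
  one_act : ∀ a : A, act 1 a = a

section Weak

variable {k A H : Type*} [CommRing k] [Ring A] [Algebra k A] [Ring H] [Bialgebra k H]

namespace WeakAction

variable (S : WeakAction k A H)

/-- `h ⊗ a ↦ a^{h⁽¹⁾} ⊗ h⁽²⁾`. -/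
def push : H ⊗[k] A →ₗ[k] A ⊗[k] H :=
  (TensorProduct.lift S.act).rTensor H ∘ₗ (TensorProduct.rightComm k H H A).toLinearMap ∘ₗ
    (Coalgebra.comul (R := k) (A := H)).rTensor A

/-- `𝐡 ⊗ a ↦ a^{𝐡̄⁽¹⁾} ⊗ 𝐡⁽²⁾` for `𝐡 = h₁ ⊗ ⋯ ⊗ hₛ`, where
`a^{𝐡̄} = (⋯((a^{hₛ})^{hₛ₋₁})⋯)^{h₁}`. -/
def pushPow : (s : ℕ) → ((⨂[k]^s H) ⊗[k] A →ₗ[k] A ⊗[k] (⨂[k]^s H))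
  | 0 => (TensorProduct.comm k _ A).toLinearMap
  | s + 1 =>
    (TP.cons k s).toLinearMap.lTensor A ∘ₗ (TensorProduct.assoc k A H _).toLinearMap ∘ₗ
      S.push.rTensor _ ∘ₗ (TensorProduct.assoc k H A _).symm.toLinearMap ∘ₗ
      (pushPow s).lTensor H ∘ₗ (TensorProduct.assoc k H _ A).toLinearMap ∘ₗ
      (TP.cons k s).symm.toLinearMap.rTensor A

/-- `h ⊗ 𝐚 ↦ 𝐚^{h⁽¹⁾} ⊗ h⁽²⁾`, that is
`h ⊗ a₁ ⊗ ⋯ ⊗ aᵣ ↦ a₁^{h⁽¹⁾} ⊗ ⋯ ⊗ aᵣ^{h⁽ʳ⁾} ⊗ h⁽ʳ⁺¹⁾`. -/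
def pushDiag : (r : ℕ) → (H ⊗[k] (⨂[k]^r A) →ₗ[k] (⨂[k]^r A) ⊗[k] H)
  | 0 => (TensorProduct.comm k H _).toLinearMap
  | r + 1 =>
    (TP.cons k r).toLinearMap.rTensor H ∘ₗ (TensorProduct.assoc k A _ H).symm.toLinearMap ∘ₗ
      (pushDiag r).lTensor A ∘ₗ (TensorProduct.assoc k A H _).toLinearMap ∘ₗ
      S.push.rTensor _ ∘ₗ (TensorProduct.assoc k H A _).symm.toLinearMap ∘ₗ
      (TP.cons k r).symm.toLinearMap.lTensor H

end WeakAction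

/-- `h ⊗ l ↦ f(h⁽¹⁾, l⁽¹⁾) ⊗ h⁽²⁾ l⁽²⁾`. -/
def twistMul (f : H ⊗[k] H →ₗ[k] A) : H ⊗[k] H →ₗ[k] A ⊗[k] H :=
  TensorProduct.map f (LinearMap.mul' k H) ∘ₗ (Coalgebra.comul (R := k) (A := H ⊗[k] H))

/-- The multiplication
`(a ⊗ h)(b ⊗ l) = a b^{h⁽¹⁾} f(h⁽²⁾, l⁽¹⁾) ⊗ h⁽³⁾ l⁽²⁾` on `A ⊗ H`. -/
def crossedMul (S : WeakAction k A H) (f : H ⊗[k] H →ₗ[k] A) :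
    (A ⊗[k] H) ⊗[k] (A ⊗[k] H) →ₗ[k] A ⊗[k] H :=
  (LinearMap.mul' k A).rTensor H ∘ₗ (TensorProduct.assoc k A A H).symm.toLinearMap ∘ₗ
  ((LinearMap.mul' k A).rTensor H ∘ₗ (TensorProduct.assoc k A A H).symm.toLinearMap ∘ₗ
    (twistMul f).lTensor A ∘ₗ (TensorProduct.assoc k A H H).toLinearMap ∘ₗ
    S.push.rTensor H ∘ₗ (TensorProduct.assoc k H A H).symm.toLinearMap).lTensor A ∘ₗ
  (TensorProduct.assoc k A H (A ⊗[k] H)).toLinearMap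

end Weak

/-- A weak action of `H` on `A` and a linear map `f : H ⊗ H → A` such that the multiplication
of `A ⊗ H` that they define is associative with identity element `1 ⊗ 1`. -/
structure CrossedSystem (k A H : Type*) [CommRing k] [Ring A] [Algebra k A] [Ring H]
    [Bialgebra k H] extends WeakAction k A H where
  /-- the cocycle `f` -/
  cocycle : H ⊗[k] H →ₗ[k] A
  mul_assoc' : ∀ x y z : A ⊗[k] H,
    crossedMul toWeakAction cocycle (crossedMul toWeakAction cocycle (x ⊗ₜ y) ⊗ₜ z) =
      crossedMul toWeakAction cocycle (x ⊗ₜ crossedMul toWeakAction cocycle (y ⊗ₜ z))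
  one_mul' : ∀ x : A ⊗[k] H, crossedMul toWeakAction cocycle ((1 ⊗ₜ 1) ⊗ₜ x) = x
  mul_one' : ∀ x : A ⊗[k] H, crossedMul toWeakAction cocycle (x ⊗ₜ (1 ⊗ₜ 1)) = x

variable {k A H : Type*} [CommRing k] [Ring A] [Algebra k A] [Ring H] [Bialgebra k H]

/-- The crossed product `E = A #_f H`, with underlying module `A ⊗ H`. -/
def CrossedProduct (_ : CrossedSystem k A H) : Type _ := A ⊗[k] H

namespace CrossedProduct

variable (S : CrossedSystem k A H)

instance : AddCommGroup (CrossedProduct S) := inferInstanceAs (AddCommGroup (A ⊗[k] H))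

instance : Module k (CrossedProduct S) := inferInstanceAs (Module k (A ⊗[k] H))

/-- The identification of the underlying module with `A ⊗ H`. -/
def equiv : (A ⊗[k] H) ≃ₗ[k] CrossedProduct S := LinearEquiv.refl k _

/-- The multiplication, as a bilinear map. -/
def mulₗ : CrossedProduct S →ₗ[k] CrossedProduct S →ₗ[k] CrossedProduct S :=
  TensorProduct.curry (crossedMul S.toWeakAction S.cocycle)

instance : Ring (CrossedProduct S) :=
  { (inferInstance : AddCommGroup (CrossedProduct S)) with
    mul := fun x y => mulₗ S x y
    one := ((1 : A) ⊗ₜ[k] (1 : H) : A ⊗[k] H)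
    left_distrib := fun x y z => (mulₗ S x).map_add y z
    right_distrib := fun x y z => LinearMap.map_add₂ (mulₗ S) x y z
    zero_mul := fun x => LinearMap.map_zero₂ (mulₗ S) x
    mul_zero := fun x => (mulₗ S x).map_zero
    mul_assoc := S.mul_assoc'
    one_mul := S.one_mul'
    mul_one := S.mul_one' }

instance : Algebra k (CrossedProduct S) :=
  Algebra.ofModule (fun r x y => LinearMap.map_smul₂ (mulₗ S) r x y)
    (fun r x y => (mulₗ S x).map_smul r y)

/-- `a ↦ a # 1`. -/
def inA : A →ₗ[k] CrossedProduct S :=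
  (equiv S).toLinearMap ∘ₗ (TensorProduct.mk k A H).flip 1

/-- `h ↦ 1 # h`. -/
def inH : H →ₗ[k] CrossedProduct S :=
  (equiv S).toLinearMap ∘ₗ TensorProduct.mk k A H 1

end CrossedProduct

namespace CrossedSystem

open CrossedProduct

variable (S : CrossedSystem k A H)

/-! ### Building blocks of the differentials -/

/-- `h₀ ⊗ ⋯ ⊗ hₙ ↦ f(hᵢ⁽¹⁾, hᵢ₊₁⁽¹⁾)^{𝐡̄⁽¹⁾} ⊗ 𝐡⁽²⁾ ⊗ hᵢ⁽²⁾hᵢ₊₁⁽²⁾ ⊗ hᵢ₊₂ ⊗ ⋯ ⊗ hₙ` with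
`𝐡 = h₀ ⊗ ⋯ ⊗ hᵢ₋₁`; only used for `i < n`. -/
def mergeAt : (n i : ℕ) → (⨂[k]^(n + 1) H →ₗ[k] A ⊗[k] (⨂[k]^n H))
  | 0, _ => 0
  | n + 1, 0 =>
    (TP.cons k n).toLinearMap.lTensor A ∘ₗ (TensorProduct.assoc k A H _).toLinearMap ∘ₗ
      (twistMul S.cocycle).rTensor _ ∘ₗ (TensorProduct.assoc k H H _).symm.toLinearMap ∘ₗ
      (TP.cons k n).symm.toLinearMap.lTensor H ∘ₗ (TP.cons k (n + 1)).symm.toLinearMap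
  | n + 1, i + 1 =>
    (TP.cons k n).toLinearMap.lTensor A ∘ₗ (TensorProduct.assoc k A H _).toLinearMap ∘ₗ
      S.push.rTensor _ ∘ₗ (TensorProduct.assoc k H A _).symm.toLinearMap ∘ₗ
      (mergeAt n i).lTensor H ∘ₗ (TP.cons k (n + 1)).symm.toLinearMap

/-- `h₁ ⊗ ⋯ ⊗ hₙ ↦ (h₁⁽¹⁾ ⊗ ⋯ ⊗ hₙ⁽¹⁾) ⊗ h₁⁽²⁾ ⋯ hₙ⁽²⁾`. -/
def comulProd (k H : Type*) [CommRing k] [Ring H] [Bialgebra k H] :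
    (n : ℕ) → (⨂[k]^n H →ₗ[k] (⨂[k]^n H) ⊗[k] H)
  | 0 => (TensorProduct.mk k _ H).flip 1
  | n + 1 =>
    TensorProduct.map (TP.cons k n).toLinearMap (LinearMap.mul' k H) ∘ₗ
      (TensorProduct.tensorTensorTensorComm k H H _ H).toLinearMap ∘ₗ
      TensorProduct.map (Coalgebra.comul (R := k)) (comulProd k H n) ∘ₗ
      (TP.cons k n).symm.toLinearMap

/-- Given maps `Gᵣ : H^{⊗ n} ⊗ A^{⊗ r} → A^{⊗ (r + m)}` for all `r`, the maps
`𝐡 ⊗ a₁ ⊗ ⋯ ⊗ aᵣ ↦ ∑_{i=0}^{r} cⁱ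
  a₁^{𝐡̄⁽¹⁾} ⊗ ⋯ ⊗ aᵢ^{𝐡̄⁽ⁱ⁾} ⊗ Gᵣ₋ᵢ(𝐡⁽ⁱ⁺¹⁾ ⊗ aᵢ₊₁ ⊗ ⋯ ⊗ aᵣ)`. -/
def insertion (n m : ℕ) (c : k)
    (G : ∀ r : ℕ, (⨂[k]^n H) ⊗[k] (⨂[k]^r A) →ₗ[k] ⨂[k]^(r + m) A) :
    (r : ℕ) → ((⨂[k]^n H) ⊗[k] (⨂[k]^r A) →ₗ[k] ⨂[k]^(r + m) A)
  | 0 => G 0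
  | r + 1 => G (r + 1) + c •
    ((TensorPower.cast k A (Nat.add_right_comm r m 1)).toLinearMap ∘ₗ
      (TP.cons k (r + m)).toLinearMap ∘ₗ (insertion n m c G r).lTensor A ∘ₗ
      (TensorProduct.assoc k A _ _).toLinearMap ∘ₗ (S.pushPow n).rTensor _ ∘ₗ
      (TensorProduct.assoc k _ A _).symm.toLinearMap ∘ₗ
      (TP.cons k r).symm.toLinearMap.lTensor _)

/-- `F m r` is the map `F_r^{(l)} : H^{⊗ l} ⊗ A^{⊗ r} → A^{⊗ (r+l-1)}`, where `l = m + 1`. It is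
given by `F_r^{(1)}(h ⊗ 𝐚) = 𝐚^h` (so `F_0^{(1)} = ε`), and
`F_r^{(l+1)}(𝐡 ⊗ 𝐚) = ∑_{j=1}^{l} ∑_{i=0}^{r} (-1)^{il+j} 𝐚_{1i}^{𝐡̄⁽¹⁾} ⊗
  f(hⱼ⁽²⁾, hⱼ₊₁⁽²⁾)^{𝐡̄₁,ⱼ₋₁⁽²⁾} ⊗
  F_{r-i}^{(l)}(𝐡₁,ⱼ₋₁⁽³⁾ ⊗ hⱼ⁽³⁾hⱼ₊₁⁽³⁾ ⊗ 𝐡ⱼ₊₂,ₗ₊₁⁽²⁾ ⊗ 𝐚_{i+1,r})`. -/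
def F : (m r : ℕ) → ((⨂[k]^(m + 1) H) ⊗[k] (⨂[k]^r A) →ₗ[k] ⨂[k]^(r + m) A)
  | 0, r =>
    (TensorProduct.rid k _).toLinearMap ∘ₗ (Coalgebra.counit (R := k)).lTensor _ ∘ₗ
      S.pushDiag r ∘ₗ
      (PiTensorProduct.subsingletonEquiv (R := k) (0 : Fin 1)).toLinearMap.rTensor _
  | m + 1, r =>
    insertion S (m + 2) (m + 1) ((-1) ^ (m + 1))
      (fun r => ∑ j ∈ Finset.range (m + 1), (-1 : k) ^ (j + 1) •
        ((TP.cons k (r + m)).toLinearMap ∘ₗ (F m r).lTensor A ∘ₗ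
          (TensorProduct.assoc k A _ _).toLinearMap ∘ₗ (S.mergeAt (m + 1) j).rTensor _)) r

/-! ### The spaces -/

/-- `H^{⊗ s} ⊗ A^{⊗ r}`. -/
abbrev W (_ : CrossedSystem k A H) (r s : ℕ) : Type _ := (⨂[k]^s H) ⊗[k] (⨂[k]^r A)

/-- `H̄^{⊗ s} ⊗ Ā^{⊗ r}`, where `H̄ = H / k` and `Ā = A / k`. -/
abbrev Wbar (_ : CrossedSystem k A H) (r s : ℕ) : Type _ :=
  (⨂[k]^s (TP.Bar k H)) ⊗[k] (⨂[k]^r (TP.Bar k A))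

/-- The projection `H^{⊗ s} ⊗ A^{⊗ r} → H̄^{⊗ s} ⊗ Ā^{⊗ r}`. -/
def proj (r s : ℕ) : W S r s →ₗ[k] Wbar S r s :=
  TensorProduct.map (TP.barPow k H s) (TP.barPow k A r)

/-- `X_{rs} = E ⊗ H̄^{⊗ s} ⊗ Ā^{⊗ r} ⊗ E`. -/
abbrev X (r s : ℕ) : Type _ := Env k (CrossedProduct S) (Wbar S r s)

/-- `E ⊗ H^{⊗ s} ⊗ A^{⊗ r} ⊗ E → X_{rs}`. -/
def projX (r s : ℕ) : Env k (CrossedProduct S) (W S r s) →ₗ[k] X S r s :=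
  ((proj S r s).rTensor _).lTensor _

/-! ### The explicit formulas -/

/-- `𝐡 ⊗ 𝐚 ↦ (a₁^{𝐡̄⁽¹⁾} # 1) ⊗ (𝐡⁽²⁾ ⊗ 𝐚_{2,r+1}) ⊗ 1 +
∑_{i=1}^{r} (-1)ⁱ 1 ⊗ (𝐡 ⊗ a₁ ⊗ ⋯ ⊗ aᵢaᵢ₊₁ ⊗ ⋯ ⊗ aᵣ₊₁) ⊗ 1 +
(-1)ʳ⁺¹ 1 ⊗ (𝐡 ⊗ 𝐚_{1r}) ⊗ (aᵣ₊₁ # 1)`, for `𝐚 = a₁ ⊗ ⋯ ⊗ aᵣ₊₁`. -/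
def delta0 (r s : ℕ) : W S (r + 1) s →ₗ[k] Env k (CrossedProduct S) (W S r s) :=
  envL ∘ₗ (inA S).rTensor _ ∘ₗ (TensorProduct.assoc k A _ _).toLinearMap ∘ₗ
    (S.pushPow s).rTensor _ ∘ₗ (TensorProduct.assoc k _ A _).symm.toLinearMap ∘ₗ
    (TP.cons k r).symm.toLinearMap.lTensor _
  + ∑ i ∈ Finset.range r, (-1 : k) ^ (i + 1) • (envGen ∘ₗ (TP.mulAt k A r i).lTensor _)
  + (-1 : k) ^ (r + 1) •
    (envR ∘ₗ (inA S).lTensor _ ∘ₗ (TensorProduct.assoc k _ _ A).symm.toLinearMap ∘ₗ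
      (TP.snoc k r).symm.toLinearMap.lTensor _)

/-- With `l = m + 1` and `𝐡 = h₁ ⊗ ⋯ ⊗ hₛ₊ₗ`, the map
`𝐡 ⊗ 𝐚 ↦ (-1)^{l(r+s+l)} 1 ⊗ (𝐡_{1s} ⊗ F_r^{(l)}(𝐡_{s+1,s+l}⁽¹⁾ ⊗ 𝐚)) ⊗
  (1 # hₛ₊₁⁽²⁾ ⋯ hₛ₊ₗ⁽²⁾)`. -/
def deltaTail (m r s : ℕ) :
    W S r (s + (m + 1)) →ₗ[k] Env k (CrossedProduct S) (W S (r + m) s) :=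
  (-1 : k) ^ ((m + 1) * (r + (s + (m + 1)))) •
    (envR ∘ₗ (TensorProduct.assoc k _ _ _).symm.toLinearMap ∘ₗ
      ((TensorProduct.map (F S m r) (inH S) ∘ₗ
        (TensorProduct.rightComm k (⨂[k]^(m + 1) H) H (⨂[k]^r A)).toLinearMap ∘ₗ
        (comulProd k H (m + 1)).rTensor _).lTensor (⨂[k]^s H)) ∘ₗ
      (TensorProduct.assoc k _ _ _).toLinearMap ∘ₗ
      (TensorPower.mulEquiv (R := k) (M := H) (n := s) (m := m + 1)).symm.toLinearMap.rTensor _)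

/-- `𝐡 ⊗ 𝐚 ↦ (-1)ʳ (1 # h₁) ⊗ (𝐡_{2,s+1} ⊗ 𝐚) ⊗ 1 + ∑_{i=1}^{s} (-1)^{r+i}
  (f(hᵢ⁽¹⁾, hᵢ₊₁⁽¹⁾)^{𝐡̄_{1,i-1}⁽¹⁾} # 1) ⊗
    (𝐡_{1,i-1}⁽²⁾ ⊗ hᵢ⁽²⁾hᵢ₊₁⁽²⁾ ⊗ 𝐡_{i+2,s+1} ⊗ 𝐚) ⊗ 1 +
(-1)^{r+s+1} 1 ⊗ (𝐡_{1s} ⊗ 𝐚^{hₛ₊₁⁽¹⁾}) ⊗ (1 # hₛ₊₁⁽²⁾)`, for `𝐡 = h₁ ⊗ ⋯ ⊗ hₛ₊₁`. -/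
def delta1 (r s : ℕ) : W S r (s + 1) →ₗ[k] Env k (CrossedProduct S) (W S r s) :=
  (-1 : k) ^ r • (envL ∘ₗ (inH S).rTensor _ ∘ₗ (TensorProduct.assoc k H _ _).toLinearMap ∘ₗ
    (TP.cons k s).symm.toLinearMap.rTensor _)
  + ∑ i ∈ Finset.range s, (-1 : k) ^ (r + (i + 1)) •
    (envL ∘ₗ (inA S).rTensor _ ∘ₗ (TensorProduct.assoc k A _ _).toLinearMap ∘ₗ
      (S.mergeAt s i).rTensor _)
  + deltaTail S 0 r s

/-! ### The complex `X_*` -/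

/-- `Y_s`, before passing to quotients: `A ⊗ (h₀ ⊗ h₁ ⊗ ⋯ ⊗ hₛ ⊗ hₛ₊₁)`, where `A ⊗ h₀` is the
factor `E`. -/
abbrev Y (_ : CrossedSystem k A H) (s : ℕ) : Type _ := A ⊗[k] (⨂[k]^(s + 2) H)

/-- `μ_s((a₀ # h₀) ⊗ 𝐡_{1s} ⊗ (a₁ # hₛ₊₁)) =
a₀ a₁^{𝐡̄_{0s}⁽¹⁾} ⊗ (𝐡_{0s}⁽²⁾ ⊗ hₛ₊₁)`. -/
def mu (s : ℕ) : Env k (CrossedProduct S) (⨂[k]^s H) →ₗ[k] Y S s :=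
  (TP.snoc k (s + 1)).toLinearMap.lTensor A ∘ₗ
    (LinearMap.mul' k A).rTensor _ ∘ₗ (TensorProduct.assoc k A A _).symm.toLinearMap ∘ₗ
    ((TensorProduct.assoc k A _ H).toLinearMap ∘ₗ (S.pushPow (s + 1)).rTensor H ∘ₗ
      (TensorProduct.assoc k _ A H).symm.toLinearMap ∘ₗ
      TensorProduct.map (TP.cons k s).toLinearMap (equiv S).symm.toLinearMap ∘ₗ
      (TensorProduct.assoc k H _ _).symm.toLinearMap).lTensor A ∘ₗ
    (TensorProduct.assoc k A H _).toLinearMap ∘ₗ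
    (equiv S).symm.toLinearMap.rTensor _

/-- `∂_{s+1}(a ⊗ 𝐡) = ∑_{i=0}^{s+1} (-1)^{i+1} a f(hᵢ⁽¹⁾, hᵢ₊₁⁽¹⁾)^{𝐡̄_{0,i-1}⁽¹⁾} ⊗
𝐡_{0,i-1}⁽²⁾ ⊗ hᵢ⁽²⁾hᵢ₊₁⁽²⁾ ⊗ 𝐡_{i+2,s+2}`. -/
def boundary (s : ℕ) : Y S (s + 1) →ₗ[k] Y S s :=
  ∑ i ∈ Finset.range (s + 2), (-1 : k) ^ (i + 1) •
    ((LinearMap.mul' k A).rTensor _ ∘ₗ (TensorProduct.assoc k A A _).symm.toLinearMap ∘ₗ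
      (S.mergeAt (s + 2) i).lTensor A)

/-- `σ⁰_{0s} : Y_s → X_{0s}`, `a ⊗ (h₀ ⊗ 𝐡_{1s} ⊗ hₛ₊₁) ↦ (a # h₀) ⊗ 𝐡_{1s} ⊗ (1 # hₛ₊₁)`. -/
def sigmaY (s : ℕ) : Y S s →ₗ[k] X S 0 s :=
  projX S 0 s ∘ₗ
    ((TensorProduct.map
      ((TensorProduct.mk k (⨂[k]^s H) (⨂[k]^0 A)).flip (PiTensorProduct.tprod k Fin.elim0))
      (inH S)).lTensor _) ∘ₗ
    (equiv S).toLinearMap.rTensor _ ∘ₗ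
    (TensorProduct.assoc k A H _).symm.toLinearMap ∘ₗ
    ((TensorProduct.assoc k H _ H).toLinearMap ∘ₗ
      (TP.cons k s).symm.toLinearMap.rTensor H ∘ₗ
      (TP.snoc k (s + 1)).symm.toLinearMap).lTensor A

/-- `σ⁰_{r+1,s} : X_{rs} → X_{r+1,s}`,
`e ⊗ 𝐡 ⊗ 𝐚 ⊗ (b # h) ↦ (-1)^{r+1} e ⊗ 𝐡 ⊗ (𝐚 ⊗ b) ⊗ (1 # h)`. -/
def sigma (r s : ℕ) : X S r s →ₗ[k] X S (r + 1) s :=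
  (-1 : k) ^ (r + 1) •
    (TensorProduct.map
      ((TP.snoc k r).toLinearMap.lTensor _ ∘ₗ
        (TensorProduct.assoc k _ _ (TP.Bar k A)).toLinearMap ∘ₗ
        (TP.barMk k A).lTensor _)
      (inH S) ∘ₗ
      (TensorProduct.assoc k (Wbar S r s) A H).symm.toLinearMap ∘ₗ
      (equiv S).symm.toLinearMap.lTensor _).lTensor _

/-- The family of maps `d r s r' s' : X_{rs} → X_{r's'}` is the family of components
`d^l_{rs} : X_{rs} → X_{r+l-1,s-l}`, `0 ≤ l ≤ s`, `r + l > 0`, of the differential of `X_*`: all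
of them are bimodule maps; `d⁰` is given by its formula; for `l > 0`, on the elements
`x = 1 ⊗ 𝐡 ⊗ 𝐚 ⊗ 1`,
* `d^1_{0s}(x) = -σ⁰ ∂ μ (x)`,
* `d^l_{rs}(x) = -∑_{j=0}^{l-1} σ⁰ d^{l-j}_{r+j-1,s-j} d^j_{rs}(x)` for `r + l > 1`, where the sum
  starts with `j = 1` if `r = 0`;

the other entries of the matrix are zero. In `recursion`, `q = (r+j-1, s-j)`. -/
structure IsResolutionDifferential
    (d : ∀ r s r' s' : ℕ, X S r s →ₗ[k] X S r' s') : Prop where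
  left : ∀ r s r' s' (e : CrossedProduct S) (x : X S r s),
    d r s r' s' (envLeft e x) = envLeft e (d r s r' s' x)
  right : ∀ r s r' s' (e : CrossedProduct S) (x : X S r s),
    d r s r' s' (envRight e x) = envRight e (d r s r' s' x)
  zero : ∀ r s (w : W S (r + 1) s),
    d (r + 1) s r s (envGen (proj S (r + 1) s w)) = projX S r s (delta0 S r s w)
  base : ∀ s (h : ⨂[k]^(s + 1) H),
    d 0 (s + 1) 0 s (envGen (proj S 0 (s + 1) (h ⊗ₜ PiTensorProduct.tprod k Fin.elim0))) =
      - sigmaY S s (boundary S s (mu S (s + 1) (envGen h)))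
  recursion : ∀ r s r' s', s' < s → r + s = r' + s' + 2 → ∀ w : Wbar S r s,
    d r s (r' + 1) s' (envGen w) =
      - ∑ q ∈ Finset.HasAntidiagonal.antidiagonal (r' + s' + 1) with s' < q.2 ∧ q.2 ≤ s,
        sigma S r' s' (d q.1 q.2 r' s' (d r s q.1 q.2 (envGen w)))
  off : ∀ r s r' s', ¬ (r + s = r' + s' + 1 ∧ s' ≤ s) → d r s r' s' = 0

/-- `X_n = ⨁_{r+s=n} X_{rs}`. -/
abbrev XTot (n : ℕ) : Type _ := ∀ p : Finset.HasAntidiagonal.antidiagonal n, X S p.1.1 p.1.2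

/-- `d_{n+1} : X_{n+1} → X_n`, the sum of all the components. -/
def dTot (d : ∀ r s r' s' : ℕ, X S r s →ₗ[k] X S r' s') (n : ℕ) :
    XTot S (n + 1) →ₗ[k] XTot S n :=
  LinearMap.pi fun q =>
    ∑ p : Finset.HasAntidiagonal.antidiagonal (n + 1), d p.1.1 p.1.2 q.1.1 q.1.2 ∘ₗ LinearMap.proj p

/-! ### The complex `X̂^*(E, M)` -/

section Hat

variable (M : Type*) [AddCommGroup M] [Module k M] [Module (CrossedProduct S) M]
  [Module (CrossedProduct S)ᵐᵒᵖ M]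
  [IsScalarTower k (CrossedProduct S) M] [IsScalarTower k (CrossedProduct S)ᵐᵒᵖ M]

/-- The family of maps `e r' s' r s : Hom_k(H̄^{s'} ⊗ Ā^{r'}, M) → Hom_k(H̄^s ⊗ Ā^r, M)` is the
family of components `d̂_l^{rs}` (`s' = s - l`, `r' = r + l - 1`, `0 ≤ l ≤ s`, `r + l > 0`) of the
differential of `X̂^*(E, M)`: they are given by the explicit formulas for `l = 0`, `l = 1` and
`l ≥ 2` (here `l = m + 2`), and the other entries of the matrix are zero. Recall that
`bimodEval φ (x ⊗ w ⊗ y) = x φ(w) y`. -/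
structure IsHatDifferential
    (e : ∀ r' s' r s : ℕ, (Wbar S r' s' →ₗ[k] M) →ₗ[k] (Wbar S r s →ₗ[k] M)) : Prop where
  zero : ∀ r s (φ : Wbar S r s →ₗ[k] M) (w : W S (r + 1) s),
    e r s (r + 1) s φ (proj S (r + 1) s w) = bimodEval (φ ∘ₗ proj S r s) (delta0 S r s w)
  one : ∀ r s (φ : Wbar S r s →ₗ[k] M) (w : W S r (s + 1)),
    e r s r (s + 1) φ (proj S r (s + 1) w) = bimodEval (φ ∘ₗ proj S r s) (delta1 S r s w)
  higher : ∀ m r s (φ : Wbar S (r + (m + 1)) s →ₗ[k] M) (w : W S r (s + (m + 2))),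
    e (r + (m + 1)) s r (s + (m + 2)) φ (proj S r (s + (m + 2)) w) =
      bimodEval (φ ∘ₗ proj S (r + (m + 1)) s) (deltaTail S (m + 1) r s w)
  off : ∀ r' s' r s, ¬ (r + s = r' + s' + 1 ∧ s' ≤ s) → e r' s' r s = 0

/-- `X̂^n = ⨁_{r+s=n} Hom_k(H̄^s ⊗ Ā^r, M)`. -/
abbrev HatTot (n : ℕ) : Type _ := ∀ p : Finset.HasAntidiagonal.antidiagonal n, Wbar S p.1.1 p.1.2 →ₗ[k] M

/-- `d̂^{n+1} : X̂^n → X̂^{n+1}`, the sum of all the components. -/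
def hatTot (e : ∀ r' s' r s : ℕ, (Wbar S r' s' →ₗ[k] M) →ₗ[k] (Wbar S r s →ₗ[k] M)) (n : ℕ) :
    HatTot S M n →ₗ[k] HatTot S M (n + 1) :=
  LinearMap.pi fun p =>
    ∑ q : Finset.HasAntidiagonal.antidiagonal n, e q.1.1 q.1.2 p.1.1 p.1.2 ∘ₗ LinearMap.proj q

/-- `Hom_{E^e}(X_n, M)`, as a submodule of `Hom_k(X_n, M)`. -/
def bimodHom (n : ℕ) : Submodule k (XTot S n →ₗ[k] M) where
  carrier := {g | ∀ (b : CrossedProduct S) (x : XTot S n),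
    g (fun p => envLeft b (x p)) = b • g x ∧
    g (fun p => envRight b (x p)) = MulOpposite.op b • g x}
  add_mem' := fun hf hg b x =>
    ⟨by simp [(hf b x).1, (hg b x).1], by simp [(hf b x).2, (hg b x).2]⟩
  zero_mem' := fun b x => by simp
  smul_mem' := fun c g hg b x =>
    ⟨by
      rw [LinearMap.smul_apply, (hg b x).1, LinearMap.smul_apply]
      exact ((leftAct k (CrossedProduct S) M b).map_smul c (g x)).symm,
    by
      rw [LinearMap.smul_apply, (hg b x).2, LinearMap.smul_apply]
      exact ((rightAct k (CrossedProduct S) M b).map_smul c (g x)).symm⟩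

/-- `θ̂ : X̂^n → Hom_k(X_n, M)`, `θ̂(φ)(x ⊗ w ⊗ y) = x φ(w) y`. -/
def theta (n : ℕ) : HatTot S M n →ₗ[k] (XTot S n →ₗ[k] M) :=
  ∑ p, LinearMap.lcomp k M (LinearMap.proj p) ∘ₗ bimodEvalₗ ∘ₗ LinearMap.proj p

end Hat

end CrossedSystem

end

open scoped TensorProduct
open TensorProduct
open LinearMap (comp_apply lTensor_tmul rTensor_tmul flip_apply id_apply mulLeft mulRight)
open LinearEquiv (coe_coe symm_apply_apply)
open AlgHom (toLinearMap_apply)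
open TensorAlgebra (ι)
open TensorProduct (assoc)
open Finset.HasAntidiagonal (antidiagonal mem_antidiagonal)

noncomputable section

section

variable {k M N : Type*} [CommSemiring k] [AddCommMonoid M] [AddCommMonoid N] [Module k M]
  [Module k N]

instance LinearMap.zeroHomClass : ZeroHomClass (M →ₗ[k] N) M N := inferInstance

instance LinearMap.addHomClass : AddHomClass (M →ₗ[k] N) M N := inferInstance

instance LinearMap.addMonoidHomClass : AddMonoidHomClass (M →ₗ[k] N) M N := inferInstance

instance LinearMap.mulActionHomClass : MulActionHomClass (M →ₗ[k] N) k M N := inferInstance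

instance LinearEquiv.zeroHomClass : ZeroHomClass (M ≃ₗ[k] N) M N := inferInstance

instance LinearEquiv.addHomClass : AddHomClass (M ≃ₗ[k] N) M N := inferInstance

instance LinearEquiv.addMonoidHomClass : AddMonoidHomClass (M ≃ₗ[k] N) M N := inferInstance

instance LinearEquiv.mulActionHomClass : MulActionHomClass (M ≃ₗ[k] N) k M N := inferInstance

end

/-! ### Tensor powers inside the tensor algebra -/

namespace TP

section
variable {k V : Type*} [CommRing k] [AddCommGroup V] [Module k V]

/-- The inclusion of a tensor power into the tensor algebra. -/
abbrev toTA (k : Type*) {V : Type*} [CommRing k] [AddCommGroup V] [Module k V] (n : ℕ) :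
    ⨂[k]^n V →ₗ[k] TensorAlgebra k V := TensorPower.toTensorAlgebra

/-- The empty tensor. -/
def nil (k V : Type*) [CommRing k] [AddCommGroup V] [Module k V] : ⨂[k]^0 V :=
  PiTensorProduct.tprod k Fin.elim0

theorem toTA_nil : toTA k 0 (nil k V) = 1 := by
  simp [toTA, nil, TensorAlgebra.tprod_apply]

theorem tprod_zero (v : Fin 0 → V) : PiTensorProduct.tprod k v = nil k V := by
  rw [nil]; congr 1; exact Subsingleton.elim _ _

/-- Induction on tensors of length zero. -/
theorem zero_eq_smul_nil (w : ⨂[k]^0 V) : ∃ c : k, w = c • nil k V := by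
  refine ⟨(PiTensorProduct.isEmptyEquiv (Fin 0)) w, ?_⟩
  apply (PiTensorProduct.isEmptyEquiv (R := k) (s := fun _ => V) (Fin 0)).injective
  rw [map_smul, nil, PiTensorProduct.isEmptyEquiv_apply_tprod, smul_eq_mul, mul_one]

theorem hom_ext_succ {N : Type*} [AddCommGroup N] [Module k N] {n : ℕ}
    {f g : ⨂[k]^(n + 1) V →ₗ[k] N}
    (h : ∀ v w, f (cons k n (v ⊗ₜ w)) = g (cons k n (v ⊗ₜ w))) : f = g := by
  have : f ∘ₗ (cons k n).toLinearMap = g ∘ₗ (cons k n).toLinearMap :=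
    ext' h
  ext1
  ext w
  have := LinearMap.congr_fun this ((cons k n).symm (PiTensorProduct.tprod k w))
  simpa using this

theorem hom_ext_snoc {N : Type*} [AddCommGroup N] [Module k N] {n : ℕ}
    {f g : ⨂[k]^(n + 1) V →ₗ[k] N}
    (h : ∀ w v, f (snoc k n (w ⊗ₜ v)) = g (snoc k n (w ⊗ₜ v))) : f = g := by
  have : f ∘ₗ (snoc k n).toLinearMap = g ∘ₗ (snoc k n).toLinearMap :=
    ext' h
  ext1
  ext w
  have := LinearMap.congr_fun this ((snoc k n).symm (PiTensorProduct.tprod k w))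
  simpa using this

@[elab_as_elim]
theorem cons_induction {n : ℕ} {P : ⨂[k]^(n + 1) V → Prop} (x : ⨂[k]^(n + 1) V)
    (zero : P 0)
    (cons : ∀ v w, P (cons k n (v ⊗ₜ w))) (add : ∀ x y, P x → P y → P (x + y)) : P x := by
  obtain ⟨t, rfl⟩ := (TP.cons k n).surjective x
  induction t with
  | zero => simpa using zero
  | tmul v w => exact cons v w
  | add x y hx hy => rw [map_add]; exact add _ _ hx hy

@[elab_as_elim]
theorem snoc_induction {n : ℕ} {P : ⨂[k]^(n + 1) V → Prop} (x : ⨂[k]^(n + 1) V)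
    (zero : P 0)
    (snoc : ∀ w v, P (snoc k n (w ⊗ₜ v))) (add : ∀ x y, P x → P y → P (x + y)) : P x := by
  obtain ⟨t, rfl⟩ := (TP.snoc k n).surjective x
  induction t with
  | zero => simpa using zero
  | tmul v w => exact snoc v w
  | add x y hx hy => rw [map_add]; exact add _ _ hx hy

theorem toTA_mulEquiv {n m : ℕ} (u : ⨂[k]^n V) (v : ⨂[k]^m V) :
    toTA k (n + m) (TensorPower.mulEquiv (u ⊗ₜ v)) = toTA k n u * toTA k m v := by
  rw [← TensorPower.gMul_def]
  exact TensorPower.toTensorAlgebra_gMul u v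

theorem toTA_cast {n m : ℕ} (h : n = m) (u : ⨂[k]^n V) :
    toTA k m (TensorPower.cast k V h u) = toTA k n u := by
  subst h; simp

theorem subsingletonEquiv_symm_eq (v : V) :
    (PiTensorProduct.subsingletonEquiv (R := k) (0 : Fin 1)).symm v
      = PiTensorProduct.tprod k (fun _ : Fin 1 => v) := by
  rw [LinearEquiv.symm_apply_eq]; simp

theorem toTA_one (v : V) : toTA k 1 ((PiTensorProduct.subsingletonEquiv (R := k)
    (0 : Fin 1)).symm v) = ι k v := by
  rw [subsingletonEquiv_symm_eq]
  simp [toTA, TensorAlgebra.tprod_apply]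

theorem toTA_cons (n : ℕ) (v : V) (w : ⨂[k]^n V) :
    toTA k (n + 1) (cons k n (v ⊗ₜ w)) = ι k v * toTA k n w := by
  simp only [cons, LinearEquiv.trans_apply, TensorProduct.congr_tmul, LinearEquiv.refl_apply]
  rw [toTA_cast, toTA_mulEquiv, toTA_one]

theorem toTA_snoc (n : ℕ) (v : V) (w : ⨂[k]^n V) :
    toTA k (n + 1) (snoc k n (w ⊗ₜ v)) = toTA k n w * ι k v := by
  simp only [snoc, LinearEquiv.trans_apply, TensorProduct.congr_tmul, LinearEquiv.refl_apply]
  rw [toTA_mulEquiv, toTA_one]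

/-- The linear map out of the tensor algebra given by a family of maps out of the tensor powers. -/
def desc {N : Type*} [AddCommGroup N] [Module k N] (f : ∀ n, ⨂[k]^n V →ₗ[k] N) :
    TensorAlgebra k V →ₗ[k] N :=
  DirectSum.toModule k ℕ N f ∘ₗ (TensorAlgebra.toDirectSum (R := k) (M := V)).toLinearMap

theorem toDirectSum_toTA (n : ℕ) (w : ⨂[k]^n V) :
    TensorAlgebra.toDirectSum (toTA k n w) = DirectSum.lof k ℕ (fun n => ⨂[k]^n V) n w := by
  have : (TensorAlgebra.toDirectSum (R := k) (M := V)).toLinearMap ∘ₗ toTA k n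
      = DirectSum.lof k ℕ (fun n => ⨂[k]^n V) n := by
    refine PiTensorProduct.ext (MultilinearMap.ext fun w => ?_)
    simp only [LinearMap.compMultilinearMap_apply, comp_apply, toLinearMap_apply]
    rw [TensorPower.toTensorAlgebra_tprod, DirectSum.lof_eq_of]
    exact TensorAlgebra.toDirectSum_tensorPower_tprod (R := k) w
  exact LinearMap.congr_fun this w

@[simp]
theorem desc_toTA {N : Type*} [AddCommGroup N] [Module k N] (f : ∀ n, ⨂[k]^n V →ₗ[k] N) (n : ℕ)
    (w : ⨂[k]^n V) : desc f (toTA k n w) = f n w := by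
  simp only [desc, comp_apply, toLinearMap_apply]
  rw [toDirectSum_toTA, DirectSum.toModule_lof]

@[elab_as_elim]
theorem ta_toTA_induction {P : TensorAlgebra k V → Prop} (x : TensorAlgebra k V)
    (of : ∀ n (w : ⨂[k]^n V), P (toTA k n w))
    (add : ∀ x y, P x → P y → P (x + y)) : P x := by
  obtain ⟨y, rfl⟩ : ∃ y, x = TensorAlgebra.ofDirectSum y :=
    ⟨_, (TensorAlgebra.ofDirectSum_toDirectSum x).symm⟩
  induction y using DirectSum.induction_on with
  | zero => simpa using of 0 0
  | of n w =>
    convert of n w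
    rw [← DirectSum.lof_eq_of k, ← toDirectSum_toTA, TensorAlgebra.ofDirectSum_toDirectSum]
  | add x y hx hy => rw [map_add]; exact add _ _ hx hy

@[elab_as_elim]
theorem ta_induction {P : TensorAlgebra k V → Prop} (x : TensorAlgebra k V) (one : P 1)
    (cons : ∀ v w, P w → P (ι k v * w))
    (smul : ∀ (c : k) x, P x → P (c • x)) (add : ∀ x y, P x → P y → P (x + y)) : P x := by
  induction x using ta_toTA_induction with
  | of n w =>
    induction n with
    | zero =>
      obtain ⟨c, rfl⟩ := zero_eq_smul_nil w
      rw [LinearMap.map_smul, toTA_nil]; exact smul _ _ one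
    | succ n ih =>
      induction w using cons_induction with
      | zero => rw [LinearMap.map_zero]; simpa using smul 0 _ one
      | cons v w => rw [toTA_cons]; exact cons _ _ (ih w)
      | add x y hx hy => rw [LinearMap.map_add]; exact add _ _ hx hy
  | add x y hx hy => exact add _ _ hx hy

theorem ta_hom_ext {N : Type*} [AddCommGroup N] [Module k N] {f g : TensorAlgebra k V →ₗ[k] N}
    (h : ∀ n (w : ⨂[k]^n V), f (toTA k n w) = g (toTA k n w)) : f = g := by
  ext x
  induction x using ta_toTA_induction with
  | of n w => exact h n w
  | add x y hx hy => rw [LinearMap.map_add, LinearMap.map_add, hx, hy]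

/-- The component of degree `n`. -/
def comp (k V : Type*) [CommRing k] [AddCommGroup V] [Module k V] (n : ℕ) :
    TensorAlgebra k V →ₗ[k] ⨂[k]^n V :=
  DirectSum.component k ℕ _ n ∘ₗ (TensorAlgebra.toDirectSum (R := k) (M := V)).toLinearMap

theorem comp_toTA_same (n : ℕ) (w : ⨂[k]^n V) : comp k V n (toTA k n w) = w := by
  simp only [comp, comp_apply, toLinearMap_apply]
  rw [toDirectSum_toTA, DirectSum.component.lof_self]

theorem comp_toTA_of_ne {m n : ℕ} (h : m ≠ n) (w : ⨂[k]^m V) : comp k V n (toTA k m w) = 0 := by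
  simp only [comp, comp_apply, toLinearMap_apply]
  rw [toDirectSum_toTA]
  exact (DirectSum.component.of _ _ _ _).trans (dif_neg h)

theorem toTA_injective (n : ℕ) : Function.Injective (toTA k (V := V) n) :=
  Function.LeftInverse.injective (comp_toTA_same n)

/-- `1 ↦ 0`, `v * w ↦ v ⊗ w`. -/
def uncons (k V : Type*) [CommRing k] [AddCommGroup V] [Module k V] :
    TensorAlgebra k V →ₗ[k] V ⊗[k] TensorAlgebra k V :=
  desc fun n => match n with
    | 0 => 0
    | n + 1 => (toTA k n).lTensor V ∘ₗ (cons k n).symm.toLinearMap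

@[simp] theorem uncons_one : uncons k V 1 = 0 := by
  rw [← toTA_nil, uncons, desc_toTA]; rfl

@[simp] theorem uncons_ι_mul (v : V) (w : TensorAlgebra k V) :
    uncons k V (ι k v * w) = v ⊗ₜ w := by
  induction w using ta_toTA_induction with
  | of n w =>
    rw [← toTA_cons, uncons, desc_toTA]
    simp
  | add x y hx hy => rw [mul_add, LinearMap.map_add, hx, hy, tmul_add]

/-- The degree one part. -/
def deg1 (k V : Type*) [CommRing k] [AddCommGroup V] [Module k V] : TensorAlgebra k V →ₗ[k] V :=
  (PiTensorProduct.subsingletonEquiv (R := k) (0 : Fin 1)).toLinearMap ∘ₗ comp k V 1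

theorem deg1_toTA_of_ne {n : ℕ} (h : n ≠ 1) (w : ⨂[k]^n V) : deg1 k V (toTA k n w) = 0 := by
  simp [deg1, comp_toTA_of_ne h]

@[simp] theorem deg1_ι (v : V) : deg1 k V (ι k v) = v := by
  rw [← toTA_one, deg1, comp_apply, comp_toTA_same]; simp

@[simp] theorem deg1_one : deg1 k V 1 = 0 := by
  rw [← toTA_nil, deg1_toTA_of_ne (by norm_num)]

@[simp] theorem deg1_ι_mul_ι_mul (v v' : V) (w : TensorAlgebra k V) :
    deg1 k V (ι k v * (ι k v' * w)) = 0 := by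
  induction w using ta_toTA_induction with
  | of n w => rw [← toTA_cons, ← toTA_cons, deg1_toTA_of_ne (by omega)]
  | add x y hx hy => rw [mul_add, mul_add, LinearMap.map_add, hx, hy, add_zero]

/-- The sign automorphism, multiplication by `(-1)ⁿ` in degree `n`. -/
def sgn (k V : Type*) [CommRing k] [AddCommGroup V] [Module k V] :
    TensorAlgebra k V →ₐ[k] TensorAlgebra k V :=
  TensorAlgebra.lift k (-(ι k))

@[simp] theorem sgn_ι (v : V) : sgn k V (ι k v) = -ι k v := by
  simp [sgn]

theorem sgn_toTA (n : ℕ) (w : ⨂[k]^n V) : sgn k V (toTA k n w) = (-1 : k) ^ n • toTA k n w := by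
  induction n with
  | zero =>
    obtain ⟨c, rfl⟩ := zero_eq_smul_nil w
    simp [toTA_nil]
  | succ n ih =>
    induction w using cons_induction with
    | zero => simp
    | cons v w => rw [toTA_cons, map_mul, ih, sgn_ι]; simp [pow_succ]
    | add x y hx hy => rw [map_add, map_add, hx, hy, smul_add]

/-- The deconcatenations `w ↦ u ⊗ v`, `w = u * v`, with `u` of degree `n`. -/
def split (k V : Type*) [CommRing k] [AddCommGroup V] [Module k V] :
    (n : ℕ) → (TensorAlgebra k V →ₗ[k] (⨂[k]^n V) ⊗[k] TensorAlgebra k V)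
  | 0 => TensorProduct.mk k _ _ (nil k V)
  | n + 1 => (cons k n).toLinearMap.rTensor _ ∘ₗ (assoc k V _ _).symm.toLinearMap ∘ₗ
      (split k V n).lTensor V ∘ₗ uncons k V

theorem split_toTA_mul {n : ℕ} (u : ⨂[k]^n V) (v : TensorAlgebra k V) :
    split k V n (toTA k n u * v) = u ⊗ₜ v := by
  induction n with
  | zero =>
    obtain ⟨c, rfl⟩ := zero_eq_smul_nil u
    simp [toTA_nil, split, smul_tmul']
  | succ n ih =>
    induction u using cons_induction with
    | zero => simp
    | cons a u =>
      rw [toTA_cons, mul_assoc]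
      simp [split, ih]
    | add x y hx hy => rw [LinearMap.map_add, add_mul, LinearMap.map_add, hx, hy, add_tmul]

end
end TP

/-! ### Relatively free resolutions of a bimodule and their comparison -/

/-- A `B`-bimodule structure on a `k`-module. -/
structure BimodStr (k B P : Type*) [CommRing k] [Ring B] [Algebra k B] [AddCommGroup P]
    [Module k P] where
  /-- left multiplication -/
  l : B →ₗ[k] P →ₗ[k] P
  /-- right multiplication -/
  r : B →ₗ[k] P →ₗ[k] P
  l_one : ∀ x, l 1 x = x
  r_one : ∀ x, r 1 x = x
  l_mul : ∀ a b x, l (a * b) x = l a (l b x)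
  r_mul : ∀ a b x, r (a * b) x = r b (r a x)
  comm : ∀ a b x, l a (r b x) = r b (l a x)

namespace BimodStr

section
variable {k B P Q R : Type*} [CommRing k] [Ring B] [Algebra k B]
  [AddCommGroup P] [Module k P] [AddCommGroup Q] [Module k Q] [AddCommGroup R] [Module k R]

/-- Bimodule homomorphisms. -/
def IsHom (b : BimodStr k B P) (c : BimodStr k B Q) (f : P →ₗ[k] Q) : Prop :=
  ∀ e x, f (b.l e x) = c.l e (f x) ∧ f (b.r e x) = c.r e (f x)

variable {b : BimodStr k B P} {c : BimodStr k B Q} {d : BimodStr k B R}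

theorem IsHom.comp {g : Q →ₗ[k] R} {f : P →ₗ[k] Q} (hg : IsHom c d g) (hf : IsHom b c f) :
    IsHom b d (g ∘ₗ f) := fun e x =>
  ⟨by simp [(hf e x).1, (hg e _).1], by simp [(hf e x).2, (hg e _).2]⟩

theorem IsHom.add {f g : P →ₗ[k] Q} (hf : IsHom b c f) (hg : IsHom b c g) : IsHom b c (f + g) :=
  fun e x => ⟨by simp [(hf e x).1, (hg e x).1], by simp [(hf e x).2, (hg e x).2]⟩

theorem IsHom.sub {f g : P →ₗ[k] Q} (hf : IsHom b c f) (hg : IsHom b c g) : IsHom b c (f - g) :=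
  fun e x => ⟨by simp [(hf e x).1, (hg e x).1], by simp [(hf e x).2, (hg e x).2]⟩

theorem IsHom.zero : IsHom b c 0 := fun e x => ⟨by simp, by simp⟩

theorem IsHom.id : IsHom b b LinearMap.id := fun _ _ => ⟨rfl, rfl⟩

theorem IsHom.sum {ι : Type*} (s : Finset ι) {f : ι → P →ₗ[k] Q}
    (hf : ∀ i ∈ s, IsHom b c (f i)) : IsHom b c (∑ i ∈ s, f i) := by
  classical
  induction s using Finset.induction_on with
  | empty => simpa using IsHom.zero
  | insert a s ha ih =>
    rw [Finset.sum_insert ha]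
    exact (hf a (by simp)).add (ih fun i hi => hf i (by simp [hi]))

variable (k B) in
/-- The regular bimodule. -/
def regular : BimodStr k B B where
  l := LinearMap.mul k B
  r := (LinearMap.mul k B).flip
  l_one := by simp
  r_one := by simp
  l_mul := by simp [mul_assoc]
  r_mul := by simp [mul_assoc]
  comm := by simp [mul_assoc]

/-- The elements `gen v` generate the bimodule `P`. -/
def Generates (b : BimodStr k B P) {V : Type*} [AddCommGroup V] [Module k V]
    (gen : V →ₗ[k] P) : Prop :=
  Submodule.span k {x | ∃ e e' v, x = b.l e (b.r e' (gen v))} = ⊤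

theorem Generates.hom_ext {V : Type*} [AddCommGroup V] [Module k V] {gen : V →ₗ[k] P}
    (h : b.Generates gen) {f g : P →ₗ[k] Q} (hf : IsHom b c f) (hg : IsHom b c g)
    (hfg : ∀ v, f (gen v) = g (gen v)) : f = g := by
  apply LinearMap.ext_on_range (v := fun x : {x | ∃ e e' v, x = b.l e (b.r e' (gen v))} => x.1)
  · rw [Subtype.range_coe]; exact h
  · rintro ⟨x, e, e', v, rfl⟩
    simp [(hf _ _).1, (hf _ _).2, (hg _ _).1, (hg _ _).2, hfg]

end

universe w

/-- `P` is freely generated, as a bimodule, by a `k`-module. -/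
def RelFree {k B : Type*} [CommRing k] [Ring B] [Algebra k B] {P : Type w} [AddCommGroup P]
    [Module k P] (b : BimodStr k B P) : Prop :=
  ∃ (V : Type w) (_ : AddCommGroup V) (_ : Module k V) (gen : V →ₗ[k] P),
    b.Generates gen ∧
      ∀ (N : Type w) [AddCommGroup N] [Module k N] (c : BimodStr k B N) (φ : V →ₗ[k] N),
        ∃ g : P →ₗ[k] N, IsHom b c g ∧ ∀ v, g (gen v) = φ v

end BimodStr

open BimodStr

universe w

/-- A resolution of the bimodule `B` by relatively free bimodules that is split over `k`. -/
structure SplitRes (k B : Type*) [CommRing k] [Ring B] [Algebra k B] (P : ℕ → Type w)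
    [∀ n, AddCommGroup (P n)] [∀ n, Module k (P n)] where
  /-- the bimodule structures -/
  str : ∀ n, BimodStr k B (P n)
  /-- the differential -/
  d : ∀ n, P (n + 1) →ₗ[k] P n
  /-- the augmentation -/
  aug : P 0 →ₗ[k] B
  /-- the cycles -/
  cyc : ∀ n, Submodule k (P n)
  cyc_zero : cyc 0 = LinearMap.ker aug
  cyc_succ : ∀ n, cyc (n + 1) = LinearMap.ker (d n)
  free : ∀ n, (str n).RelFree
  d_hom : ∀ n, IsHom (str (n + 1)) (str n) (d n)
  aug_hom : IsHom (str 0) (regular k B) aug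
  d_mem : ∀ n x, d n x ∈ cyc n
  aug_split : ∃ s : B →ₗ[k] P 0, ∀ b, aug (s b) = b
  split : ∀ n, ∃ t : cyc n →ₗ[k] P (n + 1), ∀ x, d n (t x) = x

namespace SplitRes

variable {k B : Type*} [CommRing k] [Ring B] [Algebra k B] {P Q : ℕ → Type w}
    [∀ n, AddCommGroup (P n)] [∀ n, Module k (P n)]
    [∀ n, AddCommGroup (Q n)] [∀ n, Module k (Q n)]

theorem dd (X : SplitRes k B P) (n : ℕ) (x : P (n + 2)) : X.d n (X.d (n + 1) x) = 0 := by
  have := X.d_mem (n + 1) x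
  rw [X.cyc_succ] at this
  exact this

theorem aug_d (X : SplitRes k B P) (x : P 1) : X.aug (X.d 0 x) = 0 := by
  have := X.d_mem 0 x
  rw [X.cyc_zero] at this
  exact this

theorem exists_lift (Y : SplitRes k B Q) {N : Type w} [AddCommGroup N] [Module k N]
    {b : BimodStr k B N} (hb : b.RelFree) (n : ℕ) (φ : N →ₗ[k] Q n) (hφ : IsHom b (Y.str n) φ)
    (h : ∀ x, φ x ∈ Y.cyc n) :
    ∃ g : N →ₗ[k] Q (n + 1), IsHom b (Y.str (n + 1)) g ∧ ∀ x, Y.d n (g x) = φ x := by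
  obtain ⟨V, _, _, gen, hgen, hex⟩ := hb
  obtain ⟨t, ht⟩ := Y.split n
  obtain ⟨g, hg, hgv⟩ := hex _ (Y.str (n + 1)) (t ∘ₗ (φ.codRestrict _ h) ∘ₗ gen)
  refine ⟨g, hg, fun x => ?_⟩
  refine LinearMap.congr_fun (f := Y.d n ∘ₗ g) (hgen.hom_ext ((Y.d_hom n).comp hg) hφ fun v => ?_) x
  simp [hgv, ht]

theorem exists_lift_aug (Y : SplitRes k B Q) {N : Type w} [AddCommGroup N] [Module k N]
    {b : BimodStr k B N} (hb : b.RelFree) (φ : N →ₗ[k] B) (hφ : IsHom b (regular k B) φ) :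
    ∃ g : N →ₗ[k] Q 0, IsHom b (Y.str 0) g ∧ ∀ x, Y.aug (g x) = φ x := by
  obtain ⟨V, _, _, gen, hgen, hex⟩ := hb
  obtain ⟨t, ht⟩ := Y.aug_split
  obtain ⟨g, hg, hgv⟩ := hex _ (Y.str 0) (t ∘ₗ φ ∘ₗ gen)
  refine ⟨g, hg, fun x => ?_⟩
  refine LinearMap.congr_fun (f := Y.aug ∘ₗ g) (hgen.hom_ext (Y.aug_hom.comp hg) hφ fun v => ?_) x
  simp [hgv, ht]

/-- There is a chain map between two resolutions. -/
theorem exists_chainMap (X : SplitRes k B P) (Y : SplitRes k B Q) :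
    ∃ f : ∀ n, P n →ₗ[k] Q n, (∀ n, IsHom (X.str n) (Y.str n) (f n)) ∧
      (∀ x, Y.aug (f 0 x) = X.aug x) ∧ ∀ n x, Y.d n (f (n + 1) x) = f n (X.d n x) := by
  let G : ℕ → Type _ := fun n =>
    {f : P n →ₗ[k] Q n // IsHom (X.str n) (Y.str n) f ∧ ∀ x, f (X.d n x) ∈ Y.cyc n}
  have step : ∀ n (f : G n), ∃ g : G (n + 1), ∀ x, Y.d n (g.1 x) = f.1 (X.d n x) := by
    rintro n ⟨f, hf, hfc⟩
    obtain ⟨g, hg, hgd⟩ := Y.exists_lift (X.free (n + 1)) n (f ∘ₗ X.d n) (hf.comp (X.d_hom n))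
      hfc
    refine ⟨⟨g, hg, fun x => ?_⟩, hgd⟩
    rw [Y.cyc_succ, LinearMap.mem_ker, hgd]
    simp [X.dd]
  obtain ⟨f0, hf0, hfa⟩ := Y.exists_lift_aug (X.free 0) X.aug X.aug_hom
  have f0' : ∀ x, f0 (X.d 0 x) ∈ Y.cyc 0 := fun x => by
    rw [Y.cyc_zero, LinearMap.mem_ker, hfa, X.aug_d]
  choose nxt hnxt using step
  let F : ∀ n, G n := fun n => Nat.rec ⟨f0, hf0, f0'⟩ (fun n f => nxt n f) n
  exact ⟨fun n => (F n).1, fun n => (F n).2.1, hfa, fun n x => hnxt n (F n) x⟩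

/-- Chain maps that lift zero are null-homotopic. -/
theorem exists_homotopy (X : SplitRes k B P) (Y : SplitRes k B Q) (f : ∀ n, P n →ₗ[k] Q n)
    (hf : ∀ n, IsHom (X.str n) (Y.str n) (f n)) (ha : ∀ x, Y.aug (f 0 x) = 0)
    (hd : ∀ n x, Y.d n (f (n + 1) x) = f n (X.d n x)) :
    ∃ h : ∀ n, P n →ₗ[k] Q (n + 1), (∀ n, IsHom (X.str n) (Y.str (n + 1)) (h n)) ∧
      (∀ x, f 0 x = Y.d 0 (h 0 x)) ∧
      ∀ n x, f (n + 1) x = Y.d (n + 1) (h (n + 1) x) + h n (X.d n x) := by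
  let G : ℕ → Type _ := fun n => {h : P n →ₗ[k] Q (n + 1) // IsHom (X.str n) (Y.str (n + 1)) h ∧
    ∀ x, f (n + 1) x - h (X.d n x) ∈ Y.cyc (n + 1)}
  have step : ∀ n (h : G n), ∃ g : G (n + 1),
      ∀ x, Y.d (n + 1) (g.1 x) = f (n + 1) x - h.1 (X.d n x) := by
    rintro n ⟨h, hh, hhc⟩
    obtain ⟨g, hg, hgd⟩ := Y.exists_lift (X.free (n + 1)) (n + 1) (f (n + 1) - h ∘ₗ X.d n)
      ((hf _).sub (hh.comp (X.d_hom n))) hhc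
    refine ⟨⟨g, hg, fun x => ?_⟩, hgd⟩
    rw [Y.cyc_succ, LinearMap.mem_ker, LinearMap.map_sub, hgd, hd]
    simp [X.dd]
  obtain ⟨h0, hh0, hhd⟩ := Y.exists_lift (X.free 0) 0 (f 0) (hf 0) (fun x => by
    rw [Y.cyc_zero, LinearMap.mem_ker, ha])
  have h0' : ∀ x, f 1 x - h0 (X.d 0 x) ∈ Y.cyc 1 := fun x => by
    rw [Y.cyc_succ, LinearMap.mem_ker, LinearMap.map_sub, hhd, hd, sub_self]
  choose nxt hnxt using step
  let F : ∀ n, G n := fun n => Nat.rec ⟨h0, hh0, h0'⟩ (fun n f => nxt n f) n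
  refine ⟨fun n => (F n).1, fun n => (F n).2.1, fun x => (hhd x).symm, fun n x => ?_⟩
  have := hnxt n (F n) x
  exact (sub_eq_iff_eq_add.1 this.symm)

end SplitRes

section CohomologyEquiv

variable {k : Type*} [CommRing k] {C D : ℕ → Type*}
  [∀ n, AddCommGroup (C n)] [∀ n, Module k (C n)] [∀ n, AddCommGroup (D n)] [∀ n, Module k (D n)]

/-- Cochain maps that are inverse to each other on cohomology induce an isomorphism. -/
theorem nonempty_cohomology_equiv (c : ∀ n, C n →ₗ[k] C (n + 1)) (d : ∀ n, D n →ₗ[k] D (n + 1))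
    (F : ∀ n, C n →ₗ[k] D n) (G : ∀ n, D n →ₗ[k] C n)
    (hF : ∀ n x, F (n + 1) (c n x) = d n (F n x)) (hG : ∀ n x, G (n + 1) (d n x) = c n (G n x))
    (hGF : ∀ n x, c n x = 0 → G n (F n x) - x ∈ coboundaries c n)
    (hFG : ∀ n x, d n x = 0 → F n (G n x) - x ∈ coboundaries d n) (n : ℕ) :
    Nonempty (Cohomology c n ≃ₗ[k] Cohomology d n) := by
  have hFc : ∀ n, ∀ x ∈ coboundaries c n, F n x ∈ coboundaries d n := by
    rintro (_ | n) x hx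
    · obtain rfl : x = 0 := hx
      simp
    · obtain ⟨y, rfl⟩ := hx
      exact ⟨F n y, (hF n y).symm⟩
  have hGc : ∀ n, ∀ x ∈ coboundaries d n, G n x ∈ coboundaries c n := by
    rintro (_ | n) x hx
    · obtain rfl : x = 0 := hx
      simp
    · obtain ⟨y, rfl⟩ := hx
      exact ⟨G n y, (hG n y).symm⟩
  let F' : LinearMap.ker (c n) →ₗ[k] LinearMap.ker (d n) := (F n).restrict fun x hx => by
    rw [LinearMap.mem_ker] at hx ⊢; rw [← hF, hx, LinearMap.map_zero]
  let G' : LinearMap.ker (d n) →ₗ[k] LinearMap.ker (c n) := (G n).restrict fun x hx => by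
    rw [LinearMap.mem_ker] at hx ⊢; rw [← hG, hx, LinearMap.map_zero]
  refine ⟨LinearEquiv.ofLinearMap (Submodule.mapQ _ _ F' fun x (hx : x.1 ∈ _) => show F n x.1 ∈ _ from hFc n _ hx)
    (Submodule.mapQ _ _ G' fun x (hx : x.1 ∈ _) => show G n x.1 ∈ _ from hGc n _ hx) ?_ ?_⟩
  · apply Submodule.linearMap_qext
    ext1 x
    exact (Submodule.Quotient.eq _).2 (hFG n x x.2)
  · apply Submodule.linearMap_qext
    ext1 x
    exact (Submodule.Quotient.eq _).2 (hGF n x x.2)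

end CohomologyEquiv

section
variable {k B : Type*} [CommRing k] [Ring B] [Algebra k B]
    {P Q : ℕ → Type w} [∀ n, AddCommGroup (P n)] [∀ n, Module k (P n)]
    [∀ n, AddCommGroup (Q n)] [∀ n, Module k (Q n)]
    (X : SplitRes k B P) (Y : SplitRes k B Q)
    {M : Type*} [AddCommGroup M] [Module k M] (bM : BimodStr k B M)
    {C D : ℕ → Type*} [∀ n, AddCommGroup (C n)] [∀ n, Module k (C n)] [∀ n, AddCommGroup (D n)]
    [∀ n, Module k (D n)]
include X Y bM

/-- A chain map of bimodules induces maps on the bimodule homomorphisms into `M`. -/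
theorem SplitRes.exists_pullback
    (S : ∀ n, C n →ₗ[k] (P n →ₗ[k] M)) (T : ∀ n, D n →ₗ[k] (Q n →ₗ[k] M))
    (f : ∀ n, P n →ₗ[k] Q n) (hf : ∀ n, IsHom (X.str n) (Y.str n) (f n))
    (hSi : ∀ n, Function.Injective (S n))
    (hS : ∀ n g, g ∈ LinearMap.range (S n) ↔ IsHom (X.str n) bM g)
    (hT : ∀ n g, g ∈ LinearMap.range (T n) ↔ IsHom (Y.str n) bM g) :
    ∃ F : ∀ n, D n →ₗ[k] C n, ∀ n φ, S n (F n φ) = T n φ ∘ₗ f n := by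
  let e : ∀ n, C n ≃ₗ[k] LinearMap.range (S n) := fun n => LinearEquiv.ofInjective (S n) (hSi n)
  refine ⟨fun n => (e n).symm.toLinearMap ∘ₗ
    LinearMap.codRestrict _ (LinearMap.lcomp k M (f n) ∘ₗ T n) fun φ => ?_, fun n φ => ?_⟩
  · rw [hS]
    exact ((hT n _).1 ⟨φ, rfl⟩).comp (hf n)
  · have : ∀ y, S n ((e n).symm y) = y := fun y => congrArg Subtype.val ((e n).apply_symm_apply y)
    rw [comp_apply, coe_coe, this]
    rfl

omit Y in
/-- A chain endomorphism over the identity induces the identity on cohomology. -/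
theorem SplitRes.pullback_sub_mem (c : ∀ n, C n →ₗ[k] C (n + 1))
    (S : ∀ n, C n →ₗ[k] (P n →ₗ[k] M)) (hSi : ∀ n, Function.Injective (S n))
    (hS : ∀ n g, g ∈ LinearMap.range (S n) ↔ IsHom (X.str n) bM g)
    (hSc : ∀ n φ, S (n + 1) (c n φ) = S n φ ∘ₗ X.d n)
    (f : ∀ n, P n →ₗ[k] P n) (hf : ∀ n, IsHom (X.str n) (X.str n) (f n))
    (ha : ∀ x, X.aug (f 0 x) = X.aug x) (hd : ∀ n x, X.d n (f (n + 1) x) = f n (X.d n x))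
    (F : ∀ n, C n →ₗ[k] C n) (hF : ∀ n φ, S n (F n φ) = S n φ ∘ₗ f n) (n : ℕ) (φ : C n)
    (hφ : c n φ = 0) : F n φ - φ ∈ coboundaries c n := by
  obtain ⟨h, hh, hh0, hhs⟩ := X.exists_homotopy X (fun n => f n - LinearMap.id)
    (fun n => (hf n).sub IsHom.id) (by simp [ha]) (by simp [hd])
  have hz : ∀ x, S n φ (X.d n x) = 0 := fun x => by
    rw [← comp_apply, ← hSc, hφ, LinearMap.map_zero, LinearMap.zero_apply]
  rcases n with _ | n
  · change F 0 φ - φ = 0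
    apply hSi 0
    ext x
    have := congrArg (S 0 φ) (hh0 x)
    rw [hz] at this
    rw [LinearMap.map_sub, hF, LinearMap.map_zero, LinearMap.zero_apply, ← this]
    simp
  · obtain ⟨ψ, hψ⟩ := (hS n _).2 (((hS _ _).1 ⟨φ, rfl⟩).comp (hh n))
    refine ⟨ψ, hSi _ ?_⟩
    ext x
    have := congrArg (S (n + 1) φ) (hhs n x)
    rw [LinearMap.map_add, hz, zero_add] at this
    rw [hSc, hψ, LinearMap.map_sub, hF, comp_apply, comp_apply, ← this]
    simp

/-- Two relatively free split resolutions compute the same cohomology. -/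
theorem SplitRes.nonempty_cohomology_equiv
    (c : ∀ n, C n →ₗ[k] C (n + 1)) (d : ∀ n, D n →ₗ[k] D (n + 1))
    (S : ∀ n, C n →ₗ[k] (P n →ₗ[k] M)) (T : ∀ n, D n →ₗ[k] (Q n →ₗ[k] M))
    (hSi : ∀ n, Function.Injective (S n)) (hTi : ∀ n, Function.Injective (T n))
    (hS : ∀ n g, g ∈ LinearMap.range (S n) ↔ IsHom (X.str n) bM g)
    (hT : ∀ n g, g ∈ LinearMap.range (T n) ↔ IsHom (Y.str n) bM g)
    (hSc : ∀ n φ, S (n + 1) (c n φ) = S n φ ∘ₗ X.d n)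
    (hTd : ∀ n φ, T (n + 1) (d n φ) = T n φ ∘ₗ Y.d n) (n : ℕ) :
    Nonempty (Cohomology c n ≃ₗ[k] Cohomology d n) := by
  obtain ⟨f, hf, hfa, hfd⟩ := X.exists_chainMap Y
  obtain ⟨g, hg, hga, hgd⟩ := Y.exists_chainMap X
  obtain ⟨F, hF⟩ := X.exists_pullback Y bM S T f hf hSi hS hT
  obtain ⟨G, hG⟩ := Y.exists_pullback X bM T S g hg hTi hT hS
  refine _root_.nonempty_cohomology_equiv c d G F ?_ ?_ ?_ ?_ n
  · intro n x
    apply hTi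
    rw [hG, hTd, hG, hSc]
    ext y; simp [hgd]
  · intro n x
    apply hSi
    rw [hF, hSc, hF, hTd]
    ext y; simp [hfd]
  · refine X.pullback_sub_mem bM c S hSi hS hSc (fun n => g n ∘ₗ f n) (fun n => (hg n).comp (hf n)) (by simp [hfa, hga])
      (by simp [hfd, hgd]) (fun n => F n ∘ₗ G n) ?_
    intro n φ
    rw [comp_apply, hF, hG]; rfl
  · refine Y.pullback_sub_mem bM d T hTi hT hTd (fun n => f n ∘ₗ g n) (fun n => (hf n).comp (hg n)) (by simp [hfa, hga])
      (by simp [hfd, hgd]) (fun n => G n ∘ₗ F n) ?_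
    intro n φ
    rw [comp_apply, hG, hF]; rfl

end

/-! ### Two-sided bar complexes -/

namespace TP
variable {k V : Type*} [CommRing k] [AddCommGroup V] [Module k V]

theorem snoc_cons {n : ℕ} (a b : V) (w : ⨂[k]^n V) :
    snoc k (n + 1) (cons k n (a ⊗ₜ w) ⊗ₜ b) = cons k (n + 1) (a ⊗ₜ snoc k n (w ⊗ₜ b)) := by
  apply toTA_injective
  rw [toTA_snoc, toTA_cons, toTA_cons, toTA_snoc, mul_assoc]

theorem snoc_nil (b : V) : snoc k 0 (nil k V ⊗ₜ b) = cons k 0 (b ⊗ₜ nil k V) := by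
  apply toTA_injective
  rw [toTA_snoc, toTA_cons, toTA_nil, one_mul, mul_one]

theorem snoc_symm_cons_succ {n : ℕ} (a : V) (w : ⨂[k]^(n + 1) V) :
    (snoc k (n + 1)).symm (cons k (n + 1) (a ⊗ₜ w)) =
      (cons k n).toLinearMap.rTensor V ((assoc k V _ V).symm
        (a ⊗ₜ (snoc k n).symm w)) := by
  rw [LinearEquiv.symm_apply_eq]
  induction w using snoc_induction with
  | zero => simp
  | snoc w v => simp [snoc_cons]
  | add x y hx hy => rw [tmul_add, map_add, hx, hy, map_add, tmul_add, map_add, map_add, map_add]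

theorem snoc_symm_cons_nil (a : V) :
    (snoc k 0).symm (cons k 0 (a ⊗ₜ nil k V)) = nil k V ⊗ₜ a := by
  rw [LinearEquiv.symm_apply_eq, snoc_nil]

variable (B : Type*) [Ring B] [Algebra k B]

theorem mulAt_zero_cons {n : ℕ} (a b : B) (w : ⨂[k]^n B) :
    mulAt k B (n + 1) 0 (cons k (n + 1) (a ⊗ₜ cons k n (b ⊗ₜ w))) = cons k n ((a * b) ⊗ₜ w) := by
  simp [mulAt]

theorem mulAt_succ_cons {n i : ℕ} (a : B) (w : ⨂[k]^(n + 1) B) :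
    mulAt k B (n + 1) (i + 1) (cons k (n + 1) (a ⊗ₜ w)) = cons k n (a ⊗ₜ mulAt k B n i w) := by
  simp [mulAt]

end TP

theorem pow_succ_smul' {k M : Type*} [CommRing k] [AddCommMonoid M] [Module k M] (a : k) (n : ℕ)
    (x : M) : a ^ (n + 1) • x = a • a ^ n • x := by
  rw [pow_succ', mul_smul]

namespace Bar

variable {k B N L : Type*} [CommRing k] [Ring B] [Algebra k B] [AddCommGroup N] [Module k N]
  [AddCommGroup L] [Module k L]

/-- `B^{⊗ r} ⊗ L`. -/
abbrev T (k B L : Type*) [CommRing k] [Ring B] [Algebra k B] [AddCommGroup L] [Module k L]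
    (r : ℕ) : Type _ := (⨂[k]^r B) ⊗[k] L

/-- `b ⊗ (y ⊗ x) ↦ (b ⊗ y) ⊗ x`. -/
def consE (k B L : Type*) [CommRing k] [Ring B] [Algebra k B] [AddCommGroup L] [Module k L]
    (r : ℕ) : B ⊗[k] T k B L r ≃ₗ[k] T k B L (r + 1) :=
  (assoc k B _ L).symm.trans (TensorProduct.congr (TP.cons k r) (LinearEquiv.refl k L))

theorem consE_tmul (r : ℕ) (b : B) (y : ⨂[k]^r B) (x : L) :
    consE k B L r (b ⊗ₜ (y ⊗ₜ x)) = TP.cons k r (b ⊗ₜ y) ⊗ₜ x := rfl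

theorem hom_ext_zero {M : Type*} [AddCommGroup M] [Module k M] {f g : T k B L 0 →ₗ[k] M}
    (h : ∀ x, f (TP.nil k B ⊗ₜ x) = g (TP.nil k B ⊗ₜ x)) : f = g := by
  apply ext'
  intro y x
  obtain ⟨c, rfl⟩ := TP.zero_eq_smul_nil y
  rw [← smul_tmul', LinearMap.map_smul, LinearMap.map_smul, h]

theorem hom_ext_succ {M : Type*} [AddCommGroup M] [Module k M] {r : ℕ}
    {f g : T k B L (r + 1) →ₗ[k] M}
    (h : ∀ b t, f (consE k B L r (b ⊗ₜ t)) = g (consE k B L r (b ⊗ₜ t))) : f = g := by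
  have : f ∘ₗ (consE k B L r).toLinearMap = g ∘ₗ (consE k B L r).toLinearMap :=
    ext' h
  refine ext' fun y x => ?_
  have := LinearMap.congr_fun this ((consE k B L r).symm (y ⊗ₜ x))
  simpa using this

section
variable (l : B →ₗ[k] L →ₗ[k] L)

/-- Multiplication of `b` into the first factor of `B^{⊗ r} ⊗ L`. -/
def bul : (r : ℕ) → B ⊗[k] T k B L r →ₗ[k] T k B L r
  | 0 => (TensorProduct.lift l).lTensor _ ∘ₗ (TensorProduct.leftComm k B _ L).toLinearMap
  | r + 1 => (consE k B L r).toLinearMap ∘ₗ (LinearMap.mul' k B).rTensor _ ∘ₗ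
      (assoc k B B _).symm.toLinearMap ∘ₗ (consE k B L r).symm.toLinearMap.lTensor B

@[simp] theorem bul_zero (b : B) (y : ⨂[k]^0 B) (x : L) :
    bul l 0 (b ⊗ₜ (y ⊗ₜ x)) = y ⊗ₜ l b x := by
  simp [bul]

@[simp] theorem bul_succ (r : ℕ) (a b : B) (t : T k B L r) :
    bul l (r + 1) (a ⊗ₜ consE k B L r (b ⊗ₜ t)) = consE k B L r ((a * b) ⊗ₜ t) := by
  simp [bul]

/-- The differential of the one-sided bar complex. -/
def beta : (r : ℕ) → T k B L (r + 1) →ₗ[k] T k B L r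
  | 0 => bul l 0 ∘ₗ (consE k B L 0).symm.toLinearMap
  | r + 1 => bul l (r + 1) ∘ₗ (consE k B L (r + 1)).symm.toLinearMap -
      (consE k B L r).toLinearMap ∘ₗ (beta r).lTensor B ∘ₗ (consE k B L (r + 1)).symm.toLinearMap

@[simp] theorem beta_zero (b : B) (t : T k B L 0) :
    beta l 0 (consE k B L 0 (b ⊗ₜ t)) = bul l 0 (b ⊗ₜ t) := by
  simp [beta]

@[simp] theorem beta_succ (r : ℕ) (b : B) (t : T k B L (r + 1)) :
    beta l (r + 1) (consE k B L (r + 1) (b ⊗ₜ t)) =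
      bul l (r + 1) (b ⊗ₜ t) - consE k B L r (b ⊗ₜ beta l r t) := by
  simp [beta]

theorem bul_bul (hl : ∀ a b x, l (a * b) x = l a (l b x)) (r : ℕ) (a b : B) (t : T k B L r) :
    bul l r ((a * b) ⊗ₜ t) = bul l r (a ⊗ₜ bul l r (b ⊗ₜ t)) := by
  cases r with
  | zero =>
    refine LinearMap.congr_fun (f := bul l 0 ∘ₗ TensorProduct.mk k _ _ (a * b))
      (g := bul l 0 ∘ₗ TensorProduct.mk k _ _ a ∘ₗ bul l 0 ∘ₗ TensorProduct.mk k _ _ b) ?_ t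
    exact hom_ext_zero fun x => by simp [hl]
  | succ r =>
    refine LinearMap.congr_fun (f := bul l (r + 1) ∘ₗ TensorProduct.mk k _ _ (a * b))
      (g := bul l (r + 1) ∘ₗ TensorProduct.mk k _ _ a ∘ₗ bul l (r + 1) ∘ₗ
        TensorProduct.mk k _ _ b) ?_ t
    exact hom_ext_succ fun x => by simp [mul_assoc]

theorem beta_bul (hl : ∀ a b x, l (a * b) x = l a (l b x)) (r : ℕ) (a : B)
    (t : T k B L (r + 1)) :
    beta l r (bul l (r + 1) (a ⊗ₜ t)) = bul l r (a ⊗ₜ beta l r t) := by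
  refine LinearMap.congr_fun (f := beta l r ∘ₗ bul l (r + 1) ∘ₗ TensorProduct.mk k _ _ a)
      (g := bul l r ∘ₗ TensorProduct.mk k _ _ a ∘ₗ beta l r) (hom_ext_succ fun b t => ?_) t
  cases r with
  | zero => simp [bul_bul l hl]
  | succ r => simp [bul_bul l hl, tmul_sub]

theorem beta_beta (hl : ∀ a b x, l (a * b) x = l a (l b x)) (r : ℕ) (t : T k B L (r + 2)) :
    beta l r (beta l (r + 1) t) = 0 := by
  induction r with
  | zero =>
    exact LinearMap.congr_fun (f := beta l 0 ∘ₗ beta l 1) (g := 0)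
      (hom_ext_succ fun b t => by simp [beta_bul l hl]) t
  | succ r ih =>
    exact LinearMap.congr_fun (f := beta l (r + 1) ∘ₗ beta l (r + 2)) (g := 0)
      (hom_ext_succ fun b t => by simp [beta_bul l hl, ih]) t

/-- `(y ⊗ b) ⊗ x ↦ y ⊗ b x`. -/
def lastMul (r : ℕ) : T k B L (r + 1) →ₗ[k] T k B L r :=
  (TensorProduct.lift l).lTensor _ ∘ₗ (assoc k _ B L).toLinearMap ∘ₗ
    (TP.snoc k r).symm.toLinearMap.rTensor L

theorem beta_tmul (r : ℕ) (y : ⨂[k]^(r + 1) B) (x : L) :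
    beta l r (y ⊗ₜ x) = ∑ i ∈ Finset.range r, (-1 : k) ^ i • (TP.mulAt k B r i y ⊗ₜ[k] x) +
      (-1 : k) ^ r • lastMul l r (y ⊗ₜ x) := by
  induction r with
  | zero =>
    induction y using TP.cons_induction with
    | zero => simp
    | cons b y =>
      obtain ⟨c, rfl⟩ := TP.zero_eq_smul_nil y
      rw [← consE_tmul, beta_zero]
      simp [lastMul, TP.snoc_symm_cons_nil, consE_tmul, ← smul_tmul']
    | add y y' h h' => simp only [add_tmul, map_add, h, h', Finset.range_zero, Finset.sum_empty,
        zero_add, smul_add]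
  | succ r ih =>
    induction y using TP.cons_induction with
    | zero => simp
    | cons b y =>
      rw [← consE_tmul, beta_succ, ih, Finset.sum_range_succ']
      have h1 : bul l (r + 1) (b ⊗ₜ (y ⊗ₜ x)) =
          TP.mulAt k B (r + 1) 0 (TP.cons k (r + 1) (b ⊗ₜ y)) ⊗ₜ x := by
        induction y using TP.cons_induction with
        | zero => simp
        | cons b' y => rw [← consE_tmul, bul_succ, TP.mulAt_zero_cons, consE_tmul]
        | add y y' h h' => simp only [add_tmul, tmul_add, map_add, h, h']
      have h2 : consE k B L r (b ⊗ₜ lastMul l r (y ⊗ₜ x)) =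
          lastMul l (r + 1) (consE k B L (r + 1) (b ⊗ₜ (y ⊗ₜ x))) := by
        simp only [lastMul, comp_apply, coe_coe, rTensor_tmul,
          consE_tmul, TP.snoc_symm_cons_succ]
        generalize (TP.snoc k r).symm y = z
        refine LinearMap.congr_fun (f := (consE k B L r).toLinearMap ∘ₗ TensorProduct.mk k _ _ b ∘ₗ
          (lift l).lTensor _ ∘ₗ (assoc k _ B L).toLinearMap ∘ₗ
          (TensorProduct.mk k _ L).flip x)
          (g := (lift l).lTensor _ ∘ₗ (assoc k _ B L).toLinearMap ∘ₗ
          (TensorProduct.mk k _ L).flip x ∘ₗ (TP.cons k r).toLinearMap.rTensor B ∘ₗ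
          (assoc k B _ B).symm.toLinearMap ∘ₗ TensorProduct.mk k _ _ b)
          (ext' fun z b' => ?_) z
        simp [consE_tmul]
      rw [tmul_add, map_add, tmul_smul, map_smul, h2, tmul_sum, map_sum, h1]
      simp only [TP.mulAt_succ_cons, tmul_smul, map_smul, consE_tmul, pow_zero, one_smul,
        pow_succ_smul', ← Finset.smul_sum]
      module
    | add y y' h h' =>
      simp only [add_tmul, map_add, h, h', Finset.sum_add_distrib, smul_add]
      abel

variable (rN : B →ₗ[k] N →ₗ[k] N)

/-- `n ⊗ (b ⊗ t) ↦ n b ⊗ t`. -/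
def nbul (r : ℕ) : N ⊗[k] T k B L (r + 1) →ₗ[k] N ⊗[k] T k B L r :=
  (TensorProduct.lift rN.flip).rTensor _ ∘ₗ (assoc k N B _).symm.toLinearMap ∘ₗ
    (consE k B L r).symm.toLinearMap.lTensor N

@[simp] theorem nbul_tmul (r : ℕ) (n : N) (b : B) (t : T k B L r) :
    nbul rN r (n ⊗ₜ consE k B L r (b ⊗ₜ t)) = rN b n ⊗ₜ t := by
  simp [nbul]

/-- The differential of the two-sided bar complex `N ⊗ B^{⊗ r} ⊗ L`. -/
def barD (r : ℕ) : N ⊗[k] T k B L (r + 1) →ₗ[k] N ⊗[k] T k B L r :=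
  nbul rN r - (beta l r).lTensor N

theorem barD_tmul (r : ℕ) (n : N) (b : B) (t : T k B L r) :
    barD l rN r (n ⊗ₜ consE k B L r (b ⊗ₜ t)) =
      rN b n ⊗ₜ t - n ⊗ₜ beta l r (consE k B L r (b ⊗ₜ t)) := by
  simp [barD]

variable {M : Type*} [AddCommGroup M] [Module k M]

theorem bar_hom_ext {r : ℕ} {f g : N ⊗[k] T k B L (r + 1) →ₗ[k] M}
    (h : ∀ n b t, f (n ⊗ₜ consE k B L r (b ⊗ₜ t)) = g (n ⊗ₜ consE k B L r (b ⊗ₜ t))) : f = g := by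
  refine ext' fun n t => ?_
  exact LinearMap.congr_fun (f := f ∘ₗ TensorProduct.mk k _ _ n)
    (g := g ∘ₗ TensorProduct.mk k _ _ n) (hom_ext_succ fun b t => h n b t) t

theorem barD_barD (hl : ∀ a b x, l (a * b) x = l a (l b x))
    (hr : ∀ a b n, rN (a * b) n = rN b (rN a n)) (r : ℕ) (z : N ⊗[k] T k B L (r + 2)) :
    barD l rN r (barD l rN (r + 1) z) = 0 := by
  refine LinearMap.congr_fun (f := barD l rN r ∘ₗ barD l rN (r + 1)) (g := 0)
    (bar_hom_ext fun n b t => ?_) z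
  rw [comp_apply, barD_tmul, LinearMap.map_sub]
  have h1 : barD l rN r (n ⊗ₜ beta l (r + 1) (consE k B L (r + 1) (b ⊗ₜ t))) =
      nbul rN r (n ⊗ₜ beta l (r + 1) (consE k B L (r + 1) (b ⊗ₜ t))) := by
    simp [barD, beta_beta l hl, -beta_succ]
  rw [h1, beta_succ, tmul_sub, LinearMap.map_sub, nbul_tmul, LinearMap.zero_apply]
  refine LinearMap.congr_fun (f := barD l rN r ∘ₗ TensorProduct.mk k _ _ (rN b n) -
      (nbul rN r ∘ₗ TensorProduct.mk k _ _ n ∘ₗ bul l (r + 1) ∘ₗ TensorProduct.mk k _ _ b -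
      TensorProduct.mk k _ _ (rN b n) ∘ₗ beta l r)) (g := 0) (hom_ext_succ fun a t => ?_) t
  simp [barD, hr]

variable (lam : L →ₗ[k] B ⊗[k] L)

/-- `y ⊗ x ↦ (y ⊗ b) ⊗ x'`, where `lam x = b ⊗ x'`. -/
def sg (r : ℕ) : T k B L r →ₗ[k] T k B L (r + 1) :=
  (TP.snoc k r).toLinearMap.rTensor L ∘ₗ (assoc k _ B L).symm.toLinearMap ∘ₗ
    lam.lTensor _

theorem sg_nil (x : L) :
    sg lam 0 (TP.nil k B ⊗ₜ x) =
      consE k B L 0 ((TensorProduct.mk k _ L (TP.nil k B)).lTensor B (lam x)) := by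
  simp only [sg, comp_apply, lTensor_tmul]
  generalize lam x = z
  induction z with
  | zero => simp
  | tmul b x => simp [TP.snoc_nil, consE_tmul]
  | add z z' h h' => simp only [tmul_add, map_add, h, h']

@[simp] theorem sg_consE (r : ℕ) (b : B) (t : T k B L r) :
    sg lam (r + 1) (consE k B L r (b ⊗ₜ t)) = consE k B L (r + 1) (b ⊗ₜ sg lam r t) := by
  refine LinearMap.congr_fun
    (f := sg lam (r + 1) ∘ₗ (consE k B L r).toLinearMap ∘ₗ TensorProduct.mk k _ _ b)
    (g := (consE k B L (r + 1)).toLinearMap ∘ₗ TensorProduct.mk k _ _ b ∘ₗ sg lam r)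
    (ext' fun y x => ?_) t
  simp only [sg, comp_apply, lTensor_tmul, consE_tmul, mk_apply,
    coe_coe]
  generalize lam x = z
  induction z with
  | zero => simp only [tmul_zero, map_zero]
  | tmul b x => simp [TP.snoc_cons, consE_tmul]
  | add z z' h h' => simp only [tmul_add, map_add, h, h']

theorem sg_bul (hl : ∀ a x, lam (l a x) = (mulLeft k a).rTensor L (lam x)) (r : ℕ) (a : B)
    (t : T k B L r) : sg lam r (bul l r (a ⊗ₜ t)) = bul l (r + 1) (a ⊗ₜ sg lam r t) := by
  cases r with
  | zero =>
    refine LinearMap.congr_fun (f := sg lam 0 ∘ₗ bul l 0 ∘ₗ TensorProduct.mk k _ _ a)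
      (g := bul l 1 ∘ₗ TensorProduct.mk k _ _ a ∘ₗ sg lam 0) (hom_ext_zero fun x => ?_) t
    simp only [comp_apply, mk_apply, bul_zero, sg_nil, hl]
    generalize lam x = z
    induction z with
    | zero => simp
    | tmul b x => simp
    | add z z' h h' => simp only [tmul_add, map_add, h, h']
  | succ r =>
    refine LinearMap.congr_fun (f := sg lam (r + 1) ∘ₗ bul l (r + 1) ∘ₗ TensorProduct.mk k _ _ a)
      (g := bul l (r + 2) ∘ₗ TensorProduct.mk k _ _ a ∘ₗ sg lam (r + 1))
      (hom_ext_succ fun b t => ?_) t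
    simp

theorem beta_sg_zero (hlam : ∀ x, TensorProduct.lift l (lam x) = x) (t : T k B L 0) :
    beta l 0 (sg lam 0 t) = t := by
  refine LinearMap.congr_fun (f := beta l 0 ∘ₗ sg lam 0) (g := LinearMap.id)
    (hom_ext_zero fun x => ?_) t
  rw [comp_apply, id_apply, sg_nil]
  conv_rhs => rw [← hlam x]
  generalize lam x = z
  induction z with
  | zero => simp
  | tmul b x => simp
  | add z z' h h' => simp only [tmul_add, map_add, h, h']

theorem beta_sg_succ (hlam : ∀ x, TensorProduct.lift l (lam x) = x)
    (hl : ∀ a x, lam (l a x) = (mulLeft k a).rTensor L (lam x)) (r : ℕ)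
    (t : T k B L (r + 1)) :
    beta l (r + 1) (sg lam (r + 1) t) = sg lam r (beta l r t) + (-1 : k) ^ (r + 1) • t := by
  induction r with
  | zero =>
    refine LinearMap.congr_fun (f := beta l 1 ∘ₗ sg lam 1)
      (g := sg lam 0 ∘ₗ beta l 0 + (-1 : k) ^ 1 • LinearMap.id) (hom_ext_succ fun b t => ?_) t
    simp [beta_sg_zero l lam hlam, sg_bul l lam hl, sub_eq_add_neg]
  | succ r ih =>
    refine LinearMap.congr_fun (f := beta l (r + 2) ∘ₗ sg lam (r + 2))
      (g := sg lam (r + 1) ∘ₗ beta l (r + 1) + (-1 : k) ^ (r + 2) • LinearMap.id)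
      (hom_ext_succ fun b t => ?_) t
    simp only [comp_apply, LinearMap.add_apply, LinearMap.smul_apply,
      id_apply, sg_consE, beta_succ, map_sub, sg_bul l lam hl, ih, tmul_add, map_add,
      tmul_smul, map_smul, pow_succ _ (r + 1), mul_neg_one, neg_smul]
    abel

/-- The homotopy `n ⊗ y ⊗ x ↦ (-1)ʳ⁺¹ n ⊗ (y ⊗ b) ⊗ x'`, where `lam x = b ⊗ x'`. -/
def barS (N : Type*) [AddCommGroup N] [Module k N] (r : ℕ) :
    N ⊗[k] T k B L r →ₗ[k] N ⊗[k] T k B L (r + 1) :=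
  (-1 : k) ^ (r + 1) • (sg lam r).lTensor N

/-- `n ⊗ x ↦ n b ⊗ x'`, where `lam x = b ⊗ x'`. -/
def barPi : N ⊗[k] T k B L 0 →ₗ[k] N ⊗[k] T k B L 0 := nbul rN 0 ∘ₗ (sg lam 0).lTensor N

theorem barD_barS_zero (hlam : ∀ x, TensorProduct.lift l (lam x) = x) (z : N ⊗[k] T k B L 0) :
    barD l rN 0 (barS lam N 0 z) = z - barPi rN lam z := by
  induction z with
  | zero => simp
  | tmul n t => simp [barD, barS, barPi, beta_sg_zero l lam hlam]; abel
  | add z z' h h' => rw [LinearMap.map_add, LinearMap.map_add, h, h', LinearMap.map_add]; abel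

theorem barPi_barD
    (hl : ∀ a x, lam (l a x) = (mulLeft k a).rTensor L (lam x))
    (hr : ∀ a b n, rN (a * b) n = rN b (rN a n)) (z : N ⊗[k] T k B L 1) :
    barPi rN lam (barD l rN 0 z) = 0 := by
  refine LinearMap.congr_fun (f := barPi rN lam ∘ₗ barD l rN 0) (g := 0)
    (bar_hom_ext fun n b t => ?_) z
  simp only [comp_apply, barD_tmul, beta_zero, LinearMap.map_sub, barPi, lTensor_tmul,
    sg_bul l lam hl]
  generalize sg lam 0 t = z
  refine LinearMap.congr_fun (f := nbul rN 0 ∘ₗ TensorProduct.mk k _ _ (rN b n) -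
      nbul rN 0 ∘ₗ TensorProduct.mk k _ _ n ∘ₗ bul l 1 ∘ₗ TensorProduct.mk k _ _ b) (g := 0)
      (hom_ext_succ fun a t => ?_) z
  simp [hr]

theorem barD_barS_succ (hlam : ∀ x, TensorProduct.lift l (lam x) = x)
    (hl : ∀ a x, lam (l a x) = (mulLeft k a).rTensor L (lam x)) (r : ℕ)
    (z : N ⊗[k] T k B L (r + 1)) :
    barD l rN (r + 1) (barS lam N (r + 1) z) + barS lam N r (barD l rN r z) = z := by
  refine LinearMap.congr_fun (f := barD l rN (r + 1) ∘ₗ barS lam N (r + 1) +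
    barS lam N r ∘ₗ barD l rN r) (g := LinearMap.id) (bar_hom_ext fun n b t => ?_) z
  have := beta_sg_succ l lam hlam hl r (consE k B L r (b ⊗ₜ t))
  rw [sg_consE] at this
  simp only [LinearMap.add_apply, comp_apply, barS, LinearMap.smul_apply,
    lTensor_tmul, LinearMap.map_smul, sg_consE, barD_tmul, this, LinearMap.map_sub, id_apply,
    tmul_add, tmul_smul, smul_sub, smul_add, smul_smul, pow_succ]
  have h1 : ((-1 : k) ^ r * -1 * -1) * ((-1 : k) ^ r * -1) = -1 := by
    rcases neg_one_pow_eq_or k r with h | h <;> rw [h] <;> ring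
  rw [h1]
  simp
  abel

end
end Bar

/-! ### Free bimodules and the bar resolution -/

open BimodStr

section Env

variable {k B V P Q : Type*} [CommRing k] [Ring B] [Algebra k B] [AddCommGroup V] [Module k V]
  [AddCommGroup P] [Module k P] [AddCommGroup Q] [Module k Q]

/-- The bimodule `B ⊗ V ⊗ B`. -/
def envStr (k B V : Type*) [CommRing k] [Ring B] [Algebra k B] [AddCommGroup V] [Module k V] :
    BimodStr k B (Env k B V) where
  l := LinearMap.rTensorHom _ ∘ₗ LinearMap.mul k B
  r := LinearMap.lTensorHom B ∘ₗ LinearMap.lTensorHom V ∘ₗ (LinearMap.mul k B).flip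
  l_one x := by
    have : LinearMap.mul k B 1 = LinearMap.id := by ext; simp
    simp [this]
  r_one x := by
    have : (LinearMap.mul k B).flip 1 = LinearMap.id := by ext; simp
    simp [this]
  l_mul a b x := by
    have : LinearMap.mul k B (a * b) = LinearMap.mul k B a ∘ₗ LinearMap.mul k B b := by
      ext; simp [mul_assoc]
    simp [this, LinearMap.rTensor_comp]
  r_mul a b x := by
    have : (LinearMap.mul k B).flip (a * b) =
        (LinearMap.mul k B).flip b ∘ₗ (LinearMap.mul k B).flip a := by
      ext; simp [mul_assoc]
    simp [this, LinearMap.lTensor_comp]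
  comm a b x := by
    simp only [comp_apply, LinearMap.rTensorHom, LinearMap.lTensorHom]
    refine LinearMap.congr_fun (f := LinearMap.rTensor _ (LinearMap.mul k B a) ∘ₗ
      LinearMap.lTensor B _) (g := LinearMap.lTensor B _ ∘ₗ LinearMap.rTensor _
        (LinearMap.mul k B a)) ?_ x
    rw [LinearMap.rTensor_comp_lTensor, LinearMap.lTensor_comp_rTensor]

theorem envStr_l (e : B) (x : Env k B V) : (envStr k B V).l e x = envLeft e x := rfl

theorem envStr_r (e : B) (x : Env k B V) : (envStr k B V).r e x = envRight e x := rfl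

@[simp] theorem envStr_l_tmul (e b : B) (x : V ⊗[k] B) :
    (envStr k B V).l e (b ⊗ₜ x) = (e * b) ⊗ₜ x := rfl

@[simp] theorem envStr_r_tmul (e b b' : B) (v : V) :
    (envStr k B V).r e (b ⊗ₜ (v ⊗ₜ b')) = b ⊗ₜ (v ⊗ₜ (b' * e)) := rfl

theorem envGen_apply (v : V) : (envGen v : Env k B V) = 1 ⊗ₜ (v ⊗ₜ 1) := rfl

theorem env_tmul_eq (b b' : B) (v : V) : (b ⊗ₜ (v ⊗ₜ b') : Env k B V) =
    (envStr k B V).l b ((envStr k B V).r b' (envGen v)) := by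
  simp [envGen_apply]

theorem generates_envGen : (envStr k B V).Generates envGen := by
  rw [Generates, eq_top_iff]
  rintro x -
  induction x using TensorProduct.induction_on with
  | zero => exact zero_mem _
  | tmul b y =>
    induction y with
    | zero => simp
    | tmul v b' => exact Submodule.subset_span ⟨b, b', v, env_tmul_eq b b' v⟩
    | add y y' h h' => rw [tmul_add]; exact add_mem h h'
  | add x y hx hy => exact add_mem hx hy

theorem env_ext' {f g : Env k B V →ₗ[k] P} (h : ∀ b v b', f (b ⊗ₜ (v ⊗ₜ b')) = g (b ⊗ₜ (v ⊗ₜ b'))) :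
    f = g :=
  ext' fun b y => LinearMap.congr_fun (f := f ∘ₗ TensorProduct.mk k _ _ b)
    (g := g ∘ₗ TensorProduct.mk k _ _ b) (ext' fun v b' => h b v b') y

/-- The bimodule homomorphism `B ⊗ V ⊗ B → P` that extends a linear map `V → P`. -/
def BimodStr.ext (b : BimodStr k B P) (φ : V →ₗ[k] P) : Env k B V →ₗ[k] P :=
  TensorProduct.lift b.l ∘ₗ (TensorProduct.lift (b.r.flip ∘ₗ φ)).lTensor B

variable (b : BimodStr k B P) (c : BimodStr k B Q)

@[simp] theorem BimodStr.ext_tmul (φ : V →ₗ[k] P) (e e' : B) (v : V) :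
    b.ext φ (e ⊗ₜ (v ⊗ₜ e')) = b.l e (b.r e' (φ v)) := rfl

@[simp] theorem BimodStr.ext_envGen (φ : V →ₗ[k] P) (v : V) : b.ext φ (envGen v) = φ v := by
  simp [envGen_apply, b.l_one, b.r_one]

theorem BimodStr.isHom_ext (φ : V →ₗ[k] P) : IsHom (envStr k B V) b (b.ext φ) := by
  intro e x
  constructor
  · refine LinearMap.congr_fun (f := b.ext φ ∘ₗ (envStr k B V).l e) (g := b.l e ∘ₗ b.ext φ)
      (env_ext' fun a v a' => ?_) x
    simp [b.l_mul]
  · refine LinearMap.congr_fun (f := b.ext φ ∘ₗ (envStr k B V).r e) (g := b.r e ∘ₗ b.ext φ)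
      (env_ext' fun a v a' => ?_) x
    simp [b.r_mul, b.comm]

theorem BimodStr.IsHom.comp_ext {b : BimodStr k B P} {c : BimodStr k B Q} {f : P →ₗ[k] Q}
    (hf : IsHom b c f) (φ : V →ₗ[k] P) : f ∘ₗ b.ext φ = c.ext (f ∘ₗ φ) :=
  env_ext' fun a v a' => by simp [(hf _ _).1, (hf _ _).2]

theorem BimodStr.IsHom.eq_ext {f : Env k B V →ₗ[k] P} {b : BimodStr k B P}
    (hf : IsHom (envStr k B V) b f) : f = b.ext (f ∘ₗ envGen) :=
  generates_envGen.hom_ext hf (b.isHom_ext _) fun v => by simp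

@[simp] theorem BimodStr.ext_envL (φ : V →ₗ[k] P) (e : B) (v : V) :
    b.ext φ (envL (e ⊗ₜ v)) = b.l e (φ v) := by
  simp [envL, b.r_one]

@[simp] theorem BimodStr.ext_envR (φ : V →ₗ[k] P) (e : B) (v : V) :
    b.ext φ (envR (v ⊗ₜ e)) = b.r e (φ v) := by
  simp [envR, b.l_one]

end Env

section Hochschild

universe u v

variable {k : Type u} {B : Type v} [CommRing k] [Ring B] [Algebra k B]

/-- The augmentation `B ⊗ B → B`. -/
def barAug (k B : Type*) [CommRing k] [Ring B] [Algebra k B] :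
    Env k B (⨂[k]^0 B) →ₗ[k] B :=
  (regular k B).ext (Algebra.linearMap k B ∘ₗ
    (PiTensorProduct.isEmptyEquiv (R := k) (s := fun _ : Fin 0 => B) (Fin 0)).toLinearMap)

theorem isEmptyEquiv_nil (k V : Type*) [CommRing k] [AddCommGroup V] [Module k V] :
    PiTensorProduct.isEmptyEquiv (R := k) (s := fun _ : Fin 0 => V) (Fin 0) (TP.nil k V) = 1 := by
  rw [TP.nil, PiTensorProduct.isEmptyEquiv_apply_tprod]

@[simp] theorem barAug_tmul (x y : B) : barAug k B (x ⊗ₜ (TP.nil k B ⊗ₜ y)) = x * y := by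
  simp only [barAug, BimodStr.ext_tmul, comp_apply, coe_coe, isEmptyEquiv_nil]
  simp [regular]

/-- `1 ⊗ b`. -/
def barLam (k B : Type*) [CommRing k] [Ring B] [Algebra k B] : B →ₗ[k] B ⊗[k] B :=
  (TensorProduct.mk k B B).flip 1

theorem ext_hochschildDelta (n : ℕ) :
    (envStr k B (⨂[k]^n B)).ext (hochschildDelta k B n) =
      Bar.barD (LinearMap.mul k B) (LinearMap.mul k B).flip n := by
  refine env_ext' fun x y x' => ?_
  have h1 : (envStr k B (⨂[k]^n B)).l x ((envStr k B (⨂[k]^n B)).r x'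
      (envL ((TP.cons k n).symm y))) =
      Bar.nbul (LinearMap.mul k B).flip n (x ⊗ₜ (y ⊗ₜ x')) := by
    induction y using TP.cons_induction with
    | zero => simp
    | cons b y =>
      rw [← Bar.consE_tmul, Bar.nbul_tmul]
      simp [envL]
    | add y y' h h' => simp only [map_add, h, h', add_tmul, tmul_add]
  have h2 : (envStr k B (⨂[k]^n B)).l x ((envStr k B (⨂[k]^n B)).r x'
      (envR ((TP.snoc k n).symm y))) = x ⊗ₜ Bar.lastMul (LinearMap.mul k B) n (y ⊗ₜ x') := by
    clear h1
    induction y using TP.snoc_induction with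
    | zero => simp
    | snoc y b => simp [envR, Bar.lastMul]
    | add y y' h h' => simp only [map_add, h, h', add_tmul, tmul_add]
  simp only [BimodStr.ext_tmul, hochschildDelta, LinearMap.add_apply, map_add, comp_apply,
    coe_coe, h1, LinearMap.smul_apply, map_smul, h2, LinearMap.sum_apply, map_sum,
    envGen_apply, envStr_l_tmul, envStr_r_tmul, one_mul, mul_one, Bar.barD, LinearMap.sub_apply,
    lTensor_tmul, Bar.beta_tmul, tmul_add, tmul_sum, tmul_smul, pow_succ_smul',
    ← Finset.smul_sum]
  module

theorem barPi_eq (z : Env k B (⨂[k]^0 B)) :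
    Bar.barPi (LinearMap.mul k B).flip (barLam k B) z = barAug k B z ⊗ₜ (TP.nil k B ⊗ₜ 1) := by
  refine LinearMap.congr_fun (f := Bar.barPi (LinearMap.mul k B).flip (barLam k B))
    (g := (TensorProduct.mk k _ _).flip (TP.nil k B ⊗ₜ 1) ∘ₗ barAug k B)
    (env_ext' fun x y x' => ?_) z
  obtain ⟨c, rfl⟩ := TP.zero_eq_smul_nil y
  rw [← smul_tmul', tmul_smul, LinearMap.map_smul, LinearMap.map_smul]
  congr 1
  simp only [Bar.barPi, comp_apply, lTensor_tmul, Bar.sg_nil, barLam,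
    flip_apply, mk_apply, Bar.nbul_tmul, barAug_tmul, LinearMap.mul_apply']

theorem barLam_mul (x : B) : TensorProduct.lift (LinearMap.mul k B) (barLam k B x) = x := by
  simp [barLam]

theorem barLam_linear (a x : B) : barLam k B (LinearMap.mul k B a x) =
    (mulLeft k a).rTensor B (barLam k B x) := by
  simp [barLam]

/-- The bar resolution of `B`. -/
def barRes (k : Type u) (B : Type v) [CommRing k] [Ring B] [Algebra k B] :
    SplitRes k B (fun n => Env k B (⨂[k]^n B)) where
  str n := envStr k B (⨂[k]^n B)
  d n := (envStr k B (⨂[k]^n B)).ext (hochschildDelta k B n)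
  aug := barAug k B
  cyc n := match n with
    | 0 => LinearMap.ker (barAug k B)
    | n + 1 => LinearMap.ker ((envStr k B (⨂[k]^n B)).ext (hochschildDelta k B n))
  cyc_zero := rfl
  cyc_succ _ := rfl
  free n := ⟨⨂[k]^n B, inferInstance, inferInstance, envGen, generates_envGen,
    fun N _ _ c φ => ⟨c.ext φ, c.isHom_ext φ, c.ext_envGen φ⟩⟩
  d_hom n := isHom_ext _ _
  aug_hom := isHom_ext _ _
  d_mem n x := by
    rcases n with _ | n
    · have h := Bar.barPi_barD (LinearMap.mul k B) (LinearMap.mul k B).flip (barLam k B)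
        barLam_linear (by simp [mul_assoc]) x
      rw [← ext_hochschildDelta, barPi_eq] at h
      have := congrArg (barAug k B) h
      simpa using this
    · rw [LinearMap.mem_ker, ext_hochschildDelta, ext_hochschildDelta]
      exact Bar.barD_barD _ _ (by simp [mul_assoc]) (by simp [mul_assoc]) _ _
  aug_split := ⟨(TensorProduct.mk k _ _).flip (TP.nil k B ⊗ₜ 1), fun b => by simp⟩
  split n := by
    refine ⟨Bar.barS (barLam k B) B n ∘ₗ Submodule.subtype _, fun x => ?_⟩
    rw [ext_hochschildDelta]
    rcases n with _ | n
    · have h : barAug k B x.1 = 0 := x.2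
      rw [comp_apply, Bar.barD_barS_zero _ _ _ barLam_mul]
      simp [barPi_eq, h]
    · have h : (envStr k B (⨂[k]^n B)).ext (hochschildDelta k B n) x.1 = 0 := x.2
      rw [ext_hochschildDelta] at h
      have := Bar.barD_barS_succ _ (LinearMap.mul k B).flip (barLam k B) barLam_mul barLam_linear
        n x.1
      rw [h, LinearMap.map_zero, add_zero] at this
      exact this

end Hochschild

section Module

variable (k B M : Type*) [CommRing k] [Ring B] [Algebra k B] [AddCommGroup M] [Module k M]
  [Module B M] [Module Bᵐᵒᵖ M] [IsScalarTower k B M] [IsScalarTower k Bᵐᵒᵖ M]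
  [SMulCommClass B Bᵐᵒᵖ M]

/-- A bimodule in the sense of Mathlib. -/
def moduleStr : BimodStr k B M where
  l := leftAct k B M
  r := rightAct k B M
  l_one x := one_smul B x
  r_one x := one_smul Bᵐᵒᵖ x
  l_mul a b x := mul_smul a b x
  r_mul a b x := mul_smul (MulOpposite.op b) (MulOpposite.op a) x
  comm a b x := smul_comm a (MulOpposite.op b) x

variable {k B M}

theorem bimodEval_eq_ext {V : Type*} [AddCommGroup V] [Module k V] (φ : V →ₗ[k] M) :
    bimodEval φ = (moduleStr k B M).ext φ := rfl

theorem bimodEval_comp_ext {V W : Type*} [AddCommGroup V] [Module k V] [AddCommGroup W] [Module k W]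
    (φ : V →ₗ[k] M) (g : W →ₗ[k] Env k B V) :
    bimodEval φ ∘ₗ (envStr k B V).ext g = bimodEval (bimodEval φ ∘ₗ g) := by
  simp only [bimodEval_eq_ext]
  exact ((moduleStr k B M).isHom_ext φ).comp_ext g

theorem bimodEval_envGen {V : Type*} [AddCommGroup V] [Module k V] (φ : V →ₗ[k] M) (v : V) :
    bimodEval (B := B) φ (envGen v) = φ v := by
  rw [bimodEval_eq_ext]; simp

theorem bimodEvalₗ_injective {V : Type*} [AddCommGroup V] [Module k V] :
    Function.Injective (bimodEvalₗ : (V →ₗ[k] M) →ₗ[k] (Env k B V →ₗ[k] M)) := by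
  intro φ ψ h
  ext v
  have := LinearMap.congr_fun h (envGen v)
  exact (bimodEval_envGen (B := B) φ v).symm.trans (this.trans (bimodEval_envGen (B := B) ψ v))

theorem mem_range_bimodEvalₗ {V : Type*} [AddCommGroup V] [Module k V] (g : Env k B V →ₗ[k] M) :
    g ∈ LinearMap.range (bimodEvalₗ : (V →ₗ[k] M) →ₗ[k] (Env k B V →ₗ[k] M)) ↔
      IsHom (envStr k B V) (moduleStr k B M) g := by
  constructor
  · rintro ⟨φ, rfl⟩
    exact (moduleStr k B M).isHom_ext φ
  · intro h
    exact ⟨g ∘ₗ envGen, h.eq_ext.symm⟩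

end Module

/-! ### Perturbation: total complexes with contractible rows -/

namespace Perturb

variable {k : Type*} [CommRing k] {X : ℕ → ℕ → Type*} [∀ r s, AddCommGroup (X r s)]
  [∀ r s, Module k (X r s)]

/-- The composite of two steps of the total differential. -/
def dd (d : ∀ r s r' s' : ℕ, X r s →ₗ[k] X r' s') (r s r' s' : ℕ) : X r s →ₗ[k] X r' s' :=
  ∑ q ∈ antidiagonal (r' + s' + 1), d q.1 q.2 r' s' ∘ₗ d r s q.1 q.2

/-- The total space in degree `n`. -/
abbrev Tot (X : ℕ → ℕ → Type*) (n : ℕ) : Type _ :=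
  ∀ p : antidiagonal n, X p.1.1 p.1.2

/-- The total differential. -/
def tot (d : ∀ r s r' s' : ℕ, X r s →ₗ[k] X r' s') (n : ℕ) : Tot X (n + 1) →ₗ[k] Tot X n :=
  LinearMap.pi fun q =>
    ∑ p : antidiagonal (n + 1), d p.1.1 p.1.2 q.1.1 q.1.2 ∘ₗ LinearMap.proj p

/-- Contracting data for the rows of a family of maps `d`, with values on a generating set
determined recursively. -/
structure RowData (d : ∀ r s r' s' : ℕ, X r s →ₗ[k] X r' s') (σ : ∀ r s, X r s →ₗ[k] X (r + 1) s)
    (π : ∀ s, X 0 s →ₗ[k] X 0 s) (G : ∀ r s, Set (X r s)) : Prop where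
  off : ∀ r s r' s', ¬ (r + s = r' + s' + 1 ∧ s' ≤ s) → d r s r' s' = 0
  d0d0 : ∀ r s x, d (r + 1) s r s (d (r + 2) s (r + 1) s x) = 0
  con : ∀ r s x, d (r + 2) s (r + 1) s (σ (r + 1) s x) + σ r s (d (r + 1) s r s x) = x
  con0 : ∀ s x, d 1 s 0 s (σ 0 s x) = x - π s x
  pi_d0 : ∀ s x, π s (d 1 s 0 s x) = 0
  recursion : ∀ r s r' s', s' < s → r + s = r' + s' + 2 → ∀ g ∈ G r s,
    d r s (r' + 1) s' g =
      - ∑ q ∈ antidiagonal (r' + s' + 1) with s' < q.2 ∧ q.2 ≤ s,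
        σ r' s' (d q.1 q.2 r' s' (d r s q.1 q.2 g))
  pi_d1 : ∀ s x, π s (d 0 (s + 1) 0 s x) = π s (d 0 (s + 1) 0 s (π (s + 1) x))
  pi_d1_pi_d1 : ∀ s x, π s (d 0 (s + 1) 0 s (π (s + 1) (d 0 (s + 2) 0 (s + 1) x))) = 0
  ext : ∀ r s r' s', (∀ g ∈ G r s, dd d r s r' s' g = 0) → dd d r s r' s' = 0

variable {d : ∀ r s r' s' : ℕ, X r s →ₗ[k] X r' s'} {σ : ∀ r s, X r s →ₗ[k] X (r + 1) s}
  {π : ∀ s, X 0 s →ₗ[k] X 0 s} {G : ∀ r s, Set (X r s)}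

theorem RowData.dd_of_lt (h : RowData d σ π G) {r s r' s' : ℕ} (hs : s < s') :
    dd d r s r' s' = 0 := by
  refine Finset.sum_eq_zero fun q hq => ?_
  by_cases h1 : q.2 ≤ s
  · rw [h.off q.1 q.2 r' s' (by omega), LinearMap.zero_comp]
  · rw [h.off r s q.1 q.2 (by omega), LinearMap.comp_zero]

theorem RowData.dd_eq (h : RowData d σ π G) (r s r' s' : ℕ) (x : X r s) (_ : s' < s) :
    dd d r s r' s' x = (∑ q ∈ antidiagonal (r' + s' + 1)
      with s' < q.2 ∧ q.2 ≤ s, d q.1 q.2 r' s' (d r s q.1 q.2 x)) +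
      d (r' + 1) s' r' s' (d r s (r' + 1) s' x) := by
  rw [dd, LinearMap.sum_apply, Finset.sum_filter]
  have h1 : ((r' + 1, s') : ℕ × ℕ) ∈ antidiagonal (r' + s' + 1) := by
    rw [mem_antidiagonal]; omega
  rw [← Finset.add_sum_erase _ _ h1, ← Finset.add_sum_erase _ _ h1, if_neg (by omega), zero_add,
    add_comm]
  congr 1
  refine Finset.sum_congr rfl fun q hq => ?_
  rw [Finset.mem_erase, mem_antidiagonal] at hq
  split_ifs with hif
  · rfl
  · rw [comp_apply]
    by_cases h2 : q.2 ≤ s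
    · rw [h.off q.1 q.2 r' s', LinearMap.zero_apply]
      rintro ⟨h3, h4⟩
      refine hq.1 (Prod.ext ?_ ?_) <;> simp only <;> omega
    · rw [h.off r s q.1 q.2 (by omega), LinearMap.zero_apply, LinearMap.map_zero]

theorem RowData.dd_eq_zero (h : RowData d σ π G) (n : ℕ) :
    ∀ r s r' s', r + s = n → r + s = r' + s' + 2 → dd d r s r' s' = 0 := by
  induction n with
  | zero => intro r s r' s' h1 h2; omega
  | succ n ihn =>
  intro r s r' s' hn
  obtain ⟨l, hl⟩ : ∃ l, l = s - s' := ⟨_, rfl⟩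
  induction l using Nat.strong_induction_on generalizing r' s' with
  | _ l ihl =>
  intro hr
  rcases lt_trichotomy s s' with hs | rfl | hs
  · exact h.dd_of_lt hs
  · obtain rfl : r = r' + 2 := by omega
    ext x
    rw [dd, LinearMap.sum_apply, Finset.sum_eq_single (r' + 1, s)]
    · simpa using h.d0d0 r' s x
    · intro q hq hne
      rw [mem_antidiagonal] at hq
      rw [comp_apply]
      by_cases h2 : q.2 ≤ s
      · rw [h.off q.1 q.2 r' s, LinearMap.zero_apply]
        rintro ⟨h3, h4⟩
        refine hne (Prod.ext ?_ ?_) <;> simp only <;> omega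
      · rw [h.off _ s q.1 q.2 (by omega), LinearMap.zero_apply, LinearMap.map_zero]
    · intro hmem
      rw [mem_antidiagonal] at hmem
      simp only at hmem; omega
  · apply h.ext
    intro g hg
    have hZ := h.dd_eq r s r' s' g hs
    have hrec := h.recursion r s r' s' hs hr g hg
    rw [← map_sum] at hrec
    rcases r' with _ | p
    · rw [hrec, LinearMap.map_neg, h.con0] at hZ
      have hπ : π s' (dd d r s 0 s' g) = 0 := by
        rw [h.dd_eq r s 0 s' g hs, LinearMap.map_add, h.pi_d0, add_zero]
        rw [Finset.sum_eq_single (0, s' + 1)]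
        · rw [h.pi_d1]
          rcases r with _ | r
          · obtain rfl : s = s' + 2 := by omega
            exact h.pi_d1_pi_d1 s' g
          · obtain rfl : r = 0 := by omega
            obtain rfl : s = s' + 1 := by omega
            rw [h.pi_d0, LinearMap.map_zero, LinearMap.map_zero]
        · intro q hq hne
          rw [Finset.mem_filter, mem_antidiagonal] at hq
          exfalso
          refine hne (Prod.ext ?_ ?_) <;> simp only <;> omega
        · intro hmem
          rw [Finset.mem_filter, mem_antidiagonal] at hmem
          simp only at hmem; omega
      have h2 : dd d r s 0 s' g = π s' (dd d r s 0 s' g) := by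
        conv_rhs => rw [h.dd_eq r s 0 s' g hs, LinearMap.map_add, h.pi_d0, add_zero]
        rw [hZ]; abel
      rw [h2, hπ]
    · rw [hrec, LinearMap.map_neg] at hZ
      have hd : d (p + 1) s' p s' (dd d r s (p + 1) s' g) = 0 := by
        have hsum : ∑ q' ∈ antidiagonal (p + s' + 1),
            d q'.1 q'.2 p s' (dd d r s q'.1 q'.2 g) = 0 := by
          have h0 : ∀ q ∈ antidiagonal (p + s' + 2),
              dd d q.1 q.2 p s' (d r s q.1 q.2 g) = 0 := by
            intro q hq
            rw [mem_antidiagonal] at hq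
            rw [ihn q.1 q.2 p s' (by omega) (by omega), LinearMap.zero_apply]
          have h1 := Finset.sum_eq_zero h0
          simp only [dd, LinearMap.sum_apply, comp_apply] at h1 ⊢
          rw [Finset.sum_comm] at h1
          rw [← h1]
          refine Finset.sum_congr rfl fun q' hq' => ?_
          rw [mem_antidiagonal] at hq'
          rw [map_sum, show q'.1 + q'.2 + 1 = p + s' + 2 by omega]
        rw [Finset.sum_eq_single (p + 1, s')] at hsum
        · exact hsum
        · intro q hq hne
          rw [mem_antidiagonal] at hq
          rcases lt_trichotomy q.2 s' with h1 | h1 | h1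
          · rw [h.off q.1 q.2 p s' (by omega), LinearMap.zero_apply]
          · exfalso
            refine hne (Prod.ext ?_ ?_) <;> simp only <;> omega
          · rw [ihl (s - q.2) (by omega) q.1 q.2 rfl (by omega), LinearMap.zero_apply, LinearMap.map_zero]
        · intro hmem
          rw [mem_antidiagonal] at hmem
          simp only at hmem; omega
      have hc := h.con p s' (∑ q ∈ antidiagonal (p + 1 + s' + 1)
        with s' < q.2 ∧ q.2 ≤ s, d q.1 q.2 (p + 1) s' (d r s q.1 q.2 g))
      have hdU : d (p + 1) s' p s' (∑ q ∈ antidiagonal (p + 1 + s' + 1)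
        with s' < q.2 ∧ q.2 ≤ s, d q.1 q.2 (p + 1) s' (d r s q.1 q.2 g)) = 0 := by
        rw [h.dd_eq r s (p + 1) s' g hs, LinearMap.map_add, h.d0d0, add_zero] at hd
        exact hd
      rw [hdU, LinearMap.map_zero, add_zero] at hc
      rw [hZ, hc, add_neg_cancel]

theorem RowData.tot_tot (h : RowData d σ π G) (n : ℕ) : tot d n ∘ₗ tot d (n + 1) = 0 := by
  refine LinearMap.ext fun x => funext fun q => ?_
  have hq := q.2
  rw [mem_antidiagonal] at hq
  simp only [tot, comp_apply, LinearMap.pi_apply, LinearMap.sum_apply,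
    LinearMap.proj_apply, LinearMap.zero_apply, Pi.zero_apply, map_sum]
  rw [Finset.sum_comm]
  refine Finset.sum_eq_zero fun p _ => ?_
  have hp := p.2
  rw [mem_antidiagonal] at hp
  have := LinearMap.congr_fun (h.dd_eq_zero _ p.1.1 p.1.2 q.1.1 q.1.2 rfl (by omega)) (x p)
  rw [dd, LinearMap.sum_apply, hq, ← Finset.sum_coe_sort] at this
  exact this

section exact
variable {V : Type*} [AddCommGroup V] [Module k V]

theorem tot_single (d : ∀ r s r' s' : ℕ, X r s →ₗ[k] X r' s') (n : ℕ)
    (p : antidiagonal (n + 1))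
    (q : antidiagonal n) (y : X p.1.1 p.1.2) :
    tot d n (Pi.single p y) q = d p.1.1 p.1.2 q.1.1 q.1.2 y := by
  simp only [tot, LinearMap.pi_apply, LinearMap.sum_apply, comp_apply,
    LinearMap.proj_apply]
  rw [Finset.sum_eq_single p]
  · rw [Pi.single_eq_same]
  · intro b _ hb
    rw [Pi.single_eq_of_ne hb, LinearMap.map_zero]
  · simp

/-- The element of `Tot X n` with a single component. -/
def sgl {n : ℕ} (r s : ℕ) (h : r + s = n) : X r s →ₗ[k] Tot X n :=
  LinearMap.single k (fun p : antidiagonal n => X p.1.1 p.1.2)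
    ⟨(r, s), mem_antidiagonal.2 h⟩

/-- A component of an element of `Tot X n`. -/
def cmp {n : ℕ} (r s : ℕ) (h : r + s = n) : Tot X n →ₗ[k] X r s :=
  LinearMap.proj (R := k) (φ := fun p : antidiagonal n => X p.1.1 p.1.2)
    ⟨(r, s), mem_antidiagonal.2 h⟩

theorem tot_ext {n : ℕ} {x y : Tot X n}
    (h : ∀ r s (hrs : r + s = n), cmp (k := k) r s hrs x = cmp (k := k) r s hrs y) : x = y := by
  funext p
  exact h p.1.1 p.1.2 (mem_antidiagonal.1 p.2)

theorem cmp_tot_sgl (d : ∀ r s r' s' : ℕ, X r s →ₗ[k] X r' s') {n : ℕ} (r s : ℕ)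
    (h : r + s = n + 1) (r' s' : ℕ) (h' : r' + s' = n) (y : X r s) :
    cmp (k := k) r' s' h' (tot d n (sgl (k := k) r s h y)) = d r s r' s' y :=
  tot_single d n ⟨(r, s), mem_antidiagonal.2 h⟩
    ⟨(r', s'), mem_antidiagonal.2 h'⟩ y

theorem RowData.exact_aux (h : RowData d σ π G) (n : ℕ) (m : ℕ) (hm : m ≤ n)
    (φ : V →ₗ[k] Tot X n)
    (hφ : ∀ n', (e : n = n' + 1) → ∀ v, tot d n' (e ▸ φ v) = 0)
    (hz : ∀ r s (hrs : r + s = n) v, m ≤ s → cmp (k := k) r s hrs (φ v) = 0) :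
    ∃ ψ : V →ₗ[k] Tot X (n + 1), tot d n ∘ₗ ψ = φ := by
  induction m generalizing φ with
  | zero =>
    refine ⟨0, ?_⟩
    ext1 v
    exact tot_ext fun r s hrs => by rw [hz r s hrs v (Nat.zero_le _)]; simp
  | succ m ih =>
    obtain ⟨n, rfl⟩ : ∃ n', n = n' + 1 := ⟨n - 1, by omega⟩
    obtain ⟨p, hp⟩ : ∃ p, p + 1 + m = n + 1 := ⟨n - m, by omega⟩
    have hφ' : ∀ v, tot d n (φ v) = 0 := hφ n rfl
    have hd0 : ∀ v, d (p + 1) m p m (cmp (k := k) (p + 1) m hp (φ v)) = 0 := by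
      intro v
      have h1 := congrFun (hφ' v) ⟨(p, m), mem_antidiagonal.2 (show p + m = n by omega)⟩
      simp only [tot, LinearMap.pi_apply, LinearMap.sum_apply, comp_apply,
        LinearMap.proj_apply] at h1
      rw [Finset.sum_eq_single ⟨(p + 1, m), mem_antidiagonal.2 hp⟩] at h1
      · exact h1
      · rintro ⟨⟨r, s⟩, hb⟩ _ hne
        have hb' := mem_antidiagonal.1 hb
        simp only at hb' ⊢
        rcases lt_trichotomy s m with h2 | rfl | h2
        · rw [h.off r s p m (by omega), LinearMap.zero_apply]
        · exfalso
          obtain rfl : r = p + 1 := by omega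
          exact hne rfl
        · have : φ v ⟨(r, s), hb⟩ = 0 := hz r s hb' v h2
          rw [this, LinearMap.map_zero]
      · simp
    let ψ₁ : V →ₗ[k] Tot X (n + 2) :=
      sgl (k := k) (p + 2) m (by omega) ∘ₗ σ (p + 1) m ∘ₗ cmp (k := k) (p + 1) m hp ∘ₗ φ
    obtain ⟨ψ₂, hψ₂⟩ := ih (by omega) (φ - tot d (n + 1) ∘ₗ ψ₁) (by
        rintro n' hn v
        obtain rfl : n = n' := by omega
        change tot d n (φ v - tot d (n + 1) (ψ₁ v)) = 0
        rw [LinearMap.map_sub, hφ', ← comp_apply (tot d n), h.tot_tot]; simp) (by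
        intro r s hrs v hms
        rw [LinearMap.sub_apply, LinearMap.map_sub, comp_apply]
        simp only [ψ₁, comp_apply]
        rw [cmp_tot_sgl]
        rcases hms.eq_or_lt with rfl | hlt
        · obtain rfl : r = p + 1 := by omega
          have := h.con p m (cmp (k := k) (p + 1) m hp (φ v))
          rw [hd0, LinearMap.map_zero, add_zero] at this
          rw [this, sub_self]
        · rw [hz r s hrs v hlt, h.off _ _ _ _ (by omega), LinearMap.zero_apply, sub_self])
    refine ⟨ψ₁ + ψ₂, ?_⟩
    rw [LinearMap.comp_add, hψ₂]; abel

/-- Every family of cycles is a family of boundaries. -/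
theorem RowData.exact (h : RowData d σ π G) (κ : ∀ s, X 0 s →ₗ[k] X 0 (s + 1)) (aug : X 0 0 → Prop)
    (hκ0 : ∀ x, aug x → π 0 x = π 0 (d 0 1 0 0 (κ 0 x)))
    (hκ : ∀ s x, π s (d 0 (s + 1) 0 s x) = 0 →
      π (s + 1) x = π (s + 1) (d 0 (s + 2) 0 (s + 1) (κ (s + 1) x)))
    (n : ℕ) (φ : V →ₗ[k] Tot X n)
    (hφ : ∀ n', (e : n = n' + 1) → ∀ v, tot d n' (e ▸ φ v) = 0)
    (hφ0 : (e : n = 0) → ∀ v, aug (cmp (k := k) 0 0 (by rw [e]) (φ v))) :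
    ∃ ψ : V →ₗ[k] Tot X (n + 1), tot d n ∘ₗ ψ = φ := by
  have hn : 0 + n = n := by omega
  have key : ∀ v, π n (cmp (k := k) 0 n hn (φ v)) =
      π n (d 0 (n + 1) 0 n (κ n (cmp (k := k) 0 n hn (φ v)))) := by
    intro v
    rcases n with _ | n
    · exact hκ0 _ (hφ0 rfl v)
    · apply hκ
      have h1 := congrArg (π n)
        (congrFun (hφ n rfl v) ⟨(0, n), mem_antidiagonal.2 (by omega)⟩)
      simp only [tot, LinearMap.pi_apply, LinearMap.sum_apply, comp_apply,
        LinearMap.proj_apply, map_sum] at h1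
      rw [Finset.sum_eq_single ⟨(0, n + 1), mem_antidiagonal.2 (by omega)⟩] at h1
      · exact h1.trans (LinearMap.map_zero _)
      · rintro ⟨⟨r, s⟩, hb⟩ _ hne
        have hb' := mem_antidiagonal.1 hb
        simp only at hb' ⊢
        rcases lt_trichotomy s n with h2 | rfl | h2
        · rw [h.off r s 0 n (by omega), LinearMap.zero_apply, LinearMap.map_zero]
        · obtain rfl : r = 1 := by omega
          exact h.pi_d0 _ _
        · exfalso
          obtain rfl : s = n + 1 := by omega
          obtain rfl : r = 0 := by omega
          exact hne rfl
      · simp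
  have step : ∀ (θ : V →ₗ[k] Tot X n) (ψ₁ : V →ₗ[k] Tot X (n + 1)),
      (∀ n', (e : n = n' + 1) → ∀ v, tot d n' (e ▸ θ v) = 0) →
      ∀ n', (e : n = n' + 1) → ∀ v, tot d n' (e ▸ (θ - tot d n ∘ₗ ψ₁) v) = 0 := by
    rintro θ ψ₁ hθ n' rfl v
    have := hθ n' rfl v
    simp only at this ⊢
    rw [LinearMap.sub_apply, LinearMap.map_sub, this, comp_apply,
      ← comp_apply (tot d n'), h.tot_tot]
    simp
  let ψ₁ : V →ₗ[k] Tot X (n + 1) :=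
    sgl (k := k) 0 (n + 1) (by omega) ∘ₗ κ n ∘ₗ cmp (k := k) 0 n hn ∘ₗ φ
  let φ₁ := φ - tot d n ∘ₗ ψ₁
  let ψ₂ : V →ₗ[k] Tot X (n + 1) :=
    sgl (k := k) 1 n (by omega) ∘ₗ σ 0 n ∘ₗ cmp (k := k) 0 n hn ∘ₗ φ₁
  have h1 : ∀ v, π n (cmp (k := k) 0 n hn (φ₁ v)) = 0 := by
    intro v
    simp only [φ₁, ψ₁, LinearMap.sub_apply, LinearMap.map_sub, comp_apply]
    rw [cmp_tot_sgl, key, sub_self]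
  obtain ⟨ψ₃, hψ₃⟩ := h.exact_aux n n le_rfl (φ₁ - tot d n ∘ₗ ψ₂) (step _ _ (step _ _ hφ)) (by
    intro r s hrs v hs
    obtain rfl : n = s := by omega
    obtain rfl : r = 0 := by omega
    rw [LinearMap.sub_apply, LinearMap.map_sub, comp_apply]
    simp only [ψ₂, comp_apply]
    rw [cmp_tot_sgl, h.con0, h1, sub_zero, sub_self])
  refine ⟨ψ₁ + ψ₂ + ψ₃, ?_⟩
  rw [LinearMap.comp_add, LinearMap.comp_add, hψ₃]
  simp only [φ₁]; abel

end exact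

end Perturb

/-! ### Maps out of the tensor algebra, extension of scalars -/

namespace TP

section
variable {k V N : Type*} [CommRing k] [AddCommGroup V] [Module k V] [AddCommGroup N] [Module k N]

/-- The algebra map behind `recTA`. -/
def recAux (α : V →ₗ[k] TensorAlgebra k V →ₗ[k] N) (β : V →ₗ[k] N →ₗ[k] N) :
    TensorAlgebra k V →ₐ[k] Module.End k (TensorAlgebra k V × N) :=
  TensorAlgebra.lift k
    { toFun := fun v => LinearMap.prod
        (mulLeft k (ι k v) ∘ₗ LinearMap.fst k _ _)
        (α v ∘ₗ LinearMap.fst k _ _ + β v ∘ₗ LinearMap.snd k _ _)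
      map_add' := fun v v' => by
        refine LinearMap.ext fun x => Prod.ext ?_ ?_
        · simp [add_mul]
        · change (α (v + v') x.1 + β (v + v') x.2) = (α v x.1 + β v x.2) + (α v' x.1 + β v' x.2)
          rw [LinearMap.map_add, LinearMap.map_add, LinearMap.add_apply, LinearMap.add_apply]
          abel
      map_smul' := fun c v => by
        refine LinearMap.ext fun x => Prod.ext ?_ ?_
        · simp
        · simp }

/-- The linear map out of the tensor algebra with `f 1 = n₀` and
`f (v * w) = α v w + β v (f w)`. -/
def recTA (n₀ : N) (α : V →ₗ[k] TensorAlgebra k V →ₗ[k] N) (β : V →ₗ[k] N →ₗ[k] N) :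
    TensorAlgebra k V →ₗ[k] N :=
  LinearMap.snd k _ _ ∘ₗ LinearMap.applyₗ (1, n₀) ∘ₗ (recAux α β).toLinearMap

variable (n₀ : N) (α : V →ₗ[k] TensorAlgebra k V →ₗ[k] N) (β : V →ₗ[k] N →ₗ[k] N)

@[simp] theorem recTA_one : recTA n₀ α β 1 = n₀ := by
  simp [recTA]

theorem recAux_fst (w : TensorAlgebra k V) : (recAux α β w (1, n₀)).1 = w := by
  induction w using ta_induction with
  | one => simp
  | cons v w h =>
    rw [map_mul, Module.End.mul_apply]
    simp [recAux] at h ⊢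
    rw [h]
  | smul c x h => simp [h]
  | add x y hx hy => simp [hx, hy]

@[simp] theorem recTA_ι_mul (v : V) (w : TensorAlgebra k V) :
    recTA n₀ α β (ι k v * w) = α v w + β v (recTA n₀ α β w) := by
  have h := recAux_fst n₀ α β w
  simp only [recTA, comp_apply, toLinearMap_apply, map_mul]
  conv_lhs => simp only [recAux, TensorAlgebra.lift_ι_apply]
  simp only [LinearMap.applyₗ_apply_apply, Module.End.mul_apply]
  change α v (recAux α β w (1, n₀)).1 + β v (recAux α β w (1, n₀)).2 = _
  rw [h]
  rfl

theorem ta_hom_ext' {f g : TensorAlgebra k V →ₗ[k] N} (h1 : f 1 = g 1)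
    (h : ∀ v w, f w = g w → f (ι k v * w) = g (ι k v * w)) : f = g := by
  ext w
  induction w using ta_induction with
  | one => exact h1
  | cons v w hw => exact h v w hw
  | smul c x hx => rw [LinearMap.map_smul, LinearMap.map_smul, hx]
  | add x y hx hy => rw [LinearMap.map_add, LinearMap.map_add, hx, hy]

end

end TP

section LeftExt

variable {k B M Z : Type*} [CommRing k] [Ring B] [Algebra k B] [AddCommGroup M] [Module k M]
  [AddCommGroup Z] [Module k Z] [Module B Z] [IsScalarTower k B Z]

/-- The left linear extension `b ⊗ m ↦ b φ(m)` of a linear map `φ`. -/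
def leftExt (B : Type*) [Ring B] [Algebra k B] [Module B Z] [IsScalarTower k B Z]
    (φ : M →ₗ[k] Z) : B ⊗[k] M →ₗ[k] Z :=
  TensorProduct.lift ((Algebra.lsmul k k Z : B →ₐ[k] Module.End k Z).toLinearMap.compl₂ φ)

@[simp] theorem leftExt_tmul (φ : M →ₗ[k] Z) (b : B) (m : M) : leftExt B φ (b ⊗ₜ m) = b • φ m := rfl

@[simp] theorem leftExt_smul (φ : M →ₗ[k] Z) (b : B) (x : B ⊗[k] M) :
    leftExt B φ (b • x) = b • leftExt B φ x := by
  induction x with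
  | zero => simp
  | tmul b' m => simp [smul_tmul', mul_smul]
  | add x y hx hy => simp only [smul_add, LinearMap.map_add, hx, hy]

theorem leftExt_one_tmul (φ : M →ₗ[k] Z) (m : M) : leftExt B φ (1 ⊗ₜ m) = φ m := by simp

/-- A map out of `B ⊗ M` that is left linear. -/
theorem eq_leftExt {f : B ⊗[k] M →ₗ[k] Z} (h : ∀ (b : B) x, f (b • x) = b • f x) :
    f = leftExt B (f ∘ₗ TensorProduct.mk k B M 1) :=
  ext' fun b m => by
    have := h b (1 ⊗ₜ m)
    simpa [smul_tmul'] using this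

theorem left_hom_ext {f g : B ⊗[k] M →ₗ[k] Z} (hf : ∀ (b : B) x, f (b • x) = b • f x)
    (hg : ∀ (b : B) x, g (b • x) = b • g x) (h : ∀ m, f (1 ⊗ₜ m) = g (1 ⊗ₜ m)) : f = g := by
  rw [eq_leftExt hf, eq_leftExt hg]
  congr 1
  exact LinearMap.ext h

/-- Left multiplication, as a bilinear map. -/
def lsm (k B Z : Type*) [CommRing k] [Ring B] [Algebra k B] [AddCommGroup Z] [Module k Z]
    [Module B Z] [IsScalarTower k B Z] : B →ₗ[k] Z →ₗ[k] Z :=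
  (Algebra.lsmul k k Z : B →ₐ[k] Module.End k Z).toLinearMap

@[simp] theorem lsm_apply (b : B) (z : Z) : lsm k B Z b z = b • z := rfl

variable {M' : Type*} [AddCommGroup M'] [Module k M']

theorem lTensor_smul' (φ : M →ₗ[k] M') (b : B) (x : B ⊗[k] M) :
    φ.lTensor B (b • x) = b • φ.lTensor B x := by
  induction x with
  | zero => simp
  | tmul b' m => simp [smul_tmul']
  | add x y hx hy => simp only [smul_add, LinearMap.map_add, hx, hy]

end LeftExt

/-! ### The multiplication of a crossed product -/

namespace CrossedSystem

open CrossedProduct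

variable {k A H : Type*} [CommRing k] [Ring A] [Algebra k A] [Ring H] [Bialgebra k H]
  (S : CrossedSystem k A H)

theorem push_one_right (h : H) : S.push (h ⊗ₜ 1) = 1 ⊗ₜ h := by
  have : S.push ∘ₗ (TensorProduct.mk k H A).flip 1 = (TensorProduct.mk k A H 1) := by
    have h1 : ∀ z : H ⊗[k] H, (TensorProduct.lift S.act).rTensor H
        (TensorProduct.rightComm k H H A (z ⊗ₜ 1)) =
        (Algebra.linearMap k A ∘ₗ Coalgebra.counit (R := k) (A := H)).rTensor H z := by
      intro z
      induction z with
      | zero => simp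
      | tmul a b => simp [S.act_one]
      | add x y hx hy => simp only [add_tmul, map_add, hx, hy]
    ext h
    simp only [WeakAction.push, comp_apply, flip_apply,
      mk_apply, rTensor_tmul, coe_coe, h1, LinearMap.rTensor_comp,
      Coalgebra.rTensor_counit_comul]
    simp
  exact LinearMap.congr_fun this h

theorem push_one_left (a : A) : S.push (1 ⊗ₜ a) = a ⊗ₜ 1 := by
  simp [WeakAction.push, Bialgebra.comul_one, Algebra.TensorProduct.one_def, S.one_act]

theorem crossedMul_tmul (a b : A) (h l : H) :
    crossedMul S.toWeakAction S.cocycle ((a ⊗ₜ h) ⊗ₜ (b ⊗ₜ l)) =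
      a • leftExt A (twistMul S.cocycle ∘ₗ (TensorProduct.mk k H H).flip l) (S.push (h ⊗ₜ b)) := by
  have h1 : ∀ x : A ⊗[k] H, (LinearMap.mul' k A).rTensor H
      ((assoc k A A H).symm (a ⊗ₜ x)) = a • x := by
    intro x
    induction x with
    | zero => simp
    | tmul b l => simp [smul_tmul']
    | add x y hx hy => simp only [tmul_add, map_add, hx, hy, smul_add]
  have h2 : ∀ z : A ⊗[k] H, (LinearMap.mul' k A).rTensor H ((assoc k A A H).symm
      ((twistMul S.cocycle).lTensor A (assoc k A H H (z ⊗ₜ l)))) =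
      leftExt A (twistMul S.cocycle ∘ₗ (TensorProduct.mk k H H).flip l) z := by
    intro z
    induction z with
    | zero => simp
    | tmul b h' =>
      simp only [assoc_tmul, lTensor_tmul, leftExt_tmul,
        comp_apply, flip_apply, mk_apply]
      generalize twistMul S.cocycle (h' ⊗ₜ l) = x
      induction x with
      | zero => simp
      | tmul b l => simp [smul_tmul']
      | add x y hx hy => simp only [tmul_add, map_add, hx, hy, smul_add]
    | add x y hx hy => simp only [add_tmul, map_add, hx, hy]
  simp only [crossedMul, comp_apply, coe_coe, assoc_tmul,
    lTensor_tmul, h1, assoc_symm_tmul, rTensor_tmul, h2]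

theorem twistMul_one_right (h : H) : twistMul S.cocycle (h ⊗ₜ 1) = 1 ⊗ₜ h := by
  have := S.mul_one' (1 ⊗ₜ h)
  rw [crossedMul_tmul, push_one_right] at this
  simpa using this

theorem twistMul_one_left (h : H) : twistMul S.cocycle (1 ⊗ₜ h) = 1 ⊗ₜ h := by
  have := S.one_mul' (1 ⊗ₜ h)
  rw [crossedMul_tmul, push_one_right] at this
  simpa using this

theorem mul_equiv (x y : A ⊗[k] H) : equiv S x * equiv S y =
    equiv S (crossedMul S.toWeakAction S.cocycle (x ⊗ₜ y)) := rfl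

theorem inA_apply (a : A) : inA S a = equiv S (a ⊗ₜ 1) := rfl

theorem inH_apply (h : H) : inH S h = equiv S (1 ⊗ₜ h) := rfl

theorem inH_mul_inA (h : H) (a : A) : inH S h * inA S a = equiv S (S.push (h ⊗ₜ a)) := by
  rw [inA_apply, inH_apply, mul_equiv, crossedMul_tmul, one_smul]
  congr 1
  generalize S.push (h ⊗ₜ a) = x
  refine LinearMap.congr_fun (g := LinearMap.id) (ext' fun b l => ?_) x
  simp [twistMul_one_right, smul_tmul']

theorem inH_mul_inH (h l : H) : inH S h * inH S l = equiv S (twistMul S.cocycle (h ⊗ₜ l)) := by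
  rw [inH_apply, inH_apply, mul_equiv, crossedMul_tmul, push_one_right]
  simp

theorem inA_mul_equiv (a : A) (x : A ⊗[k] H) : inA S a * equiv S x = equiv S (a • x) := by
  rw [inA_apply, mul_equiv]
  congr 1
  refine LinearMap.congr_fun (f := crossedMul S.toWeakAction S.cocycle ∘ₗ
    TensorProduct.mk k _ _ (a ⊗ₜ 1)) (g := lsm k A (A ⊗[k] H) a) (ext' fun b l => ?_) x
  simp [crossedMul_tmul, push_one_left, twistMul_one_left, smul_tmul']

theorem equiv_tmul (a : A) (h : H) : equiv S (a ⊗ₜ h) = inA S a * inH S h := by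
  rw [inH_apply, inA_mul_equiv, smul_tmul', smul_eq_mul, mul_one]

theorem inA_mul (a b : A) : inA S (a * b) = inA S a * inA S b := by
  rw [inA_apply S b, inA_mul_equiv, smul_tmul', smul_eq_mul, inA_apply]

theorem inA_one : inA S 1 = 1 := rfl

theorem inH_one : inH S 1 = 1 := rfl

theorem crossed_hom_ext {N : Type*} [AddCommGroup N] [Module k N]
    {f g : CrossedProduct S →ₗ[k] N}
    (h : ∀ a l, f (inA S a * inH S l) = g (inA S a * inH S l)) : f = g := by
  have : f ∘ₗ (equiv S).toLinearMap = g ∘ₗ (equiv S).toLinearMap :=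
    ext' fun a l => by simpa [equiv_tmul] using h a l
  ext x
  simpa using LinearMap.congr_fun this ((equiv S).symm x)

/-! ### The one-sided complex `E ⊗ T(H)` -/

/-- `(b # h) ⊗ w ↦ b ⊗ (h * w)`. -/
def cns : CrossedProduct S ⊗[k] TensorAlgebra k H →ₗ[k] A ⊗[k] TensorAlgebra k H :=
  (TensorProduct.lift (LinearMap.mul k (TensorAlgebra k H) ∘ₗ ι k)).lTensor A ∘ₗ
    (assoc k A H _).toLinearMap ∘ₗ (equiv S).symm.toLinearMap.rTensor _

@[simp] theorem cns_tmul (a : A) (h : H) (w : TensorAlgebra k H) :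
    cns S ((inA S a * inH S h) ⊗ₜ w) = a ⊗ₜ (ι k h * w) := by
  rw [← equiv_tmul]; simp [cns]

@[simp] theorem cns_inH_tmul (h : H) (w : TensorAlgebra k H) :
    cns S (inH S h ⊗ₜ w) = 1 ⊗ₜ (ι k h * w) := by
  have := cns_tmul S 1 h w
  rwa [inA_one, one_mul] at this

/-- `a ⊗ w ↦ (a # 1) ⊗ w`. -/
abbrev upA : A ⊗[k] TensorAlgebra k H →ₗ[k] CrossedProduct S ⊗[k] TensorAlgebra k H :=
  (inA S).rTensor _

/-- `(b # h) ⊗ w ↦ (b # 1) ⊗ (h * w)`. -/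
def jj : CrossedProduct S ⊗[k] TensorAlgebra k H →ₗ[k] CrossedProduct S ⊗[k] TensorAlgebra k H :=
  upA S ∘ₗ cns S

@[simp] theorem jj_tmul (a : A) (h : H) (w : TensorAlgebra k H) :
    jj S ((inA S a * inH S h) ⊗ₜ w) = inA S a ⊗ₜ (ι k h * w) := by
  simp [jj]

@[simp] theorem jj_inH_tmul (h : H) (w : TensorAlgebra k H) :
    jj S (inH S h ⊗ₜ w) = 1 ⊗ₜ (ι k h * w) := by
  simp [jj, inA_one]

theorem eth_hom_ext {N : Type*} [AddCommGroup N] [Module k N]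
    {M : Type*} [AddCommGroup M] [Module k M]
    {f g : CrossedProduct S ⊗[k] M →ₗ[k] N}
    (h : ∀ a l w, f ((inA S a * inH S l) ⊗ₜ w) = g ((inA S a * inH S l) ⊗ₜ w)) : f = g := by
  refine ext' fun e w => ?_
  refine LinearMap.congr_fun (f := f ∘ₗ (TensorProduct.mk k _ _).flip w)
    (g := g ∘ₗ (TensorProduct.mk k _ _).flip w) (crossed_hom_ext S fun a l => ?_) e
  exact h a l w

theorem jj_inA_smul (a : A) (x : CrossedProduct S ⊗[k] TensorAlgebra k H) :
    jj S (inA S a • x) = inA S a • jj S x := by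
  refine LinearMap.congr_fun (f := jj S ∘ₗ lsm k _ _ (inA S a)) (g := lsm k _ _ (inA S a) ∘ₗ jj S)
    (eth_hom_ext S fun b l w => ?_) x
  simp only [comp_apply, lsm_apply, smul_tmul', smul_eq_mul, ← mul_assoc, ← inA_mul,
    jj_tmul]

/-- `h ⊗ x ↦ (1 # h) x`, followed by `cns`. -/
def cnsH : H →ₗ[k] (CrossedProduct S ⊗[k] TensorAlgebra k H) →ₗ[k] A ⊗[k] TensorAlgebra k H :=
  LinearMap.llcomp k _ _ _ (cns S) ∘ₗ lsm k _ _ ∘ₗ inH S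

@[simp] theorem cnsH_apply (h : H) (x : CrossedProduct S ⊗[k] TensorAlgebra k H) :
    cnsH S h x = cns S (inH S h • x) := rfl

/-- `h ⊗ x ↦ (1 # h) x`, followed by `jj`. -/
def jjH : H →ₗ[k] (CrossedProduct S ⊗[k] TensorAlgebra k H) →ₗ[k]
    CrossedProduct S ⊗[k] TensorAlgebra k H :=
  LinearMap.llcomp k _ _ _ (jj S) ∘ₗ lsm k _ _ ∘ₗ inH S

@[simp] theorem jjH_apply (h : H) (x : CrossedProduct S ⊗[k] TensorAlgebra k H) :
    jjH S h x = jj S (inH S h • x) := rfl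

theorem upA_cnsH (h : H) (x : CrossedProduct S ⊗[k] TensorAlgebra k H) :
    upA S (cnsH S h x) = jjH S h x := rfl

/-- `h₁ ⋯ hₙ ↦ ∑ᵢ (-1)ⁱ f(hᵢ, hᵢ₊₁)^{⋯} ⊗ h₁ ⋯ (hᵢ hᵢ₊₁) ⋯ hₙ`. -/
def merge : TensorAlgebra k H →ₗ[k] A ⊗[k] TensorAlgebra k H :=
  TP.recTA 0 (-((cnsH S).compl₂ ((inH S).rTensor _ ∘ₗ TP.uncons k H)))
    (-((cnsH S).compl₂ (upA S)))

/-- `h₁ ⋯ hₙ ↦ (1 # h₁) ⊗ h₂ ⋯ hₙ + merge (h₁ ⋯ hₙ)`. -/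
def mergeE : TensorAlgebra k H →ₗ[k] CrossedProduct S ⊗[k] TensorAlgebra k H :=
  (inH S).rTensor _ ∘ₗ TP.uncons k H + upA S ∘ₗ merge S

@[simp] theorem merge_one : merge S 1 = 0 := by simp [merge]

@[simp] theorem mergeE_one : mergeE S 1 = 0 := by simp [mergeE]

theorem merge_ι_mul (h : H) (w : TensorAlgebra k H) :
    merge S (ι k h * w) = -cnsH S h (mergeE S w) := by
  rw [merge, TP.recTA_ι_mul]
  simp only [LinearMap.neg_apply, LinearMap.compl₂_apply, mergeE, LinearMap.add_apply, LinearMap.map_add,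
    comp_apply, merge]
  abel

theorem mergeE_ι_mul (h : H) (w : TensorAlgebra k H) :
    mergeE S (ι k h * w) = inH S h ⊗ₜ w - jjH S h (mergeE S w) := by
  rw [mergeE, LinearMap.add_apply, comp_apply, comp_apply, merge_ι_mul]
  simp only [TP.uncons_ι_mul, rTensor_tmul, LinearMap.map_neg, upA_cnsH]
  rw [sub_eq_add_neg]
  rfl

/-- The left linear extension of `mergeE`. -/
abbrev mergeX : CrossedProduct S ⊗[k] TensorAlgebra k H →ₗ[k]
    CrossedProduct S ⊗[k] TensorAlgebra k H := leftExt (CrossedProduct S) (mergeE S)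

theorem mergeX_jj (x : CrossedProduct S ⊗[k] TensorAlgebra k H) :
    mergeX S (jj S x) = x - jj S (mergeX S x) := by
  refine LinearMap.congr_fun (f := mergeX S ∘ₗ jj S) (g := LinearMap.id - jj S ∘ₗ mergeX S)
    (eth_hom_ext S fun b l w => ?_) x
  simp only [comp_apply, jj_tmul, LinearMap.sub_apply, id_apply, leftExt_tmul,
    mergeE_ι_mul, smul_sub, smul_tmul', smul_eq_mul, jjH_apply, ← jj_inA_smul, mul_smul]

theorem mergeX_mergeX (x : CrossedProduct S ⊗[k] TensorAlgebra k H) :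
    mergeX S (mergeX S x) = 0 := by
  have h1 : mergeX S ∘ₗ mergeE S = 0 := by
    refine TP.ta_hom_ext' (by simp) fun h w hw => ?_
    simp only [comp_apply, LinearMap.zero_apply] at hw ⊢
    rw [mergeE_ι_mul, LinearMap.map_sub, jjH_apply, mergeX_jj, leftExt_smul, hw, leftExt_tmul]
    simp
  refine LinearMap.congr_fun (f := mergeX S ∘ₗ mergeX S) (g := 0)
    (ext' fun e w => ?_) x
  have := LinearMap.congr_fun h1 w
  simp only [comp_apply, LinearMap.zero_apply] at this ⊢
  rw [leftExt_tmul, leftExt_smul, this, smul_zero]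

/-- `w ⊗ a ↦ a^{w̄⁽¹⁾} ⊗ w⁽²⁾`. -/
def pushT : TensorAlgebra k H →ₗ[k] A →ₗ[k] A ⊗[k] TensorAlgebra k H :=
  TP.recTA ((TensorProduct.mk k A _).flip 1) 0
    (LinearMap.llcomp k A _ _ ∘ₗ (cnsH S).compl₂ (upA S))

@[simp] theorem pushT_one (a : A) : pushT S 1 a = a ⊗ₜ 1 := by simp [pushT]

theorem pushT_ι_mul (h : H) (w : TensorAlgebra k H) (a : A) :
    pushT S (ι k h * w) a = cnsH S h (upA S (pushT S w a)) := by
  rw [pushT, TP.recTA_ι_mul, LinearMap.zero_apply, LinearMap.zero_apply, zero_add]; rfl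

/-- The right action of `A` on `E ⊗ T(H)`. -/
def actR (a : A) : CrossedProduct S ⊗[k] TensorAlgebra k H →ₗ[k]
    CrossedProduct S ⊗[k] TensorAlgebra k H :=
  leftExt (CrossedProduct S) (upA S ∘ₗ (pushT S).flip a)

theorem actR_tmul (a : A) (e : CrossedProduct S) (w : TensorAlgebra k H) :
    actR S a (e ⊗ₜ w) = e • upA S (pushT S w a) := rfl

theorem actR_jj (a : A) (x : CrossedProduct S ⊗[k] TensorAlgebra k H) :
    actR S a (jj S x) = jj S (actR S a x) := by
  refine LinearMap.congr_fun (f := actR S a ∘ₗ jj S) (g := jj S ∘ₗ actR S a)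
    (eth_hom_ext S fun b l w => ?_) x
  simp only [comp_apply, jj_tmul, actR_tmul, pushT_ι_mul, upA_cnsH, jjH_apply,
    ← jj_inA_smul, mul_smul]

theorem upA_pushT_mul (w : TensorAlgebra k H) (a b : A) :
    upA S (pushT S w (a * b)) = actR S b (upA S (pushT S w a)) := by
  refine LinearMap.congr_fun (f := upA S ∘ₗ (pushT S).flip (a * b))
    (g := actR S b ∘ₗ upA S ∘ₗ (pushT S).flip a) (TP.ta_hom_ext' ?_ fun h w hw => ?_) w
  · simp [actR_tmul, smul_tmul', inA_mul]
  · simp only [comp_apply, flip_apply] at hw ⊢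
    simp only [pushT_ι_mul, upA_cnsH, jjH_apply, actR_jj, hw]
    congr 1
    exact (leftExt_smul _ _ _).symm

theorem actR_mul (a b : A) (x : CrossedProduct S ⊗[k] TensorAlgebra k H) :
    actR S (a * b) x = actR S b (actR S a x) := by
  refine LinearMap.congr_fun (f := actR S (a * b)) (g := actR S b ∘ₗ actR S a)
    (ext' fun e w => ?_) x
  rw [comp_apply, actR_tmul, actR_tmul, upA_pushT_mul]
  exact (leftExt_smul _ _ _).symm

/-- `w ⊗ (a # h) ↦ (w · a) * h`. -/
def dia : TensorAlgebra k H →ₗ[k] CrossedProduct S →ₗ[k] CrossedProduct S ⊗[k] TensorAlgebra k H :=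
  TP.recTA (jj S ∘ₗ (TensorProduct.mk k _ _).flip 1) 0 (LinearMap.llcomp k _ _ _ ∘ₗ jjH S)

@[simp] theorem dia_one (e : CrossedProduct S) : dia S 1 e = jj S (e ⊗ₜ 1) := by simp [dia]

theorem dia_ι_mul (h : H) (w : TensorAlgebra k H) (e : CrossedProduct S) :
    dia S (ι k h * w) e = jjH S h (dia S w e) := by
  rw [dia, TP.recTA_ι_mul, LinearMap.zero_apply, LinearMap.zero_apply, zero_add]; rfl

/-- `w * l ⊗ e ↦ (-1)ⁿ⁺¹ dia (w ⊗ l e)` for `w` of degree `n`, and `1 ⊗ e ↦ e ⊗ 1`. -/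
def dial : TensorAlgebra k H →ₗ[k] CrossedProduct S →ₗ[k] CrossedProduct S ⊗[k] TensorAlgebra k H :=
  TP.recTA ((TensorProduct.mk k _ _).flip 1) 0 (LinearMap.llcomp k _ _ _ ∘ₗ (-jjH S))

@[simp] theorem dial_one (e : CrossedProduct S) : dial S 1 e = e ⊗ₜ 1 := by simp [dial]

theorem dial_ι_mul (h : H) (w : TensorAlgebra k H) (e : CrossedProduct S) :
    dial S (ι k h * w) e = -jjH S h (dial S w e) := by
  rw [dial, TP.recTA_ι_mul, LinearMap.zero_apply, LinearMap.zero_apply, zero_add]; rfl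

theorem dial_mul_ι (w : TensorAlgebra k H) (l : H) (e : CrossedProduct S) :
    dial S (w * ι k l) e = -dia S (TP.sgn k H w) (inH S l * e) := by
  refine LinearMap.congr_fun (f := (dial S).flip e ∘ₗ mulRight k (ι k l))
    (g := -((dia S).flip (inH S l * e) ∘ₗ (TP.sgn k H).toLinearMap))
    (TP.ta_hom_ext' ?_ fun h w hw => ?_) w
  · have := dial_ι_mul S l 1 e
    rw [mul_one] at this
    simp [this, smul_tmul']
  · simp only [comp_apply, flip_apply, LinearMap.mulRight_apply,
      LinearMap.neg_apply, toLinearMap_apply] at hw ⊢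
    rw [mul_assoc, dial_ι_mul, hw, map_mul (TP.sgn k H), TP.sgn_ι, neg_mul, map_neg (dia S),
      LinearMap.neg_apply, dia_ι_mul, LinearMap.map_neg]

/-- The left linear extension of `dia`. -/
abbrev diaX (e : CrossedProduct S) : CrossedProduct S ⊗[k] TensorAlgebra k H →ₗ[k]
    CrossedProduct S ⊗[k] TensorAlgebra k H := leftExt (CrossedProduct S) ((dia S).flip e)

theorem diaX_jj (e : CrossedProduct S) (x : CrossedProduct S ⊗[k] TensorAlgebra k H) :
    diaX S e (jj S x) = jj S (diaX S e x) := by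
  refine LinearMap.congr_fun (f := diaX S e ∘ₗ jj S) (g := jj S ∘ₗ diaX S e)
    (eth_hom_ext S fun b l w => ?_) x
  simp only [comp_apply, jj_tmul, leftExt_tmul, flip_apply, dia_ι_mul,
    jjH_apply, ← jj_inA_smul, mul_smul]

theorem mergeX_dia (w : TensorAlgebra k H) (e : CrossedProduct S) :
    mergeX S (dia S w e) = diaX S e (mergeE S w) + dial S w e := by
  refine LinearMap.congr_fun (f := mergeX S ∘ₗ (dia S).flip e)
    (g := diaX S e ∘ₗ mergeE S + (dial S).flip e) (TP.ta_hom_ext' ?_ fun h w hw => ?_) w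
  · simp [mergeX_jj]
  · simp only [comp_apply, flip_apply, LinearMap.add_apply] at hw ⊢
    rw [dia_ι_mul, jjH_apply, mergeX_jj, leftExt_smul, hw, mergeE_ι_mul, LinearMap.map_sub, jjH_apply,
      diaX_jj, leftExt_smul, dial_ι_mul, jjH_apply, smul_add, LinearMap.map_add, leftExt_tmul,
      flip_apply]
    abel

theorem dia_apply (w : TensorAlgebra k H) (a : A) (h : H) :
    dia S w (inA S a * inH S h) =
      (mulRight k (ι k h)).lTensor _ (upA S (pushT S w a)) := by
  have hj : ∀ x, jj S ((mulRight k (ι k h)).lTensor _ x) =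
      (mulRight k (ι k h)).lTensor _ (jj S x) := fun x => by
    refine LinearMap.congr_fun (f := jj S ∘ₗ (mulRight k (ι k h)).lTensor _)
      (g := (mulRight k (ι k h)).lTensor _ ∘ₗ jj S)
      (eth_hom_ext S fun b l w => ?_) x
    simp [mul_assoc]
  refine LinearMap.congr_fun (f := (dia S).flip (inA S a * inH S h))
    (g := (mulRight k (ι k h)).lTensor _ ∘ₗ upA S ∘ₗ (pushT S).flip a)
    (TP.ta_hom_ext' ?_ fun l w hw => ?_) w
  · simp
  · simp only [comp_apply, flip_apply] at hw ⊢
    rw [dia_ι_mul, hw, pushT_ι_mul, upA_cnsH, jjH_apply, jjH_apply, ← lTensor_smul', hj]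

end CrossedSystem

/-! ### Deconcatenation -/

namespace TP

section
variable {k V : Type*} [CommRing k] [AddCommGroup V] [Module k V]

/-- The augmentation of the tensor algebra. -/
abbrev aug (k V : Type*) [CommRing k] [AddCommGroup V] [Module k V] : TensorAlgebra k V →ₐ[k] k :=
  TensorAlgebra.algebraMapInv

@[simp] theorem aug_ι (v : V) : aug k V (ι k v) = 0 := by
  simp [aug, TensorAlgebra.algebraMapInv]

/-- The deconcatenation `w ↦ ∑ u ⊗ v`, where `w = u * v`. -/
def decon (k V : Type*) [CommRing k] [AddCommGroup V] [Module k V] :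
    TensorAlgebra k V →ₗ[k] TensorAlgebra k V ⊗[k] TensorAlgebra k V :=
  recTA (1 ⊗ₜ 1)
    ((LinearMap.mul k (TensorAlgebra k V) ∘ₗ ι k).compr₂ (TensorProduct.mk k _ _ 1))
    (LinearMap.rTensorHom _ ∘ₗ LinearMap.mul k (TensorAlgebra k V) ∘ₗ ι k)

@[simp] theorem decon_one : decon k V 1 = 1 ⊗ₜ 1 := by simp [decon]

theorem decon_ι_mul (v : V) (w : TensorAlgebra k V) :
    decon k V (ι k v * w) = 1 ⊗ₜ (ι k v * w) +
      (mulLeft k (ι k v)).rTensor _ (decon k V w) := by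
  rw [decon, recTA_ι_mul]; rfl

theorem uncons_decon (w : TensorAlgebra k V) :
    (uncons k V).rTensor _ (decon k V w) =
      (assoc k V _ _).symm ((decon k V).lTensor V (uncons k V w)) := by
  refine LinearMap.congr_fun (f := (uncons k V).rTensor _ ∘ₗ decon k V)
    (g := (assoc k V _ _).symm.toLinearMap ∘ₗ (decon k V).lTensor V ∘ₗ uncons k V)
    (ta_hom_ext' (by simp) fun v w _ => ?_) w
  simp only [comp_apply, decon_ι_mul, LinearMap.map_add, rTensor_tmul, uncons_one,
    zero_tmul, zero_add, uncons_ι_mul, lTensor_tmul, coe_coe]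
  refine LinearMap.congr_fun (f := (uncons k V).rTensor _ ∘ₗ
      (mulLeft k (ι k v)).rTensor _)
    (g := (assoc k V _ _).symm.toLinearMap ∘ₗ TensorProduct.mk k _ _ v)
    (ext' fun a b => ?_) (decon k V w)
  simp

theorem decon_sgn (w : TensorAlgebra k V) :
    decon k V (sgn k V w) =
      TensorProduct.map (sgn k V).toLinearMap (sgn k V).toLinearMap (decon k V w) := by
  refine LinearMap.congr_fun (f := decon k V ∘ₗ (sgn k V).toLinearMap)
    (g := TensorProduct.map (sgn k V).toLinearMap (sgn k V).toLinearMap ∘ₗ decon k V)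
    (ta_hom_ext' (by simp) fun v w h => ?_) w
  simp only [comp_apply, toLinearMap_apply] at h ⊢
  rw [map_mul, sgn_ι, neg_mul, LinearMap.map_neg, decon_ι_mul, h, decon_ι_mul, LinearMap.map_add, map_tmul,
    neg_add]
  congr 1
  · simp [tmul_neg]
  · refine LinearMap.congr_fun (f := -(LinearMap.rTensor (TensorAlgebra k V)
        (mulLeft k (ι k v)) ∘ₗ
        TensorProduct.map (sgn k V).toLinearMap (sgn k V).toLinearMap))
      (g := TensorProduct.map (sgn k V).toLinearMap (sgn k V).toLinearMap ∘ₗ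
        LinearMap.rTensor _ (mulLeft k (ι k v)))
      (ext' fun a b => ?_) (decon k V w)
    simp [neg_tmul]

theorem sgn_sgn (w : TensorAlgebra k V) : sgn k V (sgn k V w) = w := by
  refine LinearMap.congr_fun (f := (sgn k V).toLinearMap ∘ₗ (sgn k V).toLinearMap)
    (g := LinearMap.id) (ta_hom_ext' (by simp) fun v w h => ?_) w
  simp only [comp_apply, toLinearMap_apply, id_apply] at h ⊢
  simp [h]

theorem deg1_ι_mul (v : V) (w : TensorAlgebra k V) :
    deg1 k V (ι k v * w) = aug k V w • v := by
  refine LinearMap.congr_fun (f := deg1 k V ∘ₗ mulLeft k (ι k v))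
    (g := LinearMap.toSpanSingleton k V v ∘ₗ (aug k V).toLinearMap)
    (ta_hom_ext' (by simp) fun v w h => ?_) w
  simp

/-- The degree two part. -/
def deg2 (k V : Type*) [CommRing k] [AddCommGroup V] [Module k V] :
    TensorAlgebra k V →ₗ[k] V ⊗[k] V := (deg1 k V).lTensor V ∘ₗ uncons k V

@[simp] theorem deg2_one : deg2 k V 1 = 0 := by simp [deg2]

@[simp] theorem deg2_ι_mul (v : V) (w : TensorAlgebra k V) :
    deg2 k V (ι k v * w) = v ⊗ₜ deg1 k V w := by simp [deg2]

theorem deg1_sgn (w : TensorAlgebra k V) : deg1 k V (sgn k V w) = -deg1 k V w := by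
  refine LinearMap.congr_fun (f := deg1 k V ∘ₗ (sgn k V).toLinearMap)
    (g := -deg1 k V) (ta_hom_ext' (by simp) fun v w _ => ?_) w
  have : aug k V (sgn k V w) = aug k V w :=
    DFunLike.congr_fun (f := (aug k V).comp (sgn k V)) (g := aug k V)
      (TensorAlgebra.hom_ext (LinearMap.ext fun v => by simp)) w
  simp [deg1_ι_mul, this]

theorem map_deg1_decon (w : TensorAlgebra k V) :
    TensorProduct.map (deg1 k V) (deg1 k V) (decon k V w) = deg2 k V w := by
  have h1 : ∀ w, TensorProduct.lid k _ ((aug k V).toLinearMap.rTensor _ (decon k V w)) = w := by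
    intro w
    refine LinearMap.congr_fun (f := (TensorProduct.lid k _).toLinearMap ∘ₗ
      (aug k V).toLinearMap.rTensor _ ∘ₗ decon k V)
      (g := LinearMap.id) (ta_hom_ext' (by simp) fun v w _ => ?_) w
    have h0 : (aug k V).toLinearMap ∘ₗ mulLeft k (ι k v) = 0 := by
      ext; simp
    simp only [comp_apply, decon_ι_mul, LinearMap.map_add, ← LinearMap.rTensor_comp_apply, h0]
    simp
  refine LinearMap.congr_fun (f := TensorProduct.map (deg1 k V) (deg1 k V) ∘ₗ decon k V)
    (g := deg2 k V) (ta_hom_ext' (by simp) fun v w _ => ?_) w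
  simp only [comp_apply, decon_ι_mul, LinearMap.map_add, map_tmul, deg1_one,
    zero_tmul, zero_add, deg2_ι_mul]
  conv_rhs => rw [← h1 w]
  refine LinearMap.congr_fun (f := TensorProduct.map (deg1 k V) (deg1 k V) ∘ₗ
    (mulLeft k (ι k v)).rTensor _)
    (g := TensorProduct.mk k _ _ v ∘ₗ deg1 k V ∘ₗ (TensorProduct.lid k _).toLinearMap ∘ₗ
      (aug k V).toLinearMap.rTensor _) (ext' fun a b => ?_) (decon k V w)
  simp [deg1_ι_mul, smul_tmul]

end

end TP

/-! ### The transfer operators -/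

namespace CrossedSystem

open CrossedProduct

variable {k A H : Type*} [CommRing k] [Ring A] [Algebra k A] [Ring H] [Bialgebra k H]
  (S : CrossedSystem k A H)

theorem cns_equiv_toTA (n : ℕ) (x : A ⊗[k] H) (w : ⨂[k]^n H) :
    cns S (equiv S x ⊗ₜ TP.toTA k n w) = (TP.toTA k (n + 1)).lTensor A
      ((TP.cons k n).toLinearMap.lTensor A (assoc k A H _ (x ⊗ₜ w))) := by
  refine LinearMap.congr_fun (f := cns S ∘ₗ (TensorProduct.mk k _ _).flip (TP.toTA k n w) ∘ₗ
    (equiv S).toLinearMap) (g := (TP.toTA k (n + 1)).lTensor A ∘ₗ (TP.cons k n).toLinearMap.lTensor A ∘ₗ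
    (assoc k A H _).toLinearMap ∘ₗ (TensorProduct.mk k _ _).flip w)
    (ext' fun a h => ?_) x
  simp [equiv_tmul, TP.toTA_cons]

theorem cnsH_upA_toTA (n : ℕ) (h : H) (z : A ⊗[k] (⨂[k]^n H)) :
    cnsH S h (upA S ((TP.toTA k n).lTensor A z)) = (TP.toTA k (n + 1)).lTensor A
      ((TP.cons k n).toLinearMap.lTensor A (assoc k A H _
        (S.push.rTensor _ ((assoc k H A _).symm (h ⊗ₜ z))))) := by
  refine LinearMap.congr_fun (f := cnsH S h ∘ₗ upA S ∘ₗ (TP.toTA k n).lTensor A)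
    (g := (TP.toTA k (n + 1)).lTensor A ∘ₗ (TP.cons k n).toLinearMap.lTensor A ∘ₗ
      (assoc k A H _).toLinearMap ∘ₗ S.push.rTensor _ ∘ₗ
      (assoc k H A _).symm.toLinearMap ∘ₗ TensorProduct.mk k _ _ h)
    (ext' fun a w => ?_) z
  simp only [comp_apply, lTensor_tmul, rTensor_tmul, cnsH_apply,
    smul_tmul', smul_eq_mul, inH_mul_inA, cns_equiv_toTA, mk_apply,
    coe_coe, assoc_symm_tmul]

theorem merge_toTA_zero (w : ⨂[k]^0 H) : merge S (TP.toTA k 0 w) = 0 := by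
  obtain ⟨c, rfl⟩ := TP.zero_eq_smul_nil w
  rw [LinearMap.map_smul, LinearMap.map_smul, TP.toTA_nil, merge_one, smul_zero]

theorem merge_toTA_succ (n : ℕ) (w : ⨂[k]^(n + 1) H) :
    merge S (TP.toTA k (n + 1) w) = (TP.toTA k n).lTensor A
      (∑ i ∈ Finset.range n, (-1 : k) ^ (i + 1) • S.mergeAt n i w) := by
  induction n with
  | zero =>
    induction w using TP.cons_induction with
    | zero => simp
    | cons h w =>
      obtain ⟨c, rfl⟩ := TP.zero_eq_smul_nil w
      rw [TP.toTA_cons, merge_ι_mul, map_smul, map_smul, TP.toTA_nil]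
      simp
    | add x y hx hy => rw [map_add, map_add, hx, hy]; simp
  | succ n ih =>
    induction w using TP.cons_induction with
    | zero => simp
    | cons h w =>
      rw [TP.toTA_cons, merge_ι_mul, mergeE, LinearMap.add_apply, comp_apply,
        comp_apply, map_add, ih, cnsH_upA_toTA, Finset.sum_range_succ']
      have h1 : cnsH S h ((inH S).rTensor _ (TP.uncons k H (TP.toTA k (n + 1) w))) =
          (TP.toTA k (n + 1)).lTensor A (S.mergeAt (n + 1) 0 (TP.cons k (n + 1) (h ⊗ₜ w))) := by
        induction w using TP.cons_induction with
        | zero => simp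
        | cons l w =>
          rw [TP.toTA_cons, TP.uncons_ι_mul, rTensor_tmul, cnsH_apply, smul_tmul',
            smul_eq_mul, inH_mul_inH, cns_equiv_toTA]
          simp [mergeAt]
        | add x y hx hy => simp only [map_add, tmul_add, hx, hy]
      rw [h1]
      simp only [mergeAt, comp_apply, coe_coe, symm_apply_apply,
        lTensor_tmul, tmul_sum, tmul_smul, map_sum, map_smul, map_add, pow_succ_smul',
        ← Finset.smul_sum, pow_zero]
      module
    | add x y hx hy => simp only [map_add, hx, hy, smul_add, Finset.sum_add_distrib]

theorem pushT_toTA (n : ℕ) (w : ⨂[k]^n H) (a : A) :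
    pushT S (TP.toTA k n w) a = (TP.toTA k n).lTensor A (S.pushPow n (w ⊗ₜ a)) := by
  induction n with
  | zero =>
    obtain ⟨c, rfl⟩ := TP.zero_eq_smul_nil w
    rw [LinearMap.map_smul, LinearMap.map_smul, TP.toTA_nil, LinearMap.smul_apply, pushT_one]
    simp [WeakAction.pushPow, TP.toTA_nil]
  | succ n ih =>
    induction w using TP.cons_induction with
    | zero => simp
    | cons h w =>
      rw [TP.toTA_cons, pushT_ι_mul, ih, cnsH_upA_toTA]
      simp [WeakAction.pushPow]
    | add x y hx hy => rw [LinearMap.map_add, LinearMap.map_add, LinearMap.add_apply, hx, hy, add_tmul, LinearMap.map_add, LinearMap.map_add]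

theorem sgn_cns (x : CrossedProduct S ⊗[k] TensorAlgebra k H) :
    (TP.sgn k H).toLinearMap.lTensor A (cns S x) =
      -cns S ((TP.sgn k H).toLinearMap.lTensor _ x) := by
  refine LinearMap.congr_fun (f := (TP.sgn k H).toLinearMap.lTensor A ∘ₗ cns S)
    (g := -(cns S ∘ₗ (TP.sgn k H).toLinearMap.lTensor _)) (eth_hom_ext S fun b l w => ?_) x
  simp [tmul_neg]

theorem sgn_upA (x : A ⊗[k] TensorAlgebra k H) :
    (TP.sgn k H).toLinearMap.lTensor _ (upA S x) =
      upA S ((TP.sgn k H).toLinearMap.lTensor _ x) := by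
  rw [← comp_apply, ← comp_apply, LinearMap.lTensor_comp_rTensor,
    LinearMap.rTensor_comp_lTensor]

theorem sgn_merge (w : TensorAlgebra k H) :
    (TP.sgn k H).toLinearMap.lTensor A (merge S w) = -merge S (TP.sgn k H w) := by
  refine LinearMap.congr_fun (f := (TP.sgn k H).toLinearMap.lTensor A ∘ₗ merge S)
    (g := -(merge S ∘ₗ (TP.sgn k H).toLinearMap)) (TP.ta_hom_ext' (by simp) fun h w hw => ?_) w
  simp only [comp_apply, LinearMap.neg_apply, toLinearMap_apply] at hw ⊢
  rw [merge_ι_mul, LinearMap.map_neg, cnsH_apply, sgn_cns, lTensor_smul', map_mul, TP.sgn_ι, neg_mul, LinearMap.map_neg,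
    merge_ι_mul, cnsH_apply, mergeE, LinearMap.add_apply, LinearMap.map_add, comp_apply,
    comp_apply, sgn_upA, hw, LinearMap.add_apply, comp_apply,
    comp_apply, LinearMap.map_neg, ← sub_eq_add_neg]
  have : ∀ w, (TP.sgn k H).toLinearMap.lTensor (CrossedProduct S)
      ((inH S).rTensor _ (TP.uncons k H w)) = -(inH S).rTensor _ (TP.uncons k H (TP.sgn k H w)) := by
    intro w
    refine LinearMap.congr_fun (f := (TP.sgn k H).toLinearMap.lTensor (CrossedProduct S) ∘ₗ
      (inH S).rTensor _ ∘ₗ TP.uncons k H)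
      (g := -((inH S).rTensor _ ∘ₗ TP.uncons k H ∘ₗ (TP.sgn k H).toLinearMap))
      (TP.ta_hom_ext' (by simp) fun h w _ => ?_) w
    simp
  rw [this, smul_sub, smul_neg, LinearMap.map_sub, LinearMap.map_neg, smul_add, LinearMap.map_add]
  abel

theorem sgn_pushT (w : TensorAlgebra k H) (a : A) :
    (TP.sgn k H).toLinearMap.lTensor A (pushT S w a) = pushT S (TP.sgn k H w) a := by
  refine LinearMap.congr_fun (f := (TP.sgn k H).toLinearMap.lTensor A ∘ₗ (pushT S).flip a)
    (g := (pushT S).flip a ∘ₗ (TP.sgn k H).toLinearMap) (TP.ta_hom_ext' (by simp) fun h w hw => ?_) w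
  simp only [comp_apply, flip_apply, toLinearMap_apply] at hw ⊢
  rw [pushT_ι_mul, cnsH_apply, sgn_cns, lTensor_smul', sgn_upA, hw, map_mul, TP.sgn_ι, neg_mul,
    LinearMap.map_neg, LinearMap.neg_apply, pushT_ι_mul, cnsH_apply]

/-- `u ⊗ (b ⊗ v) ↦ b^{ū⁽¹⁾} ⊗ (u⁽²⁾ ⊗ v)`. -/
def pushL : TensorAlgebra k H →ₗ[k] A ⊗[k] TensorAlgebra k H →ₗ[k]
    A ⊗[k] (TensorAlgebra k H ⊗[k] TensorAlgebra k H) :=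
  LinearMap.llcomp k _ _ _ (assoc k A _ _).toLinearMap ∘ₗ
    LinearMap.rTensorHom _ ∘ₗ pushT S

theorem pushL_tmul (u v : TensorAlgebra k H) (b : A) :
    pushL S u (b ⊗ₜ v) = assoc k A _ _ (pushT S u b ⊗ₜ v) := rfl

/-- `cns` on the first two of three factors. -/
def cns₂ : CrossedProduct S ⊗[k] (TensorAlgebra k H ⊗[k] TensorAlgebra k H) →ₗ[k]
    A ⊗[k] (TensorAlgebra k H ⊗[k] TensorAlgebra k H) :=
  (assoc k A _ _).toLinearMap ∘ₗ (cns S).rTensor _ ∘ₗ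
    (assoc k _ _ _).symm.toLinearMap

theorem cns₂_assoc (x : CrossedProduct S ⊗[k] TensorAlgebra k H) (v : TensorAlgebra k H) :
    cns₂ S (assoc k _ _ _ (x ⊗ₜ v)) = assoc k A _ _ (cns S x ⊗ₜ v) := by
  simp [cns₂]

theorem smul_assoc_tmul {B M N : Type*} [Ring B] [Algebra k B] [AddCommGroup M] [Module k M]
    [AddCommGroup N] [Module k N] (b : B) (x : B ⊗[k] M) (v : N) :
    b • assoc k B M N (x ⊗ₜ v) = assoc k B M N ((b • x) ⊗ₜ v) := by
  induction x with
  | zero => simp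
  | tmul b' m => simp [smul_tmul']
  | add x y hx hy => simp only [add_tmul, map_add, smul_add, hx, hy]

theorem upA_assoc_tmul {M N : Type*} [AddCommGroup M] [Module k M]
    [AddCommGroup N] [Module k N] (x : A ⊗[k] M) (v : N) :
    (inA S).rTensor _ (assoc k A M N (x ⊗ₜ v)) =
      assoc k _ M N ((inA S).rTensor _ x ⊗ₜ v) := by
  induction x with
  | zero => simp
  | tmul b' m => simp
  | add x y hx hy => simp only [add_tmul, map_add, hx, hy]

theorem pushL_one (x : A ⊗[k] TensorAlgebra k H) :
    pushL S 1 x = (TensorProduct.mk k _ _ 1).lTensor A x := by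
  refine LinearMap.congr_fun (ext' fun a w => ?_) x
  simp [pushL_tmul]

theorem pushL_ι_mul (h : H) (u : TensorAlgebra k H) (x : A ⊗[k] TensorAlgebra k H) :
    pushL S (ι k h * u) x =
      cns₂ S (inH S h • (inA S).rTensor _ (pushL S u x)) := by
  refine LinearMap.congr_fun (g := cns₂ S ∘ₗ lsm k _ _ (inH S h) ∘ₗ (inA S).rTensor _ ∘ₗ
    pushL S u) (ext' fun a w => ?_) x
  simp only [comp_apply, pushL_tmul, pushT_ι_mul, lsm_apply, upA_assoc_tmul,
    smul_assoc_tmul, cns₂_assoc, cnsH_apply]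

theorem decon_cns (x : CrossedProduct S ⊗[k] TensorAlgebra k H) :
    (TP.decon k H).lTensor A (cns S x) = (TensorProduct.mk k _ _ 1).lTensor A (cns S x) +
      cns₂ S ((TP.decon k H).lTensor _ x) := by
  refine LinearMap.congr_fun (f := (TP.decon k H).lTensor A ∘ₗ cns S)
    (g := (TensorProduct.mk k _ _ 1).lTensor A ∘ₗ cns S + cns₂ S ∘ₗ (TP.decon k H).lTensor _)
    (eth_hom_ext S fun b l w => ?_) x
  simp only [comp_apply, LinearMap.add_apply, cns_tmul, lTensor_tmul,
    TP.decon_ι_mul, tmul_add, mk_apply]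
  congr 1
  refine LinearMap.congr_fun (f := TensorProduct.mk k _ _ b ∘ₗ
      (mulLeft k (ι k l)).rTensor _)
    (g := cns₂ S ∘ₗ TensorProduct.mk k _ _ (inA S b * inH S l)) (ext' fun u v => ?_)
    (TP.decon k H w)
  simp [cns₂]

theorem decon_pushT (w : TensorAlgebra k H) (a : A) :
    (TP.decon k H).lTensor A (pushT S w a) =
      TensorProduct.lift ((pushL S).compl₂ ((pushT S).flip a)) (TP.decon k H w) := by
  refine LinearMap.congr_fun (f := (TP.decon k H).lTensor A ∘ₗ (pushT S).flip a)
    (g := TensorProduct.lift ((pushL S).compl₂ ((pushT S).flip a)) ∘ₗ TP.decon k H)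
    (TP.ta_hom_ext' (by simp [pushL_one]) fun h w hw => ?_) w
  simp only [comp_apply, flip_apply] at hw ⊢
  rw [pushT_ι_mul, cnsH_apply, decon_cns, TP.decon_ι_mul, LinearMap.map_add, lift.tmul,
    LinearMap.compl₂_apply, flip_apply, pushL_one, pushT_ι_mul, cnsH_apply]
  congr 1
  rw [lTensor_smul', ← comp_apply (LinearMap.lTensor _ _), LinearMap.lTensor_comp_rTensor,
    ← LinearMap.rTensor_comp_lTensor, comp_apply, hw]
  refine LinearMap.congr_fun (f := cns₂ S ∘ₗ lsm k _ _ (inH S h) ∘ₗ (inA S).rTensor _ ∘ₗ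
      TensorProduct.lift ((pushL S).compl₂ ((pushT S).flip a)))
    (g := TensorProduct.lift ((pushL S).compl₂ ((pushT S).flip a)) ∘ₗ
      (mulLeft k (ι k h)).rTensor _) (ext' fun u v => ?_)
    (TP.decon k H w)
  simp [pushL_ι_mul]

/-- `u ⊗ v ↦ merge u ⊗ v + ū(merge v)`, with the sign rule. -/
def mergeCo : TensorAlgebra k H ⊗[k] TensorAlgebra k H →ₗ[k]
    A ⊗[k] (TensorAlgebra k H ⊗[k] TensorAlgebra k H) :=
  (assoc k A _ _).toLinearMap ∘ₗ (merge S).rTensor _ +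
    TensorProduct.lift ((pushL S ∘ₗ (TP.sgn k H).toLinearMap).compl₂ (merge S))

theorem mergeCo_tmul (u v : TensorAlgebra k H) : mergeCo S (u ⊗ₜ v) =
    assoc k A _ _ (merge S u ⊗ₜ v) + pushL S (TP.sgn k H u) (merge S v) := rfl

theorem assoc_rTensor_inH (x : H ⊗[k] TensorAlgebra k H) (v : TensorAlgebra k H) :
    (inH S).rTensor _ (assoc k H _ (TensorAlgebra k H) (x ⊗ₜ v)) =
      assoc k _ _ _ ((inH S).rTensor _ x ⊗ₜ v) := by
  induction x with
  | zero => simp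
  | tmul b' m => simp
  | add x y hx hy => simp only [add_tmul, map_add, hx, hy]

theorem mergeCo_mulLeft (h : H) (x : TensorAlgebra k H ⊗[k] TensorAlgebra k H) :
    mergeCo S ((mulLeft k (ι k h)).rTensor _ x) =
      -cns₂ S (inH S h • ((inH S).rTensor _
        (assoc k H _ _ ((TP.uncons k H).rTensor _ x)) +
        (inA S).rTensor _ (mergeCo S x))) := by
  refine LinearMap.congr_fun
    (f := mergeCo S ∘ₗ (mulLeft k (ι k h)).rTensor _)
    (g := -(cns₂ S ∘ₗ lsm k _ _ (inH S h) ∘ₗ ((inH S).rTensor _ ∘ₗ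
      (assoc k H _ _).toLinearMap ∘ₗ (TP.uncons k H).rTensor _ +
      (inA S).rTensor _ ∘ₗ mergeCo S)))
    (ext' fun u v => ?_) x
  simp only [LinearMap.neg_apply, comp_apply, LinearMap.add_apply,
    rTensor_tmul, coe_coe, assoc_rTensor_inH, mergeCo_tmul, map_add,
    upA_assoc_tmul, lsm_apply, LinearMap.mulLeft_apply, merge_ι_mul, cnsH_apply, mergeE, neg_tmul,
    map_neg, map_mul (TP.sgn k H), TP.sgn_ι, neg_mul, pushL_ι_mul, smul_add, smul_assoc_tmul,
    cns₂_assoc, add_tmul]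
  abel

theorem decon_upA (x : A ⊗[k] TensorAlgebra k H) :
    (TP.decon k H).lTensor _ (upA S x) = (inA S).rTensor _ ((TP.decon k H).lTensor _ x) := by
  rw [← comp_apply, ← comp_apply, LinearMap.lTensor_comp_rTensor,
    LinearMap.rTensor_comp_lTensor]

theorem decon_upH (x : H ⊗[k] TensorAlgebra k H) :
    (TP.decon k H).lTensor _ ((inH S).rTensor _ x) =
      (inH S).rTensor _ ((TP.decon k H).lTensor _ x) := by
  rw [← comp_apply, ← comp_apply, LinearMap.lTensor_comp_rTensor,
    LinearMap.rTensor_comp_lTensor]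

theorem decon_merge (w : TensorAlgebra k H) :
    (TP.decon k H).lTensor A (merge S w) = mergeCo S (TP.decon k H w) := by
  refine LinearMap.congr_fun (f := (TP.decon k H).lTensor A ∘ₗ merge S)
    (g := mergeCo S ∘ₗ TP.decon k H)
    (TP.ta_hom_ext' (by simp [mergeCo_tmul]) fun h w hw => ?_) w
  simp only [comp_apply] at hw ⊢
  have h1 : (TP.decon k H).lTensor _ (mergeE S w) = (inH S).rTensor _
        (assoc k H _ _ ((TP.uncons k H).rTensor _ (TP.decon k H w))) +
        (inA S).rTensor _ (mergeCo S (TP.decon k H w)) := by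
    rw [mergeE, LinearMap.add_apply, map_add, comp_apply, comp_apply, decon_upA,
      decon_upH, hw, TP.uncons_decon, LinearEquiv.apply_symm_apply]
  rw [merge_ι_mul, map_neg, cnsH_apply, decon_cns, TP.decon_ι_mul, map_add, mergeCo_tmul,
    merge_one, zero_tmul, map_zero, zero_add, map_one (TP.sgn k H), pushL_one, merge_ι_mul, map_neg,
    cnsH_apply, neg_add, mergeCo_mulLeft, lTensor_smul', h1]

end CrossedSystem

section LeftExt

variable {k B M Z : Type*} [CommRing k] [Ring B] [Algebra k B] [AddCommGroup M] [Module k M]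
  [AddCommGroup Z] [Module k Z] [Module B Z] [IsScalarTower k B Z]

/-- `leftExt`, as a linear map. -/
def leftExtₗ (k B M Z : Type*) [CommRing k] [Ring B] [Algebra k B] [AddCommGroup M] [Module k M]
    [AddCommGroup Z] [Module k Z] [Module B Z] [IsScalarTower k B Z] :
    (M →ₗ[k] Z) →ₗ[k] (B ⊗[k] M →ₗ[k] Z) where
  toFun φ := leftExt B φ
  map_add' φ ψ := ext' fun b m => by simp [smul_add]
  map_smul' c φ := ext' fun b m => by
    rw [leftExt_tmul]
    exact (lsm k B Z b).map_smul c (φ m)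

variable {V : Type*} [AddCommGroup V] [Module k V] [Module (TensorAlgebra k V) Z]
  [IsScalarTower k (TensorAlgebra k V) Z]

/-- `v ⊗ m ↦ v φ(m)`. -/
def feed (φ : M →ₗ[k] Z) : V ⊗[k] M →ₗ[k] Z :=
  leftExt (TensorAlgebra k V) φ ∘ₗ (ι k).rTensor M

@[simp] theorem feed_tmul (φ : M →ₗ[k] Z) (v : V) (m : M) :
    feed φ (v ⊗ₜ m) = ι k v • φ m := rfl

theorem feed_lTensor {M' : Type*} [AddCommGroup M'] [Module k M'] (φ : M →ₗ[k] Z) (f : M' →ₗ[k] M)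
    (x : V ⊗[k] M') : feed φ (f.lTensor V x) = feed (φ ∘ₗ f) x := by
  induction x with
  | zero => simp
  | tmul v m => simp
  | add x y hx hy => rw [LinearMap.map_add, LinearMap.map_add, hx, hy, LinearMap.map_add]

theorem feed_neg (φ : M →ₗ[k] Z) (x : V ⊗[k] M) : feed (-φ) x = -feed φ x := by
  induction x with
  | zero => simp
  | tmul v m => simp
  | add x y hx hy => rw [LinearMap.map_add, LinearMap.map_add, hx, hy]; abel

theorem feed_add (φ ψ : M →ₗ[k] Z) (x : V ⊗[k] M) : feed (φ + ψ) x = feed φ x + feed ψ x := by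
  induction x with
  | zero => simp
  | tmul v m => simp
  | add x y hx hy => rw [LinearMap.map_add, LinearMap.map_add, hx, hy, LinearMap.map_add]; abel

theorem feed_sub (φ ψ : M →ₗ[k] Z) (x : V ⊗[k] M) : feed (φ - ψ) x = feed φ x - feed ψ x := by
  rw [sub_eq_add_neg, feed_add, feed_neg, sub_eq_add_neg]

end LeftExt

namespace CrossedSystem

open CrossedProduct

variable {k A H : Type*} [CommRing k] [Ring A] [Algebra k A] [Ring H] [Bialgebra k H]
  (S : CrossedSystem k A H)

/-- `T(A) ⊗ T(H)`. -/
abbrev TT (_ : CrossedSystem k A H) : Type _ := TensorAlgebra k A ⊗[k] TensorAlgebra k H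

/-- The operator `z ⊗ w ↦ z merge(w)`. -/
def opT : Module.End k (TT S) :=
  leftExt (TensorAlgebra k A) ((ι k).rTensor _ ∘ₗ merge S)

/-- The operators `z ⊗ w ↦ -(-1)ⁿ z (w a)`, for `w` of degree `n`. -/
def opA : A →ₗ[k] Module.End k (TT S) :=
  leftExtₗ k _ _ _ ∘ₗ LinearMap.llcomp k _ _ _ ((ι k).rTensor _) ∘ₗ
    (pushT S ∘ₗ (-(TP.sgn k H).toLinearMap)).flip

theorem opT_tmul (z : TensorAlgebra k A) (w : TensorAlgebra k H) :
    opT S (z ⊗ₜ w) = z • (ι k).rTensor _ (merge S w) := rfl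

theorem opA_tmul (a : A) (z : TensorAlgebra k A) (w : TensorAlgebra k H) :
    opA S a (z ⊗ₜ w) = -(z • (ι k).rTensor _ (pushT S (TP.sgn k H w) a)) := by
  have : opA S a (z ⊗ₜ w) = z • (ι k).rTensor _ (pushT S (-TP.sgn k H w) a) := rfl
  rw [this, LinearMap.map_neg, LinearMap.neg_apply, LinearMap.map_neg, smul_neg]

theorem opT_smul (z : TensorAlgebra k A) (x : TT S) : opT S (z • x) = z • opT S x :=
  leftExt_smul _ z x

theorem opA_smul (a : A) (z : TensorAlgebra k A) (x : TT S) : opA S a (z • x) = z • opA S a x :=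
  leftExt_smul _ z x

theorem opT_pow_smul (i : ℕ) (z : TensorAlgebra k A) (x : TT S) :
    (opT S ^ i) (z • x) = z • (opT S ^ i) x := by
  induction i with
  | zero => rfl
  | succ i ih => rw [pow_succ', Module.End.mul_apply, ih, opT_smul]; rfl

theorem opT_pow_eq_zero (n : ℕ) : ∀ w : ⨂[k]^n H, (opT S ^ (n + 1)) (1 ⊗ₜ TP.toTA k n w) = 0 := by
  induction n with
  | zero =>
    intro w
    rw [zero_add, pow_one, opT_tmul, merge_toTA_zero]; simp
  | succ n ih =>
    intro w
    rw [pow_succ, Module.End.mul_apply, opT_tmul, one_smul, merge_toTA_succ]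
    generalize ∑ i ∈ Finset.range n, (-1 : k) ^ (i + 1) • S.mergeAt n i w = x
    induction x with
    | zero => simp
    | tmul a w =>
      have := opT_pow_smul S (n + 1) (ι k a) (1 ⊗ₜ TP.toTA k n w)
      rw [ih, smul_tmul', smul_eq_mul, mul_one, smul_zero] at this
      exact this
    | add x y hx hy => simp only [LinearMap.map_add, hx, hy, add_zero]

theorem opT_pow_eq_zero_of_lt {n m : ℕ} (h : n < m) (w : ⨂[k]^n H) :
    (opT S ^ m) (1 ⊗ₜ TP.toTA k n w) = 0 := by
  obtain ⟨j, rfl⟩ := Nat.exists_eq_add_of_lt h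
  rw [show n + j + 1 = j + (n + 1) by omega, pow_add, Module.End.mul_apply, opT_pow_eq_zero,
    LinearMap.map_zero]

/-- The sum of all the iterates of `opT`. -/
def opS : Module.End k (TT S) :=
  leftExt (TensorAlgebra k A) (TP.desc fun n =>
    ∑ i ∈ Finset.range (n + 1), (opT S ^ i) ∘ₗ TensorProduct.mk k _ _ 1 ∘ₗ TP.toTA k n)

theorem opS_smul (z : TensorAlgebra k A) (x : TT S) : opS S (z • x) = z • opS S x :=
  leftExt_smul _ z x

theorem exists_opS (x : TT S) :
    ∃ N, ∀ m, N ≤ m → opS S x = ∑ i ∈ Finset.range m, (opT S ^ i) x := by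
  induction x using TensorProduct.induction_on with
  | zero => exact ⟨0, fun m _ => by simp⟩
  | tmul z w =>
    induction w using TP.ta_toTA_induction with
    | of n w =>
      refine ⟨n + 1, fun m hm => ?_⟩
      obtain ⟨j, rfl⟩ := Nat.exists_eq_add_of_le hm
      have h1 : (z ⊗ₜ TP.toTA k n w : TT S) = z • (1 ⊗ₜ TP.toTA k n w) := by simp [smul_tmul']
      rw [h1]
      simp only [opT_pow_smul, ← Finset.smul_sum, opS_smul]
      rw [Finset.sum_range_add, Finset.sum_eq_zero (s := Finset.range j), add_zero]
      · simp [opS]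
      · intro i _
        exact opT_pow_eq_zero_of_lt S (by omega) w
    | add x y hx hy =>
      obtain ⟨N, hN⟩ := hx
      obtain ⟨N', hN'⟩ := hy
      refine ⟨max N N', fun m hm => ?_⟩
      rw [tmul_add, LinearMap.map_add, hN m (by omega), hN' m (by omega), ← Finset.sum_add_distrib]
      simp
  | add x y hx hy =>
    obtain ⟨N, hN⟩ := hx
    obtain ⟨N', hN'⟩ := hy
    refine ⟨max N N', fun m hm => ?_⟩
    rw [LinearMap.map_add, hN m (by omega), hN' m (by omega), ← Finset.sum_add_distrib]
    simp

theorem opS_eq_left (x : TT S) : opS S x = x + opT S (opS S x) := by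
  obtain ⟨N, hN⟩ := exists_opS S x
  conv_lhs => rw [hN (N + 1) (by omega), Finset.sum_range_succ']
  rw [hN N le_rfl, map_sum, add_comm]
  simp only [pow_succ', Module.End.mul_apply, pow_zero, Module.End.one_apply]

theorem opS_eq_right (x : TT S) : opS S x = x + opS S (opT S x) := by
  obtain ⟨N, hN⟩ := exists_opS S x
  obtain ⟨N', hN'⟩ := exists_opS S (opT S x)
  rw [hN (max N N' + 1) (by omega), Finset.sum_range_succ', hN' (max N N') (by omega), add_comm]
  simp only [pow_succ, Module.End.mul_apply, pow_zero, Module.End.one_apply]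

/-- The operators `opS opA(aᵣ) opS ⋯ opS opA(a₁) opS`, for `a₁ ⋯ aᵣ` in `T(A)`. -/
def opG : TensorAlgebra k A →ₗ[k] Module.End k (TT S) :=
  TP.recTA (opS S) 0 ((LinearMap.mul k (Module.End k (TT S))).flip ∘ₗ
    mulRight k (opS S) ∘ₗ opA S)

@[simp] theorem opG_one : opG S 1 = opS S := by simp [opG]

theorem opG_ι_mul (a : A) (y : TensorAlgebra k A) (x : TT S) :
    opG S (ι k a * y) x = opG S y (opA S a (opS S x)) := by
  rw [opG, TP.recTA_ι_mul, LinearMap.zero_apply, LinearMap.zero_apply, zero_add]; rfl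

theorem opG_smul (y : TensorAlgebra k A) (z : TensorAlgebra k A) (x : TT S) :
    opG S y (z • x) = z • opG S y x := by
  induction y using TP.ta_induction generalizing x with
  | one => rw [opG_one, opS_smul]
  | cons a y ih => rw [opG_ι_mul, opG_ι_mul, opS_smul, opA_smul, ih]
  | smul c y ih =>
    rw [map_smul (opG S), LinearMap.smul_apply, ih, LinearMap.smul_apply]
    exact ((lsm k _ (TT S) z).map_smul c _).symm
  | add y y' ih ih' => rw [LinearMap.map_add, LinearMap.add_apply, ih, ih', LinearMap.add_apply, smul_add]

theorem opG_ι_mul_eq (a : A) (y : TensorAlgebra k A) (x : TT S) :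
    opG S (ι k a * y) x =
      opG S y (opA S a x) + opG S (ι k a * y) (opT S x) := by
  rw [opG_ι_mul, opG_ι_mul, ← LinearMap.map_add, ← LinearMap.map_add, ← opS_eq_right]

theorem opG_mul_ι (a : A) (y : TensorAlgebra k A) (x : TT S) :
    opG S (y * ι k a) x = opS S (opA S a (opG S y x)) := by
  induction y using TP.ta_induction generalizing x with
  | one =>
    have := opG_ι_mul S a 1 x
    rw [mul_one] at this
    rw [one_mul, this, opG_one]
  | cons b y ih => rw [mul_assoc, opG_ι_mul, ih, opG_ι_mul]
  | smul c y ih => rw [smul_mul_assoc]; simp [ih]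
  | add y y' ih ih' => rw [add_mul]; simp [ih, ih']

theorem opG_mul_ι_eq (a : A) (y : TensorAlgebra k A) (x : TT S) :
    opG S (y * ι k a) x =
      opA S a (opG S y x) + opT S (opG S (y * ι k a) x) := by
  conv_lhs => rw [opG_mul_ι, opS_eq_left, ← opG_mul_ι]

section

variable {C : Type*} [AddCommGroup C] [Module k C] (c : TensorAlgebra k H →ₗ[k] C)

/-- `w, y ↦ (1 ⊗ c)(opG y (1 ⊗ w))`. -/
def gen : TensorAlgebra k H →ₗ[k] TensorAlgebra k A →ₗ[k] TensorAlgebra k A ⊗[k] C :=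
  LinearMap.flip (LinearMap.llcomp k _ _ _ (c.lTensor _) ∘ₗ
    LinearMap.lcomp k _ (TensorProduct.mk k _ _ 1) ∘ₗ opG S)

theorem gen_apply (w : TensorAlgebra k H) (y : TensorAlgebra k A) :
    gen S c w y = c.lTensor _ (opG S y (1 ⊗ₜ w)) := rfl

theorem lTensor_opG (y : TensorAlgebra k A) (x : TT S) :
    c.lTensor _ (opG S y x) = leftExt (TensorAlgebra k A) ((gen S c).flip y) x := by
  refine LinearMap.congr_fun (f := c.lTensor _ ∘ₗ opG S y)
    (g := leftExt (TensorAlgebra k A) ((gen S c).flip y)) (left_hom_ext (fun b x => ?_)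
      (fun b x => leftExt_smul _ _ _) fun w => ?_) x
  · rw [comp_apply, comp_apply, opG_smul, lTensor_smul']
  · simp [gen_apply]

theorem gen_one (w : TensorAlgebra k H) :
    gen S c w 1 = 1 ⊗ₜ c w + feed ((gen S c).flip 1) (merge S w) := by
  rw [gen_apply, opG_one, opS_eq_right, LinearMap.map_add, ← opG_one, lTensor_opG, opT_tmul, one_smul]
  rfl

theorem gen_ι_mul (w : TensorAlgebra k H) (a : A) (y : TensorAlgebra k A) :
    gen S c w (ι k a * y) =
      feed ((gen S c).flip (ι k a * y)) (merge S w) -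
        feed ((gen S c).flip y) (pushT S (TP.sgn k H w) a) := by
  rw [gen_apply, opG_ι_mul_eq, LinearMap.map_add, lTensor_opG, lTensor_opG, opT_tmul, one_smul, opA_tmul,
    one_smul, LinearMap.map_neg, add_comm, ← sub_eq_add_neg]
  rfl

end

/-- Uniqueness for the recursion satisfied by `gen`. -/
theorem feed_unique {Z : Type*} [AddCommGroup Z] [Module k Z] [Module (TensorAlgebra k A) Z]
    [IsScalarTower k (TensorAlgebra k A) Z] (c : TensorAlgebra k H →ₗ[k] Z)
    {Φ Ψ : TensorAlgebra k H →ₗ[k] TensorAlgebra k A →ₗ[k] Z}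
    (hΦ1 : ∀ w, Φ w 1 = c w + feed (Φ.flip 1) (merge S w))
    (hΨ1 : ∀ w, Ψ w 1 = c w + feed (Ψ.flip 1) (merge S w))
    (hΦ : ∀ w a y, Φ w (ι k a * y) =
      feed (Φ.flip (ι k a * y)) (merge S w) -
        feed (Φ.flip y) (pushT S (TP.sgn k H w) a))
    (hΨ : ∀ w a y, Ψ w (ι k a * y) =
      feed (Ψ.flip (ι k a * y)) (merge S w) -
        feed (Ψ.flip y) (pushT S (TP.sgn k H w) a)) : Φ = Ψ := by
  have key : ∀ (f g d : TensorAlgebra k H →ₗ[k] Z), (∀ w, f w = d w + feed f (merge S w)) →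
      (∀ w, g w = d w + feed g (merge S w)) → f = g := by
    intro f g d hf hg
    refine TP.ta_hom_ext fun n => ?_
    induction n with
    | zero => intro w; rw [hf, hg, merge_toTA_zero]; simp
    | succ n ih =>
      intro w
      rw [hf, hg, merge_toTA_succ, feed_lTensor, feed_lTensor]
      congr 3
      exact LinearMap.ext ih
  have : Φ.flip = Ψ.flip := by
    refine TP.ta_hom_ext' (key _ _ c hΦ1 hΨ1) fun a y hy => ?_
    refine key _ _ (-(feed (Φ.flip y) ∘ₗ (pushT S ∘ₗ (TP.sgn k H).toLinearMap).flip a))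
      (fun w => ?_) fun w => ?_
    · refine (hΦ w a y).trans ?_
      rw [sub_eq_add_neg, add_comm]; rfl
    · refine (hΨ w a y).trans ?_
      rw [sub_eq_add_neg, add_comm, hy]; rfl
  exact LinearMap.ext fun w => LinearMap.ext fun y =>
    LinearMap.congr_fun (LinearMap.congr_fun this y) w

/-- The degree one part of `gen`. -/
abbrev gen1 : TensorAlgebra k H →ₗ[k] TensorAlgebra k A →ₗ[k] TensorAlgebra k A ⊗[k] H :=
  gen S (TP.deg1 k H)

/-- `z ⊗ g ↦ gen1 u z ⊗ g`. -/
def genH : TensorAlgebra k H →ₗ[k] TensorAlgebra k A ⊗[k] H →ₗ[k]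
    TensorAlgebra k A ⊗[k] (H ⊗[k] H) :=
  LinearMap.llcomp k _ _ _ (assoc k _ H H).toLinearMap ∘ₗ
    LinearMap.rTensorHom H ∘ₗ gen1 S

theorem genH_tmul (u : TensorAlgebra k H) (z : TensorAlgebra k A) (g : H) :
    genH S u (z ⊗ₜ g) = assoc k _ H H (gen1 S u z ⊗ₜ g) := rfl

theorem assoc_feed_tmul {M N P : Type*} [AddCommGroup M] [Module k M] [AddCommGroup N] [Module k N]
    [AddCommGroup P] [Module k P] (φ : M →ₗ[k] TensorAlgebra k A ⊗[k] N) (x : A ⊗[k] M) (g : P) :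
    assoc k _ N P (feed φ x ⊗ₜ g) =
      feed ((assoc k _ N P).toLinearMap ∘ₗ
        (TensorProduct.mk k _ P).flip g ∘ₗ φ) x := by
  induction x with
  | zero => simp
  | tmul a m => simp [smul_assoc_tmul]
  | add x y hx hy => simp only [add_tmul, map_add, hx, hy]

theorem genH_one_tmul (u : TensorAlgebra k H) (g : H) :
    genH S u (1 ⊗ₜ g) =
      1 ⊗ₜ (TP.deg1 k H u ⊗ₜ g) + feed ((genH S).flip (1 ⊗ₜ g)) (merge S u) := by
  rw [genH_tmul, gen_one, add_tmul, map_add, assoc_feed_tmul]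
  rfl

theorem genH_ι_smul (u : TensorAlgebra k H) (b : A) (x : TensorAlgebra k A ⊗[k] H) :
    genH S u (ι k b • x) =
      feed ((genH S).flip (ι k b • x)) (merge S u) -
        feed ((genH S).flip x) (pushT S (TP.sgn k H u) b) := by
  induction x with
  | zero =>
    rw [smul_zero, map_zero, map_zero]
    have : ∀ x, feed (V := A) (0 : TensorAlgebra k H →ₗ[k] TensorAlgebra k A ⊗[k] (H ⊗[k] H)) x = 0 := by
      intro x
      induction x with
      | zero => simp
      | tmul v m => simp
      | add x y hx hy => rw [map_add, hx, hy, add_zero]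
    rw [this, this, sub_zero]
  | tmul z g =>
    rw [smul_tmul', smul_eq_mul, genH_tmul, gen_ι_mul, sub_tmul, map_sub, assoc_feed_tmul,
      assoc_feed_tmul]
    rfl
  | add x y hx hy =>
    rw [smul_add, map_add, hx, hy, map_add, map_add, feed_add, feed_add]
    abel

theorem genH_feed (u : TensorAlgebra k H) (φ : TensorAlgebra k H →ₗ[k] TensorAlgebra k A ⊗[k] H)
    (ξ : A ⊗[k] TensorAlgebra k H) :
    genH S u (feed φ ξ) = feed ((genH S).flip (feed φ ξ)) (merge S u) -
      feed (TensorProduct.lift ((genH S).compl₂ φ)) (pushL S (TP.sgn k H u) ξ) := by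
  induction ξ with
  | zero =>
    have := genH_ι_smul S u 0 0
    simp only [map_zero, smul_zero, sub_zero] at this ⊢
    exact this
  | tmul b v =>
    rw [feed_tmul, genH_ι_smul, pushL_tmul]
    congr 1
    generalize pushT S (TP.sgn k H u) b = x
    induction x with
    | zero => simp
    | tmul b w => simp
    | add x y hx hy => simp only [add_tmul, map_add, hx, hy]
  | add x y hx hy =>
    rw [map_add, map_add, hx, hy, map_add, map_add, map_add, feed_add]
    abel

/-- `u ⊗ v, y ↦ genH u (gen1 v y)`. -/
def genK : TensorAlgebra k H ⊗[k] TensorAlgebra k H →ₗ[k] TensorAlgebra k A →ₗ[k]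
    TensorAlgebra k A ⊗[k] (H ⊗[k] H) :=
  TensorProduct.lift (LinearMap.lcomp k _ (gen1 S) ∘ₗ LinearMap.llcomp k _ _ _ ∘ₗ genH S)

theorem genK_tmul (u v : TensorAlgebra k H) (y : TensorAlgebra k A) :
    genK S (u ⊗ₜ v) y = genH S u (gen1 S v y) := rfl

/-- `u ⊗ v ↦ merge u ⊗ v - ū(merge v)`, with the sign rule. -/
def mergeCo' : TensorAlgebra k H ⊗[k] TensorAlgebra k H →ₗ[k]
    A ⊗[k] (TensorAlgebra k H ⊗[k] TensorAlgebra k H) :=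
  (assoc k A _ _).toLinearMap ∘ₗ (merge S).rTensor _ -
    TensorProduct.lift ((pushL S ∘ₗ (TP.sgn k H).toLinearMap).compl₂ (merge S))

theorem mergeCo'_tmul (u v : TensorAlgebra k H) : mergeCo' S (u ⊗ₜ v) =
    assoc k A _ _ (merge S u ⊗ₜ v) - pushL S (TP.sgn k H u) (merge S v) := rfl

/-- Deconcatenation with a sign on the right factor. -/
def decs (k V : Type*) [CommRing k] [AddCommGroup V] [Module k V] :
    TensorAlgebra k V →ₗ[k] TensorAlgebra k V ⊗[k] TensorAlgebra k V :=
  (TP.sgn k V).toLinearMap.lTensor _ ∘ₗ TP.decon k V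

theorem sgn_pushL (u : TensorAlgebra k H) (x : A ⊗[k] TensorAlgebra k H) :
    ((TP.sgn k H).toLinearMap.lTensor _).lTensor A (pushL S u x) =
      pushL S u ((TP.sgn k H).toLinearMap.lTensor A x) := by
  refine LinearMap.congr_fun (f := ((TP.sgn k H).toLinearMap.lTensor _).lTensor A ∘ₗ pushL S u)
    (g := pushL S u ∘ₗ (TP.sgn k H).toLinearMap.lTensor A) (ext' fun b v => ?_) x
  simp only [comp_apply, lTensor_tmul, pushL_tmul]
  generalize pushT S u b = y
  induction y with
  | zero => simp
  | tmul a w => simp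
  | add x y hx hy => simp only [add_tmul, map_add, hx, hy]

theorem decs_merge (w : TensorAlgebra k H) :
    (decs k H).lTensor A (merge S w) = mergeCo' S (decs k H w) := by
  rw [decs, LinearMap.lTensor_comp, comp_apply, decon_merge, comp_apply]
  refine LinearMap.congr_fun (f := ((TP.sgn k H).toLinearMap.lTensor _).lTensor A ∘ₗ mergeCo S)
    (g := mergeCo' S ∘ₗ (TP.sgn k H).toLinearMap.lTensor _) (ext' fun u v => ?_) _
  simp only [comp_apply, mergeCo_tmul, map_add, lTensor_tmul, mergeCo'_tmul,
    sgn_pushL, sgn_merge, map_neg, toLinearMap_apply, ← sub_eq_add_neg]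
  congr 1
  generalize merge S u = y
  induction y with
  | zero => simp
  | tmul a w => simp
  | add x y hx hy => simp only [add_tmul, map_add, hx, hy]

theorem decs_pushT (w : TensorAlgebra k H) (a : A) :
    (decs k H).lTensor A (pushT S (TP.sgn k H w) a) =
      TensorProduct.lift ((pushL S ∘ₗ (TP.sgn k H).toLinearMap).compl₂
        ((pushT S ∘ₗ (TP.sgn k H).toLinearMap).flip a)) (decs k H w) := by
  rw [decs, LinearMap.lTensor_comp, comp_apply, decon_pushT, comp_apply,
    TP.decon_sgn]
  refine LinearMap.congr_fun (f := ((TP.sgn k H).toLinearMap.lTensor _).lTensor A ∘ₗ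
      TensorProduct.lift ((pushL S).compl₂ ((pushT S).flip a)) ∘ₗ
      TensorProduct.map (TP.sgn k H).toLinearMap (TP.sgn k H).toLinearMap)
    (g := TensorProduct.lift ((pushL S ∘ₗ (TP.sgn k H).toLinearMap).compl₂
        ((pushT S ∘ₗ (TP.sgn k H).toLinearMap).flip a)) ∘ₗ (TP.sgn k H).toLinearMap.lTensor _)
    (ext' fun u v => ?_) _
  simp [sgn_pushL, sgn_pushT, TP.sgn_sgn]

theorem genK_one (x : TensorAlgebra k H ⊗[k] TensorAlgebra k H) :
    genK S x 1 = 1 ⊗ₜ TensorProduct.map (TP.deg1 k H) (TP.deg1 k H) x +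
      feed ((genK S).flip 1) (mergeCo' S x) := by
  refine LinearMap.congr_fun (f := (genK S).flip 1) (g := TensorProduct.mk k _ _ 1 ∘ₗ
    TensorProduct.map (TP.deg1 k H) (TP.deg1 k H) + feed ((genK S).flip 1) ∘ₗ mergeCo' S)
    (ext' fun u v => ?_) x
  have h1 : feed ((genK S).flip 1) (assoc k A _ _ (merge S u ⊗ₜ v)) =
      feed ((genH S).flip (gen1 S v 1)) (merge S u) := by
    generalize merge S u = y
    induction y with
    | zero => simp
    | tmul a w => simp [genK_tmul]
    | add x y hx hy => simp only [add_tmul, map_add, hx, hy]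
  have h2 : TensorProduct.lift ((genH S).compl₂ ((gen1 S).flip 1)) = (genK S).flip 1 :=
    ext' fun u v => rfl
  simp only [flip_apply, LinearMap.add_apply, comp_apply, mergeCo'_tmul, map_sub,
    h1, map_tmul, mk_apply, genK_tmul]
  conv_lhs => rw [gen_one, map_add, genH_one_tmul, genH_feed, h2]
  rw [gen_one, map_add, feed_add]
  abel

theorem genK_ι_mul (x : TensorAlgebra k H ⊗[k] TensorAlgebra k H) (a : A) (y : TensorAlgebra k A) :
    genK S x (ι k a * y) =
      feed ((genK S).flip (ι k a * y)) (mergeCo' S x) +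
      feed ((genK S).flip y) (TensorProduct.lift ((pushL S ∘ₗ (TP.sgn k H).toLinearMap).compl₂
        ((pushT S ∘ₗ (TP.sgn k H).toLinearMap).flip a)) x) := by
  refine LinearMap.congr_fun (f := (genK S).flip (ι k a * y))
    (g := feed ((genK S).flip (ι k a * y)) ∘ₗ mergeCo' S +
      feed ((genK S).flip y) ∘ₗ TensorProduct.lift ((pushL S ∘ₗ (TP.sgn k H).toLinearMap).compl₂
        ((pushT S ∘ₗ (TP.sgn k H).toLinearMap).flip a)))
    (ext' fun u v => ?_) x
  have h1 : feed ((genK S).flip (ι k a * y))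
      (assoc k A _ _ (merge S u ⊗ₜ v)) =
      feed ((genH S).flip (gen1 S v (ι k a * y))) (merge S u) := by
    generalize merge S u = y
    induction y with
    | zero => simp
    | tmul a w => simp [genK_tmul]
    | add x y hx hy => simp only [add_tmul, map_add, hx, hy]
  have h2 : ∀ y, TensorProduct.lift ((genH S).compl₂ ((gen1 S).flip y)) = (genK S).flip y :=
    fun y => ext' fun u v => rfl
  simp only [flip_apply, LinearMap.add_apply, comp_apply, mergeCo'_tmul, map_sub,
    h1, genK_tmul, lift.tmul, LinearMap.compl₂_apply, toLinearMap_apply]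
  conv_lhs => rw [gen_ι_mul, map_sub, genH_feed, genH_feed, h2, h2]
  rw [gen_ι_mul, map_sub, feed_sub]
  abel

/-- The degree two part of the transfer, in terms of the degree one part. -/
theorem gen_deg2 (w : TensorAlgebra k H) (y : TensorAlgebra k A) :
    gen S (TP.deg2 k H) w y = -genK S (decs k H w) (TP.sgn k A y) := by
  have hL : ∀ y, LinearMap.flip (LinearMap.lcomp k _ (TP.sgn k A).toLinearMap ∘ₗ genK S ∘ₗ
      (-decs k H)) y = -((genK S).flip (TP.sgn k A y) ∘ₗ decs k H) := by
    intro y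
    ext w
    change genK S (-decs k H w) (TP.sgn k A y) = _
    rw [map_neg, LinearMap.neg_apply]; rfl
  have hL' : ∀ w y, (LinearMap.lcomp k _ (TP.sgn k A).toLinearMap ∘ₗ genK S ∘ₗ
      (-decs k H)) w y = -genK S (decs k H w) (TP.sgn k A y) := fun w y =>
    LinearMap.congr_fun (hL y) w
  have := feed_unique S (Φ := gen S (TP.deg2 k H))
    (Ψ := LinearMap.lcomp k _ (TP.sgn k A).toLinearMap ∘ₗ genK S ∘ₗ (-decs k H))
    (TensorProduct.mk k _ _ 1 ∘ₗ TP.deg2 k H) (gen_one S _) (fun w => ?_) (gen_ι_mul S _)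
    (fun w a y => ?_)
  · rw [this, hL']
  · have h1 : TensorProduct.map (TP.deg1 k H) (TP.deg1 k H) (decs k H w) = -TP.deg2 k H w := by
      rw [← TP.map_deg1_decon, decs, comp_apply]
      refine LinearMap.congr_fun (f := TensorProduct.map (TP.deg1 k H) (TP.deg1 k H) ∘ₗ
        LinearMap.lTensor _ _) (g := -TensorProduct.map (TP.deg1 k H) (TP.deg1 k H))
        (ext' fun u v => ?_) _
      simp [TP.deg1_sgn, tmul_neg]
    rw [hL, hL', feed_neg, ← feed_lTensor, decs_merge, map_one (TP.sgn k A), genK_one, h1, tmul_neg,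
      neg_add, neg_neg]
    rfl
  · rw [hL, hL, hL', feed_neg, feed_neg, ← feed_lTensor, ← feed_lTensor, decs_merge, decs_pushT,
      map_mul (TP.sgn k A), TP.sgn_ι, neg_mul, map_neg,
      show ∀ x, (genK S).flip (-x) = -(genK S).flip x from fun x =>
        LinearMap.ext fun w => map_neg (genK S w) x, feed_neg, neg_neg, genK_ι_mul]
    abel

/-! ### The recursion on the right -/

/-- `e ⊗ w ↦ e` in degree `0`. -/
def augE : CrossedProduct S ⊗[k] TensorAlgebra k H →ₗ[k] CrossedProduct S :=
  (TensorProduct.rid k _).toLinearMap ∘ₗ (TP.aug k H).toLinearMap.lTensor _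

theorem augE_smul (e : CrossedProduct S) (x : CrossedProduct S ⊗[k] TensorAlgebra k H) :
    augE S (e • x) = e * augE S x := by
  induction x with
  | zero => simp
  | tmul e' w => simp [augE, smul_tmul']
  | add x y hx hy => rw [smul_add, LinearMap.map_add, hx, hy, LinearMap.map_add, mul_add]

theorem deg1_cns (x : CrossedProduct S ⊗[k] TensorAlgebra k H) :
    (TP.deg1 k H).lTensor A (cns S x) = (equiv S).symm (augE S x) := by
  refine LinearMap.congr_fun (f := (TP.deg1 k H).lTensor A ∘ₗ cns S)
    (g := (equiv S).symm.toLinearMap ∘ₗ augE S) (eth_hom_ext S fun b l w => ?_) x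
  have h1 : TP.aug k H w • (b ⊗ₜ[k] l : A ⊗[k] H) =
      (equiv S).symm (TP.aug k H w • (inA S b * inH S l)) := by
    rw [← equiv_tmul, map_smul, symm_apply_apply]
  simp [augE, TP.deg1_ι_mul, h1]

theorem augE_upA_cns (x : CrossedProduct S ⊗[k] TensorAlgebra k H) :
    augE S (upA S (cns S x)) = 0 := by
  refine LinearMap.congr_fun (f := augE S ∘ₗ upA S ∘ₗ cns S) (g := 0)
    (eth_hom_ext S fun b l w => ?_) x
  simp [augE]

theorem augE_upA_merge (w : TensorAlgebra k H) : augE S (upA S (merge S w)) = 0 := by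
  refine LinearMap.congr_fun (f := augE S ∘ₗ upA S ∘ₗ merge S) (g := 0)
    (TP.ta_hom_ext' (by simp) fun h w _ => ?_) w
  simp only [comp_apply, merge_ι_mul, LinearMap.map_neg, cnsH_apply, augE_upA_cns]
  simp

theorem augE_mergeE (w : TensorAlgebra k H) : augE S (mergeE S w) = inH S (TP.deg1 k H w) := by
  rw [mergeE, LinearMap.add_apply, LinearMap.map_add, comp_apply, comp_apply,
    augE_upA_merge, add_zero]
  refine LinearMap.congr_fun (f := augE S ∘ₗ (inH S).rTensor _ ∘ₗ TP.uncons k H)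
    (g := inH S ∘ₗ TP.deg1 k H) (TP.ta_hom_ext' (by simp) fun h w _ => ?_) w
  simp [augE, TP.deg1_ι_mul]

theorem deg1_merge (w : TensorAlgebra k H) :
    (TP.deg1 k H).lTensor A (merge S w) = -twistMul S.cocycle (TP.deg2 k H w) := by
  refine LinearMap.congr_fun (f := (TP.deg1 k H).lTensor A ∘ₗ merge S)
    (g := -(twistMul S.cocycle ∘ₗ TP.deg2 k H)) (TP.ta_hom_ext' (by simp) fun h w _ => ?_) w
  simp only [comp_apply, LinearMap.neg_apply, merge_ι_mul, LinearMap.map_neg, cnsH_apply, deg1_cns,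
    augE_smul, augE_mergeE, inH_mul_inH, symm_apply_apply, TP.deg2_ι_mul]

theorem augE_upA_pushT (w : TensorAlgebra k H) (a : A) :
    augE S (upA S (pushT S w a)) = TP.aug k H w • inA S a := by
  refine LinearMap.congr_fun (f := augE S ∘ₗ upA S ∘ₗ (pushT S).flip a)
    (g := LinearMap.toSpanSingleton k _ (inA S a) ∘ₗ (TP.aug k H).toLinearMap)
    (TP.ta_hom_ext' (by simp [augE]) fun h w _ => ?_) w
  simp only [comp_apply, flip_apply, pushT_ι_mul, cnsH_apply, augE_upA_cns]
  simp

theorem deg1_pushT (w : TensorAlgebra k H) (a : A) :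
    (TP.deg1 k H).lTensor A (pushT S w a) = S.push (TP.deg1 k H w ⊗ₜ a) := by
  refine LinearMap.congr_fun (f := (TP.deg1 k H).lTensor A ∘ₗ (pushT S).flip a)
    (g := S.push ∘ₗ (TensorProduct.mk k _ _).flip a ∘ₗ TP.deg1 k H)
    (TP.ta_hom_ext' (by simp) fun h w _ => ?_) w
  simp only [comp_apply, flip_apply, pushT_ι_mul, cnsH_apply, deg1_cns,
    augE_smul, augE_upA_pushT, TP.deg1_ι_mul, mk_apply, mul_smul_comm, inH_mul_inA,
    map_smul, symm_apply_apply]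

/-- `z ⊗ h ↦ z (h a)`. -/
def pushH (a : A) : TensorAlgebra k A ⊗[k] H →ₗ[k] TensorAlgebra k A ⊗[k] H :=
  leftExt (TensorAlgebra k A) ((ι k).rTensor _ ∘ₗ S.push ∘ₗ
    (TensorProduct.mk k _ _).flip a)

/-- `z ⊗ (h ⊗ l) ↦ z f(h, l) ⊗ h l`. -/
def twistH : TensorAlgebra k A ⊗[k] (H ⊗[k] H) →ₗ[k] TensorAlgebra k A ⊗[k] H :=
  leftExt (TensorAlgebra k A) ((ι k).rTensor _ ∘ₗ twistMul S.cocycle)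

theorem lTensor_rTensor_comm {M N P Q : Type*} [AddCommGroup M] [Module k M] [AddCommGroup N]
    [Module k N] [AddCommGroup P] [Module k P] [AddCommGroup Q] [Module k Q] (f : M →ₗ[k] N)
    (g : P →ₗ[k] Q) (x : M ⊗[k] P) :
    g.lTensor N (f.rTensor P x) = f.rTensor Q (g.lTensor M x) := by
  rw [← comp_apply, ← comp_apply, LinearMap.lTensor_comp_rTensor,
    LinearMap.rTensor_comp_lTensor]

theorem deg1_opT (x : TT S) : (TP.deg1 k H).lTensor _ (opT S x) =
    -twistH S ((TP.deg2 k H).lTensor _ x) := by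
  refine LinearMap.congr_fun (f := (TP.deg1 k H).lTensor _ ∘ₗ opT S)
    (g := -(twistH S ∘ₗ (TP.deg2 k H).lTensor _)) (ext' fun z w => ?_) x
  simp only [comp_apply, LinearMap.neg_apply, opT_tmul, lTensor_smul',
    lTensor_rTensor_comm, deg1_merge, LinearMap.map_neg, smul_neg, lTensor_tmul, twistH,
    leftExt_tmul]

theorem deg1_opA (a : A) (x : TT S) : (TP.deg1 k H).lTensor _ (opA S a x) =
    pushH S a ((TP.deg1 k H).lTensor _ x) := by
  refine LinearMap.congr_fun (f := (TP.deg1 k H).lTensor _ ∘ₗ opA S a)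
    (g := pushH S a ∘ₗ (TP.deg1 k H).lTensor _) (ext' fun z w => ?_) x
  simp only [comp_apply, opA_tmul, LinearMap.map_neg, lTensor_smul',
    lTensor_rTensor_comm, deg1_pushT, lTensor_tmul, pushH,
    leftExt_tmul, TP.deg1_sgn, neg_tmul, flip_apply, mk_apply, smul_neg,
    neg_neg]

theorem gen1_mul_ι (w : TensorAlgebra k H) (y : TensorAlgebra k A) (a : A) :
    gen1 S w (y * ι k a) = pushH S a (gen1 S w y) +
      twistH S (genK S (decs k H w) (TP.sgn k A (y * ι k a))) := by
  rw [gen_apply, opG_mul_ι_eq, LinearMap.map_add, deg1_opA, deg1_opT, ← gen_apply, ← gen_apply, gen_deg2,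
    LinearMap.map_neg, neg_neg]

theorem gen1_one (w : TensorAlgebra k H) :
    gen1 S w 1 = 1 ⊗ₜ TP.deg1 k H w + twistH S (genK S (decs k H w) 1) := by
  rw [gen_apply, opG_one, opS_eq_left, LinearMap.map_add, deg1_opT, ← opG_one, ← gen_apply, gen_deg2,
    LinearMap.map_neg, neg_neg, map_one]
  simp

/-! ### Signs -/

theorem sgn_feed {V M N : Type*} [AddCommGroup V] [Module k V] [AddCommGroup M] [Module k M]
    [AddCommGroup N] [Module k N] (φ : M →ₗ[k] TensorAlgebra k V ⊗[k] N) (x : V ⊗[k] M) :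
    (TP.sgn k V).toLinearMap.rTensor N (feed φ x) =
      -feed ((TP.sgn k V).toLinearMap.rTensor N ∘ₗ φ) x := by
  induction x with
  | zero => simp
  | tmul v m =>
    simp only [feed_tmul, comp_apply]
    generalize φ m = t
    induction t with
    | zero => simp
    | tmul z n => simp [smul_tmul', neg_tmul]
    | add x y hx hy => rw [smul_add, LinearMap.map_add, hx, hy, LinearMap.map_add, smul_add]; abel
  | add x y hx hy => rw [LinearMap.map_add, LinearMap.map_add, hx, hy, LinearMap.map_add]; abel

theorem sgn_gen1 (w : TensorAlgebra k H) (y : TensorAlgebra k A) :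
    (TP.sgn k A).toLinearMap.rTensor H (gen1 S w y) = -gen1 S (TP.sgn k H w) (TP.sgn k A y) := by
  let Φ : TensorAlgebra k H →ₗ[k] TensorAlgebra k A →ₗ[k] TensorAlgebra k A ⊗[k] H :=
    LinearMap.lcomp k _ (TP.sgn k A).toLinearMap ∘ₗ LinearMap.llcomp k _ _ _
      ((TP.sgn k A).toLinearMap.rTensor H) ∘ₗ gen1 S ∘ₗ (-(TP.sgn k H).toLinearMap)
  have hΦ : ∀ w y, Φ w y =
      -(TP.sgn k A).toLinearMap.rTensor H (gen1 S (TP.sgn k H w) (TP.sgn k A y)) := by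
    intro w y
    change (TP.sgn k A).toLinearMap.rTensor H (gen1 S (-TP.sgn k H w) (TP.sgn k A y)) = _
    rw [map_neg (gen1 S), LinearMap.neg_apply, LinearMap.map_neg]
  have hf : ∀ y x, feed (Φ.flip y) x =
      (TP.sgn k A).toLinearMap.rTensor H (feed ((gen1 S).flip (TP.sgn k A y))
        ((TP.sgn k H).toLinearMap.lTensor A x)) := by
    intro y x
    rw [sgn_feed, feed_lTensor, ← feed_neg]
    exact congrArg (fun f => feed f x) (LinearMap.ext fun w => (hΦ w y).trans (by simp))
  have : Φ = gen1 S := by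
    refine feed_unique S (TensorProduct.mk k _ _ 1 ∘ₗ TP.deg1 k H) (fun w => ?_) (gen_one S _)
      (fun w a y => ?_) (gen_ι_mul S _)
    · rw [hΦ, hf, map_one, gen_one, LinearMap.map_add, sgn_merge, LinearMap.map_neg, LinearMap.map_neg, neg_add, TP.deg1_sgn,
        rTensor_tmul, tmul_neg, neg_neg]
      simp
    · rw [hΦ, hf, hf, map_mul, TP.sgn_ι, neg_mul, LinearMap.map_neg, LinearMap.map_neg, neg_neg, gen_ι_mul, LinearMap.map_sub,
        sgn_merge, sgn_pushT, show ∀ x, (gen1 S).flip (-x) = -(gen1 S).flip x from fun x =>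
        LinearMap.ext fun w => map_neg (gen1 S w) x, feed_neg, LinearMap.map_neg, LinearMap.map_neg, LinearMap.map_neg, neg_neg]
  have h2 := hΦ (TP.sgn k H w) (TP.sgn k A y)
  rw [this, TP.sgn_sgn, TP.sgn_sgn] at h2
  rw [h2, neg_neg]

/-! ### Compatibility with the comultiplication -/

/-- The algebra map `h₁ ⋯ hₙ ↦ h₁⁽¹⁾ ⋯ hₙ⁽¹⁾ ⊗ h₁⁽²⁾ ⋯ hₙ⁽²⁾`. -/
def rho (k H : Type*) [CommRing k] [Ring H] [Bialgebra k H] :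
    TensorAlgebra k H →ₐ[k] TensorAlgebra k H ⊗[k] H :=
  TensorAlgebra.lift k ((ι k).rTensor H ∘ₗ Coalgebra.comul (R := k))

theorem rho_ι (h : H) : rho k H (ι k h) =
    (ι k).rTensor H (Coalgebra.comul (R := k) h) := by simp [rho]

theorem rho_ι_mul (h : H) (w : TensorAlgebra k H) : rho k H (ι k h * w) =
    (ι k).rTensor H (Coalgebra.comul (R := k) h) * rho k H w := by
  rw [map_mul, rho_ι]

theorem rho_toTA (n : ℕ) (w : ⨂[k]^n H) :
    rho k H (TP.toTA k n w) = (TP.toTA k n).rTensor H (comulProd k H n w) := by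
  induction n with
  | zero =>
    obtain ⟨c, rfl⟩ := TP.zero_eq_smul_nil w
    rw [map_smul, map_smul, map_smul, TP.toTA_nil]
    simp [comulProd, TP.toTA_nil, Algebra.TensorProduct.one_def]
  | succ n ih =>
    induction w using TP.cons_induction with
    | zero => simp
    | cons h w =>
      rw [TP.toTA_cons, rho_ι_mul, ih]
      simp only [comulProd, comp_apply, coe_coe, symm_apply_apply,
        map_tmul]
      refine DFunLike.congr_fun (F := _ →ₗ[k] _) (f := LinearMap.mul' k _ ∘ₗ TensorProduct.map
        ((ι k).rTensor H) ((TP.toTA k n).rTensor H))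
        (g := (TP.toTA k (n + 1)).rTensor H ∘ₗ TensorProduct.map (TP.cons k n).toLinearMap
          (LinearMap.mul' k H) ∘ₗ (TensorProduct.tensorTensorTensorComm k H H _ H).toLinearMap)
        (TensorProduct.ext_fourfold' fun a b u c => ?_)
        (Coalgebra.comul (R := k) h ⊗ₜ comulProd k H n w)
      simp [TP.toTA_cons]
    | add x y hx hy => simp only [map_add, hx, hy]

theorem push_eq (h : H) (a : A) :
    S.push (h ⊗ₜ a) = (S.act.flip a).rTensor H (Coalgebra.comul (R := k) h) := by
  simp only [WeakAction.push, comp_apply, rTensor_tmul, coe_coe]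
  generalize Coalgebra.comul (R := k) h = x
  induction x with
  | zero => simp
  | tmul a b => simp
  | add x y hx hy => simp only [map_add, add_tmul, hx, hy]

theorem comul_push (h : H) (a : A) :
    (assoc k A H H).symm ((Coalgebra.comul (R := k)).lTensor A (S.push (h ⊗ₜ a))) =
      (S.push ∘ₗ (TensorProduct.mk k H A).flip a).rTensor H (Coalgebra.comul (R := k) h) := by
  have h0 : S.push ∘ₗ (TensorProduct.mk k H A).flip a =
      (S.act.flip a).rTensor H ∘ₗ Coalgebra.comul (R := k) := LinearMap.ext fun h => push_eq S h a
  rw [h0, push_eq, lTensor_rTensor_comm, LinearMap.rTensor_comp, comp_apply,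
    ← Coalgebra.coassoc_apply, LinearEquiv.symm_apply_eq]
  generalize (Coalgebra.comul (R := k)).rTensor H (Coalgebra.comul (R := k) h) = x
  refine LinearMap.congr_fun (f := (S.act.flip a).rTensor _ ∘ₗ
    (assoc k H H H).toLinearMap) (g := (assoc k A H H).toLinearMap ∘ₗ
      ((S.act.flip a).rTensor H).rTensor H) ?_ x
  ext
  simp

theorem comul_mul' (x : H ⊗[k] H) : Coalgebra.comul (R := k) (LinearMap.mul' k H x) =
    TensorProduct.map (LinearMap.mul' k H) (LinearMap.mul' k H) (Coalgebra.comul (R := k) x) := by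
  refine LinearMap.congr_fun (f := Coalgebra.comul (R := k) ∘ₗ LinearMap.mul' k H)
    (g := TensorProduct.map (LinearMap.mul' k H) (LinearMap.mul' k H) ∘ₗ
      Coalgebra.comul (R := k) (A := H ⊗[k] H)) (ext' fun a b => ?_) x
  simp only [comp_apply, LinearMap.mul'_apply, Bialgebra.comul_mul,
    TensorProduct.comul_tmul]
  generalize Coalgebra.comul (R := k) a = x
  generalize Coalgebra.comul (R := k) b = y
  induction x with
  | zero => simp
  | tmul a b =>
    induction y with
    | zero => simp
    | tmul u c => simp
    | add x y hx hy => simp only [map_add, tmul_add, mul_add, hx, hy]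
  | add x y hx hy => simp only [map_add, add_tmul, add_mul, hx, hy]

theorem comul_twistMul (x : H ⊗[k] H) :
    (assoc k A H H).symm ((Coalgebra.comul (R := k)).lTensor A
      (twistMul S.cocycle x)) =
      TensorProduct.map (twistMul S.cocycle) (LinearMap.mul' k H) (Coalgebra.comul (R := k) x) := by
  have h1 : twistMul S.cocycle = TensorProduct.map S.cocycle (LinearMap.mul' k H) ∘ₗ
      (Coalgebra.comul (R := k) (A := H ⊗[k] H)) := rfl
  let C := H ⊗[k] H
  have h2 : (assoc k A H H).toLinearMap ∘ₗ TensorProduct.map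
      (TensorProduct.map S.cocycle (LinearMap.mul' k H)) (LinearMap.mul' k H) =
      TensorProduct.map S.cocycle (TensorProduct.map (LinearMap.mul' k H) (LinearMap.mul' k H)) ∘ₗ
        (assoc k C C C).toLinearMap :=
    TensorProduct.ext_threefold fun x y z => by simp
  have h3 := Coalgebra.coassoc_apply (R := k) (A := C) x
  have h4 : ∀ y : C ⊗[k] C, (Coalgebra.comul (R := k)).lTensor A
      (TensorProduct.map S.cocycle (LinearMap.mul' k H) y) =
      TensorProduct.map S.cocycle (TensorProduct.map (LinearMap.mul' k H) (LinearMap.mul' k H))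
        ((Coalgebra.comul (R := k)).lTensor C y) := fun y =>
    LinearMap.congr_fun (f := (Coalgebra.comul (R := k)).lTensor A ∘ₗ
      TensorProduct.map S.cocycle (LinearMap.mul' k H)) (g := TensorProduct.map S.cocycle
        (TensorProduct.map (LinearMap.mul' k H) (LinearMap.mul' k H)) ∘ₗ
          (Coalgebra.comul (R := k)).lTensor C) (ext' fun x y => by
      simp only [comp_apply, map_tmul, lTensor_tmul,
        comul_mul']) y
  rw [LinearEquiv.symm_apply_eq, h1, comp_apply, h4, ← h3]
  have h5 := LinearMap.congr_fun h2 ((Coalgebra.comul (R := k)).rTensor C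
    (Coalgebra.comul (R := k) x))
  refine h5.symm.trans (congrArg (assoc k A H H) ?_)
  have h6 : TensorProduct.map (TensorProduct.map S.cocycle (LinearMap.mul' k H) ∘ₗ
      Coalgebra.comul (R := k) (A := C)) (LinearMap.mul' k H) = TensorProduct.map
      (TensorProduct.map S.cocycle (LinearMap.mul' k H)) (LinearMap.mul' k H) ∘ₗ
      (Coalgebra.comul (R := k) (A := C)).rTensor C :=
    ext' fun x y => by simp
  exact (LinearMap.congr_fun h6 _).symm

/-! ### The coaction of `H` on the crossed product and on `E ⊗ T(H)` -/

/-- `a # h ↦ (a # h⁽¹⁾) ⊗ h⁽²⁾`. -/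
def coE : CrossedProduct S →ₗ[k] CrossedProduct S ⊗[k] H :=
  (equiv S).toLinearMap.rTensor H ∘ₗ (assoc k A H H).symm.toLinearMap ∘ₗ
    (Coalgebra.comul (R := k)).lTensor A ∘ₗ (equiv S).symm.toLinearMap

theorem coE_equiv (x : A ⊗[k] H) : coE S (equiv S x) = (equiv S).toLinearMap.rTensor H
    ((assoc k A H H).symm ((Coalgebra.comul (R := k)).lTensor A x)) := by
  simp [coE]

theorem coE_inH (h : H) : coE S (inH S h) = (inH S).rTensor H (Coalgebra.comul (R := k) h) := by
  rw [inH_apply, coE_equiv, lTensor_tmul]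
  generalize Coalgebra.comul (R := k) h = x
  induction x with
  | zero => simp
  | tmul a b => simp [inH_apply]
  | add x y hx hy => simp only [tmul_add, map_add, hx, hy]

theorem coE_inA_mul (a : A) (e : CrossedProduct S) :
    coE S (inA S a * e) = (inA S a ⊗ₜ 1) * coE S e := by
  obtain ⟨x, rfl⟩ := (equiv S).surjective e
  rw [inA_mul_equiv, coE_equiv, coE_equiv, lTensor_smul']
  generalize (Coalgebra.comul (R := k)).lTensor A x = x
  refine LinearMap.congr_fun (f := (equiv S).toLinearMap.rTensor H ∘ₗ
    (assoc k A H H).symm.toLinearMap ∘ₗ lsm k A _ a)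
    (g := mulLeft k (inA S a ⊗ₜ 1) ∘ₗ (equiv S).toLinearMap.rTensor H ∘ₗ
      (assoc k A H H).symm.toLinearMap) (TensorProduct.ext_threefold' fun b g l => ?_) x
  simp [smul_tmul', equiv_tmul, inA_mul, mul_assoc]

theorem coE_inH_mul_inA (h : H) (a : A) :
    coE S (inH S h * inA S a) = coE S (inH S h) * (inA S a ⊗ₜ 1) := by
  rw [inH_mul_inA, coE_equiv, comul_push, coE_inH]
  generalize Coalgebra.comul (R := k) h = x
  induction x with
  | zero => simp
  | tmul g l => simp [inH_mul_inA]
  | add x y hx hy => simp only [add_mul, LinearMap.map_add, hx, hy]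

theorem coE_inH_mul_inH (h l : H) :
    coE S (inH S h * inH S l) = coE S (inH S h) * coE S (inH S l) := by
  rw [inH_mul_inH, coE_equiv, comul_twistMul, coE_inH, coE_inH, TensorProduct.comul_tmul]
  refine DFunLike.congr_fun (F := _ →ₗ[k] _) (f := (equiv S).toLinearMap.rTensor H ∘ₗ
    TensorProduct.map (twistMul S.cocycle) (LinearMap.mul' k H) ∘ₗ
    (TensorProduct.AlgebraTensorModule.tensorTensorTensorComm k k k k H H H H).toLinearMap)
    (g := LinearMap.mul' k _ ∘ₗ TensorProduct.map ((inH S).rTensor H) ((inH S).rTensor H))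
    (TensorProduct.ext_fourfold' fun a b c d => ?_)
    (Coalgebra.comul (R := k) h ⊗ₜ Coalgebra.comul (R := k) l)
  simp [inH_mul_inH]

theorem coE_inH_mul (h : H) (e : CrossedProduct S) :
    coE S (inH S h * e) = coE S (inH S h) * coE S e := by
  refine LinearMap.congr_fun (f := coE S ∘ₗ mulLeft k (inH S h))
    (g := mulLeft k (coE S (inH S h)) ∘ₗ coE S) (crossed_hom_ext S fun a l => ?_) e
  simp only [comp_apply, LinearMap.mulLeft_apply]
  rw [← mul_assoc, coE_inA_mul, ← mul_assoc, ← coE_inH_mul_inA, inH_mul_inA]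
  generalize S.push (h ⊗ₜ a) = x
  refine LinearMap.congr_fun (f := coE S ∘ₗ mulRight k (inH S l) ∘ₗ
    (equiv S).toLinearMap) (g := mulRight k (coE S (inH S l)) ∘ₗ coE S ∘ₗ
      (equiv S).toLinearMap) (ext' fun b g => ?_) x
  simp [equiv_tmul, coE_inA_mul, mul_assoc, coE_inH_mul_inH]

theorem coE_mul (e e' : CrossedProduct S) : coE S (e * e') = coE S e * coE S e' := by
  refine LinearMap.congr_fun (f := coE S ∘ₗ mulRight k e')
    (g := mulRight k (coE S e') ∘ₗ coE S) (crossed_hom_ext S fun a l => ?_) e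
  simp [coE_inA_mul, mul_assoc, coE_inH_mul]

/-- `e ⊗ h, z ⊗ g ↦ e z ⊗ h g`. -/
def hact : CrossedProduct S ⊗[k] H →ₗ[k]
    (CrossedProduct S ⊗[k] TensorAlgebra k H) ⊗[k] H →ₗ[k]
      (CrossedProduct S ⊗[k] TensorAlgebra k H) ⊗[k] H :=
  TensorProduct.homTensorHomMap (RingHom.id k) _ _ _ _ ∘ₗ
    TensorProduct.map (lsm k _ _) (LinearMap.mul k H)

theorem hact_tmul_tmul (e : CrossedProduct S) (h : H)
    (z : CrossedProduct S ⊗[k] TensorAlgebra k H) (g : H) :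
    hact S (e ⊗ₜ h) (z ⊗ₜ g) = (e • z) ⊗ₜ (h * g) := rfl

theorem hact_mul (x y : CrossedProduct S ⊗[k] H)
    (z : (CrossedProduct S ⊗[k] TensorAlgebra k H) ⊗[k] H) :
    hact S (x * y) z = hact S x (hact S y z) := by
  induction x with
  | zero => simp
  | tmul a b =>
    induction y with
    | zero => simp
    | tmul c d =>
      induction z using TensorProduct.induction_on with
      | zero => simp
      | tmul z g => simp [hact_tmul_tmul, mul_smul, mul_assoc]
      | add x y hx hy => simp only [LinearMap.map_add, hx, hy]
    | add x y hx hy => simp only [mul_add, LinearMap.map_add, LinearMap.add_apply, hx, hy]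
  | add x y hx hy => simp only [add_mul, LinearMap.map_add, LinearMap.add_apply, hx, hy]

/-- The coaction `e ⊗ w ↦ (e⁽¹⁾ ⊗ w⁽¹⁾) ⊗ e⁽²⁾ w⁽²⁾`. -/
def coX : CrossedProduct S ⊗[k] TensorAlgebra k H →ₗ[k]
    (CrossedProduct S ⊗[k] TensorAlgebra k H) ⊗[k] H :=
  TensorProduct.lift ((hact S ∘ₗ coE S).compl₂
    ((TensorProduct.mk k _ _ 1).rTensor H ∘ₗ (rho k H).toLinearMap))

theorem coX_tmul (e : CrossedProduct S) (w : TensorAlgebra k H) :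
    coX S (e ⊗ₜ w) = hact S (coE S e) ((TensorProduct.mk k _ _ 1).rTensor H (rho k H w)) := rfl

theorem coX_smul (e : CrossedProduct S) (x : CrossedProduct S ⊗[k] TensorAlgebra k H) :
    coX S (e • x) = hact S (coE S e) (coX S x) := by
  induction x with
  | zero => simp
  | tmul e' w => rw [smul_tmul', smul_eq_mul, coX_tmul, coX_tmul, coE_mul, hact_mul]
  | add x y hx hy => rw [smul_add, LinearMap.map_add, hx, hy, LinearMap.map_add, LinearMap.map_add]

/-- `a ⊗ w ↦ (a ⊗ w⁽¹⁾) ⊗ w⁽²⁾`. -/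
def coA : A ⊗[k] TensorAlgebra k H →ₗ[k] (A ⊗[k] TensorAlgebra k H) ⊗[k] H :=
  (assoc k A _ H).symm.toLinearMap ∘ₗ (rho k H).toLinearMap.lTensor A

theorem coA_cns (x : CrossedProduct S ⊗[k] TensorAlgebra k H) :
    coA (cns S x) = (cns S).rTensor H (coX S x) := by
  refine LinearMap.congr_fun (f := coA ∘ₗ cns S) (g := (cns S).rTensor H ∘ₗ coX S)
    (eth_hom_ext S fun b l w => ?_) x
  simp only [comp_apply, cns_tmul, coA, lTensor_tmul, coX_tmul, coE_inA_mul,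
    coE_inH, toLinearMap_apply, rho_ι_mul, coe_coe]
  generalize Coalgebra.comul (R := k) l = x
  generalize rho k H w = y
  induction x with
  | zero => simp
  | tmul a c =>
    induction y with
    | zero => simp
    | tmul u g => simp [hact_tmul_tmul, smul_tmul']
    | add x y hx hy => simp only [mul_add, tmul_add, map_add, hx, hy]
  | add x y hx hy => simp only [mul_add, add_mul, tmul_add, map_add, LinearMap.add_apply, hx, hy]

theorem coX_upA (x : A ⊗[k] TensorAlgebra k H) :
    coX S (upA S x) = (upA S).rTensor H (coA x) := by
  refine LinearMap.congr_fun (f := coX S ∘ₗ upA S) (g := (upA S).rTensor H ∘ₗ coA)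
    (ext' fun a w => ?_) x
  have h1 : coE S (inA S a) = inA S a ⊗ₜ 1 := by
    simp [inA_apply, coE_equiv, Bialgebra.comul_one, Algebra.TensorProduct.one_def]
  simp only [comp_apply, rTensor_tmul, coX_tmul, h1, coA, lTensor_tmul,
    toLinearMap_apply, coe_coe]
  generalize rho k H w = y
  induction y with
  | zero => simp
  | tmul u g => simp [hact_tmul_tmul, smul_tmul']
  | add x y hx hy => simp only [map_add, tmul_add, hx, hy]

theorem coX_jj (x : CrossedProduct S ⊗[k] TensorAlgebra k H) :
    coX S (jj S x) = (jj S).rTensor H (coX S x) := by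
  rw [jj, comp_apply, coX_upA, coA_cns, LinearMap.rTensor_comp_apply]

theorem rTensor_ι_mul {N : Type*} [AddCommGroup N] [Module k N] (f : TensorAlgebra k H →ₗ[k] N)
    (g : TensorAlgebra k H →ₗ[k] CrossedProduct S ⊗[k] TensorAlgebra k H)
    (i : (CrossedProduct S ⊗[k] TensorAlgebra k H) →ₗ[k] N)
    (hf : ∀ h w, f (ι k h * w) = i (inH S h • g w))
    (t : H ⊗[k] H) (s : TensorAlgebra k H ⊗[k] H) :
    f.rTensor H ((ι k).rTensor H t * s) =
      i.rTensor H (hact S ((inH S).rTensor H t) (g.rTensor H s)) := by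
  induction t with
  | zero => simp
  | tmul a c =>
    induction s with
    | zero => simp
    | tmul u g => simp [hact_tmul_tmul, hf]
    | add x y hx hy => simp only [mul_add, LinearMap.map_add, hx, hy]
  | add x y hx hy => simp only [add_mul, LinearMap.map_add, LinearMap.add_apply, hx, hy]

theorem coX_mergeE (w : TensorAlgebra k H) :
    coX S (mergeE S w) = (mergeE S).rTensor H (rho k H w) := by
  refine LinearMap.congr_fun (f := coX S ∘ₗ mergeE S) (g := (mergeE S).rTensor H ∘ₗ
    (rho k H).toLinearMap) (TP.ta_hom_ext' (by simp [Algebra.TensorProduct.one_def])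
      fun h w ih => ?_) w
  simp only [comp_apply, toLinearMap_apply] at ih ⊢
  rw [rho_ι_mul, mergeE_ι_mul, LinearMap.map_sub, jjH_apply, coX_jj, coX_smul, ih, coX_tmul, coE_inH]
  generalize Coalgebra.comul (R := k) h = t
  generalize rho k H w = s
  induction t with
  | zero => simp
  | tmul a c =>
    induction s with
    | zero => simp
    | tmul u g => simp [hact_tmul_tmul, mergeE_ι_mul, smul_tmul', sub_tmul]
    | add x y hx hy => simp only [mul_add, LinearMap.map_add, ← hx, ← hy]; abel
  | add x y hx hy => simp only [add_mul, LinearMap.map_add, LinearMap.add_apply, ← hx, ← hy]; abel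

theorem coA_merge (w : TensorAlgebra k H) :
    coA (merge S w) = (merge S).rTensor H (rho k H w) := by
  refine LinearMap.congr_fun (f := coA ∘ₗ merge S) (g := (merge S).rTensor H ∘ₗ
    (rho k H).toLinearMap) (TP.ta_hom_ext' (by simp [Algebra.TensorProduct.one_def])
      fun h w ih => ?_) w
  simp only [comp_apply, toLinearMap_apply] at ih ⊢
  rw [rho_ι_mul, merge_ι_mul, cnsH_apply, LinearMap.map_neg, coA_cns, coX_smul, coE_inH, coX_mergeE,
    rTensor_ι_mul S (merge S) (mergeE S) (-cns S) (fun h w => by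
      rw [merge_ι_mul, cnsH_apply, LinearMap.neg_apply]), LinearMap.rTensor_neg,
    LinearMap.neg_apply]

theorem coA_pushT (w : TensorAlgebra k H) (a : A) :
    coA (pushT S w a) = ((pushT S).flip a).rTensor H (rho k H w) := by
  refine LinearMap.congr_fun (f := coA ∘ₗ (pushT S).flip a) (g := ((pushT S).flip a).rTensor H ∘ₗ
    (rho k H).toLinearMap) (TP.ta_hom_ext' (by simp [coA, Algebra.TensorProduct.one_def])
      fun h w ih => ?_) w
  simp only [comp_apply, toLinearMap_apply, flip_apply] at ih ⊢
  rw [rho_ι_mul, pushT_ι_mul, cnsH_apply, coA_cns, coX_smul, coE_inH, coX_upA, ih,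
    ← LinearMap.rTensor_comp_apply,
    rTensor_ι_mul S ((pushT S).flip a) (upA S ∘ₗ (pushT S).flip a) (cns S) (fun h w => by
      rw [flip_apply, pushT_ι_mul, cnsH_apply, comp_apply,
        flip_apply])]

theorem rho_sgn (w : TensorAlgebra k H) :
    rho k H (TP.sgn k H w) = (TP.sgn k H).toLinearMap.rTensor H (rho k H w) := by
  refine LinearMap.congr_fun (f := (rho k H).toLinearMap ∘ₗ (TP.sgn k H).toLinearMap)
    (g := (TP.sgn k H).toLinearMap.rTensor H ∘ₗ (rho k H).toLinearMap)
    (TP.ta_hom_ext' (by simp [Algebra.TensorProduct.one_def]) fun h w ih => ?_) w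
  simp only [comp_apply, toLinearMap_apply] at ih ⊢
  rw [map_mul (TP.sgn k H), TP.sgn_ι, neg_mul, map_neg, rho_ι_mul, rho_ι_mul, ih]
  generalize Coalgebra.comul (R := k) h = t
  generalize rho k H w = s
  induction t with
  | zero => simp
  | tmul a c =>
    induction s with
    | zero => simp
    | tmul u g => simp [neg_tmul]
    | add x y hx hy => simp only [mul_add, map_add, ← hx, ← hy]; abel
  | add x y hx hy => simp only [add_mul, map_add, ← hx, ← hy]; abel

theorem aug_rho (w : TensorAlgebra k H) :
    (TP.aug k H).toLinearMap.rTensor H (rho k H w) = TP.aug k H w ⊗ₜ 1 := by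
  refine LinearMap.congr_fun (f := (TP.aug k H).toLinearMap.rTensor H ∘ₗ (rho k H).toLinearMap)
    (g := (TensorProduct.mk k k H).flip 1 ∘ₗ (TP.aug k H).toLinearMap)
    (TP.ta_hom_ext' (by simp [Algebra.TensorProduct.one_def]) fun h w _ => ?_) w
  simp only [comp_apply, toLinearMap_apply, rho_ι_mul]
  generalize Coalgebra.comul (R := k) h = t
  generalize rho k H w = s
  induction t with
  | zero => simp
  | tmul a c =>
    induction s with
    | zero => simp
    | tmul u g => simp
    | add x y hx hy => simp only [mul_add, LinearMap.map_add, hx, hy]; simp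
  | add x y hx hy => simp only [add_mul, LinearMap.map_add, hx, hy]; simp

theorem deg1_rho (w : TensorAlgebra k H) :
    (TP.deg1 k H).rTensor H (rho k H w) = Coalgebra.comul (R := k) (TP.deg1 k H w) := by
  refine LinearMap.congr_fun (f := (TP.deg1 k H).rTensor H ∘ₗ (rho k H).toLinearMap)
    (g := Coalgebra.comul (R := k) ∘ₗ TP.deg1 k H)
    (TP.ta_hom_ext' (by simp [Algebra.TensorProduct.one_def]) fun h w _ => ?_) w
  simp only [comp_apply, toLinearMap_apply, rho_ι_mul, TP.deg1_ι_mul, map_smul]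
  have h1 : ∀ (t : H ⊗[k] H) (s : TensorAlgebra k H ⊗[k] H),
      (TP.deg1 k H).rTensor H ((ι k).rTensor H t * s) =
      TensorProduct.map LinearMap.id (LinearMap.mul' k H) (assoc k H H H
        (t ⊗ₜ TensorProduct.lid k H ((TP.aug k H).toLinearMap.rTensor H s))) := by
    intro t s
    induction t with
    | zero => simp
    | tmul a c =>
      induction s with
      | zero => simp
      | tmul u g => simp [TP.deg1_ι_mul, smul_tmul]
      | add x y hx hy => simp only [mul_add, map_add, tmul_add, hx, hy]
    | add x y hx hy => simp only [add_mul, map_add, add_tmul, hx, hy]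
  rw [h1, aug_rho]
  generalize Coalgebra.comul (R := k) h = t
  induction t with
  | zero => simp
  | tmul a c => simp
  | add x y hx hy => simp only [map_add, add_tmul, smul_add, hx, hy]

theorem assoc_feed_coA {M : Type*} [AddCommGroup M] [Module k M]
    (φ : TensorAlgebra k H →ₗ[k] TensorAlgebra k A ⊗[k] M) (x : A ⊗[k] TensorAlgebra k H) :
    assoc k _ M H ((feed φ).rTensor H (coA x)) =
      feed ((assoc k _ M H).toLinearMap ∘ₗ φ.rTensor H ∘ₗ (rho k H).toLinearMap) x := by
  induction x with
  | zero => simp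
  | tmul a w =>
    simp only [coA, comp_apply, lTensor_tmul, feed_tmul,
      toLinearMap_apply, coe_coe]
    generalize rho k H w = y
    induction y with
    | zero => simp
    | tmul u g => simp [smul_assoc_tmul]
    | add x y hx hy => simp only [tmul_add, map_add, smul_add, hx, hy]
  | add x y hx hy => simp only [map_add, hx, hy]

theorem comul_gen1 (w : TensorAlgebra k H) (y : TensorAlgebra k A) :
    (Coalgebra.comul (R := k)).lTensor _ (gen1 S w y) =
      assoc k _ H H (((gen1 S).flip y).rTensor H (rho k H w)) := by
  let Ψ : TensorAlgebra k H →ₗ[k] TensorAlgebra k A →ₗ[k] TensorAlgebra k A ⊗[k] (H ⊗[k] H) :=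
    LinearMap.flip ((LinearMap.llcomp k _ _ _ (assoc k _ H H).toLinearMap) ∘ₗ
      LinearMap.lcomp k _ (rho k H).toLinearMap ∘ₗ LinearMap.rTensorHom H ∘ₗ (gen1 S).flip)
  have h0 : gen S (Coalgebra.comul (R := k) ∘ₗ TP.deg1 k H) w y =
      (Coalgebra.comul (R := k)).lTensor _ (gen1 S w y) := by
    rw [gen_apply, gen_apply, LinearMap.lTensor_comp_apply]
  have hΨ : ∀ w y, Ψ w y =
      assoc k _ H H (((gen1 S).flip y).rTensor H (rho k H w)) := fun _ _ => rfl
  have hΨ' : ∀ y, Ψ.flip y = (assoc k _ H H).toLinearMap ∘ₗ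
    ((gen1 S).flip y).rTensor H ∘ₗ (rho k H).toLinearMap := fun _ => rfl
  rw [← h0, ← hΨ]
  refine LinearMap.congr_fun₂ (feed_unique S (TensorProduct.mk k _ _ 1 ∘ₗ
    Coalgebra.comul (R := k) ∘ₗ TP.deg1 k H) (gen_one S _) (fun w => ?_) (gen_ι_mul S _)
    (fun w a y => ?_)) w y
  · have h1 : (gen1 S).flip 1 = TensorProduct.mk k _ _ 1 ∘ₗ TP.deg1 k H +
        feed ((gen1 S).flip 1) ∘ₗ merge S := LinearMap.ext fun w => gen_one S _ w
    rw [hΨ, hΨ', ← assoc_feed_coA, coA_merge, comp_apply, comp_apply,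
      ← deg1_rho, ← LinearMap.rTensor_comp_apply]
    conv_lhs => rw [h1]
    rw [LinearMap.rTensor_add, LinearMap.add_apply, map_add]
    congr 1
    generalize rho k H w = y
    induction y with
    | zero => simp
    | tmul u g => simp
    | add x y hx hy => simp only [map_add, hx, hy]
  · have h1 : (gen1 S).flip (ι k a * y) =
        feed ((gen1 S).flip (ι k a * y)) ∘ₗ merge S -
        feed ((gen1 S).flip y) ∘ₗ (pushT S).flip a ∘ₗ (TP.sgn k H).toLinearMap :=
      LinearMap.ext fun w => gen_ι_mul S _ w a y
    rw [hΨ, hΨ', hΨ', ← assoc_feed_coA, ← assoc_feed_coA, coA_merge, coA_pushT, rho_sgn,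
      ← LinearMap.rTensor_comp_apply, ← LinearMap.rTensor_comp_apply,
      ← LinearMap.rTensor_comp_apply, ← map_sub]
    conv_lhs => rw [h1, LinearMap.rTensor_sub]
    rfl

/-- The scalar part of `gen1`. -/
def gen0 : TensorAlgebra k H →ₗ[k] TensorAlgebra k A →ₗ[k] TensorAlgebra k A :=
  LinearMap.flip (LinearMap.llcomp k _ _ _ ((TensorProduct.rid k _).toLinearMap ∘ₗ
    (Coalgebra.counit (R := k)).lTensor _) ∘ₗ (gen1 S).flip)

theorem gen0_apply (w : TensorAlgebra k H) (y : TensorAlgebra k A) :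
    gen0 S w y = TensorProduct.rid k _ ((Coalgebra.counit (R := k)).lTensor _ (gen1 S w y)) := rfl

theorem gen1_eq (w : TensorAlgebra k H) (y : TensorAlgebra k A) :
    gen1 S w y = ((gen0 S).flip y).rTensor H (rho k H w) := by
  have h := congrArg ((TensorProduct.lid k H).toLinearMap.lTensor (TensorAlgebra k A) ∘ₗ
    ((Coalgebra.counit (R := k)).rTensor H).lTensor _) (comul_gen1 S w y)
  have h1 : ∀ t : TensorAlgebra k A ⊗[k] H, ((TensorProduct.lid k H).toLinearMap.lTensor _ ∘ₗ
      ((Coalgebra.counit (R := k)).rTensor H).lTensor _)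
        ((Coalgebra.comul (R := k)).lTensor _ t) = t := by
    intro t
    induction t with
    | zero => simp
    | tmul z l => simp
    | add x y hx hy => simp only [map_add, hx, hy]
  rw [h1] at h
  rw [h]
  generalize rho k H w = x
  induction x with
  | zero => simp
  | tmul u g =>
    simp only [rTensor_tmul, flip_apply, gen0_apply]
    generalize gen1 S u y = x
    induction x with
    | zero => simp
    | tmul z l => simp [smul_tmul]
    | add x y hx hy => simp only [add_tmul, map_add, ← hx, ← hy]
  | add x y hx hy => simp only [map_add, hx, hy]

/-! ### Homogeneous components of the transfer -/

theorem rid_counit_feed (φ : TensorAlgebra k H →ₗ[k] TensorAlgebra k A ⊗[k] H)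
    (x : A ⊗[k] TensorAlgebra k H) :
    TensorProduct.rid k _ ((Coalgebra.counit (R := k)).lTensor _ (feed φ x)) =
      feed ((TensorProduct.rid k (TensorAlgebra k A)).toLinearMap ∘ₗ
        (Coalgebra.counit (R := k)).lTensor _ ∘ₗ φ) x := by
  induction x with
  | zero => simp
  | tmul a w =>
    simp only [feed_tmul, comp_apply, lTensor_smul', coe_coe]
    generalize (Coalgebra.counit (R := k)).lTensor _ (φ w) = y
    induction y with
    | zero => simp
    | tmul z c => simp [smul_tmul']
    | add x y hx hy => simp only [map_add, smul_add, hx, hy]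
  | add x y hx hy => simp only [map_add, hx, hy]

theorem gen0_one (w : TensorAlgebra k H) :
    gen0 S w 1 = Coalgebra.counit (R := k) (TP.deg1 k H w) • 1 +
      feed ((gen0 S).flip 1) (merge S w) := by
  rw [gen0_apply, gen_one, map_add, map_add, rid_counit_feed]
  simp only [lTensor_tmul, TensorProduct.rid_tmul]
  rfl

theorem gen0_ι_mul (w : TensorAlgebra k H) (a : A) (y : TensorAlgebra k A) :
    gen0 S w (ι k a * y) =
      feed ((gen0 S).flip (ι k a * y)) (merge S w) -
        feed ((gen0 S).flip y) (pushT S (TP.sgn k H w) a) := by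
  rw [gen0_apply, gen_ι_mul, map_sub, map_sub, rid_counit_feed, rid_counit_feed]
  rfl

theorem merge_ι (h : H) : merge S (ι k h) = 0 := by
  have := merge_ι_mul S h 1
  rwa [mul_one, mergeE_one, LinearMap.map_zero, neg_zero] at this

theorem pushT_ι (h : H) (a : A) :
    pushT S (ι k h) a = (ι k).lTensor A (S.push (h ⊗ₜ a)) := by
  have := pushT_ι_mul S h 1 a
  rw [mul_one] at this
  rw [this, cnsH_apply, pushT_one, rTensor_tmul, smul_tmul', smul_eq_mul, inH_mul_inA]
  generalize S.push (h ⊗ₜ a) = x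
  induction x with
  | zero => simp
  | tmul b l => simp [equiv_tmul]
  | add x y hx hy => simp only [map_add, add_tmul, hx, hy]

theorem gen1_ι_one (h : H) : gen1 S (ι k h) 1 = 1 ⊗ₜ h := by
  rw [gen_one, merge_ι]; simp

theorem gen1_ι_ι_mul (h : H) (a : A) (y : TensorAlgebra k A) :
    gen1 S (ι k h) (ι k a * y) =
      feed ((gen1 S).flip y ∘ₗ ι k) (S.push (h ⊗ₜ a)) := by
  rw [gen_ι_mul, merge_ι, TP.sgn_ι, LinearMap.map_neg, LinearMap.neg_apply, LinearMap.map_neg, pushT_ι, feed_lTensor]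
  simp

set_option synthInstance.maxHeartbeats 200000 in
theorem gen1_ι_toTA (h : H) (r : ℕ) (y : ⨂[k]^r A) :
    gen1 S (ι k h) (TP.toTA k r y) =
      (TP.toTA k r).rTensor H (S.pushDiag r (h ⊗ₜ y)) := by
  induction r generalizing h with
  | zero =>
    obtain ⟨c, rfl⟩ := TP.zero_eq_smul_nil y
    rw [map_smul, map_smul, tmul_smul, map_smul, map_smul, TP.toTA_nil, gen1_ι_one]
    simp [WeakAction.pushDiag, TP.toTA_nil]
  | succ r ih =>
    induction y using TP.cons_induction with
    | zero => simp
    | cons a y =>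
      rw [TP.toTA_cons, gen1_ι_ι_mul]
      simp only [WeakAction.pushDiag, comp_apply, coe_coe,
        lTensor_tmul, symm_apply_apply, assoc_symm_tmul,
        rTensor_tmul]
      generalize S.push (h ⊗ₜ a) = x
      induction x with
      | zero => simp
      | tmul b l =>
        simp only [feed_tmul, comp_apply, flip_apply, ih,
          assoc_tmul, lTensor_tmul]
        generalize S.pushDiag r (l ⊗ₜ y) = t
        induction t with
        | zero => simp
        | tmul z g => simp [smul_tmul', TP.toTA_cons]
        | add x y hx hy => simp only [map_add, smul_add, tmul_add, hx, hy]
      | add x y hx hy => simp only [map_add, add_tmul, hx, hy]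
    | add x y hx hy => simp only [map_add, tmul_add, hx, hy]

theorem gen1_one_left (y : TensorAlgebra k A) : gen1 S 1 y = 0 := by
  induction y using TP.ta_induction with
  | one => rw [gen_one]; simp
  | cons a y ih => rw [gen_ι_mul, merge_one, LinearMap.map_zero, map_one, pushT_one]; simp [ih]
  | smul c y ih => rw [LinearMap.map_smul, ih, smul_zero]
  | add x y hx hy => rw [LinearMap.map_add, hx, hy, add_zero]

set_option synthInstance.maxHeartbeats 200000 in
theorem toTA_insertion (n m : ℕ) (c : k)
    (G : ∀ r : ℕ, (⨂[k]^n H) ⊗[k] (⨂[k]^r A) →ₗ[k] ⨂[k]^(r + m) A)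
    (w : TensorAlgebra k H →ₗ[k] TensorAlgebra k A →ₗ[k] TensorAlgebra k A)
    (g : (⨂[k]^n H) → TensorAlgebra k A →ₗ[k] TensorAlgebra k A)
    (hG : ∀ r v y, TP.toTA k (r + m) (G r (v ⊗ₜ y)) = g v (TP.toTA k r y))
    (h1 : ∀ v, w (TP.toTA k n v) 1 = g v 1)
    (hι : ∀ v a y, w (TP.toTA k n v) (ι k a * y) = g v (ι k a * y) +
      c • feed (w.flip y) (pushT S (TP.toTA k n v) a)) (r : ℕ) (v : ⨂[k]^n H) (y : ⨂[k]^r A) :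
    TP.toTA k (r + m) (insertion S n m c G r (v ⊗ₜ y)) = w (TP.toTA k n v) (TP.toTA k r y) := by
  induction r generalizing v with
  | zero =>
    obtain ⟨c, rfl⟩ := TP.zero_eq_smul_nil y
    rw [insertion, hG, map_smul, map_smul, map_smul, TP.toTA_nil, h1]
  | succ r ih =>
    induction y using TP.cons_induction with
    | zero => simp
    | cons a y =>
      rw [TP.toTA_cons, hι, insertion, LinearMap.add_apply, map_add, hG, TP.toTA_cons]
      congr 1
      simp only [LinearMap.smul_apply, map_smul, comp_apply, coe_coe,
        TP.toTA_cast, lTensor_tmul, symm_apply_apply,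
        assoc_symm_tmul, rTensor_tmul, pushT_toTA]
      congr 1
      generalize S.pushPow n (v ⊗ₜ a) = x
      induction x with
      | zero => simp
      | tmul b u => simp [TP.toTA_cons, ih]
      | add x y hx hy => simp only [map_add, add_tmul, hx, hy]
    | add x y hx hy => simp only [map_add, tmul_add, hx, hy]

set_option synthInstance.maxHeartbeats 200000 in
theorem toTA_F (m r : ℕ) (v : ⨂[k]^(m + 1) H) (y : ⨂[k]^r A) :
    TP.toTA k (r + m) (F S m r (v ⊗ₜ y)) = gen0 S (TP.toTA k (m + 1) v) (TP.toTA k r y) := by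
  induction m generalizing r with
  | zero =>
    obtain ⟨h, rfl⟩ := (PiTensorProduct.subsingletonEquiv (R := k) (s := fun _ => H)
      (0 : Fin 1)).symm.surjective v
    rw [TP.toTA_one, gen0_apply, gen1_ι_toTA]
    simp only [F, comp_apply, rTensor_tmul, coe_coe,
      LinearEquiv.apply_symm_apply]
    generalize S.pushDiag r (h ⊗ₜ y) = t
    induction t with
    | zero => simp
    | tmul z g => simp
    | add x y hx hy => simp only [map_add, hx, hy]
  | succ m ih =>
    rw [F]
    have hs : ∀ v : ⨂[k]^(m + 2) H, ∀ a, pushT S (TP.sgn k H (TP.toTA k (m + 2) v)) a =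
        -((-1 : k) ^ (m + 1) • pushT S (TP.toTA k (m + 2) v) a) := by
      intro v a
      rw [TP.sgn_toTA, map_smul, LinearMap.smul_apply, pow_succ_smul', neg_one_smul]
    refine toTA_insertion S (m + 2) (m + 1) _ _ (gen0 S)
      (fun v => LinearMap.applyₗ ((ι k).rTensor _ (merge S (TP.toTA k (m + 2) v))) ∘ₗ
        leftExtₗ k (TensorAlgebra k A) _ _ ∘ₗ (gen0 S).flip) (fun r v y => ?_) (fun v => ?_)
        (fun v a y => ?_) r v y
    · change _ = feed ((gen0 S).flip (TP.toTA k r y)) (merge S (TP.toTA k (m + 2) v))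
      rw [merge_toTA_succ, feed_lTensor, LinearMap.sum_apply, map_sum, map_sum]
      refine Finset.sum_congr rfl fun j _ => ?_
      rw [LinearMap.smul_apply, map_smul, map_smul]
      congr 1
      simp only [comp_apply, coe_coe, rTensor_tmul]
      generalize S.mergeAt (m + 1) j v = x
      induction x with
      | zero => simp
      | tmul b u =>
        simp only [assoc_tmul, lTensor_tmul, feed_tmul,
          comp_apply, flip_apply, ← ih, smul_eq_mul]
        exact TP.toTA_cons (r + m) b (F S m r (u ⊗ₜ y))
      | add x y hx hy => simp only [map_add, add_tmul, hx, hy]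
    · rw [gen0_one, TP.deg1_toTA_of_ne (by omega), map_zero, zero_smul, zero_add]
      rfl
    · rw [gen0_ι_mul, hs, map_neg, sub_neg_eq_add, map_smul]
      rfl

/-- `𝐡 ⊗ 𝐚 ↦ F_r(𝐡⁽¹⁾ ⊗ 𝐚) ⊗ h₁⁽²⁾ ⋯ hₗ⁽²⁾`. -/
def FH (m r : ℕ) : (⨂[k]^(m + 1) H) ⊗[k] (⨂[k]^r A) →ₗ[k] (⨂[k]^(r + m) A) ⊗[k] H :=
  (F S m r).rTensor H ∘ₗ
    (TensorProduct.rightComm k (⨂[k]^(m + 1) H) H (⨂[k]^r A)).toLinearMap ∘ₗ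
      (comulProd k H (m + 1)).rTensor _

set_option synthInstance.maxHeartbeats 200000 in
theorem toTA_FH (m r : ℕ) (v : ⨂[k]^(m + 1) H) (y : ⨂[k]^r A) :
    (TP.toTA k (r + m)).rTensor H (FH S m r (v ⊗ₜ y)) =
      gen1 S (TP.toTA k (m + 1) v) (TP.toTA k r y) := by
  rw [gen1_eq, rho_toTA]
  simp only [FH, comp_apply, rTensor_tmul, coe_coe]
  generalize comulProd k H (m + 1) v = x
  induction x with
  | zero => simp
  | tmul u g => simp [toTA_F]
  | add x y hx hy => simp only [map_add, add_tmul, hx, hy]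

end CrossedSystem

/-! ### Degenerate tensors -/

/-- The span of the `m ⊗ n` with `m ∈ p` or `n ∈ q`. -/
def tensorSpan {k M N : Type*} [CommRing k] [AddCommGroup M] [Module k M] [AddCommGroup N]
    [Module k N] (p : Submodule k M) (q : Submodule k N) : Submodule k (M ⊗[k] N) :=
  Submodule.span k {x | ∃ m n, (m ∈ p ∨ n ∈ q) ∧ x = m ⊗ₜ n}

section
variable {k M N P : Type*} [CommRing k] [AddCommGroup M] [Module k M] [AddCommGroup N]
    [Module k N] [AddCommGroup P] [Module k P] {p : Submodule k M} {q : Submodule k N}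

theorem tmul_mem_tensorSpan_left {m : M} (h : m ∈ p) (n : N) : m ⊗ₜ n ∈ tensorSpan p q :=
  Submodule.subset_span ⟨m, n, Or.inl h, rfl⟩

theorem tmul_mem_tensorSpan_right (m : M) {n : N} (h : n ∈ q) : m ⊗ₜ n ∈ tensorSpan p q :=
  Submodule.subset_span ⟨m, n, Or.inr h, rfl⟩

theorem map_mem_of_mem_tensorSpan {T : Submodule k P} (f : M ⊗[k] N →ₗ[k] P)
    (h1 : ∀ m ∈ p, ∀ n, f (m ⊗ₜ n) ∈ T) (h2 : ∀ m, ∀ n ∈ q, f (m ⊗ₜ n) ∈ T) {x : M ⊗[k] N}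
    (hx : x ∈ tensorSpan p q) : f x ∈ T := by
  have : tensorSpan p q ≤ T.comap f := by
    rw [tensorSpan, Submodule.span_le]
    rintro _ ⟨m, n, h | h, rfl⟩
    · exact h1 m h n
    · exact h2 m n h
  exact this hx

end

namespace TP

variable (k : Type*) (B : Type*) [CommRing k] [Ring B] [Algebra k B]

/-- `T(B) → T(B / k)`. -/
def barTA : TensorAlgebra k B →ₐ[k] TensorAlgebra k (Bar k B) :=
  TensorAlgebra.lift k (ι k ∘ₗ barMk k B)

@[simp] theorem barTA_ι (b : B) :
    barTA k B (ι k b) = ι k (barMk k B b) := by simp [barTA]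

@[simp] theorem barMk_one : barMk k B 1 = 0 :=
  (Submodule.Quotient.mk_eq_zero _).2 ⟨1, by simp⟩

theorem barPow_cons (n : ℕ) (b : B) (w : ⨂[k]^n B) :
    barPow k B (n + 1) (cons k n (b ⊗ₜ w)) = cons k n (barMk k B b ⊗ₜ barPow k B n w) := by
  induction w using PiTensorProduct.induction_on with
  | smul_tprod c v =>
    rw [tmul_smul, map_smul, map_smul, map_smul, tmul_smul, map_smul, cons_tprod]
    simp only [barPow, PiTensorProduct.map_tprod, cons_tprod]
    congr 2
    funext i
    refine Fin.cases ?_ (fun j => ?_) i <;> simp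
  | add x y hx hy => simp only [tmul_add, map_add, hx, hy]

theorem barPow_nil : barPow k B 0 (nil k B) = nil k (Bar k B) := by
  rw [nil, barPow, PiTensorProduct.map_tprod, tprod_zero]

theorem barTA_toTA (n : ℕ) (w : ⨂[k]^n B) :
    barTA k B (toTA k n w) = toTA k n (barPow k B n w) := by
  induction n with
  | zero =>
    obtain ⟨c, rfl⟩ := zero_eq_smul_nil w
    rw [map_smul, map_smul, map_smul, map_smul, barPow_nil, toTA_nil, toTA_nil, map_one]
  | succ n ih =>
    induction w using cons_induction with
    | zero => simp
    | cons b w => rw [toTA_cons, map_mul, barPow_cons, toTA_cons, barTA_ι, ih]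
    | add x y hx hy => simp only [map_add, hx, hy]

theorem barTA_sgn (y : TensorAlgebra k B) : barTA k B (sgn k B y) = sgn k _ (barTA k B y) := by
  refine LinearMap.congr_fun (f := (barTA k B).toLinearMap ∘ₗ (sgn k B).toLinearMap)
    (g := (sgn k _).toLinearMap ∘ₗ (barTA k B).toLinearMap) (ta_hom_ext' (by simp) fun v w h => ?_) y
  simp only [comp_apply, toLinearMap_apply] at h ⊢
  simp [h]

theorem barMk_surjective : Function.Surjective (barMk k B) := Submodule.mkQ_surjective _

theorem barPow_surjective (n : ℕ) : Function.Surjective (barPow k B n) := by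
  induction n with
  | zero =>
    intro w
    obtain ⟨c, rfl⟩ := zero_eq_smul_nil w
    exact ⟨c • nil k B, by rw [LinearMap.map_smul, barPow_nil]⟩
  | succ n ih =>
    intro w
    obtain ⟨t, rfl⟩ := (cons k n).surjective w
    obtain ⟨x, rfl⟩ := TensorProduct.map_surjective (barMk_surjective k B) ih t
    refine ⟨cons k n x, ?_⟩
    exact LinearMap.congr_fun (f := barPow k B (n + 1) ∘ₗ (cons k n).toLinearMap)
      (g := (cons k n).toLinearMap ∘ₗ TensorProduct.map (barMk k B) (barPow k B n))
      (ext' fun b w => barPow_cons k B n b w) x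

variable {k B}

theorem barMk_eq_zero {b : B} (h : barMk k B b = 0) : ∃ c : k, b = c • 1 := by
  obtain ⟨c, hc⟩ := (Submodule.Quotient.mk_eq_zero _).1 h
  exact ⟨c, by rw [← hc, Algebra.linearMap_apply, Algebra.algebraMap_eq_smul_one]⟩

theorem ker_map_eq {M N M' N' : Type*} [AddCommGroup M] [Module k M] [AddCommGroup N]
    [Module k N] [AddCommGroup M'] [Module k M'] [AddCommGroup N'] [Module k N']
    {f : M →ₗ[k] M'} {g : N →ₗ[k] N'} (hf : Function.Surjective f) (hg : Function.Surjective g) :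
    LinearMap.ker (TensorProduct.map f g) = tensorSpan (LinearMap.ker f) (LinearMap.ker g) := by
  apply le_antisymm
  · rw [TensorProduct.map_ker (f := (LinearMap.ker f).subtype) (g := f)
      (f' := (LinearMap.ker g).subtype) (g' := g) (LinearMap.exact_subtype_ker_map f) hf
      (LinearMap.exact_subtype_ker_map g) hg]
    refine sup_le ?_ ?_
    · rintro _ ⟨x, rfl⟩
      induction x with
      | zero => simp
      | tmul m n => exact tmul_mem_tensorSpan_right m n.2
      | add x y hx hy => rw [LinearMap.map_add]; exact add_mem hx hy
    · rintro _ ⟨x, rfl⟩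
      induction x with
      | zero => simp
      | tmul m n => exact tmul_mem_tensorSpan_left m.2 n
      | add x y hx hy => rw [LinearMap.map_add]; exact add_mem hx hy
  · rw [tensorSpan, Submodule.span_le]
    rintro _ ⟨m, n, h | h, rfl⟩
    · simp [LinearMap.mem_ker.1 h]
    · simp [LinearMap.mem_ker.1 h]

/-- Linear maps that vanish on the tensors with an entry `1` descend to the bar quotient. -/
theorem eq_zero_of_barPow_eq_zero {N : Type*} [AddCommGroup N] [Module k N]
    (f : TensorAlgebra k B →ₗ[k] N)
    (h : ∀ u v, f (u * (ι k 1 * v)) = 0) (n : ℕ) (w : ⨂[k]^n B)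
    (hw : barPow k B n w = 0) : f (toTA k n w) = 0 := by
  induction n generalizing f with
  | zero =>
    obtain ⟨c, rfl⟩ := zero_eq_smul_nil w
    rw [map_smul, barPow_nil] at hw
    have : c = 0 := by
      have := congrArg (PiTensorProduct.isEmptyEquiv (R := k) (s := fun _ => Bar k B) (Fin 0)) hw
      rwa [map_smul, isEmptyEquiv_nil, map_zero, smul_eq_mul, mul_one] at this
    simp [this]
  | succ n ih =>
    obtain ⟨x, rfl⟩ := (cons k n).surjective w
    have hx : x ∈ LinearMap.ker (TensorProduct.map (barMk k B) (barPow k B n)) := by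
      have h1 : barPow k B (n + 1) ∘ₗ (cons k n).toLinearMap =
          (cons k n).toLinearMap ∘ₗ TensorProduct.map (barMk k B) (barPow k B n) :=
        ext' fun b w => barPow_cons k B n b w
      have h2 := LinearMap.congr_fun h1 x
      rw [comp_apply, comp_apply] at h2
      exact (cons k n).injective (h2.symm.trans (hw.trans (map_zero _).symm))
    rw [ker_map_eq (barMk_surjective k B) (barPow_surjective k B n)] at hx
    have := map_mem_of_mem_tensorSpan (T := ⊥) (f ∘ₗ toTA k (n + 1) ∘ₗ (cons k n).toLinearMap)
      (fun m hm w => ?_) (fun m w hw => ?_) hx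
    · exact this
    · obtain ⟨c, rfl⟩ := barMk_eq_zero (LinearMap.mem_ker.1 hm)
      rw [← smul_tmul', map_smul]
      refine Submodule.smul_mem _ _ ?_
      simp only [comp_apply, coe_coe, toTA_cons, Submodule.mem_bot]
      rw [← one_mul (ι k 1 * _), h]
    · simp only [comp_apply, coe_coe, toTA_cons, Submodule.mem_bot]
      exact ih (f ∘ₗ mulLeft k (ι k m)) (fun u v => by
        simp only [comp_apply, LinearMap.mulLeft_apply]; rw [← mul_assoc, h]) w
        (LinearMap.mem_ker.1 hw)

variable (k B)

/-- The span of the tensors of degree `≥ 2` with an entry `1`. -/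
def degen : Submodule k (TensorAlgebra k B) :=
  Submodule.span k {x | ∃ u b v, x = u * (ι k b * (ι k 1 * v)) ∨
    x = u * (ι k 1 * (ι k b * v))}

variable {k B}

theorem mem_degen_left (b : B) (v : TensorAlgebra k B) :
    ι k b * (ι k 1 * v) ∈ degen k B :=
  Submodule.subset_span ⟨1, b, v, Or.inl (one_mul _).symm⟩

theorem mem_degen_right (b : B) (v : TensorAlgebra k B) :
    ι k 1 * (ι k b * v) ∈ degen k B :=
  Submodule.subset_span ⟨1, b, v, Or.inr (one_mul _).symm⟩

theorem mul_mem_degen (u : TensorAlgebra k B) {x : TensorAlgebra k B} (hx : x ∈ degen k B) :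
    u * x ∈ degen k B := by
  have : degen k B ≤ (degen k B).comap (mulLeft k u) := by
    conv_lhs => rw [degen]
    rw [Submodule.span_le]
    rintro _ ⟨u', b, v, rfl | rfl⟩
    · exact Submodule.subset_span ⟨u * u', b, v, Or.inl (mul_assoc _ _ _).symm⟩
    · exact Submodule.subset_span ⟨u * u', b, v, Or.inr (mul_assoc _ _ _).symm⟩
  exact this hx

/-- Induction for degenerate tensors. -/
theorem degen_induction {P : Submodule k (TensorAlgebra k B)}
    (h1 : ∀ b v, ι k b * (ι k 1 * v) ∈ P)
    (h2 : ∀ b v, ι k 1 * (ι k b * v) ∈ P)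
    (h3 : ∀ b, ∀ x ∈ degen k B, x ∈ P → ι k b * x ∈ P) {x : TensorAlgebra k B}
    (hx : x ∈ degen k B) : x ∈ P := by
  have key : ∀ u x, x ∈ degen k B → x ∈ P → u * x ∈ P := by
    intro u x hx hP
    induction u using ta_induction with
    | one => rwa [one_mul]
    | cons b u ih => rw [mul_assoc]; exact h3 b _ (mul_mem_degen u hx) ih
    | smul c u ih => rw [smul_mul_assoc]; exact P.smul_mem c ih
    | add u u' ih ih' => rw [add_mul]; exact add_mem ih ih'
  have : degen k B ≤ P := by
    rw [degen, Submodule.span_le]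
    rintro _ ⟨u, b, v, rfl | rfl⟩
    · exact key u _ (mem_degen_left b v) (h1 b v)
    · exact key u _ (mem_degen_right b v) (h2 b v)
  exact this hx

theorem sgn_mem_degen {x : TensorAlgebra k B} (hx : x ∈ degen k B) : sgn k B x ∈ degen k B := by
  refine degen_induction (P := (degen k B).comap (sgn k B).toLinearMap) (fun b v => ?_)
    (fun b v => ?_) (fun b x _ h => ?_) hx
  · simpa using mem_degen_left b (sgn k B v)
  · simpa using mem_degen_right b (sgn k B v)
  · simpa using mul_mem_degen (ι k b) h

theorem deg1_degen {x : TensorAlgebra k B} (hx : x ∈ degen k B) : deg1 k B x = 0 :=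
  degen_induction (P := LinearMap.ker (deg1 k B)) (fun b v => by simp) (fun b v => by simp)
    (fun b x hx h => by
      rw [LinearMap.mem_ker, deg1_ι_mul]
      have : aug k B x = 0 := degen_induction (P := LinearMap.ker (aug k B).toLinearMap)
        (fun b v => by simp) (fun b v => by simp) (fun b x _ h => by simp) hx
      rw [this, zero_smul]) hx

end TP

namespace CrossedSystem

open CrossedProduct

variable {k A H : Type*} [CommRing k] [Ring A] [Algebra k A] [Ring H] [Bialgebra k H]
  (S : CrossedSystem k A H)

theorem cns_smul_tmul_mem (e : CrossedProduct S) (a : A) {w : TensorAlgebra k H}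
    {P : Submodule k (TensorAlgebra k H)} (h : ∀ l : H, ι k l * w ∈ P)
    (q : Submodule k A) :
    cns S (e • (inA S a ⊗ₜ w)) ∈ tensorSpan q P := by
  rw [smul_tmul', smul_eq_mul]
  generalize e * inA S a = e
  obtain ⟨x, rfl⟩ := (equiv S).surjective e
  induction x with
  | zero => simp
  | tmul b l => rw [equiv_tmul, cns_tmul]; exact tmul_mem_tensorSpan_right b (h l)
  | add x y hx hy => rw [map_add, add_tmul, map_add]; exact add_mem hx hy

theorem cns_upA (x : A ⊗[k] TensorAlgebra k H) :
    cns S (upA S x) = (mulLeft k (ι k 1)).lTensor A x := by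
  induction x with
  | zero => simp
  | tmul b w =>
    have := cns_tmul S b 1 w
    rw [inH_one, mul_one] at this
    exact this
  | add x y hx hy => rw [LinearMap.map_add, LinearMap.map_add, hx, hy, LinearMap.map_add]

theorem ι_one_cns_mem (x : CrossedProduct S ⊗[k] TensorAlgebra k H) (q : Submodule k A) :
    cns S (upA S (cns S x)) ∈ tensorSpan q (TP.degen k H) := by
  rw [cns_upA]
  induction x using TensorProduct.induction_on with
  | zero => simp
  | tmul e w =>
    obtain ⟨x, rfl⟩ := (equiv S).surjective e
    induction x with
    | zero => simp
    | tmul b l =>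
      rw [equiv_tmul, cns_tmul]; exact tmul_mem_tensorSpan_right b (TP.mem_degen_right l w)
    | add x y hx hy => rw [map_add, add_tmul, map_add, map_add]; exact add_mem hx hy
  | add x y hx hy => rw [map_add, map_add]; exact add_mem hx hy

theorem cns_smul_upA_ι_one_mem (e : CrossedProduct S) (x : A ⊗[k] TensorAlgebra k H)
    (q : Submodule k A) : cns S (e • upA S (cns S (upA S x))) ∈ tensorSpan q (TP.degen k H) := by
  rw [cns_upA]
  induction x with
  | zero => simp
  | tmul b w => exact cns_smul_tmul_mem S e b (fun l => TP.mem_degen_left l w) q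
  | add x y hx hy => rw [LinearMap.map_add, LinearMap.map_add, smul_add, LinearMap.map_add]; exact add_mem hx hy

theorem pushT_mem_degen (a : A) {w : TensorAlgebra k H} (hw : w ∈ TP.degen k H) :
    pushT S w a ∈ tensorSpan (⊥ : Submodule k A) (TP.degen k H) := by
  refine TP.degen_induction (P := (tensorSpan (⊥ : Submodule k A) (TP.degen k H)).comap
    ((pushT S).flip a)) (fun b v => ?_) (fun b v => ?_) (fun b x _ h => ?_) hw
  · rw [Submodule.mem_comap, flip_apply, pushT_ι_mul, pushT_ι_mul, cnsH_apply,
      cnsH_apply, inH_one, one_smul]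
    exact cns_smul_upA_ι_one_mem S _ _ _
  · rw [Submodule.mem_comap, flip_apply, pushT_ι_mul, pushT_ι_mul, cnsH_apply,
      cnsH_apply, inH_one, one_smul]
    exact ι_one_cns_mem S _ _
  · rw [Submodule.mem_comap, flip_apply, pushT_ι_mul]
    refine map_mem_of_mem_tensorSpan (cnsH S b ∘ₗ upA S) (fun m hm n => ?_) (fun m n hn => ?_) h
    · rw [(Submodule.mem_bot k).1 hm]; simp
    · exact cns_smul_tmul_mem S _ m (fun l => TP.mul_mem_degen _ hn) _

/-- The span of the `1 ⊗ w` and of the `a ⊗ w`, for degenerate `w`. -/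
abbrev degenA (k A H : Type*) [CommRing k] [Ring A] [Algebra k A] [Ring H] [Algebra k H] :
    Submodule k (A ⊗[k] TensorAlgebra k H) :=
  tensorSpan (Submodule.span k {(1 : A)}) (TP.degen k H)

theorem one_tmul_mem_degenA (w : TensorAlgebra k H) : (1 : A) ⊗ₜ w ∈ degenA k A H :=
  tmul_mem_tensorSpan_left (Submodule.mem_span_singleton_self 1) w

theorem cns_inH_smul_upA_mem (g : H) {x : A ⊗[k] TensorAlgebra k H} (hx : x ∈ degenA k A H) :
    cns S (inH S g • upA S x) ∈ degenA k A H := by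
  refine map_mem_of_mem_tensorSpan (cnsH S g ∘ₗ upA S) (fun m hm n => ?_) (fun m n hn => ?_) hx
  · obtain ⟨c, rfl⟩ := Submodule.mem_span_singleton.1 hm
    rw [← smul_tmul', LinearMap.map_smul]
    refine Submodule.smul_mem _ c ?_
    rw [comp_apply, rTensor_tmul, inA_one, cnsH_apply, smul_tmul', smul_eq_mul,
      mul_one, cns_inH_tmul]
    exact one_tmul_mem_degenA _
  · exact cns_smul_tmul_mem S _ m (fun l => TP.mul_mem_degen _ hn) _

theorem cns_mem_degenA (e : CrossedProduct S) {w : TensorAlgebra k H}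
    (hw : ∀ l : H, ι k l * w ∈ TP.degen k H) : cns S (e ⊗ₜ w) ∈ degenA k A H := by
  have := cns_smul_tmul_mem S e 1 hw (Submodule.span k {(1 : A)})
  rwa [inA_one, smul_tmul', smul_eq_mul, mul_one] at this

theorem merge_mem_degenA {w : TensorAlgebra k H} (hw : w ∈ TP.degen k H) :
    merge S w ∈ degenA k A H := by
  let U : TensorAlgebra k H →ₗ[k] CrossedProduct S ⊗[k] TensorAlgebra k H :=
    (inH S).rTensor _ ∘ₗ TP.uncons k H
  have hE : ∀ x, mergeE S x = U x + upA S (merge S x) := fun x => rfl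
  have hU : ∀ h x, U (ι k h * x) = inH S h ⊗ₜ x := fun h x => by simp [U]
  have hUT : ∀ h x, (∀ l : H, ι k l * x ∈ TP.degen k H) → ∀ g,
      cns S (inH S g • U (ι k h * x)) ∈ degenA k A H := by
    intro h x hx g
    rw [hU, smul_tmul', smul_eq_mul]
    exact cns_mem_degenA S _ hx
  let Q : Submodule k (TensorAlgebra k H) :=
    (degenA k A H).comap (merge S) ⊓ ⨅ g : H, (degenA k A H).comap (cnsH S g ∘ₗ U)
  suffices h : w ∈ Q from h.1
  have hQ : ∀ x, x ∈ Q ↔ merge S x ∈ degenA k A H ∧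
      ∀ g, cns S (inH S g • U x) ∈ degenA k A H := by
    intro x
    simp only [Q, Submodule.mem_inf, Submodule.mem_comap, Submodule.mem_iInf]
    rfl
  refine TP.degen_induction (P := Q) (fun h v => ?_) (fun h v => ?_) (fun h x hx hxQ => ?_) hw
  · rw [hQ]
    refine ⟨?_, hUT h _ fun l => TP.mem_degen_left l v⟩
    rw [merge_ι_mul, cnsH_apply, mergeE_ι_mul, inH_one, smul_sub, LinearMap.map_sub, jjH_apply, inH_one,
      one_smul, smul_tmul', smul_eq_mul, mul_one, cns_inH_tmul]
    refine neg_mem (sub_mem (one_tmul_mem_degenA _) ?_)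
    rw [hE, LinearMap.map_add, smul_add, LinearMap.map_add]
    refine add_mem ?_ (cns_smul_upA_ι_one_mem S _ _ _)
    generalize TP.uncons k H v = x
    have : ∀ x : H ⊗[k] TensorAlgebra k H,
        cns S (inH S h • jj S ((inH S).rTensor _ x)) ∈ degenA k A H := by
      intro x
      induction x with
      | zero => simp
      | tmul l w =>
        rw [rTensor_tmul, jj_inH_tmul, smul_tmul', smul_eq_mul, mul_one, cns_inH_tmul]
        exact one_tmul_mem_degenA _
      | add x y hx hy => rw [LinearMap.map_add, LinearMap.map_add, smul_add, LinearMap.map_add]; exact add_mem hx hy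
    exact this _
  · rw [hQ]
    refine ⟨?_, fun g => ?_⟩
    · rw [merge_ι_mul, cnsH_apply, mergeE_ι_mul, inH_one, one_smul, LinearMap.map_sub, cns_inH_tmul]
      exact neg_mem (sub_mem (one_tmul_mem_degenA _) (ι_one_cns_mem S _ _))
    · rw [hU, inH_one, smul_tmul', smul_eq_mul, mul_one, cns_inH_tmul]
      exact one_tmul_mem_degenA _
  · rw [hQ] at hxQ ⊢
    refine ⟨?_, hUT h x fun l => TP.mul_mem_degen _ hx⟩
    rw [merge_ι_mul, cnsH_apply, hE, smul_add, LinearMap.map_add]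
    exact neg_mem (add_mem (hxQ.2 h) (cns_inH_smul_upA_mem S h hxQ.1))

/-- The degenerate part of `T(A) ⊗ T(H)`. -/
abbrev degenT : Submodule k (TT S) := tensorSpan (LinearMap.ker (TP.barTA k A).toLinearMap) (TP.degen k H)

theorem smul_mem_degenT (z : TensorAlgebra k A) {x : TT S} (hx : x ∈ degenT S) :
    z • x ∈ degenT S := by
  refine map_mem_of_mem_tensorSpan (lsm k _ (TT S) z) (fun m hm n => ?_) (fun m n hn => ?_) hx
  · refine tmul_mem_tensorSpan_left (p := LinearMap.ker (TP.barTA k A).toLinearMap) ?_ n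
    rw [LinearMap.mem_ker] at hm ⊢
    rw [toLinearMap_apply] at hm
    rw [smul_eq_mul, toLinearMap_apply, map_mul, hm, mul_zero]
  · exact tmul_mem_tensorSpan_right _ hn

theorem ι_one_mem_ker : ι k (1 : A) ∈ LinearMap.ker (TP.barTA k A).toLinearMap := by
  simp

theorem mul_mem_ker_left {z : TensorAlgebra k A}
    (hz : z ∈ LinearMap.ker (TP.barTA k A).toLinearMap) (z' : TensorAlgebra k A) :
    z * z' ∈ LinearMap.ker (TP.barTA k A).toLinearMap := by
  rw [LinearMap.mem_ker] at hz ⊢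
  rw [toLinearMap_apply, map_mul, ← toLinearMap_apply, hz, zero_mul]

theorem smul_mem_degenT' {z : TensorAlgebra k A}
    (hz : z ∈ LinearMap.ker (TP.barTA k A).toLinearMap) (x : TT S) : z • x ∈ degenT S := by
  induction x using TensorProduct.induction_on with
  | zero => simp
  | tmul z' w => exact tmul_mem_tensorSpan_left (mul_mem_ker_left hz z') w
  | add x y hx hy => rw [smul_add]; exact add_mem hx hy

theorem opT_mem {x : TT S} (hx : x ∈ degenT S) : opT S x ∈ degenT S := by
  refine map_mem_of_mem_tensorSpan (opT S) (fun m hm n => ?_) (fun m n hn => ?_) hx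
  · exact smul_mem_degenT' S hm _
  · rw [opT_tmul]
    refine smul_mem_degenT S m (map_mem_of_mem_tensorSpan (T := degenT S)
      ((ι k).rTensor _) (fun a ha n => ?_)
      (fun a n hn => ?_) (merge_mem_degenA S hn))
    · obtain ⟨c, rfl⟩ := Submodule.mem_span_singleton.1 ha
      refine tmul_mem_tensorSpan_left (p := LinearMap.ker (TP.barTA k A).toLinearMap) ?_ n
      rw [LinearMap.map_smul]
      exact Submodule.smul_mem _ c ι_one_mem_ker
    · exact tmul_mem_tensorSpan_right _ hn

theorem opA_mem (a : A) {x : TT S} (hx : x ∈ degenT S) : opA S a x ∈ degenT S := by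
  refine map_mem_of_mem_tensorSpan (opA S a) (fun m hm n => ?_) (fun m n hn => ?_) hx
  · rw [opA_tmul]; exact neg_mem (smul_mem_degenT' S hm _)
  · rw [opA_tmul]
    refine neg_mem (smul_mem_degenT S m (map_mem_of_mem_tensorSpan (T := degenT S)
      ((ι k).rTensor _) (fun a ha n => ?_)
      (fun a n hn => ?_) (pushT_mem_degen S a (TP.sgn_mem_degen hn))))
    · rw [(Submodule.mem_bot k).1 ha]; simp
    · exact tmul_mem_tensorSpan_right _ hn

theorem opS_mem {x : TT S} (hx : x ∈ degenT S) : opS S x ∈ degenT S := by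
  obtain ⟨N, hN⟩ := exists_opS S x
  rw [hN N le_rfl]
  refine sum_mem fun i hi => ?_
  clear hi
  induction i with
  | zero => exact hx
  | succ i ih => rw [pow_succ', Module.End.mul_apply]; exact opT_mem S ih

theorem opG_mem (y : TensorAlgebra k A) {x : TT S} (hx : x ∈ degenT S) : opG S y x ∈ degenT S := by
  induction y using TP.ta_induction generalizing x with
  | one => rw [opG_one]; exact opS_mem S hx
  | cons a y ih => rw [opG_ι_mul]; exact ih (opA_mem S a (opS_mem S hx))
  | smul c y ih => rw [LinearMap.map_smul]; exact Submodule.smul_mem _ c (ih hx)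
  | add y y' ih ih' => rw [LinearMap.map_add]; exact add_mem (ih hx) (ih' hx)

theorem pushT_one_right (w : TensorAlgebra k H) : pushT S w 1 = 1 ⊗ₜ w := by
  refine LinearMap.congr_fun (f := (pushT S).flip 1) (g := TensorProduct.mk k _ _ 1)
    (TP.ta_hom_ext' (by simp) fun h w hw => ?_) w
  simp only [flip_apply, mk_apply] at hw ⊢
  rw [pushT_ι_mul, hw, cnsH_apply, rTensor_tmul, inA_one, smul_tmul', smul_eq_mul,
    mul_one, cns_inH_tmul]

theorem opA_one_mem (x : TT S) : opA S 1 x ∈ degenT S := by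
  induction x using TensorProduct.induction_on with
  | zero => simp
  | tmul z w =>
    rw [opA_tmul, pushT_one_right]
    refine neg_mem (smul_mem_degenT S z ?_)
    exact tmul_mem_tensorSpan_left ι_one_mem_ker _
  | add x y hx hy => rw [LinearMap.map_add]; exact add_mem hx hy

theorem opG_degen (p q : TensorAlgebra k A) (x : TT S) :
    opG S (p * (ι k 1 * q)) x ∈ degenT S := by
  induction p using TP.ta_induction generalizing x with
  | one => rw [one_mul, opG_ι_mul]; exact opG_mem S _ (opA_one_mem S _)
  | cons a y ih => rw [mul_assoc, opG_ι_mul]; exact ih _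
  | smul c y ih => rw [smul_mul_assoc, LinearMap.map_smul]; exact Submodule.smul_mem _ c (ih x)
  | add y y' ih ih' => rw [add_mul, LinearMap.map_add]; exact add_mem (ih x) (ih' x)

/-- `gen1`, with values in `T(A / k) ⊗ H`. -/
def genBar : TensorAlgebra k H →ₗ[k] TensorAlgebra k A →ₗ[k] TensorAlgebra k (TP.Bar k A) ⊗[k] H :=
  LinearMap.compr₂ (gen1 S) ((TP.barTA k A).toLinearMap.rTensor H)

theorem genBar_apply (w : TensorAlgebra k H) (y : TensorAlgebra k A) :
    genBar S w y = (TP.barTA k A).toLinearMap.rTensor H (gen1 S w y) := rfl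

theorem genBar_eq_zero {w : TensorAlgebra k H} {y : TensorAlgebra k A}
    (h : opG S y (1 ⊗ₜ w) ∈ degenT S) : genBar S w y = 0 := by
  rw [genBar_apply, gen_apply]
  have := map_mem_of_mem_tensorSpan (T := ⊥) ((TP.barTA k A).toLinearMap.rTensor H ∘ₗ
    (TP.deg1 k H).lTensor _) (fun m hm n => ?_) (fun m n hn => ?_) h
  · exact this
  · rw [comp_apply, lTensor_tmul, rTensor_tmul,
      LinearMap.mem_ker.1 hm, zero_tmul]; simp
  · rw [comp_apply, lTensor_tmul, TP.deg1_degen hn, tmul_zero, LinearMap.map_zero]; simp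

theorem genBar_degen_left {w : TensorAlgebra k H} (hw : w ∈ TP.degen k H) (y : TensorAlgebra k A) :
    genBar S w y = 0 :=
  genBar_eq_zero S (opG_mem S y (tmul_mem_tensorSpan_right 1 hw))

theorem genBar_degen_right (w : TensorAlgebra k H) (p q : TensorAlgebra k A) :
    genBar S w (p * (ι k 1 * q)) = 0 :=
  genBar_eq_zero S (opG_degen S p q _)

theorem gen1_ι_one_left (y : TensorAlgebra k A) : gen1 S (ι k 1) y = y ⊗ₜ 1 := by
  refine LinearMap.congr_fun (f := gen1 S (ι k 1)) (g := (TensorProduct.mk k _ _).flip 1)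
    (TP.ta_hom_ext' ?_ fun a y hy => ?_) y
  · rw [gen1_ι_one]; rfl
  · rw [gen1_ι_ι_mul, push_one_left, feed_tmul, comp_apply, flip_apply, hy]
    simp [smul_tmul']

end CrossedSystem

namespace TP

section
variable {k V : Type*} [CommRing k] [AddCommGroup V] [Module k V]

theorem decon_mul (a b : TensorAlgebra k V) : decon k V (a * b) =
    (mulRight k b).lTensor _ (decon k V a) +
      (mulLeft k a).rTensor _ (decon k V b) - a ⊗ₜ b := by
  induction a using ta_induction with
  | one =>
    have : mulLeft k (1 : TensorAlgebra k V) = LinearMap.id := by ext; simp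
    rw [this]; simp
  | cons v a ih =>
    rw [mul_assoc, decon_ι_mul, ih, decon_ι_mul, map_sub, map_add, map_add]
    have h1 : ∀ x, (mulLeft k (ι k v)).rTensor _
        ((mulRight k b).lTensor (TensorAlgebra k V) x) = (mulRight k b).lTensor _
        ((mulLeft k (ι k v)).rTensor (TensorAlgebra k V) x) := fun x => by
      rw [← comp_apply, ← comp_apply, LinearMap.rTensor_comp_lTensor,
        LinearMap.lTensor_comp_rTensor]
    rw [h1, ← LinearMap.rTensor_comp_apply, ← LinearMap.mulLeft_mul]
    simp only [lTensor_tmul, rTensor_tmul, LinearMap.mulRight_apply,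
      LinearMap.mulLeft_apply, mul_assoc]
    abel
  | smul c a ih =>
    have : mulLeft k (c • a) = c • mulLeft k a := by ext; simp
    rw [smul_mul_assoc, map_smul, ih, map_smul, map_smul, this, LinearMap.rTensor_smul,
      LinearMap.smul_apply, ← smul_tmul']
    module
  | add a a' h h' =>
    have : mulLeft k (a + a') = mulLeft k a + mulLeft k a' := by
      ext; simp [add_mul]
    rw [add_mul, map_add, h, h', map_add, map_add, this, LinearMap.rTensor_add,
      LinearMap.add_apply, add_tmul]
    abel

theorem decon_coassoc (w : TensorAlgebra k V) :
    assoc k _ _ _ ((decon k V).rTensor _ (decon k V w)) =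
      (decon k V).lTensor _ (decon k V w) := by
  refine LinearMap.congr_fun (f := (assoc k _ _ _).toLinearMap ∘ₗ
    (decon k V).rTensor _ ∘ₗ decon k V) (g := (decon k V).lTensor _ ∘ₗ decon k V)
    (ta_hom_ext' (by simp) fun v w ih => ?_) w
  simp only [comp_apply, coe_coe] at ih ⊢
  have h1 : ∀ x : TensorAlgebra k V ⊗[k] TensorAlgebra k V,
      assoc k _ _ _ ((decon k V).rTensor _
        ((mulLeft k (ι k v)).rTensor _ x)) =
      (mulLeft k (ι k v)).rTensor _
        (assoc k _ _ _ ((decon k V).rTensor _ x)) +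
      1 ⊗ₜ (mulLeft k (ι k v)).rTensor _ x := by
    intro x
    induction x with
    | zero => simp
    | tmul a b =>
      simp only [rTensor_tmul, LinearMap.mulLeft_apply, decon_ι_mul, add_tmul, map_add,
        assoc_tmul]
      rw [add_comm]
      congr 1
      generalize decon k V a = y
      induction y with
      | zero => simp
      | tmul c d => simp
      | add x y hx hy => simp only [map_add, add_tmul, hx, hy]
    | add x y hx hy => simp only [map_add, hx, hy, tmul_add]; abel
  have h2 : ∀ x, (decon k V).lTensor _
      ((mulLeft k (ι k v)).rTensor (TensorAlgebra k V) x) =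
      (mulLeft k (ι k v)).rTensor _ ((decon k V).lTensor _ x) := fun x => by
    rw [← comp_apply, ← comp_apply, LinearMap.rTensor_comp_lTensor,
      LinearMap.lTensor_comp_rTensor]
  rw [decon_ι_mul, map_add, map_add, map_add, h1, ih, h2]
  simp only [rTensor_tmul, lTensor_tmul, decon_one, assoc_tmul,
    decon_ι_mul, tmul_add]
  abel

theorem comp_zero (w : TensorAlgebra k V) : comp k V 0 w = aug k V w • nil k V := by
  refine LinearMap.congr_fun (f := comp k V 0) (g := LinearMap.toSpanSingleton k _ (nil k V) ∘ₗ
    (aug k V).toLinearMap) (ta_hom_ext' ?_ fun v w h => ?_) w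
  · rw [← toTA_nil, comp_toTA_same, toTA_nil]; simp
  · clear h
    induction w using ta_toTA_induction with
    | of n w => rw [← toTA_cons, comp_toTA_of_ne (by omega), toTA_cons]; simp
    | add x y hx hy => rw [mul_add, map_add, map_add, hx, hy]

theorem comp_succ (n : ℕ) (w : TensorAlgebra k V) :
    comp k V (n + 1) w = cons k n ((comp k V n).lTensor V (uncons k V w)) := by
  refine LinearMap.congr_fun (f := comp k V (n + 1)) (g := (cons k n).toLinearMap ∘ₗ
    (comp k V n).lTensor V ∘ₗ uncons k V) (ta_hom_ext' ?_ fun v w h => ?_) w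
  · rw [← toTA_nil, comp_toTA_of_ne (by omega), toTA_nil]; simp
  · clear h
    induction w using ta_toTA_induction with
    | of m w =>
      rw [← toTA_cons]
      by_cases h : m = n
      · subst h
        rw [comp_toTA_same, toTA_cons]
        simp [comp_toTA_same]
      · rw [comp_toTA_of_ne (by omega), toTA_cons]
        simp [comp_toTA_of_ne h]
    | add x y hx hy => rw [mul_add, map_add, map_add, hx, hy]

theorem comp_decon (n : ℕ) (w : TensorAlgebra k V) :
    (comp k V n).rTensor _ (decon k V w) = split k V n w := by
  induction n generalizing w with
  | zero =>
    refine LinearMap.congr_fun (f := (comp k V 0).rTensor _ ∘ₗ decon k V)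
      (g := split k V 0) (ta_hom_ext' ?_ fun v w _ => ?_) w
    · simp [comp_zero, split]
    · simp only [comp_apply, decon_ι_mul, map_add, rTensor_tmul, comp_zero,
        map_one, one_smul, split, mk_apply]
      rw [add_eq_left]
      generalize decon k V w = x
      induction x with
      | zero => simp
      | tmul a b => simp [comp_zero]
      | add x y hx hy => simp only [map_add, hx, hy, add_zero]
  | succ n ih =>
    have h1 : comp k V (n + 1) = (cons k n).toLinearMap ∘ₗ (comp k V n).lTensor V ∘ₗ uncons k V :=
      LinearMap.ext (comp_succ n)
    rw [h1, LinearMap.rTensor_comp_apply, LinearMap.rTensor_comp_apply, uncons_decon]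
    simp only [split, comp_apply]
    generalize uncons k V w = x
    induction x with
    | zero => simp
    | tmul v w =>
      simp only [lTensor_tmul, ← ih]
      generalize decon k V w = x
      induction x with
      | zero => simp
      | tmul a b => simp
      | add x y hx hy => simp only [map_add, hx, hy, tmul_add]
    | add x y hx hy => simp only [map_add, hx, hy]

/-- The iterates of the sign automorphism. -/
def sgp (k V : Type*) [CommRing k] [AddCommGroup V] [Module k V] (N : ℕ) :
    TensorAlgebra k V →ₗ[k] TensorAlgebra k V := (sgn k V).toLinearMap ^ N

theorem sgp_succ (N : ℕ) (w : TensorAlgebra k V) : sgp k V (N + 1) w = sgn k V (sgp k V N w) := by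
  rw [sgp, pow_succ', Module.End.mul_apply]; rfl

theorem sgp_zero (w : TensorAlgebra k V) : sgp k V 0 w = w := rfl

theorem sgp_one (N : ℕ) : sgp k V N 1 = 1 := by
  induction N with
  | zero => rfl
  | succ N ih => rw [sgp_succ, ih, map_one]

theorem sgp_ι (N : ℕ) (v : V) :
    sgp k V N (ι k v) = (-1 : k) ^ N • ι k v := by
  induction N with
  | zero => rw [sgp_zero, pow_zero, one_smul]
  | succ N ih => rw [sgp_succ, ih, map_smul, sgn_ι, pow_succ, mul_smul, neg_one_smul]

theorem sgp_toTA (N n : ℕ) (w : ⨂[k]^n V) :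
    sgp k V N (toTA k n w) = (-1 : k) ^ (n * N) • toTA k n w := by
  induction N with
  | zero => rw [sgp_zero, mul_zero, pow_zero, one_smul]
  | succ N ih => rw [sgp_succ, ih, map_smul, sgn_toTA, smul_smul, ← pow_add, mul_add, mul_one]

theorem decon_sgp (N : ℕ) (w : TensorAlgebra k V) :
    decon k V (sgp k V N w) = TensorProduct.map (sgp k V N) (sgp k V N) (decon k V w) := by
  induction N with
  | zero =>
    have : sgp k V 0 = LinearMap.id := rfl
    rw [this, TensorProduct.map_id]; rfl
  | succ N ih =>
    have : sgp k V (N + 1) = (sgn k V).toLinearMap ∘ₗ sgp k V N := LinearMap.ext (sgp_succ N)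
    rw [sgp_succ, decon_sgn, ih, this, TensorProduct.map_comp, comp_apply]

end

theorem comp_barTA (k B : Type*) [CommRing k] [Ring B] [Algebra k B] (n : ℕ)
    (w : TensorAlgebra k B) : comp k _ n (barTA k B w) = barPow k B n (comp k B n w) := by
  refine LinearMap.congr_fun (f := comp k _ n ∘ₗ (barTA k B).toLinearMap)
    (g := barPow k B n ∘ₗ comp k B n) (ta_hom_ext fun m w => ?_) w
  simp only [comp_apply, toLinearMap_apply, barTA_toTA]
  by_cases h : m = n
  · subst h; rw [comp_toTA_same, comp_toTA_same]
  · rw [comp_toTA_of_ne h, comp_toTA_of_ne h, map_zero]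

end TP

namespace CrossedSystem

open CrossedProduct BimodStr

variable {k A H : Type*} [CommRing k] [Ring A] [Algebra k A] [Ring H] [Bialgebra k H]
  (S : CrossedSystem k A H)

/-! ### The higher differentials, on `E ⊗ T(H) ⊗ T(A) ⊗ E` -/

/-- `E ⊗ T(H) ⊗ T(A) ⊗ E`. -/
abbrev U (S : CrossedSystem k A H) : Type _ :=
  Env k (CrossedProduct S) (TensorAlgebra k H ⊗[k] TensorAlgebra k A)

/-- `E ⊗ T(H / k) ⊗ T(A / k) ⊗ E`. -/
abbrev Ubar (S : CrossedSystem k A H) : Type _ :=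
  Env k (CrossedProduct S) (TensorAlgebra k (TP.Bar k H) ⊗[k] TensorAlgebra k (TP.Bar k A))

/-- `E ⊗ T(H) ⊗ T(A) ⊗ H`. -/
abbrev UH (S : CrossedSystem k A H) : Type _ :=
  CrossedProduct S ⊗[k] ((TensorAlgebra k H ⊗[k] TensorAlgebra k A) ⊗[k] H)

/-- The bimodule map `E ⊗ V ⊗ E → E ⊗ V' ⊗ E` induced by a linear map. -/
abbrev envMap {B V V' : Type*} [Ring B] [Algebra k B] [AddCommGroup V] [Module k V]
    [AddCommGroup V'] [Module k V'] (φ : V →ₗ[k] V') : Env k B V →ₗ[k] Env k B V' :=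
  (φ.rTensor B).lTensor B

/-- The inclusion `E ⊗ T(H) ⊗ T(A) ⊗ H → E ⊗ T(H) ⊗ T(A) ⊗ E`. -/
def rH : UH S →ₗ[k] U S := ((inH S).lTensor _).lTensor _

theorem rH_tmul (e : CrossedProduct S) (g : TensorAlgebra k H ⊗[k] TensorAlgebra k A) (h : H) :
    rH S (e ⊗ₜ (g ⊗ₜ h)) = e ⊗ₜ (g ⊗ₜ inH S h) := rfl

/-- The projection to the quotient. -/
def barU : U S →ₗ[k] Ubar S :=
  envMap (TensorProduct.map (TP.barTA k H).toLinearMap (TP.barTA k A).toLinearMap)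

/-- `w ⊗ y ↦ ± mergeE w ⊗ y ⊗ 1`. -/
def dMerge : TensorAlgebra k H ⊗[k] TensorAlgebra k A →ₗ[k] UH S :=
  ((TensorProduct.mk k _ H).flip 1).lTensor _ ∘ₗ (assoc k _ _ _).toLinearMap ∘ₗ
    TensorProduct.map (mergeE S) (TP.sgn k A).toLinearMap

/-- `u ⊗ (z ⊗ g) ↦ 1 ⊗ (u ⊗ z) ⊗ g`. -/
def putUH : TensorAlgebra k H ⊗[k] (TensorAlgebra k A ⊗[k] H) →ₗ[k] UH S :=
  TensorProduct.mk k _ _ 1 ∘ₗ (assoc k _ _ _).symm.toLinearMap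

/-- `u ⊗ v ↦ u ⊗ gen1(v; y)`. -/
def tailAux (N : ℕ) (y : TensorAlgebra k A) : TensorAlgebra k H ⊗[k] TensorAlgebra k H →ₗ[k]
    TensorAlgebra k H ⊗[k] (TensorAlgebra k A ⊗[k] H) :=
  ((gen1 S).flip y ∘ₗ TP.sgp k H N).lTensor _

/-- `w ⊗ y ↦ 1 ⊗ u ⊗ gen1(v; y)`, where `u ⊗ v` is the deconcatenation of `w`. -/
def dTail (N : ℕ) : TensorAlgebra k H ⊗[k] TensorAlgebra k A →ₗ[k] UH S :=
  putUH S ∘ₗ (TensorProduct.lift (gen1 S ∘ₗ TP.sgp k H N)).lTensor _ ∘ₗ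
    (assoc k _ _ _).toLinearMap ∘ₗ (TP.decon k H).rTensor _

theorem dTail_tmul (N : ℕ) (w : TensorAlgebra k H) (y : TensorAlgebra k A) :
    dTail S N (w ⊗ₜ y) = putUH S (tailAux S N y (TP.decon k H w)) := by
  simp only [dTail, comp_apply, rTensor_tmul, coe_coe, tailAux]
  congr 1
  generalize TP.decon k H w = x
  induction x with
  | zero => simp
  | tmul u v => simp
  | add x y hx hy => simp only [map_add, add_tmul, hx, hy]

/-- The sum of the components `d^l`, `l ≥ 1`, of the differential; `N` is the total degree. -/
def dPlus (N : ℕ) : TensorAlgebra k H ⊗[k] TensorAlgebra k A →ₗ[k] UH S := dMerge S + dTail S N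

/-- The bimodule map that extends `dPlus`. -/
def dPlusX (N : ℕ) : U S →ₗ[k] U S := (envStr k _ _).ext (rH S ∘ₗ dPlus S N)

/-- `e ⊗ u ⊗ z ⊗ (b # h) ↦ ± e ⊗ u ⊗ z b ⊗ (1 # h)`. -/
def sigU : Ubar S →ₗ[k] Ubar S :=
  (TensorProduct.map
      ((LinearMap.mul' k _ ∘ₗ TensorProduct.map (-(TP.sgn k _).toLinearMap)
        (ι k ∘ₗ TP.barMk k A)).lTensor _ ∘ₗ
        (assoc k _ _ A).toLinearMap)
      (inH S) ∘ₗ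
      (assoc k _ A H).symm.toLinearMap ∘ₗ
      (equiv S).symm.toLinearMap.lTensor _).lTensor _

theorem sigU_tmul (e : CrossedProduct S) (u : TensorAlgebra k (TP.Bar k H))
    (z : TensorAlgebra k (TP.Bar k A)) (b : A) (h : H) :
    sigU S (e ⊗ₜ ((u ⊗ₜ z) ⊗ₜ (inA S b * inH S h))) =
      -(e ⊗ₜ ((u ⊗ₜ (TP.sgn k _ z * ι k (TP.barMk k A b))) ⊗ₜ inH S h)) := by
  rw [← equiv_tmul]
  refine Eq.trans ?_ ((TensorProduct.mk k (CrossedProduct S) _ e ∘ₗ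
    (TensorProduct.mk k _ (CrossedProduct S)).flip (inH S h) ∘ₗ
    TensorProduct.mk k _ (TensorAlgebra k (TP.Bar k A)) u).map_neg _)
  rw [← neg_mul]
  rfl

/-! ### The recursion for the higher differentials -/

theorem fourfold_ext {P₁ P₂ P₃ P₄ Q : Type*} [AddCommGroup P₁] [Module k P₁] [AddCommGroup P₂]
    [Module k P₂] [AddCommGroup P₃] [Module k P₃] [AddCommGroup P₄] [Module k P₄] [AddCommGroup Q]
    [Module k Q] {f g : P₁ ⊗[k] ((P₂ ⊗[k] P₃) ⊗[k] P₄) →ₗ[k] Q}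
    (h : ∀ a b c d, f (a ⊗ₜ ((b ⊗ₜ c) ⊗ₜ d)) = g (a ⊗ₜ ((b ⊗ₜ c) ⊗ₜ d))) : f = g :=
  ext' fun a x => LinearMap.congr_fun (f := f ∘ₗ TensorProduct.mk k _ _ a)
    (g := g ∘ₗ TensorProduct.mk k _ _ a) (TensorProduct.ext_threefold fun b c d => h a b c d) x

/-- `u ⊗ (z ⊗ g) ↦ 1 ⊗ (u ⊗ z) ⊗ (1 # g)`, in the quotient. -/
def putH : TensorAlgebra k H ⊗[k] (TensorAlgebra k A ⊗[k] H) →ₗ[k] Ubar S :=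
  barU S ∘ₗ rH S ∘ₗ putUH S

theorem barU_tmul (e e' : CrossedProduct S) (u : TensorAlgebra k H) (z : TensorAlgebra k A) :
    barU S (e ⊗ₜ ((u ⊗ₜ z) ⊗ₜ e')) = e ⊗ₜ ((TP.barTA k H u ⊗ₜ TP.barTA k A z) ⊗ₜ e') := rfl

theorem putUH_tmul (u : TensorAlgebra k H) (z : TensorAlgebra k A) (g : H) :
    putUH S (u ⊗ₜ (z ⊗ₜ g)) = 1 ⊗ₜ ((u ⊗ₜ z) ⊗ₜ g) := rfl

theorem sigU_inA (e : CrossedProduct S) (u : TensorAlgebra k (TP.Bar k H))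
    (z : TensorAlgebra k (TP.Bar k A)) (b : A) :
    sigU S (e ⊗ₜ ((u ⊗ₜ z) ⊗ₜ inA S b)) =
      -(e ⊗ₜ ((u ⊗ₜ (TP.sgn k _ z * ι k (TP.barMk k A b))) ⊗ₜ 1)) := by
  have := sigU_tmul S e u z b 1
  rwa [inH_one, mul_one] at this

theorem sigU_inH (e : CrossedProduct S) (u : TensorAlgebra k (TP.Bar k H))
    (z : TensorAlgebra k (TP.Bar k A)) (h : H) : sigU S (e ⊗ₜ ((u ⊗ₜ z) ⊗ₜ inH S h)) = 0 := by
  have h1 := sigU_tmul S e u z 1 h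
  rw [inA_one, one_mul, TP.barMk_one, LinearMap.map_zero, mul_zero, tmul_zero, zero_tmul, tmul_zero,
    neg_zero] at h1
  exact h1

theorem sigU_barU_rH (x : UH S) : sigU S (barU S (rH S x)) = 0 := by
  refine LinearMap.congr_fun (f := sigU S ∘ₗ barU S ∘ₗ rH S) (g := 0)
    (fourfold_ext fun e u z g => ?_) x
  simp only [comp_apply, rH_tmul, barU_tmul]
  exact sigU_inH S _ _ _ _

theorem sigU_barU_equiv (u : TensorAlgebra k H) (z : TensorAlgebra k A) (x : A ⊗[k] H) :
    sigU S (barU S (1 ⊗ₜ ((u ⊗ₜ z) ⊗ₜ equiv S x))) =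
      -putH S (u ⊗ₜ (TP.sgn k A z • (ι k).rTensor H x)) := by
  induction x with
  | zero =>
    rw [(equiv S).map_zero, LinearMap.map_zero, smul_zero, tmul_zero, tmul_zero, tmul_zero, LinearMap.map_zero, LinearMap.map_zero, LinearMap.map_zero,
      neg_zero]
  | tmul b h =>
    rw [equiv_tmul, barU_tmul, sigU_tmul, rTensor_tmul, smul_tmul', smul_eq_mul, putH]
    simp only [comp_apply, putUH_tmul, rH_tmul, barU_tmul]
    rw [map_mul (TP.barTA k A), TP.barTA_ι, TP.barTA_sgn]
  | add x y hx hy =>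
    rw [(equiv S).map_add, LinearMap.map_add, smul_add, tmul_add, tmul_add, tmul_add, LinearMap.map_add, LinearMap.map_add, LinearMap.map_add, hx, hy]
    abel

theorem sigU_envRight_inA (a : A) (u : TensorAlgebra k H) (t : TensorAlgebra k A ⊗[k] H) :
    sigU S (barU S (envRight (inA S a) (rH S (putUH S (u ⊗ₜ t))))) =
      -putH S (u ⊗ₜ pushH S a ((TP.sgn k A).toLinearMap.rTensor H t)) := by
  induction t with
  | zero => simp only [LinearMap.map_zero, LinearEquiv.map_zero, tmul_zero, neg_zero]
  | tmul z g =>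
    rw [putUH_tmul, rH_tmul, ← envStr_r, envStr_r_tmul, inH_mul_inA, sigU_barU_equiv]
    rfl
  | add x y hx hy =>
    simp only [tmul_add, LinearMap.map_add, LinearEquiv.map_add, hx, hy]
    abel

theorem sigU_envRight_inH (h : H) (u : TensorAlgebra k H) (t : TensorAlgebra k A ⊗[k] H) :
    sigU S (barU S (envRight (inH S h) (rH S (putUH S (u ⊗ₜ t))))) =
      -putH S (u ⊗ₜ twistH S (assoc k _ _ _
        ((TP.sgn k A).toLinearMap.rTensor H t ⊗ₜ h))) := by
  induction t with
  | zero => simp only [LinearMap.map_zero, LinearEquiv.map_zero, tmul_zero, zero_tmul, neg_zero]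
  | tmul z g =>
    rw [putUH_tmul, rH_tmul, ← envStr_r, envStr_r_tmul, inH_mul_inH, sigU_barU_equiv]
    rfl
  | add x y hx hy =>
    simp only [tmul_add, LinearMap.map_add, LinearEquiv.map_add, add_tmul, hx, hy]
    abel

/-- `x ⊗ z ↦ x ⊗ z ⊗ 1` for `x ∈ E ⊗ T(H)`. -/
def putE : (CrossedProduct S ⊗[k] TensorAlgebra k H) ⊗[k] TensorAlgebra k A →ₗ[k] UH S :=
  ((TensorProduct.mk k _ H).flip 1).lTensor _ ∘ₗ (assoc k _ _ _).toLinearMap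

theorem dMerge_eq (w : TensorAlgebra k H) (y : TensorAlgebra k A) :
    dMerge S (w ⊗ₜ y) = putE S (mergeE S w ⊗ₜ TP.sgn k A y) := rfl

theorem sigU_putE_inA (a : A) (x : CrossedProduct S ⊗[k] TensorAlgebra k H)
    (z : TensorAlgebra k A) : sigU S (barU S (envRight (inA S a) (rH S (putE S (x ⊗ₜ z))))) =
      -barU S (rH S (putE S (x ⊗ₜ (TP.sgn k A z * ι k a)))) := by
  induction x using TensorProduct.induction_on with
  | zero => simp only [LinearMap.map_zero, LinearEquiv.map_zero, zero_tmul, neg_zero]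
  | tmul e u =>
    change sigU S (barU S (e ⊗ₜ ((u ⊗ₜ z) ⊗ₜ (inH S 1 * inA S a)))) =
      -barU S (e ⊗ₜ ((u ⊗ₜ (TP.sgn k A z * ι k a)) ⊗ₜ inH S 1))
    rw [inH_one, one_mul, barU_tmul, barU_tmul, sigU_inA, map_mul (TP.barTA k A), TP.barTA_ι,
      TP.barTA_sgn]
  | add x y hx hy =>
    simp only [add_tmul, LinearMap.map_add, LinearEquiv.map_add, hx, hy]
    abel

theorem sigU_putE_inH (h : H) (x : (CrossedProduct S ⊗[k] TensorAlgebra k H) ⊗[k]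
    TensorAlgebra k A) : sigU S (barU S (envRight (inH S h) (rH S (putE S x)))) = 0 := by
  refine LinearMap.congr_fun (f := sigU S ∘ₗ barU S ∘ₗ envRight (inH S h) ∘ₗ rH S ∘ₗ putE S) (g := 0)
    (TensorProduct.ext_threefold fun e u z => ?_) x
  change sigU S (barU S (e ⊗ₜ ((u ⊗ₜ z) ⊗ₜ (inH S 1 * inH S h)))) = 0
  rw [inH_one, one_mul, barU_tmul, sigU_inH]

theorem envLeft_rH (e : CrossedProduct S) (x : UH S) :
    ∃ y, envLeft e (rH S x) = rH S y := by
  refine ⟨(mulLeft k e).rTensor _ x, ?_⟩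
  refine LinearMap.congr_fun (f := envLeft e ∘ₗ rH S)
    (g := rH S ∘ₗ (mulLeft k e).rTensor _) (fourfold_ext fun a u z g => rfl) x

theorem dPlusX_tmul (N : ℕ) (e e' : CrossedProduct S)
    (v : TensorAlgebra k H ⊗[k] TensorAlgebra k A) :
    dPlusX S N (e ⊗ₜ (v ⊗ₜ e')) = envLeft e (envRight e' (rH S (dPlus S N v))) := rfl

theorem envRight_one {V : Type*} [AddCommGroup V] [Module k V] (x : Env k (CrossedProduct S) V) :
    envRight 1 x = x := (envStr k _ V).r_one x

theorem envLeft_one {V : Type*} [AddCommGroup V] [Module k V] (x : Env k (CrossedProduct S) V) :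
    envLeft 1 x = x := (envStr k _ V).l_one x

/-- The differential of `e ⊗ v ⊗ 1` is killed by the contraction. -/
theorem sigU_dPlusX_envL (N : ℕ) (x : CrossedProduct S ⊗[k]
    (TensorAlgebra k H ⊗[k] TensorAlgebra k A)) : sigU S (barU S (dPlusX S N (envL x))) = 0 := by
  refine LinearMap.congr_fun (f := sigU S ∘ₗ barU S ∘ₗ dPlusX S N ∘ₗ envL) (g := 0)
    (ext' fun e v => ?_) x
  change sigU S (barU S (dPlusX S N (e ⊗ₜ (v ⊗ₜ 1)))) = 0
  rw [dPlusX_tmul, envRight_one]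
  obtain ⟨y, hy⟩ := envLeft_rH S e (dPlus S N v)
  rw [hy, sigU_barU_rH]

theorem rH_putE (x : (CrossedProduct S ⊗[k] TensorAlgebra k H) ⊗[k] TensorAlgebra k A) :
    rH S (putE S x) = envL (assoc k _ _ _ x) := by
  refine LinearMap.congr_fun (f := rH S ∘ₗ putE S) (g := envL ∘ₗ
    (assoc k _ _ _).toLinearMap) (TensorProduct.ext_threefold fun e u z => ?_) x
  rfl

theorem dPlus_apply (N : ℕ) (v : TensorAlgebra k H ⊗[k] TensorAlgebra k A) :
    dPlus S N v = dMerge S v + dTail S N v := rfl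

/-- The bilinear form of the quadratic terms of the differential. -/
theorem sigU_dPlusX_putUH (N : ℕ) (u : TensorAlgebra k H) (t : TensorAlgebra k A ⊗[k] H) :
    sigU S (barU S (dPlusX S N (rH S (putUH S (u ⊗ₜ t))))) =
      putH S ((twistH S ∘ₗ (genH S).flip ((TP.sgn k A).toLinearMap.rTensor H t) ∘ₗ
        TP.sgp k H (N + 1)).lTensor _ (TP.decon k H u)) := by
  induction t with
  | zero =>
    simp only [LinearMap.map_zero, LinearEquiv.map_zero, tmul_zero, LinearMap.comp_zero, LinearMap.zero_comp,
      LinearMap.lTensor_zero, LinearMap.zero_apply]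
  | tmul z h =>
    rw [putUH_tmul, rH_tmul, dPlusX_tmul, envLeft_one, dPlus_apply, dMerge_eq, dTail_tmul, LinearMap.map_add,
      LinearMap.map_add, LinearMap.map_add, LinearMap.map_add, sigU_putE_inH, zero_add]
    generalize TP.decon k H u = x
    induction x with
    | zero => simp only [LinearMap.map_zero, LinearEquiv.map_zero]
    | tmul u v =>
      rw [tailAux, lTensor_tmul, sigU_envRight_inH, lTensor_tmul]
      simp only [comp_apply, flip_apply, rTensor_tmul,
        toLinearMap_apply, genH_tmul, sgn_gen1, TP.sgp_succ]
      rw [neg_tmul, map_neg (assoc k (TensorAlgebra k A) H H), map_neg (twistH S),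
        tmul_neg, map_neg (putH S), neg_neg]
    | add x y hx hy => simp only [LinearMap.map_add, LinearEquiv.map_add, hx, hy]
  | add x y hx hy =>
    simp only [tmul_add, LinearMap.map_add, LinearEquiv.map_add, hx, hy, LinearMap.comp_add, LinearMap.add_comp,
      LinearMap.lTensor_add, LinearMap.add_apply]

theorem sigU_dPlusX_dPlus (N : ℕ) (w : TensorAlgebra k H) (y : TensorAlgebra k A) :
    sigU S (barU S (dPlusX S N (rH S (dPlus S (N + 1) (w ⊗ₜ y))))) =
      -putH S ((twistH S ∘ₗ (genK S).flip (TP.sgn k A y) ∘ₗ decs k H ∘ₗ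
        TP.sgp k H (N + 1)).lTensor _ (TP.decon k H w)) := by
  rw [dPlus_apply, LinearMap.map_add, LinearMap.map_add, LinearMap.map_add, LinearMap.map_add, dMerge_eq, rH_putE, sigU_dPlusX_envL,
    zero_add, dTail_tmul]
  have h1 : decs k H ∘ₗ TP.sgp k H (N + 1) = TensorProduct.map (TP.sgp k H (N + 1))
      (TP.sgp k H (N + 2)) ∘ₗ TP.decon k H := by
    refine LinearMap.ext fun x => ?_
    have h2 : TP.sgp k H (N + 2) = (TP.sgn k H).toLinearMap ∘ₗ TP.sgp k H (N + 1) :=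
      LinearMap.ext (TP.sgp_succ (N + 1))
    rw [comp_apply, decs, comp_apply, TP.decon_sgp, h2, comp_apply,
      LinearMap.lTensor, ← comp_apply, ← TensorProduct.map_comp, LinearMap.id_comp]
  rw [h1, ← LinearMap.comp_assoc, ← LinearMap.comp_assoc, LinearMap.lTensor_comp_apply,
    ← TP.decon_coassoc]
  generalize TP.decon k H w = x
  induction x with
  | zero => simp only [LinearMap.map_zero, LinearEquiv.map_zero, neg_zero]
  | tmul u v =>
    rw [tailAux, lTensor_tmul, sigU_dPlusX_putUH, rTensor_tmul]
    generalize TP.decon k H u = x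
    induction x with
    | zero => simp only [LinearMap.map_zero, LinearEquiv.map_zero, zero_tmul, neg_zero]
    | tmul a b =>
      simp only [lTensor_tmul, assoc_tmul, comp_apply,
        flip_apply, map_tmul, genK_tmul, sgn_gen1]
      rw [map_neg (genH S _), map_neg (twistH S), tmul_neg, map_neg (putH S), ← TP.sgp_succ]
    | add x y hx hy =>
      simp only [LinearMap.map_add, LinearEquiv.map_add, add_tmul, hx, hy]
      abel
  | add x y hx hy =>
    simp only [LinearMap.map_add, LinearEquiv.map_add, hx, hy]
    abel

theorem recursion_mul_ι (N : ℕ) (w : TensorAlgebra k H) (y : TensorAlgebra k A) (a : A) :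
    barU S (rH S (dPlus S (N + 1) (w ⊗ₜ (y * ι k a)))) +
      sigU S (barU S (dPlusX S N (rH S (dPlus S (N + 1) (w ⊗ₜ (y * ι k a)))))) =
    sigU S (barU S (dPlusX S N (1 ⊗ₜ ((w ⊗ₜ TP.sgn k A y) ⊗ₜ inA S a)))) := by
  have h1 : barU S (rH S (dMerge S (w ⊗ₜ (y * ι k a)))) =
      -barU S (rH S (putE S (mergeE S w ⊗ₜ (TP.sgn k A y * ι k a)))) := by
    rw [dMerge_eq, map_mul (TP.sgn k A), TP.sgn_ι, mul_neg, tmul_neg, map_neg (putE S),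
      map_neg (rH S), map_neg (barU S)]
  rw [sigU_dPlusX_dPlus, dPlus_apply, dPlusX_tmul, envLeft_one, dPlus_apply, dMerge_eq S w (TP.sgn k A y),
    dTail_tmul, dTail_tmul, LinearMap.map_add, LinearMap.map_add, LinearMap.map_add, LinearMap.map_add, LinearMap.map_add, LinearMap.map_add, h1, sigU_putE_inA,
    TP.sgn_sgn, add_assoc]
  congr 1
  generalize TP.decon k H w = x
  change putH S _ + _ = _
  induction x with
  | zero => simp only [LinearMap.map_zero, LinearEquiv.map_zero, neg_zero, add_zero]
  | tmul u v =>
    simp only [tailAux, lTensor_tmul, sigU_envRight_inA, comp_apply,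
      flip_apply, gen1_mul_ι, sgn_gen1, TP.sgn_sgn, ← TP.sgp_succ]
    rw [tmul_add, LinearMap.map_add, add_neg_cancel_right, map_neg (pushH S a), tmul_neg, map_neg (putH S),
      neg_neg]
  | add x y hx hy =>
    simp only [LinearMap.map_add, LinearEquiv.map_add] at hx hy ⊢
    rw [← hx, ← hy]
    abel

theorem recursion_one (N : ℕ) (w : TensorAlgebra k H) :
    barU S (rH S (dTail S (N + 1) (w ⊗ₜ 1))) +
      sigU S (barU S (dPlusX S N (rH S (dPlus S (N + 1) (w ⊗ₜ 1))))) =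
    putH S ((TensorProduct.mk k _ H 1 ∘ₗ TP.deg1 k H ∘ₗ TP.sgp k H (N + 1)).lTensor _
      (TP.decon k H w)) := by
  rw [sigU_dPlusX_dPlus, dTail_tmul]
  generalize TP.decon k H w = x
  change putH S _ + _ = _
  induction x with
  | zero => simp only [LinearMap.map_zero, LinearEquiv.map_zero, neg_zero, add_zero]
  | tmul u v =>
    simp only [tailAux, lTensor_tmul, comp_apply, flip_apply, gen1_one,
      map_one (TP.sgn k A), mk_apply]
    rw [tmul_add, LinearMap.map_add, add_neg_cancel_right]
  | add x y hx hy =>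
    simp only [LinearMap.map_add, LinearEquiv.map_add] at hx hy ⊢
    rw [← hx, ← hy]
    abel

end CrossedSystem

namespace TP

variable {k V : Type*} [CommRing k] [AddCommGroup V] [Module k V]

theorem split_toTA_of_lt {n m : ℕ} (h : m < n) (w : ⨂[k]^m V) : split k V n (toTA k m w) = 0 := by
  induction n generalizing m with
  | zero => omega
  | succ n ih =>
    rw [split, comp_apply, comp_apply, comp_apply]
    cases m with
    | zero =>
      obtain ⟨c, rfl⟩ := zero_eq_smul_nil w
      simp [toTA_nil]
    | succ m =>
      have : (split k V n).lTensor V ∘ₗ uncons k V ∘ₗ toTA k (m + 1) = 0 := by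
        refine hom_ext_succ fun v w => ?_
        rw [comp_apply, comp_apply, toTA_cons, uncons_ι_mul,
          lTensor_tmul, ih (by omega), tmul_zero]
        rfl
      have h2 := LinearMap.congr_fun this w
      rw [comp_apply, comp_apply] at h2
      rw [h2]
      simp

theorem mulEquiv_hom_ext {M : Type*} [AddCommGroup M] [Module k M] {n m : ℕ}
    {f g : ⨂[k]^(n + m) V →ₗ[k] M}
    (h : ∀ u v, f (TensorPower.mulEquiv (u ⊗ₜ v)) = g (TensorPower.mulEquiv (u ⊗ₜ v))) : f = g := by
  have : f ∘ₗ (TensorPower.mulEquiv (R := k) (M := V) (n := n) (m := m)).toLinearMap =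
      g ∘ₗ (TensorPower.mulEquiv (R := k) (M := V) (n := n) (m := m)).toLinearMap :=
    ext' h
  refine LinearMap.ext fun x => ?_
  obtain ⟨y, rfl⟩ := (TensorPower.mulEquiv (R := k) (M := V) (n := n) (m := m)).surjective x
  exact LinearMap.congr_fun this y

end TP

namespace CrossedSystem

open CrossedProduct BimodStr

variable {k A H : Type*} [CommRing k] [Ring A] [Algebra k A] [Ring H] [Bialgebra k H]
  (S : CrossedSystem k A H)

/-! ### The components of the differential -/

/-- The inclusion of a homogeneous component. -/
def inc (r s : ℕ) : W S r s →ₗ[k] TensorAlgebra k H ⊗[k] TensorAlgebra k A :=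
  TensorProduct.map (TP.toTA k s) (TP.toTA k r)

/-- The projection to a homogeneous component. -/
def pr (r s : ℕ) : TensorAlgebra k H ⊗[k] TensorAlgebra k A →ₗ[k] W S r s :=
  TensorProduct.map (TP.comp k H s) (TP.comp k A r)

theorem inc_tmul {r s : ℕ} (h : ⨂[k]^s H) (a : ⨂[k]^r A) :
    inc S r s (h ⊗ₜ a) = TP.toTA k s h ⊗ₜ TP.toTA k r a := rfl

theorem pr_inc (r s : ℕ) (w : W S r s) : pr S r s (inc S r s w) = w := by
  refine LinearMap.congr_fun (f := pr S r s ∘ₗ inc S r s) (g := LinearMap.id)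
    (ext' fun h a => ?_) w
  simp only [comp_apply, inc_tmul, pr, map_tmul, TP.comp_toTA_same,
    id_apply]

theorem pr_inc_of_ne {r s r' s' : ℕ} (hne : (r, s) ≠ (r', s')) (w : W S r s) :
    pr S r' s' (inc S r s w) = 0 := by
  refine LinearMap.congr_fun (f := pr S r' s' ∘ₗ inc S r s) (g := 0)
    (ext' fun h a => ?_) w
  simp only [comp_apply, inc_tmul, pr, map_tmul, LinearMap.zero_apply]
  by_cases hs : s = s'
  · subst hs
    rw [TP.comp_toTA_of_ne (V := A) (by rintro rfl; exact hne rfl), tmul_zero]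
  · rw [TP.comp_toTA_of_ne hs, zero_tmul]

theorem envMap_comp {B V V' V'' : Type*} [Ring B] [Algebra k B] [AddCommGroup V] [Module k V]
    [AddCommGroup V'] [Module k V'] [AddCommGroup V''] [Module k V''] (g : V' →ₗ[k] V'')
    (f : V →ₗ[k] V') (x : Env k B V) : envMap g (envMap f x) = envMap (g ∘ₗ f) x := by
  rw [envMap, envMap, envMap, LinearMap.rTensor_comp, LinearMap.lTensor_comp, comp_apply]

theorem envMap_envLeft {B V V' : Type*} [Ring B] [Algebra k B] [AddCommGroup V] [Module k V]
    [AddCommGroup V'] [Module k V'] (f : V →ₗ[k] V') (b : B) (x : Env k B V) :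
    envMap f (envLeft b x) = envLeft b (envMap f x) :=
  LinearMap.congr_fun (f := envMap f ∘ₗ envLeft b) (g := envLeft b ∘ₗ envMap f)
    (env_ext' fun _ _ _ => rfl) x

theorem envMap_envRight {B V V' : Type*} [Ring B] [Algebra k B] [AddCommGroup V] [Module k V]
    [AddCommGroup V'] [Module k V'] (f : V →ₗ[k] V') (b : B) (x : Env k B V) :
    envMap f (envRight b x) = envRight b (envMap f x) :=
  LinearMap.congr_fun (f := envMap f ∘ₗ envRight b) (g := envRight b ∘ₗ envMap f)
    (env_ext' fun _ _ _ => rfl) x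

theorem envMap_pr_inc (r s : ℕ) (x : Env k (CrossedProduct S) (W S r s)) :
    envMap (pr S r s) (envMap (inc S r s) x) = x := by
  rw [envMap_comp, show pr S r s ∘ₗ inc S r s = LinearMap.id from LinearMap.ext (pr_inc S r s),
    envMap, LinearMap.rTensor_id, LinearMap.lTensor_id]
  rfl

theorem envMap_pr_inc_of_ne {r s r' s' : ℕ} (hne : (r, s) ≠ (r', s'))
    (x : Env k (CrossedProduct S) (W S r s)) :
    envMap (pr S r' s') (envMap (inc S r s) x) = 0 := by
  rw [envMap_comp, show pr S r' s' ∘ₗ inc S r s = 0 from LinearMap.ext (pr_inc_of_ne S hne),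
    envMap, LinearMap.rTensor_zero, LinearMap.lTensor_zero, LinearMap.zero_apply]

/-- `𝐡 ⊗ (𝐚 ⊗ g) ↦ 1 ⊗ (𝐡 ⊗ 𝐚) ⊗ (1 # g)`. -/
def outE (r s : ℕ) : (⨂[k]^s H) ⊗[k] ((⨂[k]^r A) ⊗[k] H) →ₗ[k]
    Env k (CrossedProduct S) (W S r s) :=
  envR ∘ₗ (inH S).lTensor _ ∘ₗ (assoc k _ _ _).symm.toLinearMap

theorem envMap_pr_putUH (r s : ℕ) (x : TensorAlgebra k H ⊗[k] (TensorAlgebra k A ⊗[k] H)) :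
    envMap (pr S r s) (rH S (putUH S x)) =
      outE S r s (TensorProduct.map (TP.comp k H s) ((TP.comp k A r).rTensor H) x) := by
  refine LinearMap.congr_fun (f := envMap (pr S r s) ∘ₗ rH S ∘ₗ putUH S) (g := outE S r s ∘ₗ
    TensorProduct.map (TP.comp k H s) ((TP.comp k A r).rTensor H))
    (ext' fun u t => ?_) x
  refine LinearMap.congr_fun (f := (envMap (pr S r s) ∘ₗ rH S ∘ₗ putUH S) ∘ₗ TensorProduct.mk k _ _ u)
    (g := (outE S r s ∘ₗ TensorProduct.map (TP.comp k H s) ((TP.comp k A r).rTensor H)) ∘ₗ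
      TensorProduct.mk k _ _ u) (ext' fun z g => rfl) t

/-- `(e ⊗ v) ⊗ w ↦ e ⊗ (v ⊗ w) ⊗ 1`. -/
def asL (S : CrossedSystem k A H) (V V' : Type*) [AddCommGroup V] [Module k V] [AddCommGroup V']
    [Module k V'] : (CrossedProduct S ⊗[k] V) ⊗[k] V' →ₗ[k] Env k (CrossedProduct S) (V ⊗[k] V') :=
  envL ∘ₗ (assoc k _ _ _).toLinearMap

theorem asL_tmul {V V' : Type*} [AddCommGroup V] [Module k V] [AddCommGroup V'] [Module k V']
    (e : CrossedProduct S) (v : V) (v' : V') :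
    asL S V V' ((e ⊗ₜ v) ⊗ₜ v') = e ⊗ₜ ((v ⊗ₜ v') ⊗ₜ 1) := rfl

theorem envMap_pr_putE (r s : ℕ) (x : CrossedProduct S ⊗[k] TensorAlgebra k H)
    (z : TensorAlgebra k A) : envMap (pr S r s) (rH S (putE S (x ⊗ₜ z))) =
      asL S _ _ ((TP.comp k H s).lTensor _ x ⊗ₜ TP.comp k A r z) := by
  refine LinearMap.congr_fun (f := envMap (pr S r s) ∘ₗ rH S ∘ₗ putE S ∘ₗ
    (TensorProduct.mk k _ _).flip z)
    (g := asL S _ _ ∘ₗ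
      (TensorProduct.mk k _ _).flip (TP.comp k A r z) ∘ₗ (TP.comp k H s).lTensor _)
    (ext' fun e u => ?_) x
  simp only [comp_apply, flip_apply, mk_apply, rH_putE,
    lTensor_tmul, asL_tmul, assoc_tmul]
  rfl

theorem envMap_pr_dTail (N r s r' s' : ℕ) (h : ⨂[k]^s H) (a : ⨂[k]^r A) :
    envMap (pr S r' s') (rH S (dTail S N (inc S r s (h ⊗ₜ a)))) =
      outE S r' s' (((TP.comp k A r').rTensor H ∘ₗ (gen1 S).flip (TP.toTA k r a) ∘ₗ
        TP.sgp k H N).lTensor _ (TP.split k H s' (TP.toTA k s h))) := by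
  rw [inc_tmul, dTail_tmul, envMap_pr_putUH, ← TP.comp_decon, tailAux]
  congr 1
  generalize TP.decon k H _ = x
  exact LinearMap.congr_fun (f := TensorProduct.map (TP.comp k H s') ((TP.comp k A r').rTensor H) ∘ₗ
    ((gen1 S).flip (TP.toTA k r a) ∘ₗ TP.sgp k H N).lTensor _) (g := ((TP.comp k A r').rTensor H ∘ₗ
      (gen1 S).flip (TP.toTA k r a) ∘ₗ TP.sgp k H N).lTensor _ ∘ₗ (TP.comp k H s').rTensor _)
    (ext' fun u v => rfl) x

/-- The component of `mergeE` in degree `s + 1`. -/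
def mergeS (s : ℕ) : ⨂[k]^(s + 1) H →ₗ[k] CrossedProduct S ⊗[k] ⨂[k]^s H :=
  (inH S).rTensor _ ∘ₗ (TP.cons k s).symm.toLinearMap +
    ∑ i ∈ Finset.range s, (-1 : k) ^ (i + 1) • ((inA S).rTensor _ ∘ₗ S.mergeAt s i)

theorem mergeE_toTA_zero (h : ⨂[k]^0 H) : mergeE S (TP.toTA k 0 h) = 0 := by
  obtain ⟨c, rfl⟩ := TP.zero_eq_smul_nil h
  rw [LinearMap.map_smul, LinearMap.map_smul, TP.toTA_nil, mergeE_one, smul_zero]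

theorem mergeE_toTA_succ (s : ℕ) (h : ⨂[k]^(s + 1) H) :
    mergeE S (TP.toTA k (s + 1) h) = (TP.toTA k s).lTensor _ (mergeS S s h) := by
  rw [mergeE, LinearMap.add_apply, comp_apply, comp_apply, merge_toTA_succ,
    mergeS, LinearMap.add_apply, map_add]
  congr 1
  · refine LinearMap.congr_fun (f := (inH S).rTensor _ ∘ₗ TP.uncons k H ∘ₗ TP.toTA k (s + 1))
      (g := (TP.toTA k s).lTensor _ ∘ₗ (inH S).rTensor _ ∘ₗ (TP.cons k s).symm.toLinearMap)
      (TP.hom_ext_succ fun v w => ?_) h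
    simp [TP.toTA_cons]
  · have h1 : ∀ x : A ⊗[k] ⨂[k]^s H, upA S ((TP.toTA k s).lTensor A x) =
        (TP.toTA k s).lTensor _ ((inA S).rTensor _ x) := fun x =>
      LinearMap.congr_fun (f := upA S ∘ₗ (TP.toTA k s).lTensor A)
        (g := (TP.toTA k s).lTensor _ ∘ₗ (inA S).rTensor _) (ext' fun a w => rfl) x
    rw [h1]
    simp only [LinearMap.sum_apply, LinearMap.smul_apply, comp_apply, map_sum, map_smul]

theorem sgn_toTA_pow (r : ℕ) (a : ⨂[k]^r A) :
    TP.sgn k A (TP.toTA k r a) = (-1 : k) ^ r • TP.toTA k r a := TP.sgn_toTA r a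

theorem envMap_pr_dMerge_zero (r r' s' : ℕ) (w : W S r 0) :
    envMap (pr S r' s') (rH S (dMerge S (inc S r 0 w))) = 0 := by
  refine LinearMap.congr_fun (f := envMap (pr S r' s') ∘ₗ rH S ∘ₗ dMerge S ∘ₗ inc S r 0) (g := 0)
    (ext' fun h a => ?_) w
  simp only [comp_apply, inc_tmul, dMerge_eq, mergeE_toTA_zero, zero_tmul, LinearMap.map_zero,
    LinearMap.zero_apply]

theorem envMap_pr_dMerge (r s : ℕ) (h : ⨂[k]^(s + 1) H) (a : ⨂[k]^r A) :
    envMap (pr S r s) (rH S (dMerge S (inc S r (s + 1) (h ⊗ₜ a)))) =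
      (-1 : k) ^ r • asL S _ _ (mergeS S s h ⊗ₜ a) := by
  rw [inc_tmul, dMerge_eq, envMap_pr_putE, mergeE_toTA_succ, sgn_toTA_pow, LinearMap.map_smul,
    TP.comp_toTA_same, ← LinearMap.lTensor_comp_apply,
    show TP.comp k H s ∘ₗ TP.toTA k s = LinearMap.id from LinearMap.ext (TP.comp_toTA_same s),
    LinearMap.lTensor_id, id_apply, tmul_smul, LinearMap.map_smul]

theorem envMap_pr_dMerge_of_ne {r s r' s' : ℕ} (hne : (r, s) ≠ (r', s')) (h : ⨂[k]^(s + 1) H)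
    (a : ⨂[k]^r A) :
    envMap (pr S r' s') (rH S (dMerge S (inc S r (s + 1) (h ⊗ₜ a)))) = 0 := by
  rw [inc_tmul, dMerge_eq, envMap_pr_putE, mergeE_toTA_succ, sgn_toTA_pow, LinearMap.map_smul,
    ← LinearMap.lTensor_comp_apply]
  by_cases hs : s = s'
  · subst hs
    rw [TP.comp_toTA_of_ne (V := A) (by rintro rfl; exact hne rfl), smul_zero, tmul_zero,
      LinearMap.map_zero]
  · rw [show TP.comp k H s' ∘ₗ TP.toTA k s = 0 from LinearMap.ext (TP.comp_toTA_of_ne hs),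
      LinearMap.lTensor_zero, LinearMap.zero_apply, zero_tmul, LinearMap.map_zero]

theorem gen1_sgp_toTA (N m r : ℕ) (v : ⨂[k]^(m + 1) H) (a : ⨂[k]^r A) :
    gen1 S (TP.sgp k H N (TP.toTA k (m + 1) v)) (TP.toTA k r a) =
      (-1 : k) ^ ((m + 1) * N) • (TP.toTA k (r + m)).rTensor H (FH S m r (v ⊗ₜ a)) := by
  rw [TP.sgp_toTA, LinearMap.map_smul, LinearMap.smul_apply, toTA_FH]

theorem envMap_pr_dTail_eq (m r s : ℕ) (w : W S r (s + (m + 1))) :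
    envMap (pr S (r + m) s) (rH S (dTail S (r + (s + (m + 1))) (inc S r (s + (m + 1)) w))) =
      deltaTail S m r s w := by
  refine LinearMap.congr_fun (f := envMap (pr S (r + m) s) ∘ₗ rH S ∘ₗ dTail S _ ∘ₗ inc S r _)
    (g := deltaTail S m r s) (ext' fun h a => ?_) w
  refine LinearMap.congr_fun (f := (envMap (pr S (r + m) s) ∘ₗ rH S ∘ₗ dTail S _ ∘ₗ inc S r _) ∘ₗ
    (TensorProduct.mk k _ _).flip a) (g := deltaTail S m r s ∘ₗ (TensorProduct.mk k _ _).flip a)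
    (TP.mulEquiv_hom_ext fun u v => ?_) h
  simp only [comp_apply, flip_apply, mk_apply]
  rw [envMap_pr_dTail, TP.toTA_mulEquiv, TP.split_toTA_mul, lTensor_tmul,
    comp_apply, comp_apply, flip_apply, gen1_sgp_toTA,
    LinearMap.map_smul, ← LinearMap.rTensor_comp_apply,
    show TP.comp k A (r + m) ∘ₗ TP.toTA k (r + m) = LinearMap.id from
      LinearMap.ext (TP.comp_toTA_same (r + m)), LinearMap.rTensor_id, id_apply,
    tmul_smul, LinearMap.map_smul, deltaTail, LinearMap.smul_apply]
  refine congrArg _ ?_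
  simp only [comp_apply, rTensor_tmul, coe_coe,
    symm_apply_apply, assoc_tmul, lTensor_tmul, FH, outE]
  refine congrArg envR ?_
  generalize TensorProduct.rightComm k (⨂[k]^(m + 1) H) H (⨂[k]^r A)
    (comulProd k H (m + 1) v ⊗ₜ a) = x
  refine LinearMap.congr_fun (f := (inH S).lTensor _ ∘ₗ (assoc k _ _ _).symm.toLinearMap ∘ₗ
    TensorProduct.mk k _ _ u ∘ₗ (F S m r).rTensor H)
    (g := (assoc k _ _ _).symm.toLinearMap ∘ₗ TensorProduct.mk k _ _ u ∘ₗ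
      TensorProduct.map (F S m r) (inH S)) (ext' fun y g => rfl) x

theorem envMap_pr_dTail_of_not {N r s r' s' : ℕ} (hn : ¬ (r + s = r' + s' + 1 ∧ s' < s))
    (w : W S r s) : envMap (pr S r' s') (rH S (dTail S N (inc S r s w))) = 0 := by
  refine LinearMap.congr_fun (f := envMap (pr S r' s') ∘ₗ rH S ∘ₗ dTail S N ∘ₗ inc S r s)
    (g := 0) (ext' fun h a => ?_) w
  simp only [comp_apply, LinearMap.zero_apply]
  rw [envMap_pr_dTail]
  rcases lt_or_ge s s' with hs | hs
  · rw [TP.split_toTA_of_lt hs, LinearMap.map_zero, LinearMap.map_zero]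
  obtain ⟨j, rfl⟩ := Nat.exists_eq_add_of_le hs
  rw [← comp_apply, ← comp_apply, ← comp_apply]
  refine LinearMap.congr_fun (g := 0) (TP.mulEquiv_hom_ext fun u v => ?_) h
  rw [comp_apply, comp_apply, comp_apply, TP.toTA_mulEquiv,
    TP.split_toTA_mul, lTensor_tmul, comp_apply, comp_apply,
    flip_apply, LinearMap.zero_apply]
  have hz : (TP.comp k A r').rTensor H (gen1 S (TP.sgp k H N (TP.toTA k j v)) (TP.toTA k r a)) = 0 := by
    rcases j with _ | m
    · obtain ⟨c, rfl⟩ := TP.zero_eq_smul_nil v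
      rw [LinearMap.map_smul, LinearMap.map_smul, TP.toTA_nil, TP.sgp_one, LinearMap.map_smul,
        LinearMap.smul_apply, gen1_one_left, smul_zero, LinearMap.map_zero]
    · rw [gen1_sgp_toTA, LinearMap.map_smul, ← LinearMap.rTensor_comp_apply,
        show TP.comp k A r' ∘ₗ TP.toTA k (r + m) = 0 from
          LinearMap.ext (TP.comp_toTA_of_ne (by omega)), LinearMap.rTensor_zero,
        LinearMap.zero_apply, smul_zero]
  rw [hz, tmul_zero, LinearMap.map_zero]

theorem envMap_pr_dPlus_of_not {N r s r' s' : ℕ} (hn : ¬ (r + s = r' + s' + 1 ∧ s' < s))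
    (w : W S r s) : envMap (pr S r' s') (rH S (dPlus S N (inc S r s w))) = 0 := by
  rw [dPlus_apply, LinearMap.map_add, LinearMap.map_add, envMap_pr_dTail_of_not S hn, add_zero]
  rcases s with _ | s
  · exact envMap_pr_dMerge_zero S r r' s' w
  · refine LinearMap.congr_fun (f := envMap (pr S r' s') ∘ₗ rH S ∘ₗ dMerge S ∘ₗ inc S r (s + 1))
      (g := 0) (ext' fun h a => ?_) w
    exact envMap_pr_dMerge_of_ne S (by rintro ⟨⟩; omega) h a

/-- The part `d⁰` of the differential. -/
def dZero : (r s : ℕ) → (W S r s →ₗ[k] U S)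
  | 0, _ => 0
  | r + 1, s => envMap (inc S r s) ∘ₗ delta0 S r s

/-- The differential on generators. -/
def dU (r s : ℕ) : W S r s →ₗ[k] U S := dZero S r s + rH S ∘ₗ dPlus S (r + s) ∘ₗ inc S r s

theorem dU_apply (r s : ℕ) (w : W S r s) :
    dU S r s w = dZero S r s w + rH S (dPlus S (r + s) (inc S r s w)) := rfl

theorem envMap_pr_dZero_of_not {r s r' s' : ℕ} (hn : ¬ (r = r' + 1 ∧ s = s')) (w : W S r s) :
    envMap (pr S r' s') (dZero S r s w) = 0 := by
  rcases r with _ | r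
  · exact (envMap (pr S r' s')).map_zero
  · exact envMap_pr_inc_of_ne S (by rintro ⟨⟩; exact hn ⟨rfl, rfl⟩) _

theorem envMap_pr_dU_of_not {r s r' s' : ℕ} (hn : ¬ (r + s = r' + s' + 1 ∧ s' ≤ s)) (w : W S r s) :
    envMap (pr S r' s') (dU S r s w) = 0 := by
  rw [dU_apply, LinearMap.map_add, envMap_pr_dZero_of_not S (by omega),
    envMap_pr_dPlus_of_not S (by omega), add_zero]

theorem envMap_pr_dU_zero (r s : ℕ) (w : W S (r + 1) s) :
    envMap (pr S r s) (dU S (r + 1) s w) = delta0 S r s w := by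
  rw [dU_apply, LinearMap.map_add, envMap_pr_dPlus_of_not S (by omega), add_zero]
  exact envMap_pr_inc S r s _

theorem envMap_pr_dU_tail (m r s : ℕ) (w : W S r (s + (m + 2))) :
    envMap (pr S (r + (m + 1)) s) (dU S r (s + (m + 2)) w) = deltaTail S (m + 1) r s w := by
  rw [dU_apply, LinearMap.map_add, envMap_pr_dZero_of_not S (by omega), zero_add, dPlus_apply,
    LinearMap.map_add, LinearMap.map_add, envMap_pr_dTail_eq]
  convert zero_add _
  refine LinearMap.congr_fun (f := envMap (pr S (r + (m + 1)) s) ∘ₗ rH S ∘ₗ dMerge S ∘ₗ inc S r _)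
    (g := 0) (ext' fun h a => ?_) w
  exact envMap_pr_dMerge_of_ne S (s := s + (m + 1)) (by simp) h a

theorem envMap_pr_dU_one (r s : ℕ) (w : W S r (s + 1)) :
    envMap (pr S r s) (dU S r (s + 1) w) = delta1 S r s w := by
  rw [dU_apply, LinearMap.map_add, envMap_pr_dZero_of_not S (by omega), zero_add, dPlus_apply,
    LinearMap.map_add, LinearMap.map_add]
  have h1 : envMap (pr S r s) (rH S (dTail S (r + (s + 1)) (inc S r (s + 1) w))) =
    deltaTail S 0 r s w := envMap_pr_dTail_eq S 0 r s w
  have h2 : envMap (pr S r s) (rH S (dMerge S (inc S r (s + 1) w))) =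
      (-1 : k) ^ r • (asL S _ _ ∘ₗ (mergeS S s).rTensor _) w := by
    refine LinearMap.congr_fun (f := envMap (pr S r s) ∘ₗ rH S ∘ₗ dMerge S ∘ₗ inc S r _)
      (g := (-1 : k) ^ r • (asL S _ _ ∘ₗ (mergeS S s).rTensor _))
      (ext' fun h a => ?_) w
    exact envMap_pr_dMerge S r s h a
  rw [h1, h2]
  rw [delta1, LinearMap.add_apply]
  refine congrArg (· + _) ?_
  rw [← LinearMap.smul_apply]
  refine LinearMap.congr_fun (ext' fun h a => ?_) w
  simp only [LinearMap.smul_apply, LinearMap.add_apply, comp_apply, mergeS,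
    rTensor_tmul, LinearMap.sum_apply, add_tmul, sum_tmul, LinearMap.map_add, map_sum,
    coe_coe, smul_add, Finset.smul_sum, ← smul_tmul', LinearMap.map_smul, smul_smul, ← pow_add]
  refine congrArg₂ (· + ·) (congrArg _ ?_) ?_
  · generalize (TP.cons k s).symm h = x
    refine LinearMap.congr_fun (f := asL S _ _ ∘ₗ
      (TensorProduct.mk k _ _).flip a ∘ₗ (inH S).rTensor _) (g := envL ∘ₗ (inH S).rTensor _ ∘ₗ
      (assoc k H _ _).toLinearMap ∘ₗ (TensorProduct.mk k _ _).flip a)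
      (ext' fun _ _ => rfl) x
  · refine Finset.sum_congr rfl fun i _ => congrArg _ ?_
    generalize S.mergeAt s i h = x
    refine LinearMap.congr_fun (f := asL S _ _ ∘ₗ
      (TensorProduct.mk k _ _).flip a ∘ₗ (inA S).rTensor _) (g := envL ∘ₗ (inA S).rTensor _ ∘ₗ
      (assoc k A _ _).toLinearMap ∘ₗ (TensorProduct.mk k _ _).flip a)
      (ext' fun _ _ => rfl) x

end CrossedSystem

namespace TP

variable {k V : Type*} [CommRing k] [AddCommGroup V] [Module k V]

theorem decon_mul_ι_mul (u v : TensorAlgebra k V) (x : V) :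
    decon k V (u * (ι k x * v)) =
      (mulRight k (ι k x * v)).lTensor _ (decon k V u) +
      (mulLeft k u ∘ₗ mulLeft k (ι k x)).rTensor _
        (decon k V v) := by
  rw [decon_mul, decon_ι_mul, LinearMap.map_add, rTensor_tmul, LinearMap.mulLeft_apply,
    mul_one, LinearMap.rTensor_comp_apply]
  abel

theorem lTensor_aug_decon (u : TensorAlgebra k V) :
    (aug k V).toLinearMap.lTensor _ (decon k V u) = u ⊗ₜ 1 := by
  refine LinearMap.congr_fun (f := (aug k V).toLinearMap.lTensor _ ∘ₗ decon k V)
    (g := (TensorProduct.mk k _ _).flip 1) (ta_hom_ext' (by simp) fun v w ih => ?_) u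
  simp only [comp_apply, flip_apply, mk_apply] at ih ⊢
  have h1 : ∀ x, (aug k V).toLinearMap.lTensor _
      ((mulLeft k (ι k v)).rTensor (TensorAlgebra k V) x) =
      (mulLeft k (ι k v)).rTensor k
        ((aug k V).toLinearMap.lTensor _ x) := fun x => by
    rw [← comp_apply, ← comp_apply, LinearMap.rTensor_comp_lTensor,
      LinearMap.lTensor_comp_rTensor]
  rw [decon_ι_mul, LinearMap.map_add, h1, ih]
  simp [aug]

theorem map_decon_of_aug {P Q : Type*} [AddCommGroup P] [Module k P] [AddCommGroup Q] [Module k Q]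
    (f : TensorAlgebra k V →ₗ[k] P) (q : Q) (u : TensorAlgebra k V) :
    TensorProduct.map f (LinearMap.toSpanSingleton k Q q ∘ₗ (aug k V).toLinearMap) (decon k V u) =
      f u ⊗ₜ q := by
  rw [← LinearMap.map_comp_lTensor, comp_apply, lTensor_aug_decon, map_tmul]
  simp

theorem toTA_comp_toTA (n m : ℕ) (w : ⨂[k]^m V) :
    toTA k n (comp k V n (toTA k m w)) = if m = n then toTA k m w else 0 := by
  split_ifs with h
  · subst h; rw [comp_toTA_same]
  · rw [comp_toTA_of_ne h, LinearMap.map_zero]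

theorem ι_mul_mul_ι_one_mem_degen {B : Type*} [Ring B] [Algebra k B] (b : B)
    (z : TensorAlgebra k B) :
    ι k b * z * ι k 1 ∈ degen k B := by
  induction z using ta_induction generalizing b with
  | one =>
    have := mem_degen_left (k := k) b 1
    rwa [mul_one] at this ⊢
  | cons c z ih =>
    rw [mul_assoc, mul_assoc, ← mul_assoc (ι k c)]
    exact mul_mem_degen _ (ih c)
  | smul c z ih =>
    rw [mul_smul_comm, smul_mul_assoc]
    exact Submodule.smul_mem _ _ (ih b)
  | add z z' h h' =>
    rw [mul_add, add_mul]
    exact add_mem (h b) (h' b)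

theorem sgp_mem_degen {B : Type*} [Ring B] [Algebra k B] (N : ℕ) {x : TensorAlgebra k B}
    (hx : x ∈ degen k B) : sgp k B N x ∈ degen k B := by
  induction N with
  | zero => exact hx
  | succ N ih => rw [sgp_succ]; exact sgn_mem_degen ih

theorem barTA_ι_one {B : Type*} [Ring B] [Algebra k B] : barTA k B (ι k 1) = 0 := by
  rw [barTA_ι, barMk_one, LinearMap.map_zero]

end TP

namespace CrossedSystem

open CrossedProduct BimodStr

variable {k A H : Type*} [CommRing k] [Ring A] [Algebra k A] [Ring H] [Bialgebra k H]
  (S : CrossedSystem k A H)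

/-! ### Passage to the quotients -/

/-- `(b # h) ⊗ w ↦ (b # 1) ⊗ (h * w)` on `E ⊗ T(H / k)`. -/
def jjBar : CrossedProduct S ⊗[k] TensorAlgebra k (TP.Bar k H) →ₗ[k]
    CrossedProduct S ⊗[k] TensorAlgebra k (TP.Bar k H) :=
  TensorProduct.map (inA S) (LinearMap.mul' k _ ∘ₗ
    (ι k ∘ₗ TP.barMk k H).rTensor _) ∘ₗ
    (assoc k A H _).toLinearMap ∘ₗ (equiv S).symm.toLinearMap.rTensor _

theorem jjBar_tmul (a : A) (h : H) (w : TensorAlgebra k (TP.Bar k H)) :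
    jjBar S ((inA S a * inH S h) ⊗ₜ w) =
      inA S a ⊗ₜ (ι k (TP.barMk k H h) * w) := by
  rw [← equiv_tmul]
  simp [jjBar]

/-- The projection `E ⊗ T(H) → E ⊗ T(H / k)`. -/
abbrev barE : CrossedProduct S ⊗[k] TensorAlgebra k H →ₗ[k]
    CrossedProduct S ⊗[k] TensorAlgebra k (TP.Bar k H) := (TP.barTA k H).toLinearMap.lTensor _

theorem barE_jj (x : CrossedProduct S ⊗[k] TensorAlgebra k H) :
    barE S (jj S x) = jjBar S (barE S x) := by
  refine LinearMap.congr_fun (f := barE S ∘ₗ jj S) (g := jjBar S ∘ₗ barE S)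
    (eth_hom_ext S fun b l w => ?_) x
  simp only [comp_apply, jj_tmul, lTensor_tmul, jjBar_tmul,
    toLinearMap_apply]
  rw [map_mul (TP.barTA k H), TP.barTA_ι]

theorem barE_jj_upA (x : A ⊗[k] TensorAlgebra k H) : barE S (jj S (upA S x)) = 0 := by
  refine LinearMap.congr_fun (f := barE S ∘ₗ jj S ∘ₗ upA S) (g := 0)
    (ext' fun a w => ?_) x
  have h1 : upA S (a ⊗ₜ w) = (inA S a * inH S 1) ⊗ₜ w := by rw [inH_one, mul_one]; rfl
  simp only [comp_apply, h1, jj_tmul, lTensor_tmul, LinearMap.zero_apply,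
    toLinearMap_apply]
  rw [map_mul (TP.barTA k H), TP.barTA_ι_one, zero_mul, tmul_zero]

theorem barE_mergeE_ι_one_mul (v : TensorAlgebra k H) :
    barE S (mergeE S (ι k 1 * v)) = TP.aug k H v • 1 ⊗ₜ 1 := by
  refine LinearMap.congr_fun (f := barE S ∘ₗ mergeE S ∘ₗ mulLeft k (ι k 1))
    (g := LinearMap.toSpanSingleton k _ (1 ⊗ₜ 1) ∘ₗ (TP.aug k H).toLinearMap)
    (TP.ta_hom_ext' ?_ fun h w _ => ?_) v
  · simp only [comp_apply, LinearMap.mulLeft_apply]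
    rw [mergeE_ι_mul, mergeE_one, LinearMap.map_zero, sub_zero, inH_one]
    simp
  · simp only [comp_apply, LinearMap.mulLeft_apply]
    have h1 : jjH S 1 (inH S h ⊗ₜ w) = 1 ⊗ₜ (ι k h * w) := by
      rw [jjH_apply, inH_one, one_smul, jj_inH_tmul]
    rw [mergeE_ι_mul, mergeE_ι_mul, LinearMap.map_sub, LinearMap.map_sub, LinearMap.map_sub, h1,
      inH_one, sub_sub_cancel, jjH_apply, inH_one, one_smul, ← upA_cnsH, barE_jj_upA]
    simp [TP.aug]

theorem barE_mergeE_mul_ι_one_mul (u v : TensorAlgebra k H) :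
    barE S (mergeE S (u * (ι k 1 * v))) =
      1 ⊗ₜ (TP.aug k H v • TP.barTA k H (TP.sgn k H u)) := by
  suffices key : barE S ∘ₗ mergeE S ∘ₗ mulRight k (ι k 1 * v) =
      TensorProduct.mk k (CrossedProduct S) (TensorAlgebra k (TP.Bar k H)) 1 ∘ₗ
        (TP.aug k H v • (TP.barTA k H).toLinearMap) ∘ₗ (TP.sgn k H).toLinearMap by
    have := LinearMap.congr_fun key u
    simp only [comp_apply, LinearMap.mulRight_apply, LinearMap.smul_apply,
      mk_apply, toLinearMap_apply] at this
    exact this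
  refine TP.ta_hom_ext' ?_ fun h w ih => ?_
  · simp only [comp_apply, LinearMap.mulRight_apply, one_mul, barE_mergeE_ι_one_mul]
    simp
  · simp only [comp_apply, LinearMap.mulRight_apply, LinearMap.smul_apply,
      mk_apply, toLinearMap_apply] at ih ⊢
    have h1 : ∀ x, barE S (inH S h • x) = inH S h • barE S x := fun x => lTensor_smul' _ _ _
    have h2 := fun x => jjBar_tmul S 1 h x
    simp only [inA_one, one_mul] at h2
    rw [mul_assoc, mergeE_ι_mul, LinearMap.map_sub, jjH_apply, barE_jj, h1, ih,
      lTensor_tmul, toLinearMap_apply]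
    rw [map_mul (TP.barTA k H), map_mul (TP.barTA k H), TP.barTA_ι_one, zero_mul, mul_zero, tmul_zero,
      zero_sub, map_mul (TP.sgn k H), map_mul (TP.barTA k H), TP.sgn_ι, map_neg (TP.barTA k H),
      TP.barTA_ι, neg_mul, smul_neg, tmul_neg, neg_inj, smul_tmul', smul_eq_mul, mul_one, h2,
      mul_smul_comm]

/-- `putUH`, with values in the quotient. -/
def putBar : TensorAlgebra k (TP.Bar k H) ⊗[k] (TensorAlgebra k (TP.Bar k A) ⊗[k] H) →ₗ[k]
    Ubar S :=
  envR ∘ₗ (inH S).lTensor _ ∘ₗ (assoc k _ _ _).symm.toLinearMap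

theorem barU_rH_putUH (x : TensorAlgebra k H ⊗[k] (TensorAlgebra k A ⊗[k] H)) :
    barU S (rH S (putUH S x)) = putBar S (TensorProduct.map (TP.barTA k H).toLinearMap
      ((TP.barTA k A).toLinearMap.rTensor H) x) := by
  refine LinearMap.congr_fun (f := barU S ∘ₗ rH S ∘ₗ putUH S) (g := putBar S ∘ₗ
    TensorProduct.map (TP.barTA k H).toLinearMap ((TP.barTA k A).toLinearMap.rTensor H))
    (ext' fun u t => ?_) x
  exact LinearMap.congr_fun (f := (barU S ∘ₗ rH S ∘ₗ putUH S) ∘ₗ TensorProduct.mk k _ _ u)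
    (g := (putBar S ∘ₗ TensorProduct.map (TP.barTA k H).toLinearMap
      ((TP.barTA k A).toLinearMap.rTensor H)) ∘ₗ TensorProduct.mk k _ _ u)
      (ext' fun z g => rfl) t

theorem barU_rH_putE (x : CrossedProduct S ⊗[k] TensorAlgebra k H) (z : TensorAlgebra k A) :
    barU S (rH S (putE S (x ⊗ₜ z))) = asL S _ _ (barE S x ⊗ₜ TP.barTA k A z) := by
  refine LinearMap.congr_fun (f := barU S ∘ₗ rH S ∘ₗ putE S ∘ₗ (TensorProduct.mk k _ _).flip z)
    (g := asL S _ _ ∘ₗ (TensorProduct.mk k _ _).flip (TP.barTA k A z) ∘ₗ barE S)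
    (ext' fun e u => rfl) x

theorem barU_rH_dTail (N : ℕ) (w : TensorAlgebra k H) (y : TensorAlgebra k A) :
    barU S (rH S (dTail S N (w ⊗ₜ y))) = putBar S (TensorProduct.map (TP.barTA k H).toLinearMap
      ((genBar S).flip y ∘ₗ TP.sgp k H N) (TP.decon k H w)) := by
  rw [dTail_tmul, barU_rH_putUH, tailAux]
  refine congrArg _ ?_
  generalize TP.decon k H w = x
  exact LinearMap.congr_fun (f := TensorProduct.map (TP.barTA k H).toLinearMap
      ((TP.barTA k A).toLinearMap.rTensor H) ∘ₗ ((gen1 S).flip y ∘ₗ TP.sgp k H N).lTensor _)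
    (g := TensorProduct.map (TP.barTA k H).toLinearMap ((genBar S).flip y ∘ₗ TP.sgp k H N))
    (ext' fun u v => rfl) x

theorem map_barTA_decon {Q : Type*} [AddCommGroup Q] [Module k Q] (ψ : TensorAlgebra k H →ₗ[k] Q)
    (u v : TensorAlgebra k H) :
    TensorProduct.map (TP.barTA k H).toLinearMap ψ
      (TP.decon k H (u * (ι k 1 * v))) =
    TensorProduct.map (TP.barTA k H).toLinearMap
      (ψ ∘ₗ mulRight k (ι k 1 * v)) (TP.decon k H u) := by
  have h1 : (TP.barTA k H).toLinearMap ∘ₗ mulLeft k u ∘ₗ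
      mulLeft k (ι k 1) = 0 := by
    refine LinearMap.ext fun x => ?_
    simp only [comp_apply, LinearMap.mulLeft_apply, toLinearMap_apply]
    rw [map_mul (TP.barTA k H), map_mul (TP.barTA k H), TP.barTA_ι_one, zero_mul, mul_zero]
    rfl
  have h2 : TensorProduct.map (TP.barTA k H).toLinearMap ψ ∘ₗ (mulLeft k u ∘ₗ
      mulLeft k (ι k 1)).rTensor (TensorAlgebra k H) = 0 := by
    rw [LinearMap.map_comp_rTensor, h1, TensorProduct.map_zero_left]
  rw [TP.decon_mul_ι_mul, LinearMap.map_add, ← LinearMap.map_comp_lTensor]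
  exact add_eq_left.2 (LinearMap.congr_fun h2 _)

theorem barU_dPlus_ι_ι (N : ℕ) (u v : TensorAlgebra k H) (h : H) (y : TensorAlgebra k A) :
    barU S (rH S (dPlus S N ((u * (ι k 1 * (ι k h * v))) ⊗ₜ y))) = 0 := by
  have h1 : ((genBar S).flip y ∘ₗ TP.sgp k H N) ∘ₗ
      mulRight k (ι k 1 * (ι k h * v)) = 0 :=
    LinearMap.ext fun z => genBar_degen_left S
      (TP.sgp_mem_degen N (TP.mul_mem_degen z (TP.mem_degen_right h v))) y
  have h2 : TP.aug k H (ι k h * v) = 0 := by simp [TP.aug]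
  rw [dPlus_apply, LinearMap.map_add, LinearMap.map_add, dMerge_eq, barU_rH_putE,
    barE_mergeE_mul_ι_one_mul, barU_rH_dTail, map_barTA_decon, h1, h2, zero_smul, tmul_zero, zero_tmul,
    LinearMap.map_zero, TensorProduct.map_zero_right, LinearMap.zero_apply, LinearMap.map_zero,
    add_zero]

theorem genBar_mul_ι_one (N : ℕ) (y : TensorAlgebra k A) :
    ((genBar S).flip y ∘ₗ TP.sgp k H N) ∘ₗ mulRight k (ι k 1 * 1) =
      LinearMap.toSpanSingleton k _ ((-1 : k) ^ N • (TP.barTA k A y ⊗ₜ (1 : H))) ∘ₗ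
        (TP.aug k H).toLinearMap := by
  refine TP.ta_hom_ext' ?_ fun h w _ => ?_
  · simp only [comp_apply, LinearMap.mulRight_apply, one_mul, mul_one, TP.sgp_ι,
      flip_apply, map_one, toLinearMap_apply, LinearMap.toSpanSingleton_apply,
      one_smul]
    rw [LinearMap.map_smul, LinearMap.smul_apply, genBar_apply, gen1_ι_one_left]
    rfl
  · have h2 : TP.aug k H (ι k h * w) = 0 := by simp [TP.aug]
    simp only [comp_apply, LinearMap.mulRight_apply, mul_one, toLinearMap_apply, h2]
    rw [LinearMap.map_zero]
    exact genBar_degen_left S (TP.sgp_mem_degen N (TP.ι_mul_mul_ι_one_mem_degen h w)) y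

theorem barU_dPlus_ι_one (i r : ℕ) (u : ⨂[k]^i H) (a : ⨂[k]^r A) :
    barU S (rH S (dPlus S (r + (i + 1))
      ((TP.toTA k i u * (ι k 1 * 1)) ⊗ₜ TP.toTA k r a))) = 0 := by
  rw [dPlus_apply, LinearMap.map_add, LinearMap.map_add, dMerge_eq, barU_rH_putE,
    barE_mergeE_mul_ι_one_mul, barU_rH_dTail, map_barTA_decon, genBar_mul_ι_one,
    TP.map_decon_of_aug, map_one, one_smul, sgn_toTA_pow, TP.sgn_toTA, map_smul (TP.barTA k H),
    map_smul (TP.barTA k A), tmul_smul, tmul_smul, tmul_smul, ← smul_tmul', LinearMap.map_smul,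
    LinearMap.map_smul, LinearMap.map_smul, toLinearMap_apply]
  have h1 : asL S _ _ ((1 ⊗ₜ TP.barTA k H (TP.toTA k i u)) ⊗ₜ TP.barTA k A (TP.toTA k r a)) =
      putBar S (TP.barTA k H (TP.toTA k i u) ⊗ₜ (TP.barTA k A (TP.toTA k r a) ⊗ₜ 1)) := rfl
  rw [h1, ← add_assoc, pow_succ, pow_add]
  module

theorem barU_dPlus_left (r s : ℕ) (h : ⨂[k]^s H) (hh : TP.barPow k H s h = 0) (a : ⨂[k]^r A) :
    barU S (rH S (dPlus S (r + s) (inc S r s (h ⊗ₜ a)))) = 0 := by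
  rw [inc_tmul]
  have := TP.eq_zero_of_barPow_eq_zero (barU S ∘ₗ rH S ∘ₗ dPlus S (r + s) ∘ₗ
    (TensorProduct.mk k _ _).flip (TP.toTA k r a) ∘ₗ TP.toTA k s ∘ₗ TP.comp k H s) ?_ s h hh
  · simp only [comp_apply, TP.comp_toTA_same] at this
    exact this
  · intro u v
    simp only [comp_apply, flip_apply, mk_apply]
    induction u using TP.ta_toTA_induction with
    | of i u =>
      induction v using TP.ta_toTA_induction with
      | of j v =>
        rw [← TP.toTA_cons, ← TP.toTA_mulEquiv, TP.toTA_comp_toTA]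
        split_ifs with hs
        · subst hs
          rw [TP.toTA_mulEquiv, TP.toTA_cons]
          rcases j with _ | j
          · obtain ⟨c, rfl⟩ := TP.zero_eq_smul_nil v
            rw [LinearMap.map_smul, TP.toTA_nil, mul_smul_comm, mul_smul_comm, ← smul_tmul',
              LinearMap.map_smul, LinearMap.map_smul, LinearMap.map_smul, barU_dPlus_ι_one, smul_zero]
          · refine LinearMap.congr_fun (f := barU S ∘ₗ rH S ∘ₗ dPlus S _ ∘ₗ
              (TensorProduct.mk k _ _).flip (TP.toTA k r a) ∘ₗ mulLeft k (TP.toTA k i u) ∘ₗ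
              mulLeft k (ι k 1) ∘ₗ TP.toTA k (j + 1)) (g := 0)
              (TP.hom_ext_succ fun g w => ?_) v
            simp only [comp_apply, TP.toTA_cons]
            exact barU_dPlus_ι_ι S _ _ _ _ _
        · rw [zero_tmul, LinearMap.map_zero, LinearMap.map_zero, LinearMap.map_zero]
      | add v v' h h' =>
        simp only [mul_add, LinearMap.map_add, add_tmul, h, h', add_zero]
    | add u u' h h' =>
      simp only [add_mul, LinearMap.map_add, add_tmul, h, h', add_zero]

theorem barU_dPlus_right (N r : ℕ) (w : TensorAlgebra k H) (a : ⨂[k]^r A)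
    (ha : TP.barPow k A r a = 0) : barU S (rH S (dPlus S N (w ⊗ₜ TP.toTA k r a))) = 0 := by
  refine TP.eq_zero_of_barPow_eq_zero (barU S ∘ₗ rH S ∘ₗ dPlus S N ∘ₗ TensorProduct.mk k _ _ w)
    (fun p q => ?_) r a ha
  simp only [comp_apply, mk_apply]
  have h1 : (genBar S).flip (p * (ι k 1 * q)) = 0 :=
    LinearMap.ext fun v => genBar_degen_right S v p q
  rw [dPlus_apply, LinearMap.map_add, LinearMap.map_add, dMerge_eq, barU_rH_putE, barU_rH_dTail, h1,
    map_mul (TP.sgn k A), map_mul (TP.sgn k A), TP.sgn_ι, map_mul (TP.barTA k A),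
    map_mul (TP.barTA k A), map_neg (TP.barTA k A), TP.barTA_ι_one, neg_zero, zero_mul, mul_zero,
    tmul_zero, LinearMap.map_zero, LinearMap.zero_comp, TensorProduct.map_zero_right,
    LinearMap.zero_apply, LinearMap.map_zero, add_zero]

theorem mem_ker_proj_induction {r s : ℕ} {P : Type*} [AddCommGroup P] [Module k P]
    (f : W S r s →ₗ[k] P)
    (h1 : ∀ h, TP.barPow k H s h = 0 → ∀ a, f (h ⊗ₜ a) = 0)
    (h2 : ∀ h a, TP.barPow k A r a = 0 → f (h ⊗ₜ a) = 0) (w : W S r s) (hw : proj S r s w = 0) :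
    f w = 0 := by
  have h3 : w ∈ LinearMap.ker (proj S r s) := hw
  rw [proj, TP.ker_map_eq (TP.barPow_surjective _ _ s) (TP.barPow_surjective _ _ r)] at h3
  exact map_mem_of_mem_tensorSpan (T := ⊥) f (fun m hm n => h1 m hm n) (fun m n hn => h2 m n hn) h3

theorem barU_dPlus_eq_zero (r s : ℕ) (w : W S r s) (hw : proj S r s w = 0) :
    barU S (rH S (dPlus S (r + s) (inc S r s w))) = 0 :=
  mem_ker_proj_induction S (barU S ∘ₗ rH S ∘ₗ dPlus S (r + s) ∘ₗ inc S r s)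
    (fun h hh a => barU_dPlus_left S r s h hh a)
    (fun h a ha => barU_dPlus_right S (r + s) r (TP.toTA k s h) a ha) w hw

end CrossedSystem

/-! ### The rows -/

namespace TP

variable {k B : Type*} [CommRing k] [Ring B] [Algebra k B]

theorem barPow_zero_injective {y : ⨂[k]^0 B} (h : barPow k B 0 y = 0) : y = 0 := by
  have := eq_zero_of_barPow_eq_zero (comp k B 0) (fun u v => ?_) 0 y h
  · rwa [comp_toTA_same] at this
  · rw [comp_zero]; simp [aug]

theorem barPow_succ_induction {r : ℕ} {P : Type*} [AddCommGroup P] [Module k P]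
    (f : ⨂[k]^(r + 1) B →ₗ[k] P) (h1 : ∀ y, f (cons k r (1 ⊗ₜ y)) = 0)
    (h2 : ∀ b y, barPow k B r y = 0 → f (cons k r (b ⊗ₜ y)) = 0) (y : ⨂[k]^(r + 1) B)
    (hy : barPow k B (r + 1) y = 0) : f y = 0 := by
  obtain ⟨x, rfl⟩ := (cons k r).surjective y
  have hx : x ∈ LinearMap.ker (TensorProduct.map (barMk k B) (barPow k B r)) := by
    have h3 := LinearMap.congr_fun (f := barPow k B (r + 1) ∘ₗ (cons k r).toLinearMap)
      (g := (cons k r).toLinearMap ∘ₗ TensorProduct.map (barMk k B) (barPow k B r))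
      (ext' fun b w => barPow_cons k B r b w) x
    rw [comp_apply, comp_apply] at h3
    exact (cons k r).injective (h3.symm.trans (hy.trans (map_zero _).symm))
  rw [ker_map_eq (barMk_surjective k B) (barPow_surjective k B r)] at hx
  refine map_mem_of_mem_tensorSpan (T := ⊥) (f ∘ₗ (cons k r).toLinearMap)
    (fun m hm w => ?_) (fun m w hw => h2 m w hw) hx
  obtain ⟨c, rfl⟩ := barMk_eq_zero (LinearMap.mem_ker.1 hm)
  rw [← smul_tmul', LinearMap.map_smul]
  exact Submodule.smul_mem _ _ ((Submodule.mem_bot k).2 (h1 w))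

theorem barPow_snoc (r : ℕ) (b : B) (y : ⨂[k]^r B) :
    barPow k B (r + 1) (snoc k r (y ⊗ₜ b)) = snoc k r (barPow k B r y ⊗ₜ barMk k B b) := by
  apply toTA_injective
  rw [← barTA_toTA, toTA_snoc, toTA_snoc, map_mul (barTA k B), barTA_toTA, barTA_ι]

end TP

namespace Bar

variable {k B L : Type*} [CommRing k] [Ring B] [Algebra k B] [AddCommGroup L] [Module k L]

/-- The projection `B^{⊗ r} ⊗ L → (B / k)^{⊗ r} ⊗ L`. -/
abbrev barT (k B L : Type*) [CommRing k] [Ring B] [Algebra k B] [AddCommGroup L] [Module k L]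
    (r : ℕ) : T k B L r →ₗ[k] (⨂[k]^r (TP.Bar k B)) ⊗[k] L := (TP.barPow k B r).rTensor L

theorem barT_consE_one (r : ℕ) (t : T k B L r) :
    barT k B L (r + 1) (consE k B L r (1 ⊗ₜ t)) = 0 := by
  refine LinearMap.congr_fun (f := barT k B L (r + 1) ∘ₗ (consE k B L r).toLinearMap ∘ₗ
    TensorProduct.mk k _ _ 1) (g := 0) (ext' fun y x => ?_) t
  simp only [comp_apply, mk_apply, coe_coe, consE_tmul, barT,
    rTensor_tmul, TP.barPow_cons, TP.barMk_one, zero_tmul, LinearEquiv.map_zero,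
    LinearMap.zero_apply]

theorem barT_consE (r : ℕ) (b : B) {t t' : T k B L r} (h : barT k B L r t = barT k B L r t') :
    barT k B L (r + 1) (consE k B L r (b ⊗ₜ t)) = barT k B L (r + 1) (consE k B L r (b ⊗ₜ t')) := by
  have h1 : ∀ t : T k B L r, barT k B L (r + 1) (consE k B L r (b ⊗ₜ t)) =
      ((TP.cons k r).toLinearMap ∘ₗ TensorProduct.mk k _ _ (TP.barMk k B b)).rTensor L
        (barT k B L r t) := fun t =>
    LinearMap.congr_fun (f := barT k B L (r + 1) ∘ₗ (consE k B L r).toLinearMap ∘ₗ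
      TensorProduct.mk k _ _ b) (g := ((TP.cons k r).toLinearMap ∘ₗ
        TensorProduct.mk k _ _ (TP.barMk k B b)).rTensor L ∘ₗ barT k B L r)
      (ext' fun y x => by
        simp only [comp_apply, mk_apply, coe_coe, consE_tmul,
          barT, rTensor_tmul, TP.barPow_cons]) t
  rw [h1, h1, h]

variable (l : B →ₗ[k] L →ₗ[k] L)

theorem bul_one (hl : ∀ x, l 1 x = x) (r : ℕ) (t : T k B L r) : bul l r (1 ⊗ₜ t) = t := by
  cases r with
  | zero =>
    exact LinearMap.congr_fun (f := bul l 0 ∘ₗ TensorProduct.mk k _ _ 1) (g := LinearMap.id)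
      (hom_ext_zero fun x => by simp [hl]) t
  | succ r =>
    exact LinearMap.congr_fun (f := bul l (r + 1) ∘ₗ TensorProduct.mk k _ _ 1) (g := LinearMap.id)
      (hom_ext_succ fun b t => by simp) t

theorem barT_beta_one (hl : ∀ x, l 1 x = x) (r : ℕ) (t : T k B L r) :
    barT k B L r (beta l r (consE k B L r (1 ⊗ₜ t))) = barT k B L r t := by
  cases r with
  | zero => rw [beta_zero, bul_one l hl]
  | succ r => rw [beta_succ, bul_one l hl, LinearMap.map_sub, barT_consE_one, sub_zero]

theorem barT_beta (hl : ∀ x, l 1 x = x) (r : ℕ) (b : B) (y : ⨂[k]^r B) (x : L)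
    (hy : TP.barPow k B r y = 0) :
    barT k B L r (beta l r (consE k B L r (b ⊗ₜ (y ⊗ₜ x)))) = 0 := by
  induction r generalizing b with
  | zero => simp [TP.barPow_zero_injective hy]
  | succ r ih =>
    refine TP.barPow_succ_induction (barT k B L (r + 1) ∘ₗ beta l (r + 1) ∘ₗ
      (consE k B L (r + 1)).toLinearMap ∘ₗ TensorProduct.mk k _ _ b ∘ₗ
      (TensorProduct.mk k _ _).flip x) (fun y => ?_) (fun c y hy => ?_) y hy
    · simp only [comp_apply, flip_apply, mk_apply,
        coe_coe]
      rw [← consE_tmul, beta_succ, bul_succ, mul_one, LinearMap.map_sub,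
        barT_consE r b (barT_beta_one l hl r (y ⊗ₜ x)), sub_self]
    · simp only [comp_apply, flip_apply, mk_apply,
        coe_coe]
      have h1 : barT k B L r (y ⊗ₜ x) = barT k B L r 0 := by simp [hy]
      have h2 := (ih c y hy).trans (LinearMap.map_zero (barT k B L r)).symm
      rw [← consE_tmul, beta_succ, bul_succ, LinearMap.map_sub, barT_consE r _ h1,
        barT_consE r _ h2, tmul_zero, tmul_zero, sub_self]

end Bar

namespace CrossedSystem

open CrossedProduct BimodStr

variable {k A H : Type*} [CommRing k] [Ring A] [Algebra k A] [Ring H] [Bialgebra k H]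
  (S : CrossedSystem k A H)

theorem barE_upA_pushT (u v : TensorAlgebra k H) (b : A) :
    barE S (upA S (pushT S (u * (ι k 1 * v)) b)) = 0 := by
  refine LinearMap.congr_fun (f := barE S ∘ₗ upA S ∘ₗ (pushT S).flip b ∘ₗ
    mulRight k (ι k 1 * v)) (g := 0) (TP.ta_hom_ext' ?_ fun h w ih => ?_) u
  · simp only [comp_apply, LinearMap.mulRight_apply, one_mul, flip_apply,
      pushT_ι_mul, upA_cnsH, jjH_apply, inH_one, one_smul, barE_jj_upA, LinearMap.zero_apply]
  · have h1 : ∀ x, barE S (inH S h • x) = inH S h • barE S x := fun x => lTensor_smul' _ _ _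
    simp only [comp_apply, LinearMap.mulRight_apply, flip_apply,
      LinearMap.zero_apply] at ih ⊢
    rw [mul_assoc, pushT_ι_mul, upA_cnsH, jjH_apply, barE_jj, h1, ih, smul_zero, LinearMap.map_zero]

/-- The right action of `A` on `E ⊗ T(H)`, as a linear map. -/
def actRₗ : A →ₗ[k] CrossedProduct S ⊗[k] TensorAlgebra k H →ₗ[k]
    CrossedProduct S ⊗[k] TensorAlgebra k H :=
  leftExtₗ k (CrossedProduct S) (TensorAlgebra k H) (CrossedProduct S ⊗[k] TensorAlgebra k H) ∘ₗ
    LinearMap.llcomp k _ _ _ (upA S) ∘ₗ (pushT S).flip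

theorem actRₗ_apply (a : A) (x : CrossedProduct S ⊗[k] TensorAlgebra k H) :
    actRₗ S a x = actR S a x := rfl

/-- The left action of `A` on `E`. -/
def lA : A →ₗ[k] CrossedProduct S →ₗ[k] CrossedProduct S := LinearMap.mul k _ ∘ₗ inA S

/-- `b # h ↦ b ⊗ (1 # h)`. -/
def lamA : CrossedProduct S →ₗ[k] A ⊗[k] CrossedProduct S :=
  (inH S).lTensor A ∘ₗ (equiv S).symm.toLinearMap

theorem lamA_mul (b : A) (h : H) : lamA S (inA S b * inH S h) = b ⊗ₜ inH S h := by
  rw [← equiv_tmul]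
  simp [lamA]

theorem lA_mul (a b : A) (x : CrossedProduct S) : lA S (a * b) x = lA S a (lA S b x) := by
  change inA S (a * b) * x = inA S a * (inA S b * x)
  rw [inA_mul, mul_assoc]

theorem lA_one (x : CrossedProduct S) : lA S 1 x = x := by
  change inA S 1 * x = x
  rw [inA_one, one_mul]

theorem lift_lA_lamA (x : CrossedProduct S) : TensorProduct.lift (lA S) (lamA S x) = x := by
  refine LinearMap.congr_fun (f := TensorProduct.lift (lA S) ∘ₗ lamA S) (g := LinearMap.id)
    (crossed_hom_ext S fun b h => ?_) x
  rw [comp_apply, lamA_mul]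
  rfl

theorem lamA_lA (a : A) (x : CrossedProduct S) :
    lamA S (lA S a x) = (mulLeft k a).rTensor _ (lamA S x) := by
  refine LinearMap.congr_fun (f := lamA S ∘ₗ lA S a)
    (g := (mulLeft k a).rTensor _ ∘ₗ lamA S) (crossed_hom_ext S fun b h => ?_) x
  change lamA S (inA S a * (inA S b * inH S h)) = (mulLeft k a).rTensor _ (lamA S _)
  rw [← mul_assoc, ← inA_mul, lamA_mul, lamA_mul]
  rfl

section
variable {V V' P : Type*} [AddCommGroup V] [Module k V] [AddCommGroup V'] [Module k V']
  [AddCommGroup P] [Module k P]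

/-- `e ⊗ (v ⊗ y) ⊗ e' ↦ (e ⊗ f(v)) ⊗ (y ⊗ e')`. -/
def regroup (f : V →ₗ[k] V') : Env k (CrossedProduct S) (V ⊗[k] P) →ₗ[k]
    (CrossedProduct S ⊗[k] V') ⊗[k] (P ⊗[k] CrossedProduct S) :=
  (assoc k _ _ _).symm.toLinearMap ∘ₗ
    ((assoc k _ _ _).toLinearMap ∘ₗ (f.rTensor P).rTensor _).lTensor _

theorem regroup_tmul (f : V →ₗ[k] V') (e e' : CrossedProduct S) (v : V) (y : P) :
    regroup S f (e ⊗ₜ ((v ⊗ₜ y) ⊗ₜ e')) = (e ⊗ₜ f v) ⊗ₜ (y ⊗ₜ e') := rfl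

theorem regroup_injective {f : V →ₗ[k] V'} {g : V' →ₗ[k] V} (h : ∀ v, g (f v) = v) :
    Function.Injective (regroup S f (P := P)) := by
  refine Function.LeftInverse.injective (g := ((g.rTensor P).rTensor _ ∘ₗ
    (assoc k _ _ _).symm.toLinearMap).lTensor _ ∘ₗ
    (assoc k _ _ _).toLinearMap) fun x => ?_
  refine LinearMap.congr_fun (f := (((g.rTensor P).rTensor _ ∘ₗ
    (assoc k _ _ _).symm.toLinearMap).lTensor _ ∘ₗ
    (assoc k _ _ _).toLinearMap) ∘ₗ regroup S f) (g := LinearMap.id)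
    (fourfold_ext fun e v y e' => ?_) x
  rw [comp_apply, regroup_tmul]
  simp only [comp_apply, coe_coe, assoc_tmul,
    lTensor_tmul, assoc_symm_tmul, rTensor_tmul, h,
    id_apply]

end

/-- `regroup`, before passing to the quotients. -/
abbrev reg (r s : ℕ) : Env k (CrossedProduct S) (W S r s) →ₗ[k]
    (CrossedProduct S ⊗[k] TensorAlgebra k H) ⊗[k] Bar.T k A (CrossedProduct S) r :=
  regroup S (TP.toTA k s)

/-- `regroup`, on the quotients. -/
abbrev regBar (r s : ℕ) : X S r s →ₗ[k] (CrossedProduct S ⊗[k] TensorAlgebra k (TP.Bar k H)) ⊗[k]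
    ((⨂[k]^r (TP.Bar k A)) ⊗[k] CrossedProduct S) :=
  regroup S (TP.toTA k s)

/-- The projection to the quotient. -/
abbrev barN (r : ℕ) : (CrossedProduct S ⊗[k] TensorAlgebra k H) ⊗[k]
    Bar.T k A (CrossedProduct S) r →ₗ[k]
    (CrossedProduct S ⊗[k] TensorAlgebra k (TP.Bar k H)) ⊗[k]
    ((⨂[k]^r (TP.Bar k A)) ⊗[k] CrossedProduct S) :=
  TensorProduct.map (barE S) (Bar.barT k A (CrossedProduct S) r)

theorem regBar_injective (r s : ℕ) : Function.Injective (regBar S r s) :=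
  regroup_injective S (TP.comp_toTA_same s)

theorem projX_tmul (r s : ℕ) (e e' : CrossedProduct S) (h : ⨂[k]^s H) (a : ⨂[k]^r A) :
    projX S r s (e ⊗ₜ ((h ⊗ₜ a) ⊗ₜ e')) =
      e ⊗ₜ ((TP.barPow k H s h ⊗ₜ TP.barPow k A r a) ⊗ₜ e') := rfl

theorem regBar_projX (r s : ℕ) (x : Env k (CrossedProduct S) (W S r s)) :
    regBar S r s (projX S r s x) = barN S r (reg S r s x) := by
  refine LinearMap.congr_fun (f := regBar S r s ∘ₗ projX S r s) (g := barN S r ∘ₗ reg S r s)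
    (fourfold_ext fun e h a e' => ?_) x
  rw [comp_apply, comp_apply, projX_tmul, regroup_tmul, regroup_tmul,
    map_tmul, lTensor_tmul, rTensor_tmul, toLinearMap_apply,
    TP.barTA_toTA]

/-- The bimodule map that extends `delta0`. -/
abbrev dRow (r s : ℕ) : Env k (CrossedProduct S) (W S (r + 1) s) →ₗ[k]
    Env k (CrossedProduct S) (W S r s) := (envStr k _ _).ext (delta0 S r s)

theorem reg_dRow (r s : ℕ) (x : Env k (CrossedProduct S) (W S (r + 1) s)) :
    reg S r s (dRow S r s x) = Bar.barD (lA S) (actRₗ S) r (reg S (r + 1) s x) := by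
  refine LinearMap.congr_fun (f := reg S r s ∘ₗ dRow S r s)
    (g := Bar.barD (lA S) (actRₗ S) r ∘ₗ reg S (r + 1) s) (fourfold_ext fun e h y e' => ?_) x
  have h1 : reg S r s ((envStr k _ _).l e ((envStr k _ _).r e' (envL ((inA S).rTensor _
      (assoc k A _ _ ((S.pushPow s).rTensor _ ((assoc k _ A _).symm
        (h ⊗ₜ (TP.cons k r).symm y)))))))) =
      Bar.nbul (actRₗ S) r ((e ⊗ₜ TP.toTA k s h) ⊗ₜ (y ⊗ₜ e')) := by
    refine LinearMap.congr_fun (f := reg S r s ∘ₗ (envStr k _ _).l e ∘ₗ (envStr k _ _).r e' ∘ₗ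
      envL ∘ₗ (inA S).rTensor _ ∘ₗ (assoc k A _ _).toLinearMap ∘ₗ
      (S.pushPow s).rTensor _ ∘ₗ (assoc k _ A _).symm.toLinearMap ∘ₗ
      TensorProduct.mk k _ _ h ∘ₗ (TP.cons k r).symm.toLinearMap)
      (g := Bar.nbul (actRₗ S) r ∘ₗ TensorProduct.mk k _ _ (e ⊗ₜ TP.toTA k s h) ∘ₗ
        (TensorProduct.mk k _ _).flip e') (TP.hom_ext_succ fun b y => ?_) y
    simp only [comp_apply, flip_apply, mk_apply,
      coe_coe, symm_apply_apply, assoc_symm_tmul,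
      rTensor_tmul]
    rw [← Bar.consE_tmul, Bar.nbul_tmul, actRₗ_apply, actR_tmul, pushT_toTA]
    generalize S.pushPow s (h ⊗ₜ b) = z
    refine LinearMap.congr_fun (f := reg S r s ∘ₗ (envStr k _ _).l e ∘ₗ (envStr k _ _).r e' ∘ₗ
      envL ∘ₗ (inA S).rTensor _ ∘ₗ (assoc k A _ _).toLinearMap ∘ₗ
      (TensorProduct.mk k _ _).flip y) (g := (TensorProduct.mk k _ _).flip (y ⊗ₜ e') ∘ₗ
        lsm k (CrossedProduct S) _ e ∘ₗ upA S ∘ₗ (TP.toTA k s).lTensor A)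
        (ext' fun c w => ?_) z
    simp only [comp_apply, flip_apply, mk_apply, lsm_apply,
      coe_coe, assoc_tmul, lTensor_tmul,
      rTensor_tmul]
    change (e * inA S c) ⊗ₜ TP.toTA k s w ⊗ₜ (y ⊗ₜ (1 * e')) = _
    rw [one_mul]
    rfl
  have h2 : reg S r s ((envStr k _ _).l e ((envStr k _ _).r e' (envR ((inA S).lTensor _
      ((assoc k _ _ A).symm (h ⊗ₜ (TP.snoc k r).symm y)))))) =
      (e ⊗ₜ TP.toTA k s h) ⊗ₜ Bar.lastMul (lA S) r (y ⊗ₜ e') := by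
    clear h1
    induction y using TP.snoc_induction with
    | zero =>
      simp only [LinearEquiv.map_zero, LinearMap.map_zero, tmul_zero, zero_tmul]
    | snoc y b =>
      simp only [Bar.lastMul, comp_apply, coe_coe, rTensor_tmul,
        symm_apply_apply, assoc_tmul, assoc_symm_tmul,
        lTensor_tmul, TensorProduct.lift.tmul]
      change ((e * 1) ⊗ₜ TP.toTA k s h) ⊗ₜ (y ⊗ₜ (inA S b * e')) = _
      rw [mul_one]
      rfl
    | add y y' h h' =>
      simp only [LinearEquiv.map_add, LinearMap.map_add, tmul_add, add_tmul, h, h']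
  have h3 : ∀ w : W S r s, (envStr k (CrossedProduct S) _).l e ((envStr k _ _).r e' (envGen w)) =
      e ⊗ₜ (w ⊗ₜ e') := fun w => (env_tmul_eq e e' w).symm
  rw [comp_apply, comp_apply, regroup_tmul, BimodStr.ext_tmul, delta0]
  simp only [LinearMap.add_apply, LinearMap.map_add, comp_apply, lTensor_tmul,
    coe_coe, h1, LinearMap.smul_apply, LinearMap.map_smul, h2, LinearMap.sum_apply,
    map_sum, h3, regroup_tmul, Bar.barD, LinearMap.sub_apply, Bar.beta_tmul, tmul_add, tmul_sum,
    tmul_smul, pow_succ_smul', ← Finset.smul_sum]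
  module

theorem barN_barD_left (r s : ℕ) (h : ⨂[k]^s H) (hh : TP.barPow k H s h = 0)
    (t : Bar.T k A (CrossedProduct S) (r + 1)) :
    barN S r (Bar.barD (lA S) (actRₗ S) r ((1 ⊗ₜ TP.toTA k s h) ⊗ₜ t)) = 0 := by
  refine LinearMap.congr_fun (f := barN S r ∘ₗ Bar.barD (lA S) (actRₗ S) r ∘ₗ
    TensorProduct.mk k _ _ (1 ⊗ₜ TP.toTA k s h)) (g := 0) (Bar.hom_ext_succ fun b t => ?_) t
  have h1 : barE S (upA S (pushT S (TP.toTA k s h) b)) = 0 :=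
    TP.eq_zero_of_barPow_eq_zero (barE S ∘ₗ upA S ∘ₗ (pushT S).flip b)
      (fun u v => barE_upA_pushT S u v b) s h hh
  simp only [comp_apply, mk_apply, LinearMap.zero_apply]
  rw [Bar.barD_tmul, LinearMap.map_sub, map_tmul, map_tmul, actRₗ_apply,
    actR_tmul, one_smul, h1, lTensor_tmul, toLinearMap_apply, TP.barTA_toTA, hh,
    LinearMap.map_zero, tmul_zero, zero_tmul, zero_tmul, sub_zero]

theorem barN_barD_right (r : ℕ) (n : CrossedProduct S ⊗[k] TensorAlgebra k H) (y : ⨂[k]^(r + 1) A)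
    (hy : TP.barPow k A (r + 1) y = 0) (e : CrossedProduct S) :
    barN S r (Bar.barD (lA S) (actRₗ S) r (n ⊗ₜ (y ⊗ₜ e))) = 0 := by
  refine TP.barPow_succ_induction (barN S r ∘ₗ Bar.barD (lA S) (actRₗ S) r ∘ₗ
    TensorProduct.mk k _ _ n ∘ₗ (TensorProduct.mk k _ _).flip e) (fun y => ?_) (fun b y hy => ?_) y hy
  · simp only [comp_apply, flip_apply, mk_apply]
    have h1 : actRₗ S 1 n = n :=
      LinearMap.congr_fun (f := actRₗ S 1) (g := LinearMap.id) (ext' fun e w => by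
        rw [actRₗ_apply, actR_tmul, pushT_one_right]
        change (e * inA S 1) ⊗ₜ w = _
        rw [inA_one, mul_one]; rfl) n
    rw [← Bar.consE_tmul, Bar.barD_tmul, LinearMap.map_sub, map_tmul,
      map_tmul, h1, Bar.barT_beta_one (lA S) (lA_one S), sub_self]
  · simp only [comp_apply, flip_apply, mk_apply]
    rw [← Bar.consE_tmul, Bar.barD_tmul, LinearMap.map_sub, map_tmul,
      map_tmul, Bar.barT_beta (lA S) (lA_one S) r b y e hy, rTensor_tmul, hy,
      zero_tmul, tmul_zero, tmul_zero, sub_zero]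

theorem projX_delta0_eq_zero (r s : ℕ) (w : W S (r + 1) s) (hw : proj S (r + 1) s w = 0) :
    projX S r s (delta0 S r s w) = 0 := by
  apply regBar_injective S r s
  rw [LinearMap.map_zero, regBar_projX]
  have h1 : delta0 S r s w = dRow S r s (envGen w) := ((envStr k _ _).ext_envGen _ w).symm
  rw [h1, reg_dRow]
  refine mem_ker_proj_induction S (barN S r ∘ₗ Bar.barD (lA S) (actRₗ S) r ∘ₗ reg S (r + 1) s ∘ₗ envGen)
    (fun h hh a => ?_) (fun h a ha => ?_) w hw
  · exact barN_barD_left S r s h hh (a ⊗ₜ 1)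
  · exact barN_barD_right S r (1 ⊗ₜ TP.toTA k s h) a ha 1

/-- `sigma`, before passing to the quotients. -/
def sigmaRow (r s : ℕ) : Env k (CrossedProduct S) (W S r s) →ₗ[k]
    Env k (CrossedProduct S) (W S (r + 1) s) :=
  (-1 : k) ^ (r + 1) •
    (TensorProduct.map ((TP.snoc k r).toLinearMap.lTensor _ ∘ₗ
        (assoc k _ _ A).toLinearMap) (inH S) ∘ₗ
      (assoc k (W S r s) A H).symm.toLinearMap ∘ₗ
      (equiv S).symm.toLinearMap.lTensor _).lTensor _

theorem sigmaRow_tmul (r s : ℕ) (e : CrossedProduct S) (h : ⨂[k]^s H) (y : ⨂[k]^r A) (b : A)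
    (g : H) : sigmaRow S r s (e ⊗ₜ ((h ⊗ₜ y) ⊗ₜ (inA S b * inH S g))) =
      (-1 : k) ^ (r + 1) • e ⊗ₜ ((h ⊗ₜ TP.snoc k r (y ⊗ₜ b)) ⊗ₜ inH S g) := by
  rw [← equiv_tmul]; rfl

theorem sigma_tmul (r s : ℕ) (e : CrossedProduct S) (h : ⨂[k]^s (TP.Bar k H))
    (y : ⨂[k]^r (TP.Bar k A)) (b : A) (g : H) :
    sigma S r s (e ⊗ₜ ((h ⊗ₜ y) ⊗ₜ (inA S b * inH S g))) =
      (-1 : k) ^ (r + 1) • e ⊗ₜ ((h ⊗ₜ TP.snoc k r (y ⊗ₜ TP.barMk k A b)) ⊗ₜ inH S g) := by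
  rw [← equiv_tmul]; rfl

theorem env_crossed_ext {V V' P : Type*} [AddCommGroup V] [Module k V] [AddCommGroup V']
    [Module k V'] [AddCommGroup P] [Module k P]
    {f g : Env k (CrossedProduct S) (V ⊗[k] V') →ₗ[k] P}
    (h : ∀ e v v' b l, f (e ⊗ₜ ((v ⊗ₜ v') ⊗ₜ (inA S b * inH S l))) =
      g (e ⊗ₜ ((v ⊗ₜ v') ⊗ₜ (inA S b * inH S l)))) : f = g :=
  fourfold_ext fun e v v' e' => LinearMap.congr_fun
    (f := f ∘ₗ TensorProduct.mk k _ _ e ∘ₗ TensorProduct.mk k _ _ (v ⊗ₜ v'))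
    (g := g ∘ₗ TensorProduct.mk k _ _ e ∘ₗ TensorProduct.mk k _ _ (v ⊗ₜ v'))
    (crossed_hom_ext S fun b l => h e v v' b l) e'

theorem projX_sigmaRow (r s : ℕ) (x : Env k (CrossedProduct S) (W S r s)) :
    projX S (r + 1) s (sigmaRow S r s x) = sigma S r s (projX S r s x) := by
  refine LinearMap.congr_fun (f := projX S (r + 1) s ∘ₗ sigmaRow S r s)
    (g := sigma S r s ∘ₗ projX S r s) (env_crossed_ext S fun e h y b g => ?_) x
  rw [comp_apply, comp_apply, sigmaRow_tmul, projX_tmul, sigma_tmul,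
    LinearMap.map_smul, projX_tmul, TP.barPow_snoc]

theorem reg_sigmaRow (r s : ℕ) (x : Env k (CrossedProduct S) (W S r s)) :
    reg S (r + 1) s (sigmaRow S r s x) = Bar.barS (lamA S) _ r (reg S r s x) := by
  refine LinearMap.congr_fun (f := reg S (r + 1) s ∘ₗ sigmaRow S r s)
    (g := Bar.barS (lamA S) _ r ∘ₗ reg S r s) (env_crossed_ext S fun e h y b g => ?_) x
  rw [comp_apply, comp_apply, sigmaRow_tmul, regroup_tmul, LinearMap.map_smul,
    regroup_tmul, Bar.barS, LinearMap.smul_apply, lTensor_tmul, Bar.sg,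
    comp_apply, comp_apply, lTensor_tmul, lamA_mul]
  rfl

theorem dRow_dRow (r s : ℕ) (x : Env k (CrossedProduct S) (W S (r + 2) s)) :
    dRow S r s (dRow S (r + 1) s x) = 0 := by
  apply regroup_injective S (TP.comp_toTA_same s)
  rw [reg_dRow, reg_dRow, Bar.barD_barD (lA S) (actRₗ S) (lA_mul S) (actR_mul S), LinearMap.map_zero]

theorem dRow_sigmaRow (r s : ℕ) (x : Env k (CrossedProduct S) (W S (r + 1) s)) :
    dRow S (r + 1) s (sigmaRow S (r + 1) s x) + sigmaRow S r s (dRow S r s x) = x := by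
  apply regroup_injective S (TP.comp_toTA_same s)
  rw [LinearMap.map_add, reg_dRow, reg_sigmaRow, reg_sigmaRow, reg_dRow,
    Bar.barD_barS_succ (lA S) (actRₗ S) (lamA S) (lift_lA_lamA S) (lamA_lA S)]

/-! ### The differential of `X_*` -/

theorem proj_surjective (r s : ℕ) : Function.Surjective (proj S r s) :=
  TensorProduct.map_surjective (TP.barPow_surjective k H s) (TP.barPow_surjective k A r)

theorem projX_surjective (r s : ℕ) : Function.Surjective (projX S r s) :=
  LinearMap.lTensor_surjective _ (LinearMap.rTensor_surjective _ (proj_surjective S r s))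

/-- The projection of `E ⊗ T(H / k) ⊗ T(A / k) ⊗ E` to `X_{rs}`. -/
def prX (r s : ℕ) : Ubar S →ₗ[k] X S r s :=
  envMap (TensorProduct.map (TP.comp k (TP.Bar k H) s) (TP.comp k (TP.Bar k A) r))

theorem prX_tmul (r s : ℕ) (e e' : CrossedProduct S) (u : TensorAlgebra k (TP.Bar k H))
    (z : TensorAlgebra k (TP.Bar k A)) : prX S r s (e ⊗ₜ ((u ⊗ₜ z) ⊗ₜ e')) =
      e ⊗ₜ ((TP.comp k _ s u ⊗ₜ TP.comp k _ r z) ⊗ₜ e') := rfl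

theorem projX_envMap_pr (r s : ℕ) (x : U S) :
    projX S r s (envMap (pr S r s) x) = prX S r s (barU S x) := by
  refine LinearMap.congr_fun (f := projX S r s ∘ₗ envMap (pr S r s)) (g := prX S r s ∘ₗ barU S)
    (fourfold_ext fun e u z e' => ?_) x
  rw [comp_apply, comp_apply, barU_tmul, prX_tmul, TP.comp_barTA, TP.comp_barTA]
  rfl

theorem sigma_prX (r s : ℕ) (x : Ubar S) :
    sigma S r s (prX S r s x) = prX S (r + 1) s (sigU S x) := by
  refine LinearMap.congr_fun (f := sigma S r s ∘ₗ prX S r s) (g := prX S (r + 1) s ∘ₗ sigU S)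
    (env_crossed_ext S fun e u z b l => ?_) x
  rw [comp_apply, comp_apply, prX_tmul, sigma_tmul, sigU_tmul,
    LinearMap.map_neg, prX_tmul]
  have h1 : TP.comp k _ (r + 1) (TP.sgn k _ z * ι k (TP.barMk k A b)) =
      (-1 : k) ^ r • TP.snoc k r (TP.comp k _ r z ⊗ₜ TP.barMk k A b) := by
    induction z using TP.ta_toTA_induction with
    | of n z =>
      rw [TP.sgn_toTA, smul_mul_assoc, ← TP.toTA_snoc, LinearMap.map_smul]
      by_cases h : n = r
      · subst h
        rw [TP.comp_toTA_same, TP.comp_toTA_same]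
      · rw [TP.comp_toTA_of_ne (by omega), TP.comp_toTA_of_ne h, zero_tmul, LinearEquiv.map_zero,
          smul_zero, smul_zero]
    | add z z' h h' =>
      rw [map_add (TP.sgn k _), add_mul, LinearMap.map_add, h, h', LinearMap.map_add, add_tmul,
        LinearEquiv.map_add, smul_add]
  rw [h1, tmul_smul, ← smul_tmul', tmul_smul, pow_succ, mul_smul, neg_one_smul, smul_neg]

theorem exists_sum_inc_pr (x : U S) : ∃ Q₀ : Finset (ℕ × ℕ), ∀ Q, Q₀ ⊆ Q →
    ∑ q ∈ Q, envMap (inc S q.1 q.2) (envMap (pr S q.1 q.2) x) = x := by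
  classical
  induction x using TensorProduct.induction_on with
  | zero => exact ⟨∅, fun Q _ => Finset.sum_eq_zero fun q _ => by simp only [LinearMap.map_zero]⟩
  | add x y hx hy =>
    obtain ⟨Q₁, h₁⟩ := hx
    obtain ⟨Q₂, h₂⟩ := hy
    refine ⟨Q₁ ∪ Q₂, fun Q hQ => ?_⟩
    simp only [LinearMap.map_add, Finset.sum_add_distrib]
    rw [h₁ Q (Finset.union_subset_left hQ), h₂ Q (Finset.union_subset_right hQ)]
  | tmul e y =>
  induction y using TensorProduct.induction_on with
  | zero => exact ⟨∅, fun Q _ => by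
      rw [tmul_zero]
      exact Finset.sum_eq_zero fun q _ => by simp only [LinearMap.map_zero]⟩
  | add x y hx hy =>
    obtain ⟨Q₁, h₁⟩ := hx
    obtain ⟨Q₂, h₂⟩ := hy
    refine ⟨Q₁ ∪ Q₂, fun Q hQ => ?_⟩
    simp only [tmul_add, LinearMap.map_add, Finset.sum_add_distrib]
    rw [h₁ Q (Finset.union_subset_left hQ), h₂ Q (Finset.union_subset_right hQ)]
  | tmul v e' =>
  induction v using TensorProduct.induction_on with
  | zero => exact ⟨∅, fun Q _ => by
      rw [zero_tmul, tmul_zero]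
      exact Finset.sum_eq_zero fun q _ => by simp only [LinearMap.map_zero]⟩
  | add x y hx hy =>
    obtain ⟨Q₁, h₁⟩ := hx
    obtain ⟨Q₂, h₂⟩ := hy
    refine ⟨Q₁ ∪ Q₂, fun Q hQ => ?_⟩
    simp only [add_tmul, tmul_add, LinearMap.map_add, Finset.sum_add_distrib]
    rw [h₁ Q (Finset.union_subset_left hQ), h₂ Q (Finset.union_subset_right hQ)]
  | tmul u z =>
  induction u using TP.ta_toTA_induction with
  | add x y hx hy =>
    obtain ⟨Q₁, h₁⟩ := hx
    obtain ⟨Q₂, h₂⟩ := hy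
    refine ⟨Q₁ ∪ Q₂, fun Q hQ => ?_⟩
    simp only [add_tmul, tmul_add, LinearMap.map_add, Finset.sum_add_distrib]
    rw [h₁ Q (Finset.union_subset_left hQ), h₂ Q (Finset.union_subset_right hQ)]
  | of s h =>
  induction z using TP.ta_toTA_induction with
  | add x y hx hy =>
    obtain ⟨Q₁, h₁⟩ := hx
    obtain ⟨Q₂, h₂⟩ := hy
    refine ⟨Q₁ ∪ Q₂, fun Q hQ => ?_⟩
    simp only [add_tmul, tmul_add, LinearMap.map_add, Finset.sum_add_distrib]
    rw [h₁ Q (Finset.union_subset_left hQ), h₂ Q (Finset.union_subset_right hQ)]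
  | of r a =>
    refine ⟨{(r, s)}, fun Q hQ => ?_⟩
    have h1 : (e ⊗ₜ ((TP.toTA k s h ⊗ₜ TP.toTA k r a) ⊗ₜ e') : U S) =
        envMap (inc S r s) (e ⊗ₜ ((h ⊗ₜ a) ⊗ₜ e')) := rfl
    rw [h1, Finset.sum_eq_single (r, s), envMap_pr_inc]
    · intro q _ hq
      rw [envMap_pr_inc_of_ne S (r' := q.1) (s' := q.2) (fun h => hq h.symm), LinearMap.map_zero]
    · exact fun h => absurd (hQ (Finset.mem_singleton_self _)) h

theorem sum_inc_pr_dU (r s n : ℕ) (hn : r + s = n + 1) (w : W S r s) :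
    ∑ q ∈ antidiagonal n,
      envMap (inc S q.1 q.2) (envMap (pr S q.1 q.2) (dU S r s w)) = dU S r s w := by
  classical
  obtain ⟨Q, hQ⟩ := exists_sum_inc_pr S (dU S r s w)
  refine Eq.trans ?_ (hQ (Q ∪ antidiagonal n) Finset.subset_union_left)
  refine Finset.sum_subset Finset.subset_union_right fun q _ hq => ?_
  rw [mem_antidiagonal] at hq
  rw [envMap_pr_dU_of_not S (by omega), LinearMap.map_zero]

theorem prX_barU_dU_eq_zero (r s r' s' : ℕ) (w : W S r s) (hw : proj S r s w = 0) :
    prX S r' s' (barU S (dU S r s w)) = 0 := by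
  rw [dU_apply, LinearMap.map_add, LinearMap.map_add, barU_dPlus_eq_zero S r s w hw,
    LinearMap.map_zero, add_zero, ← projX_envMap_pr]
  by_cases h : r = r' + 1 ∧ s = s'
  · obtain ⟨rfl, rfl⟩ := h
    rw [dZero, comp_apply, envMap_pr_inc, projX_delta0_eq_zero S r' s w hw]
  · rw [envMap_pr_dZero_of_not S h, LinearMap.map_zero]

/-- The components of the differential on generators. -/
def dGen (r s r' s' : ℕ) : Wbar S r s →ₗ[k] X S r' s' :=
  (LinearMap.ker (proj S r s)).liftQ (prX S r' s' ∘ₗ barU S ∘ₗ dU S r s)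
    (fun w hw => prX_barU_dU_eq_zero S r s r' s' w hw) ∘ₗ
  ((proj S r s).quotKerEquivOfSurjective (proj_surjective S r s)).symm.toLinearMap

theorem dGen_proj (r s r' s' : ℕ) (w : W S r s) :
    dGen S r s r' s' (proj S r s w) = projX S r' s' (envMap (pr S r' s') (dU S r s w)) := by
  have h1 : ((proj S r s).quotKerEquivOfSurjective (proj_surjective S r s)).symm (proj S r s w) =
      (LinearMap.ker (proj S r s)).mkQ w := by
    rw [LinearEquiv.symm_apply_eq]; rfl
  rw [dGen, comp_apply, coe_coe, h1, projX_envMap_pr]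
  rfl

/-- The components of the differential. -/
def dX (r s r' s' : ℕ) : X S r s →ₗ[k] X S r' s' := (envStr k _ _).ext (dGen S r s r' s')

theorem dX_envGen (r s r' s' : ℕ) (w : Wbar S r s) :
    dX S r s r' s' (envGen w) = dGen S r s r' s' w := (envStr k _ _).ext_envGen _ w

theorem dX_tmul (r s r' s' : ℕ) (e e' : CrossedProduct S) (w : Wbar S r s) :
    dX S r s r' s' (e ⊗ₜ (w ⊗ₜ e')) = envLeft e (envRight e' (dGen S r s r' s' w)) := rfl

theorem dX_projX (r s r' s' : ℕ) (x : Env k (CrossedProduct S) (W S r s)) :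
    dX S r s r' s' (projX S r s x) = projX S r' s'
      ((envStr k _ _).ext (envMap (pr S r' s') ∘ₗ dU S r s) x) := by
  refine LinearMap.congr_fun (f := dX S r s r' s' ∘ₗ projX S r s) (g := projX S r' s' ∘ₗ
    (envStr k _ _).ext (envMap (pr S r' s') ∘ₗ dU S r s)) (env_ext' fun e w e' => ?_) x
  have h1 : projX S r s (e ⊗ₜ (w ⊗ₜ e')) = e ⊗ₜ (proj S r s w ⊗ₜ e') := rfl
  rw [comp_apply, comp_apply, h1, dX_tmul, dGen_proj, BimodStr.ext_tmul,
    envStr_l, envStr_r, comp_apply, projX]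
  exact ((envMap_envLeft (proj S r' s') e _).trans
    (congrArg _ (envMap_envRight (proj S r' s') e' _))).symm

theorem dX_left (r s r' s' : ℕ) (e : CrossedProduct S) (x : X S r s) :
    dX S r s r' s' (envLeft e x) = envLeft e (dX S r s r' s' x) :=
  ((envStr k _ _).isHom_ext (dGen S r s r' s') e x).1

theorem dX_right (r s r' s' : ℕ) (e : CrossedProduct S) (x : X S r s) :
    dX S r s r' s' (envRight e x) = envRight e (dX S r s r' s' x) :=
  ((envStr k _ _).isHom_ext (dGen S r s r' s') e x).2

theorem dX_off (r s r' s' : ℕ) (h : ¬ (r + s = r' + s' + 1 ∧ s' ≤ s)) : dX S r s r' s' = 0 := by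
  have h1 : dGen S r s r' s' = 0 := by
    refine LinearMap.ext fun w => ?_
    obtain ⟨w, rfl⟩ := proj_surjective S r s w
    rw [dGen_proj, envMap_pr_dU_of_not S h, LinearMap.map_zero, LinearMap.zero_apply]
  rw [dX, h1]
  exact env_ext' fun e w e' => by
    rw [BimodStr.ext_tmul, LinearMap.zero_apply, LinearMap.map_zero, LinearMap.map_zero,
      LinearMap.zero_apply]

theorem dX_zero (r s : ℕ) (w : W S (r + 1) s) :
    dX S (r + 1) s r s (envGen (proj S (r + 1) s w)) = projX S r s (delta0 S r s w) := by
  rw [dX_envGen, dGen_proj, envMap_pr_dU_zero]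

theorem dX_projX_zero (r s : ℕ) (x : Env k (CrossedProduct S) (W S (r + 1) s)) :
    dX S (r + 1) s r s (projX S (r + 1) s x) = projX S r s (dRow S r s x) := by
  have h1 : envMap (pr S r s) ∘ₗ dU S (r + 1) s = delta0 S r s :=
    LinearMap.ext (envMap_pr_dU_zero S r s)
  rw [dX_projX, h1]

theorem dX_projX_of_lt {r s r' s' : ℕ} (h : s' < s) (x : Env k (CrossedProduct S) (W S r s)) :
    dX S r s r' s' (projX S r s x) =
      prX S r' s' (barU S (dPlusX S (r + s) (envMap (inc S r s) x))) := by
  rw [dX_projX, ← projX_envMap_pr]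
  refine congrArg _ ?_
  refine LinearMap.congr_fun (f := (envStr k _ _).ext (envMap (pr S r' s') ∘ₗ dU S r s))
    (g := envMap (pr S r' s') ∘ₗ dPlusX S (r + s) ∘ₗ envMap (inc S r s))
    (env_ext' fun e w e' => ?_) x
  have h1 : envMap (inc S r s) (e ⊗ₜ (w ⊗ₜ e')) = e ⊗ₜ (inc S r s w ⊗ₜ e') := rfl
  rw [BimodStr.ext_tmul, envStr_l, envStr_r, comp_apply, comp_apply,
    comp_apply, h1, dPlusX_tmul, dU_apply, LinearMap.map_add,
    envMap_pr_dZero_of_not S (by omega), zero_add, envMap_envLeft, envMap_envRight]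

theorem prX_dPlusX_of_not {N r s r' s' : ℕ} (hn : ¬ (r + s = r' + s' + 1 ∧ s' < s))
    (x : Env k (CrossedProduct S) (W S r s)) :
    prX S r' s' (barU S (dPlusX S N (envMap (inc S r s) x))) = 0 := by
  rw [← projX_envMap_pr]
  refine LinearMap.congr_fun (f := projX S r' s' ∘ₗ envMap (pr S r' s') ∘ₗ dPlusX S N ∘ₗ
    envMap (inc S r s)) (g := 0) (env_ext' fun e w e' => ?_) x
  have h1 : envMap (inc S r s) (e ⊗ₜ (w ⊗ₜ e')) = e ⊗ₜ (inc S r s w ⊗ₜ e') := rfl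
  rw [comp_apply, comp_apply,
    comp_apply, h1, dPlusX_tmul, envMap_envLeft, envMap_envRight,
    envMap_pr_dPlus_of_not S hn, LinearMap.map_zero, LinearMap.map_zero, LinearMap.map_zero,
    LinearMap.zero_apply]

theorem sum_dX_dX (r s r' s' : ℕ) (hs : r + s = r' + s' + 2) (w : W S r s) :
    ∑ q ∈ antidiagonal (r' + s' + 1) with s' < q.2 ∧ q.2 ≤ s,
        sigma S r' s' (dX S q.1 q.2 r' s' (dX S r s q.1 q.2 (envGen (proj S r s w)))) =
      prX S (r' + 1) s' (sigU S (barU S (dPlusX S (r' + s' + 1) (dU S r s w)))) := by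
  conv_rhs => rw [← sum_inc_pr_dU S r s (r' + s' + 1) (by omega) w]
  rw [map_sum (dPlusX S _), map_sum (barU S), map_sum (sigU S), map_sum (prX S _ _)]
  refine Eq.trans (Finset.sum_congr rfl fun q hq => ?_) (Finset.sum_filter_of_ne fun q hq hne => ?_)
  · rw [Finset.mem_filter, mem_antidiagonal] at hq
    rw [dX_envGen, dGen_proj, dX_projX_of_lt S hq.2.1, hq.1, sigma_prX]
  · rw [mem_antidiagonal] at hq
    by_contra hc
    refine hne ?_
    rw [← sigma_prX]
    by_cases h : q.2 ≤ s
    · rw [prX_dPlusX_of_not S (by omega), LinearMap.map_zero]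
    · rw [envMap_pr_dU_of_not S (by omega), LinearMap.map_zero, LinearMap.map_zero,
        LinearMap.map_zero, LinearMap.map_zero, LinearMap.map_zero]

theorem envMap_envL {B V V' : Type*} [Ring B] [Algebra k B] [AddCommGroup V] [Module k V]
    [AddCommGroup V'] [Module k V'] (f : V →ₗ[k] V') (x : B ⊗[k] V) :
    envMap f (envL x) = envL (f.lTensor B x) :=
  LinearMap.congr_fun (f := envMap f ∘ₗ envL) (g := envL ∘ₗ f.lTensor B)
    (ext' fun _ _ => rfl) x

theorem sigU_dPlusX_dZero (N r s : ℕ) (h : ⨂[k]^s H) (y : ⨂[k]^r A) (a : A) :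
    sigU S (barU S (dPlusX S N (dZero S (r + 1) s (h ⊗ₜ TP.snoc k r (y ⊗ₜ a))))) =
      -sigU S (barU S (dPlusX S N
        (1 ⊗ₜ ((TP.toTA k s h ⊗ₜ TP.sgn k A (TP.toTA k r y)) ⊗ₜ inA S a)))) := by
  have h1 : ∀ x, sigU S (barU S (dPlusX S N (envMap (inc S r s) (envL x)))) = 0 := fun x => by
    rw [envMap_envL, sigU_dPlusX_envL]
  have h2 : ∀ w : W S r s, (envGen w : Env k (CrossedProduct S) _) = envL (1 ⊗ₜ w) := fun w => rfl
  have h3 : envMap (inc S r s) (envR ((inA S).lTensor _ ((assoc k _ _ A).symm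
      ((TP.snoc k r).symm.toLinearMap.lTensor _ (h ⊗ₜ TP.snoc k r (y ⊗ₜ a)))))) =
      (1 ⊗ₜ ((TP.toTA k s h ⊗ₜ TP.toTA k r y) ⊗ₜ inA S a) : U S) := by
    rw [lTensor_tmul, coe_coe, symm_apply_apply]
    rfl
  rw [dZero, comp_apply, delta0]
  simp only [LinearMap.add_apply, LinearMap.map_add, LinearMap.sum_apply, LinearMap.smul_apply,
    map_sum, LinearMap.map_smul, comp_apply, h2, h1, smul_zero, Finset.sum_const_zero,
    zero_add, coe_coe]
  rw [h3, sgn_toTA_pow, tmul_smul, ← smul_tmul', tmul_smul, LinearMap.map_smul, LinearMap.map_smul,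
    LinearMap.map_smul, pow_succ, mul_smul, neg_one_smul, smul_neg]

theorem prX_asL_one (r s : ℕ) (x : CrossedProduct S ⊗[k] TensorAlgebra k (TP.Bar k H)) :
    prX S (r + 1) s (asL S _ _ (x ⊗ₜ 1)) = 0 := by
  refine LinearMap.congr_fun (f := prX S (r + 1) s ∘ₗ asL S _ _ ∘ₗ (TensorProduct.mk k _ _).flip 1)
    (g := 0) (ext' fun e w => ?_) x
  rw [comp_apply, comp_apply, flip_apply, mk_apply,
    asL_tmul, prX_tmul, ← TP.toTA_nil, TP.comp_toTA_of_ne (by omega), tmul_zero, zero_tmul,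
    tmul_zero]
  rfl

theorem prX_putH_one (r s : ℕ) (f : TensorAlgebra k H →ₗ[k] H)
    (x : TensorAlgebra k H ⊗[k] TensorAlgebra k H) :
    prX S (r + 1) s (putH S ((TensorProduct.mk k _ H 1 ∘ₗ f).lTensor _ x)) = 0 := by
  refine LinearMap.congr_fun (f := prX S (r + 1) s ∘ₗ putH S ∘ₗ
    (TensorProduct.mk k _ H 1 ∘ₗ f).lTensor _) (g := 0) (ext' fun u v => ?_) x
  rw [comp_apply, comp_apply, lTensor_tmul, comp_apply,
    mk_apply, putH, comp_apply, comp_apply, putUH_tmul, rH_tmul,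
    barU_tmul, prX_tmul, map_one (TP.barTA k A), ← TP.toTA_nil, TP.comp_toTA_of_ne (by omega),
    tmul_zero, zero_tmul, tmul_zero]
  rfl

theorem prX_recursion (r s n r' s' : ℕ) (hs : s' < s) (hn : r + s = n + 1) (w : W S r s) :
    prX S (r' + 1) s' (barU S (dU S r s w)) +
      prX S (r' + 1) s' (sigU S (barU S (dPlusX S n (dU S r s w)))) = 0 := by
  have h0 : prX S (r' + 1) s' (barU S (dZero S r s w)) = 0 := by
    rw [← projX_envMap_pr, envMap_pr_dZero_of_not S (by omega), LinearMap.map_zero]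
  rw [dU_apply, hn, LinearMap.map_add, LinearMap.map_add, h0, zero_add]
  clear h0
  simp only [LinearMap.map_add]
  rcases r with _ | r
  · suffices key : prX S (r' + 1) s' ∘ₗ (barU S ∘ₗ rH S ∘ₗ dPlus S (n + 1) +
        sigU S ∘ₗ barU S ∘ₗ dPlusX S n ∘ₗ rH S ∘ₗ dPlus S (n + 1)) ∘ₗ inc S 0 s = 0 by
      have h1 := LinearMap.congr_fun key w
      simp only [comp_apply, LinearMap.add_apply, LinearMap.map_add] at h1
      rw [dZero, LinearMap.zero_apply]
      simp only [LinearMap.map_zero, zero_add]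
      exact h1
    refine ext' fun h y => ?_
    obtain ⟨c, rfl⟩ := TP.zero_eq_smul_nil y
    rw [tmul_smul, LinearMap.map_smul]
    refine (congrArg _ ?_).trans (smul_zero c)
    have h2 := congrArg (prX S (r' + 1) s') (recursion_one S n (TP.toTA k s h))
    rw [prX_putH_one S r' s' (TP.deg1 k H ∘ₗ TP.sgp k H (n + 1)), LinearMap.map_add] at h2
    rw [comp_apply, comp_apply, inc_tmul, TP.toTA_nil]
    simp only [LinearMap.add_apply, comp_apply]
    rw [LinearMap.map_add, ← h2]
    refine congrArg (· + _) ?_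
    rw [dPlus_apply, LinearMap.map_add, LinearMap.map_add, LinearMap.map_add, dMerge_eq,
      map_one (TP.sgn k A), barU_rH_putE, map_one (TP.barTA k A), prX_asL_one, zero_add]
  · suffices key : prX S (r' + 1) s' ∘ₗ (barU S ∘ₗ rH S ∘ₗ dPlus S (n + 1) ∘ₗ inc S (r + 1) s +
        (sigU S ∘ₗ barU S ∘ₗ dPlusX S n ∘ₗ dZero S (r + 1) s +
        sigU S ∘ₗ barU S ∘ₗ dPlusX S n ∘ₗ rH S ∘ₗ dPlus S (n + 1) ∘ₗ inc S (r + 1) s)) = 0 by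
      have h1 := LinearMap.congr_fun key w
      simp only [comp_apply, LinearMap.add_apply, LinearMap.map_add] at h1
      exact h1
    refine ext' fun h y => ?_
    rw [comp_apply]
    refine (congrArg _ ?_).trans (LinearMap.map_zero _)
    induction y using TP.snoc_induction with
    | zero => rw [tmul_zero, LinearMap.map_zero]
    | add x y hx hy => rw [tmul_add, LinearMap.map_add, hx, hy, add_zero]
    | snoc y a =>
      simp only [LinearMap.add_apply, comp_apply]
      rw [sigU_dPlusX_dZero, inc_tmul, TP.toTA_snoc, ← recursion_mul_ι]
      abel

theorem dX_recursion (r s r' s' : ℕ) (hs : s' < s) (hn : r + s = r' + s' + 2) (w : Wbar S r s) :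
    dX S r s (r' + 1) s' (envGen w) =
      - ∑ q ∈ antidiagonal (r' + s' + 1) with s' < q.2 ∧ q.2 ≤ s,
        sigma S r' s' (dX S q.1 q.2 r' s' (dX S r s q.1 q.2 (envGen w))) := by
  obtain ⟨w, rfl⟩ := proj_surjective S r s w
  rw [sum_dX_dX S r s r' s' hn w, dX_envGen, dGen_proj, projX_envMap_pr]
  exact eq_neg_of_add_eq_zero_left (prX_recursion S r s (r' + s' + 1) r' s' hs hn w)

end CrossedSystem

namespace TP

variable {k V : Type*} [CommRing k] [AddCommGroup V] [Module k V]

theorem ta_hom_ext_snoc {N : Type*} [AddCommGroup N] [Module k N] {f g : TensorAlgebra k V →ₗ[k] N}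
    (h1 : f 1 = g 1)
    (h : ∀ w v, f (w * ι k v) = g (w * ι k v)) : f = g := by
  refine ta_hom_ext fun n w => ?_
  rcases n with _ | n
  · obtain ⟨c, rfl⟩ := zero_eq_smul_nil w
    rw [LinearMap.map_smul, LinearMap.map_smul, LinearMap.map_smul, toTA_nil, h1]
  · refine LinearMap.congr_fun (f := f ∘ₗ toTA k (n + 1)) (g := g ∘ₗ toTA k (n + 1))
      (hom_ext_snoc fun w v => ?_) w
    rw [comp_apply, comp_apply, toTA_snoc, h]

/-- `w * v ↦ w ⊗ v` and `1 ↦ 0`. -/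
def unsnoc (k V : Type*) [CommRing k] [AddCommGroup V] [Module k V] :
    TensorAlgebra k V →ₗ[k] TensorAlgebra k V ⊗[k] V :=
  recTA 0 (((LinearMap.lsmul k _).flip ∘ₗ TensorProduct.mk k _ _ 1).compl₂ (aug k V).toLinearMap)
    (LinearMap.rTensorHom V ∘ₗ LinearMap.mul k _ ∘ₗ ι k)

theorem unsnoc_one : unsnoc k V 1 = 0 := recTA_one _ _ _

theorem unsnoc_ι_mul (v : V) (w : TensorAlgebra k V) :
    unsnoc k V (ι k v * w) = aug k V w • 1 ⊗ₜ v +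
      (mulLeft k (ι k v)).rTensor V (unsnoc k V w) :=
  recTA_ι_mul _ _ _ v w

theorem unsnoc_mul_ι (w : TensorAlgebra k V) (v : V) :
    unsnoc k V (w * ι k v) = w ⊗ₜ v := by
  refine LinearMap.congr_fun (f := unsnoc k V ∘ₗ mulRight k (ι k v))
    (g := (TensorProduct.mk k _ _).flip v) (ta_hom_ext' ?_ fun u w ih => ?_) w
  · have := unsnoc_ι_mul v (1 : TensorAlgebra k V)
    rw [unsnoc_one, LinearMap.map_zero, add_zero, map_one, one_smul, mul_one] at this
    simpa using this
  · simp only [comp_apply, LinearMap.mulRight_apply, flip_apply,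
      mk_apply] at ih ⊢
    rw [mul_assoc, unsnoc_ι_mul, ih, map_mul (aug k V), aug_ι, mul_zero, zero_smul, zero_add]
    rfl

end TP

namespace CrossedSystem

open CrossedProduct BimodStr

variable {k A H : Type*} [CommRing k] [Ring A] [Algebra k A] [Ring H] [Bialgebra k H]
  (S : CrossedSystem k A H)

/-! ### The bottom row -/

/-- `e ⊗ (w * l) ↦ e ⊗ w ⊗ (1 # l)`. -/
def sec : CrossedProduct S ⊗[k] TensorAlgebra k H →ₗ[k]
    Env k (CrossedProduct S) (TensorAlgebra k H) :=
  ((inH S).lTensor _ ∘ₗ TP.unsnoc k H).lTensor _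

theorem sec_tmul (e : CrossedProduct S) (w : TensorAlgebra k H) (l : H) :
    sec S (e ⊗ₜ (w * ι k l)) = e ⊗ₜ (w ⊗ₜ inH S l) := by
  rw [sec, lTensor_tmul, comp_apply, TP.unsnoc_mul_ι, lTensor_tmul]

theorem sec_tmul_one (e : CrossedProduct S) : sec S (e ⊗ₜ 1) = 0 := by
  rw [sec, lTensor_tmul, comp_apply, TP.unsnoc_one, LinearMap.map_zero,
    tmul_zero]

/-- `e ⊗ w ⊗ e' ↦ e (w ⊗ e')`. -/
def star : Env k (CrossedProduct S) (TensorAlgebra k H) →ₗ[k]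
    CrossedProduct S ⊗[k] TensorAlgebra k H :=
  leftExt (CrossedProduct S) (TensorProduct.lift (dia S))

theorem star_tmul (e e' : CrossedProduct S) (w : TensorAlgebra k H) :
    star S (e ⊗ₜ (w ⊗ₜ e')) = e • dia S w e' := rfl

theorem dia_inH (w : TensorAlgebra k H) (l : H) :
    dia S w (inH S l) = 1 ⊗ₜ (w * ι k l) := by
  have h := dia_apply S w 1 l
  rw [inA_one, one_mul, pushT_one_right] at h
  exact h

/-- The projection to degree zero. -/
def dg : CrossedProduct S ⊗[k] TensorAlgebra k H →ₗ[k] CrossedProduct S ⊗[k] TensorAlgebra k H :=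
  (LinearMap.toSpanSingleton k _ 1 ∘ₗ (TP.aug k H).toLinearMap).lTensor _

theorem dg_tmul (e : CrossedProduct S) (w : TensorAlgebra k H) :
    dg S (e ⊗ₜ w) = e ⊗ₜ (TP.aug k H w • 1) := rfl

theorem star_sec (x : CrossedProduct S ⊗[k] TensorAlgebra k H) :
    star S (sec S x) = x - dg S x := by
  refine LinearMap.congr_fun (f := star S ∘ₗ sec S) (g := LinearMap.id - dg S)
    (ext' fun e w => ?_) x
  refine LinearMap.congr_fun (f := (star S ∘ₗ sec S) ∘ₗ TensorProduct.mk k _ _ e)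
    (g := (LinearMap.id - dg S) ∘ₗ TensorProduct.mk k _ _ e) (TP.ta_hom_ext_snoc ?_ fun w l => ?_) w
  · simp only [comp_apply, mk_apply, LinearMap.sub_apply,
      id_apply]
    rw [sec_tmul_one, LinearMap.map_zero, dg_tmul, map_one, one_smul, sub_self]
  · simp only [comp_apply, mk_apply, LinearMap.sub_apply,
      id_apply]
    rw [sec_tmul, star_tmul, dia_inH, dg_tmul, map_mul (TP.aug k H), TP.aug_ι, mul_zero, zero_smul,
      tmul_zero, sub_zero, smul_tmul', smul_eq_mul, mul_one]

theorem dg_jj (x : CrossedProduct S ⊗[k] TensorAlgebra k H) : dg S (jj S x) = 0 := by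
  refine LinearMap.congr_fun (f := dg S ∘ₗ jj S) (g := 0) (eth_hom_ext S fun b l w => ?_) x
  rw [comp_apply, jj_tmul, dg_tmul, map_mul (TP.aug k H), TP.aug_ι, zero_mul, zero_smul,
    tmul_zero]
  rfl

theorem mergeX_dg (x : CrossedProduct S ⊗[k] TensorAlgebra k H) : mergeX S (dg S x) = 0 := by
  refine LinearMap.congr_fun (f := mergeX S ∘ₗ dg S) (g := 0) (ext' fun e w => ?_) x
  rw [comp_apply, dg_tmul, leftExt_tmul, LinearMap.map_smul, mergeE_one, smul_zero,
    smul_zero]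
  rfl

theorem dg_star (x : Env k (CrossedProduct S) (TensorAlgebra k H)) : dg S (star S x) = 0 := by
  refine LinearMap.congr_fun (f := dg S ∘ₗ star S) (g := 0) (env_ext' fun e w e' => ?_) x
  have h1 : ∀ w, dg S (dia S w e') = 0 := fun w =>
    LinearMap.congr_fun (f := dg S ∘ₗ (dia S).flip e') (g := 0) (TP.ta_hom_ext' (by
      rw [comp_apply, flip_apply, dia_one, dg_jj]; rfl) fun h w _ => by
      rw [comp_apply, flip_apply, dia_ι_mul, jjH_apply, dg_jj]; rfl) w
  have h2 : ∀ z, dg S (e • z) = e • dg S z := fun z => lTensor_smul' _ _ _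
  rw [comp_apply, star_tmul, h2, h1, smul_zero]
  rfl

theorem star_sec_star (x : Env k (CrossedProduct S) (TensorAlgebra k H)) :
    star S (sec S (star S x)) = star S x := by
  rw [star_sec, dg_star, sub_zero]

/-- `w * l ↦ ∓ 1 ⊗ w ⊗ (1 # l)`. -/
def tl : TensorAlgebra k H →ₗ[k] Env k (CrossedProduct S) (TensorAlgebra k H) :=
  TensorProduct.mk k _ _ 1 ∘ₗ TensorProduct.map (-(TP.sgn k H).toLinearMap) (inH S) ∘ₗ TP.unsnoc k H

theorem tl_one : tl S 1 = 0 := by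
  rw [tl, comp_apply, comp_apply, TP.unsnoc_one, LinearMap.map_zero,
    LinearMap.map_zero]

theorem tl_mul_ι (w : TensorAlgebra k H) (l : H) :
    tl S (w * ι k l) = -(1 ⊗ₜ (TP.sgn k H w ⊗ₜ inH S l)) := by
  rw [tl, comp_apply, comp_apply, TP.unsnoc_mul_ι, map_tmul,
    LinearMap.neg_apply, neg_tmul, LinearMap.map_neg]
  rfl

theorem mergeE_mul_ι_one (w : TensorAlgebra k H) : mergeE S (w * ι k 1) =
    (mulRight k (ι k 1)).lTensor _ (mergeE S w) + dial S w 1 := by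
  have h := mergeX_dia S w 1
  have h1 : ∀ w : TensorAlgebra k H, dia S w 1 = 1 ⊗ₜ (w * ι k 1) := fun w => dia_inH S w 1
  rw [h1, leftExt_one_tmul] at h
  rw [h]
  refine congrArg (· + _) (LinearMap.congr_fun (f := diaX S 1)
    (g := (mulRight k (ι k 1)).lTensor _)
    (ext' fun e w => ?_) _)
  rw [leftExt_tmul, flip_apply, h1, smul_tmul', smul_eq_mul, mul_one]
  rfl

theorem sec_mergeE (w : TensorAlgebra k H) :
    sec S (mergeE S (w * ι k 1)) = envL (mergeE S w) + tl S w := by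
  rw [mergeE_mul_ι_one, LinearMap.map_add]
  refine congrArg₂ (· + ·) ?_ ?_
  · refine LinearMap.congr_fun (f := sec S ∘ₗ
      (mulRight k (ι k 1)).lTensor _) (g := envL)
      (ext' fun e w => ?_) _
    rw [comp_apply, lTensor_tmul, LinearMap.mulRight_apply, sec_tmul, inH_one]
    rfl
  · refine LinearMap.congr_fun (f := sec S ∘ₗ (dial S).flip 1) (g := tl S)
      (TP.ta_hom_ext_snoc ?_ fun w l => ?_) w
    · rw [comp_apply, flip_apply, dial_one, sec_tmul_one, tl_one]
    · rw [comp_apply, flip_apply, dial_mul_ι, mul_one, dia_inH, tl_mul_ι,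
        map_neg (sec S), sec_tmul]

/-- The differential of the bottom row. -/
def D1 : Env k (CrossedProduct S) (TensorAlgebra k H) →ₗ[k]
    Env k (CrossedProduct S) (TensorAlgebra k H) := (envStr k _ _).ext (envL ∘ₗ mergeE S + tl S)

theorem D1_tmul (e e' : CrossedProduct S) (w : TensorAlgebra k H) :
    D1 S (e ⊗ₜ (w ⊗ₜ e')) = envLeft e (envRight e' (envL (mergeE S w) + tl S w)) := rfl

/-- `e ⊗ w ⊗ e' ↦ e e'`, for `w` of degree zero. -/
def eps : Env k (CrossedProduct S) (TensorAlgebra k H) →ₗ[k] CrossedProduct S :=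
  (regular k _).ext (Algebra.linearMap k _ ∘ₗ (TP.aug k H).toLinearMap)

theorem eps_tmul (e e' : CrossedProduct S) (w : TensorAlgebra k H) :
    eps S (e ⊗ₜ (w ⊗ₜ e')) = TP.aug k H w • (e * e') := by
  rw [eps, BimodStr.ext_tmul]
  change e * (algebraMap k _ (TP.aug k H w) * e') = _
  rw [← Algebra.smul_def, mul_smul_comm]

theorem star_D1 (x : Env k (CrossedProduct S) (TensorAlgebra k H)) :
    star S (D1 S x) = mergeX S (star S x) - eps S x ⊗ₜ 1 := by
  refine LinearMap.congr_fun (f := star S ∘ₗ D1 S) (g := mergeX S ∘ₗ star S -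
    (TensorProduct.mk k _ _).flip 1 ∘ₗ eps S) (env_ext' fun e w e' => ?_) x
  have h1 : ∀ x, star S (envLeft e x) = e • star S x := fun x =>
    LinearMap.congr_fun (f := star S ∘ₗ envLeft e) (g := lsm k _ _ e ∘ₗ star S)
      (env_ext' fun b w b' => by
        rw [comp_apply, comp_apply, lsm_apply, star_tmul, ← mul_smul]
        rfl) x
  have h2 : ∀ x, star S (envRight e' (envL x)) = diaX S e' x := fun x =>
    LinearMap.congr_fun (f := star S ∘ₗ envRight e' ∘ₗ envL) (g := diaX S e')
      (ext' fun b w => by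
        change b • dia S w (1 * e') = b • dia S w e'
        rw [one_mul]) x
  have h3 : star S (envRight e' (tl S w)) + TP.aug k H w • e' ⊗ₜ 1 = dial S w e' := by
    refine LinearMap.congr_fun (f := star S ∘ₗ envRight e' ∘ₗ tl S +
      LinearMap.toSpanSingleton k _ (e' ⊗ₜ 1) ∘ₗ (TP.aug k H).toLinearMap) (g := (dial S).flip e')
      (TP.ta_hom_ext_snoc ?_ fun w l => ?_) w
    · rw [LinearMap.add_apply, comp_apply, comp_apply, tl_one,
        LinearMap.map_zero, LinearMap.map_zero, zero_add,
        flip_apply, dial_one, comp_apply, toLinearMap_apply, map_one,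
        LinearMap.toSpanSingleton_apply, one_smul]
    · rw [LinearMap.add_apply, comp_apply, comp_apply, tl_mul_ι,
        flip_apply, dial_mul_ι, comp_apply, toLinearMap_apply,
        map_mul (TP.aug k H), TP.aug_ι, mul_zero, LinearMap.map_zero, add_zero, LinearMap.map_neg,
        LinearMap.map_neg]
      change -((1 : CrossedProduct S) • dia S _ (inH S l * e')) = _
      rw [one_smul]
      rfl
  rw [comp_apply, D1_tmul, h1, LinearMap.map_add, LinearMap.map_add,
    h2, LinearMap.sub_apply, comp_apply, comp_apply, eps_tmul, star_tmul,
    leftExt_smul, mergeX_dia, ← h3, ← add_assoc, smul_add, smul_add, flip_apply,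
    mk_apply]
  have h4 : e • (TP.aug k H w • (e' ⊗ₜ[k] (1 : TensorAlgebra k H))) =
      (TP.aug k H w • (e * e')) ⊗ₜ 1 := by
    rw [smul_tmul', smul_tmul', smul_eq_mul, mul_smul_comm]
  rw [h4, smul_add]
  abel

/-- The projection of the bottom row that is homotopic to zero. -/
abbrev pi0 : Env k (CrossedProduct S) (TensorAlgebra k H) →ₗ[k]
    Env k (CrossedProduct S) (TensorAlgebra k H) := sec S ∘ₗ star S

theorem pi0_D1 (x : Env k (CrossedProduct S) (TensorAlgebra k H)) :
    pi0 S (D1 S x) = sec S (mergeX S (star S x)) := by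
  rw [comp_apply, star_D1, LinearMap.map_sub, sec_tmul_one, sub_zero]

theorem pi0_D1_pi0 (x : Env k (CrossedProduct S) (TensorAlgebra k H)) :
    pi0 S (D1 S (pi0 S x)) = pi0 S (D1 S x) := by
  rw [pi0_D1, pi0_D1, comp_apply, star_sec_star]

theorem pi0_D1_pi0_D1 (x : Env k (CrossedProduct S) (TensorAlgebra k H)) :
    pi0 S (D1 S (pi0 S (D1 S x))) = 0 := by
  rw [pi0_D1, pi0_D1, star_sec, LinearMap.map_sub, mergeX_dg, mergeX_mergeX, sub_zero,
    LinearMap.map_zero]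

/-- `(b # l) ⊗ w ⊗ e' ↦ (b # 1) ⊗ (l * w) ⊗ e'`. -/
def jX : Env k (CrossedProduct S) (TensorAlgebra k H) →ₗ[k]
    Env k (CrossedProduct S) (TensorAlgebra k H) :=
  (assoc k _ _ _).toLinearMap ∘ₗ (jj S).rTensor _ ∘ₗ
    (assoc k _ _ _).symm.toLinearMap

theorem jX_tmul (b : A) (l : H) (w : TensorAlgebra k H) (e' : CrossedProduct S) :
    jX S ((inA S b * inH S l) ⊗ₜ (w ⊗ₜ e')) = inA S b ⊗ₜ ((ι k l * w) ⊗ₜ e') := by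
  rw [jX, comp_apply, comp_apply, coe_coe, coe_coe,
    assoc_symm_tmul, rTensor_tmul, jj_tmul, assoc_tmul]

theorem star_jX (x : Env k (CrossedProduct S) (TensorAlgebra k H)) :
    star S (jX S x) = jj S (star S x) := by
  refine LinearMap.congr_fun (f := star S ∘ₗ jX S) (g := jj S ∘ₗ star S)
    (eth_hom_ext S fun b l y => ?_) x
  refine LinearMap.congr_fun (f := (star S ∘ₗ jX S) ∘ₗ TensorProduct.mk k _ _ (inA S b * inH S l))
    (g := (jj S ∘ₗ star S) ∘ₗ TensorProduct.mk k _ _ (inA S b * inH S l))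
    (ext' fun w e' => ?_) y
  simp only [comp_apply, mk_apply]
  rw [jX_tmul, star_tmul, star_tmul, dia_ι_mul, jjH_apply, mul_smul, jj_inA_smul]

theorem sec_jj (x : CrossedProduct S ⊗[k] TensorAlgebra k H) :
    sec S (jj S x) = jX S (sec S x) + sec S (jj S (dg S x)) := by
  refine LinearMap.congr_fun (f := sec S ∘ₗ jj S) (g := jX S ∘ₗ sec S + sec S ∘ₗ jj S ∘ₗ dg S)
    (eth_hom_ext S fun b l w => ?_) x
  refine LinearMap.congr_fun (f := (sec S ∘ₗ jj S) ∘ₗ TensorProduct.mk k _ _ (inA S b * inH S l))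
    (g := (jX S ∘ₗ sec S + sec S ∘ₗ jj S ∘ₗ dg S) ∘ₗ TensorProduct.mk k _ _ (inA S b * inH S l))
    (TP.ta_hom_ext_snoc ?_ fun w g => ?_) w
  · simp only [comp_apply, mk_apply, LinearMap.add_apply]
    rw [sec_tmul_one, LinearMap.map_zero, zero_add, dg_tmul, map_one, one_smul]
  · simp only [comp_apply, mk_apply, LinearMap.add_apply]
    rw [jj_tmul, ← mul_assoc, sec_tmul, sec_tmul, jX_tmul, dg_tmul, map_mul (TP.aug k H), TP.aug_ι,
      mul_zero, zero_smul, tmul_zero, LinearMap.map_zero, LinearMap.map_zero, add_zero]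

theorem dg_mergeX_star (x : Env k (CrossedProduct S) (TensorAlgebra k H)) :
    dg S (mergeX S (star S x)) = eps S x ⊗ₜ 1 := by
  have h := congrArg (dg S) (star_D1 S x)
  rw [dg_star, LinearMap.map_sub, dg_tmul, map_one, one_smul] at h
  exact (sub_eq_zero.1 h.symm)

/-- The homotopy of the bottom row. -/
theorem pi0_D1_jX (x : Env k (CrossedProduct S) (TensorAlgebra k H)) :
    pi0 S (D1 S (jX S (pi0 S x))) =
      pi0 S x - jX S (pi0 S (D1 S x)) - sec S (jj S (eps S x ⊗ₜ 1)) := by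
  rw [pi0_D1, star_jX, comp_apply, star_sec_star, mergeX_jj, LinearMap.map_sub, sec_jj,
    pi0_D1, dg_mergeX_star, sub_add_eq_sub_sub]

/-- `w ↦ w ⊗ 1`, in degree `s`. -/
def bot (s : ℕ) : TensorAlgebra k H →ₗ[k] W S 0 s :=
  (TensorProduct.mk k _ _).flip (TP.nil k A) ∘ₗ TP.comp k H s

theorem bot_toTA (s : ℕ) (h : ⨂[k]^s H) : bot S s (TP.toTA k s h) = h ⊗ₜ TP.nil k A := by
  rw [bot, comp_apply, TP.comp_toTA_same]; rfl

theorem bot_toTA_of_ne {m s : ℕ} (hm : m ≠ s) (h : ⨂[k]^m H) : bot S s (TP.toTA k m h) = 0 := by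
  rw [bot, comp_apply, TP.comp_toTA_of_ne hm, LinearMap.map_zero]

/-- The projection of `E ⊗ T(H) ⊗ E` to `X_{0s}`. -/
def prV (s : ℕ) : Env k (CrossedProduct S) (TensorAlgebra k H) →ₗ[k] X S 0 s :=
  projX S 0 s ∘ₗ envMap (bot S s)

theorem prV_tmul (s : ℕ) (e e' : CrossedProduct S) (w : TensorAlgebra k H) :
    prV S s (e ⊗ₜ (w ⊗ₜ e')) = projX S 0 s (e ⊗ₜ (bot S s w ⊗ₜ e')) := rfl

theorem prV_envLeft (s : ℕ) (e : CrossedProduct S)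
    (x : Env k (CrossedProduct S) (TensorAlgebra k H)) :
    prV S s (envLeft e x) = envLeft e (prV S s x) :=
  LinearMap.congr_fun (f := prV S s ∘ₗ envLeft e) (g := envLeft e ∘ₗ prV S s)
    (env_ext' fun _ _ _ => rfl) x

theorem prV_envRight (s : ℕ) (e : CrossedProduct S)
    (x : Env k (CrossedProduct S) (TensorAlgebra k H)) :
    prV S s (envRight e x) = envRight e (prV S s x) :=
  LinearMap.congr_fun (f := prV S s ∘ₗ envRight e) (g := envRight e ∘ₗ prV S s)
    (env_ext' fun _ _ _ => rfl) x

theorem prV_surjective (s : ℕ) : Function.Surjective (prV S s) := by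
  refine (projX_surjective S 0 s).comp (LinearMap.lTensor_surjective _
    (LinearMap.rTensor_surjective _ fun x => ?_))
  induction x using TensorProduct.induction_on with
  | zero => exact ⟨0, LinearMap.map_zero _⟩
  | tmul h y =>
    obtain ⟨c, rfl⟩ := TP.zero_eq_smul_nil y
    exact ⟨c • TP.toTA k s h, by rw [LinearMap.map_smul, bot_toTA, tmul_smul]⟩
  | add x y hx hy =>
    obtain ⟨x, rfl⟩ := hx
    obtain ⟨y, rfl⟩ := hy
    exact ⟨x + y, LinearMap.map_add _ _ _⟩

theorem prX_asL (s : ℕ) (x : CrossedProduct S ⊗[k] TensorAlgebra k H) :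
    prX S 0 s (asL S _ _ (barE S x ⊗ₜ 1)) = prV S s (envL x) := by
  refine LinearMap.congr_fun (f := prX S 0 s ∘ₗ asL S _ _ ∘ₗ (TensorProduct.mk k _ _).flip 1 ∘ₗ
    barE S) (g := prV S s ∘ₗ envL) (ext' fun e w => ?_) x
  simp only [comp_apply, lTensor_tmul, flip_apply,
    mk_apply, toLinearMap_apply]
  rw [asL_tmul, prX_tmul, TP.comp_barTA, ← TP.toTA_nil, TP.comp_toTA_same]
  change _ = e ⊗ₜ ((TP.barPow k H s (TP.comp k H s w) ⊗ₜ TP.barPow k A 0 (TP.nil k A)) ⊗ₜ 1)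
  rw [TP.barPow_nil]

theorem dGen_bot (s : ℕ) (w : TensorAlgebra k H) :
    dGen S 0 (s + 1) 0 s (proj S 0 (s + 1) (bot S (s + 1) w)) =
      prV S s (envL (mergeE S w) + tl S w) := by
  refine LinearMap.congr_fun (f := dGen S 0 (s + 1) 0 s ∘ₗ proj S 0 (s + 1) ∘ₗ bot S (s + 1))
    (g := prV S s ∘ₗ (envL ∘ₗ mergeE S + tl S)) (TP.ta_hom_ext fun n h => ?_) w
  simp only [comp_apply, LinearMap.add_apply]
  by_cases hn : n = s + 1
  · subst hn
    rw [bot_toTA, dGen_proj, projX_envMap_pr, dU_apply, dZero, LinearMap.zero_apply, zero_add,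
      dPlus_apply, LinearMap.map_add, LinearMap.map_add, LinearMap.map_add, LinearMap.map_add,
      inc_tmul, TP.toTA_nil, dMerge_eq, map_one (TP.sgn k A), barU_rH_putE, map_one (TP.barTA k A),
      prX_asL]
    refine congrArg (_ + ·) ?_
    rw [← TP.toTA_nil, ← inc_tmul, ← projX_envMap_pr, envMap_pr_dTail]
    refine LinearMap.congr_fun (f := projX S 0 s ∘ₗ outE S 0 s ∘ₗ
      ((TP.comp k A 0).rTensor H ∘ₗ (gen1 S).flip (TP.toTA k 0 (TP.nil k A)) ∘ₗ
        TP.sgp k H (0 + (s + 1))).lTensor _ ∘ₗ TP.split k H s ∘ₗ TP.toTA k (s + 1))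
      (g := prV S s ∘ₗ tl S ∘ₗ TP.toTA k (s + 1)) (TP.hom_ext_snoc fun u l => ?_) h
    simp only [comp_apply, TP.toTA_snoc, tl_mul_ι, TP.split_toTA_mul,
      lTensor_tmul, TP.sgp_ι, LinearMap.map_smul, flip_apply,
      TP.sgn_toTA]
    rw [LinearMap.smul_apply, TP.toTA_nil, gen1_ι_one, LinearMap.map_smul, rTensor_tmul,
      ← TP.toTA_nil, TP.comp_toTA_same, LinearMap.map_neg, prV_tmul, LinearMap.map_smul, bot_toTA,
      zero_add, tmul_smul, LinearMap.map_smul, LinearMap.map_smul, ← smul_tmul', tmul_smul,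
      LinearMap.map_smul, pow_succ, mul_smul, neg_one_smul, smul_neg]
    rfl
  · rw [bot_toTA_of_ne S hn, LinearMap.map_zero, LinearMap.map_zero]
    rcases n with _ | n
    · obtain ⟨c, rfl⟩ := TP.zero_eq_smul_nil h
      rw [LinearMap.map_smul, TP.toTA_nil, LinearMap.map_smul, LinearMap.map_smul (tl S), mergeE_one,
        tl_one, smul_zero, smul_zero, LinearMap.map_zero, add_zero, LinearMap.map_zero]
    · have h1 : ∀ h, prV S s (tl S (TP.toTA k (n + 1) h)) = 0 := fun h =>
        LinearMap.congr_fun (f := prV S s ∘ₗ tl S ∘ₗ TP.toTA k (n + 1)) (g := 0)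
          (TP.hom_ext_snoc fun u l => by
            rw [comp_apply, comp_apply, TP.toTA_snoc, tl_mul_ι,
              LinearMap.map_neg, TP.sgn_toTA, prV_tmul, LinearMap.map_smul,
              bot_toTA_of_ne S (by omega), smul_zero, zero_tmul, tmul_zero, LinearMap.map_zero,
              neg_zero]
            rfl) h
      rw [LinearMap.map_add, h1, mergeE_toTA_succ, add_zero]
      refine (LinearMap.congr_fun (f := prV S s ∘ₗ envL ∘ₗ (TP.toTA k n).lTensor _) (g := 0)
        (ext' fun e u => ?_) _).symm
      have h2 : (envL (e ⊗ₜ TP.toTA k n u) : Env k (CrossedProduct S) (TensorAlgebra k H)) =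
        e ⊗ₜ (TP.toTA k n u ⊗ₜ 1) := rfl
      rw [comp_apply, comp_apply, lTensor_tmul, h2, prV_tmul,
        bot_toTA_of_ne S (by omega), zero_tmul, tmul_zero, LinearMap.map_zero]
      rfl

theorem dX_prV (s : ℕ) (x : Env k (CrossedProduct S) (TensorAlgebra k H)) :
    dX S 0 (s + 1) 0 s (prV S (s + 1) x) = prV S s (D1 S x) := by
  refine LinearMap.congr_fun (f := dX S 0 (s + 1) 0 s ∘ₗ prV S (s + 1)) (g := prV S s ∘ₗ D1 S)
    (env_ext' fun e w e' => ?_) x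
  have h1 : prV S (s + 1) (e ⊗ₜ (w ⊗ₜ e')) = e ⊗ₜ (proj S 0 (s + 1) (bot S (s + 1) w) ⊗ₜ e') := rfl
  rw [comp_apply, comp_apply, h1, dX_tmul, dGen_bot, D1_tmul, prV_envLeft,
    prV_envRight]

/-! ### The initial condition -/

/-- `a ⊗ (h₀ ⊗ w) ↦ (a # h₀) ⊗ w`. -/
def unY (s : ℕ) : Y S s →ₗ[k] CrossedProduct S ⊗[k] TensorAlgebra k H :=
  (TP.toTA k (s + 1)).lTensor _ ∘ₗ (equiv S).toLinearMap.rTensor _ ∘ₗ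
    (assoc k A H _).symm.toLinearMap ∘ₗ
    (TP.cons k (s + 1)).symm.toLinearMap.lTensor A

theorem unY_tmul (s : ℕ) (a : A) (h : H) (w : ⨂[k]^(s + 1) H) :
    unY S s (a ⊗ₜ TP.cons k (s + 1) (h ⊗ₜ w)) = (inA S a * inH S h) ⊗ₜ TP.toTA k (s + 1) w := by
  simp only [unY, comp_apply, lTensor_tmul, coe_coe,
    symm_apply_apply, assoc_symm_tmul, rTensor_tmul]
  rw [equiv_tmul]

theorem cns_unY (s : ℕ) (y : Y S s) : cns S (unY S s y) = (TP.toTA k (s + 2)).lTensor A y := by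
  refine LinearMap.congr_fun (f := cns S ∘ₗ unY S s) (g := (TP.toTA k (s + 2)).lTensor A)
    (ext' fun a z => ?_) y
  refine LinearMap.congr_fun (f := (cns S ∘ₗ unY S s) ∘ₗ TensorProduct.mk k _ _ a)
    (g := (TP.toTA k (s + 2)).lTensor A ∘ₗ TensorProduct.mk k _ _ a)
    (TP.hom_ext_succ fun h w => ?_) z
  simp only [comp_apply, mk_apply]
  rw [unY_tmul, cns_tmul, lTensor_tmul, TP.toTA_cons]

theorem cns_injective : Function.Injective (cns S) := by
  refine Function.LeftInverse.injective (g := (equiv S).toLinearMap.rTensor _ ∘ₗ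
    (assoc k A H _).symm.toLinearMap ∘ₗ (TP.uncons k H).lTensor A) fun x => ?_
  refine LinearMap.congr_fun (f := ((equiv S).toLinearMap.rTensor _ ∘ₗ
    (assoc k A H _).symm.toLinearMap ∘ₗ (TP.uncons k H).lTensor A) ∘ₗ cns S)
    (g := LinearMap.id) (eth_hom_ext S fun b l w => ?_) x
  rw [comp_apply, cns_tmul]
  simp only [comp_apply, lTensor_tmul, TP.uncons_ι_mul, coe_coe,
    assoc_symm_tmul, rTensor_tmul, id_apply]
  rw [equiv_tmul]

theorem cns_inA_smul (a : A) (x : CrossedProduct S ⊗[k] TensorAlgebra k H) :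
    cns S (inA S a • x) = (mulLeft k a).rTensor _ (cns S x) := by
  refine LinearMap.congr_fun (f := cns S ∘ₗ lsm k _ _ (inA S a))
    (g := (mulLeft k a).rTensor _ ∘ₗ cns S) (eth_hom_ext S fun b l w => ?_) x
  simp only [comp_apply, lsm_apply, smul_tmul', smul_eq_mul, ← mul_assoc, ← inA_mul,
    cns_tmul, rTensor_tmul, LinearMap.mulLeft_apply]

theorem unY_boundary (s : ℕ) (y : Y S (s + 1)) :
    unY S s (boundary S s y) = mergeX S (-unY S (s + 1) y) := by
  apply cns_injective S
  rw [cns_unY]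
  refine LinearMap.congr_fun (f := (TP.toTA k (s + 2)).lTensor A ∘ₗ boundary S s)
    (g := cns S ∘ₗ mergeX S ∘ₗ (-unY S (s + 1))) (ext' fun a z => ?_) y
  have h1 : boundary S s (a ⊗ₜ z) = (mulLeft k a).rTensor _
      (∑ i ∈ Finset.range (s + 2), (-1 : k) ^ (i + 1) • S.mergeAt (s + 2) i z) := by
    rw [boundary, LinearMap.sum_apply, map_sum]
    refine Finset.sum_congr rfl fun i _ => ?_
    rw [LinearMap.smul_apply, LinearMap.map_smul]
    refine congrArg _ ?_
    simp only [comp_apply, lTensor_tmul]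
    exact LinearMap.congr_fun (f := (LinearMap.mul' k A).rTensor _ ∘ₗ
      (assoc k A A _).symm.toLinearMap ∘ₗ TensorProduct.mk k _ _ a)
      (g := (mulLeft k a).rTensor _) (ext' fun _ _ => rfl) _
  have h2 : ∀ x : A ⊗[k] ⨂[k]^(s + 2) H, (TP.toTA k (s + 2)).lTensor A
      ((mulLeft k a).rTensor _ x) =
      (mulLeft k a).rTensor _ ((TP.toTA k (s + 2)).lTensor A x) := fun x => by
    rw [← comp_apply, ← comp_apply, LinearMap.rTensor_comp_lTensor,
      LinearMap.lTensor_comp_rTensor]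
  rw [comp_apply, h1, h2, ← merge_toTA_succ]
  refine LinearMap.congr_fun (f := (mulLeft k a).rTensor _ ∘ₗ merge S ∘ₗ
    TP.toTA k (s + 3)) (g := (cns S ∘ₗ mergeX S ∘ₗ (-unY S (s + 1))) ∘ₗ TensorProduct.mk k _ _ a)
    (TP.hom_ext_succ fun h w => ?_) z
  simp only [comp_apply, LinearMap.neg_apply, mk_apply, LinearMap.map_neg]
  rw [TP.toTA_cons, merge_ι_mul, unY_tmul, leftExt_tmul, mul_smul, cns_inA_smul, LinearMap.map_neg,
    cnsH_apply]

theorem pushPow_one_right (s : ℕ) (w : ⨂[k]^s H) : S.pushPow s (w ⊗ₜ 1) = 1 ⊗ₜ w := by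
  have h := congrArg ((TP.comp k H s).lTensor A) (pushT_toTA S s w 1)
  rw [pushT_one_right, lTensor_tmul, TP.comp_toTA_same, ← LinearMap.lTensor_comp_apply,
    show TP.comp k H s ∘ₗ TP.toTA k s = LinearMap.id from LinearMap.ext (TP.comp_toTA_same s),
    LinearMap.lTensor_id] at h
  exact h.symm

theorem mu_envGen (s : ℕ) (h : ⨂[k]^s H) :
    mu S s (envGen h) = 1 ⊗ₜ TP.snoc k (s + 1) (TP.cons k s (1 ⊗ₜ h) ⊗ₜ 1) := by
  have h1 : (equiv S).symm (1 : CrossedProduct S) = 1 ⊗ₜ 1 := rfl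
  rw [envGen_apply, mu]
  simp only [comp_apply, rTensor_tmul, coe_coe, h1,
    assoc_tmul, lTensor_tmul, assoc_symm_tmul,
    map_tmul, pushPow_one_right, LinearMap.mul'_apply, mul_one]

theorem unY_mu_envGen (s : ℕ) (h : ⨂[k]^s H) :
    unY S s (mu S s (envGen h)) = 1 ⊗ₜ (TP.toTA k s h * ι k 1) := by
  apply cns_injective S
  have h1 := cns_inH_tmul S 1 (TP.toTA k s h * ι k 1)
  rw [inH_one] at h1
  rw [cns_unY, mu_envGen, lTensor_tmul, TP.toTA_snoc, TP.toTA_cons, h1, mul_assoc]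

theorem sigmaY_eq (s : ℕ) (y : Y S s) : sigmaY S s y = prV S s (sec S (unY S s y)) := by
  refine LinearMap.congr_fun (f := sigmaY S s) (g := prV S s ∘ₗ sec S ∘ₗ unY S s)
    (ext' fun a z => ?_) y
  refine LinearMap.congr_fun (f := sigmaY S s ∘ₗ TensorProduct.mk k _ _ a)
    (g := (prV S s ∘ₗ sec S ∘ₗ unY S s) ∘ₗ TensorProduct.mk k _ _ a)
    (TP.hom_ext_succ fun h z => ?_) z
  refine LinearMap.congr_fun (f := (sigmaY S s ∘ₗ TensorProduct.mk k _ _ a) ∘ₗ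
    (TP.cons k (s + 1)).toLinearMap ∘ₗ TensorProduct.mk k _ _ h)
    (g := ((prV S s ∘ₗ sec S ∘ₗ unY S s) ∘ₗ TensorProduct.mk k _ _ a) ∘ₗ
      (TP.cons k (s + 1)).toLinearMap ∘ₗ TensorProduct.mk k _ _ h)
    (TP.hom_ext_snoc fun w l => ?_) z
  simp only [comp_apply, mk_apply, coe_coe]
  have h1 : TP.cons k (s + 1) (h ⊗ₜ TP.snoc k s (w ⊗ₜ l)) =
      TP.snoc k (s + 1) (TP.cons k s (h ⊗ₜ w) ⊗ₜ l) := by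
    apply TP.toTA_injective
    rw [TP.toTA_cons, TP.toTA_snoc, TP.toTA_snoc, TP.toTA_cons, mul_assoc]
  rw [unY_tmul, TP.toTA_snoc, sec_tmul, prV_tmul, bot_toTA, h1, ← equiv_tmul]
  simp only [sigmaY, comp_apply, lTensor_tmul, coe_coe,
    symm_apply_apply, rTensor_tmul, assoc_tmul,
    assoc_symm_tmul, map_tmul, flip_apply,
    mk_apply, TP.tprod_zero]

theorem dX_base (s : ℕ) (h : ⨂[k]^(s + 1) H) :
    dX S 0 (s + 1) 0 s (envGen (proj S 0 (s + 1) (h ⊗ₜ PiTensorProduct.tprod k Fin.elim0))) =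
      - sigmaY S s (boundary S s (mu S (s + 1) (envGen h))) := by
  have h1 : mergeX S (-(1 ⊗ₜ (TP.toTA k (s + 1) h * ι k 1))) =
      -mergeE S (TP.toTA k (s + 1) h * ι k 1) := by
    rw [map_neg (mergeX S), leftExt_one_tmul]
  rw [sigmaY_eq, unY_boundary, unY_mu_envGen, h1, map_neg (sec S), map_neg (prV S s), neg_neg,
    sec_mergeE, ← dGen_bot, bot_toTA, TP.tprod_zero, dX_envGen]

theorem isResolutionDifferential_dX : S.IsResolutionDifferential (dX S) where
  left := dX_left S
  right := dX_right S
  zero := dX_zero S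
  base := dX_base S
  recursion := dX_recursion S
  off := dX_off S

/-! ### The contraction of the rows -/

theorem reg_bot_sec (s : ℕ) (l : H) (z : CrossedProduct S ⊗[k] TensorAlgebra k H) :
    reg S 0 s (envMap (bot S s)
      (sec S ((mulRight k (ι k l)).lTensor _ z))) =
      ((TP.toTA k s ∘ₗ TP.comp k H s).lTensor _ z) ⊗ₜ (TP.nil k A ⊗ₜ inH S l) := by
  refine LinearMap.congr_fun (f := reg S 0 s ∘ₗ envMap (bot S s) ∘ₗ sec S ∘ₗ
    (mulRight k (ι k l)).lTensor _)
    (g := (TensorProduct.mk k _ _).flip (TP.nil k A ⊗ₜ inH S l) ∘ₗ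
      (TP.toTA k s ∘ₗ TP.comp k H s).lTensor _) (ext' fun e w => ?_) z
  rw [comp_apply, comp_apply, comp_apply, lTensor_tmul,
    LinearMap.mulRight_apply, sec_tmul]
  rfl

theorem envMap_bot_pi0 (s : ℕ) (x : Env k (CrossedProduct S) (TensorAlgebra k H)) :
    envMap (bot S s) (pi0 S x) =
      envMap (bot S s) x - dRow S 0 s (sigmaRow S 0 s (envMap (bot S s) x)) := by
  apply regroup_injective S (TP.comp_toTA_same s)
  rw [LinearMap.map_sub, reg_dRow, reg_sigmaRow,
    Bar.barD_barS_zero (lA S) (actRₗ S) (lamA S) (lift_lA_lamA S), sub_sub_cancel]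
  refine LinearMap.congr_fun (f := reg S 0 s ∘ₗ envMap (bot S s) ∘ₗ pi0 S)
    (g := Bar.barPi (actRₗ S) (lamA S) ∘ₗ reg S 0 s ∘ₗ envMap (bot S s))
    (env_ext' fun e w e' => ?_) x
  refine LinearMap.congr_fun (f := (reg S 0 s ∘ₗ envMap (bot S s) ∘ₗ pi0 S) ∘ₗ
    TensorProduct.mk k _ _ e ∘ₗ TensorProduct.mk k _ _ w)
    (g := (Bar.barPi (actRₗ S) (lamA S) ∘ₗ reg S 0 s ∘ₗ envMap (bot S s)) ∘ₗ
      TensorProduct.mk k _ _ e ∘ₗ TensorProduct.mk k _ _ w) (crossed_hom_ext S fun b l => ?_) e'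
  have h1 : ∀ w, envMap (bot S s) (e ⊗ₜ (w ⊗ₜ (inA S b * inH S l))) =
      e ⊗ₜ (bot S s w ⊗ₜ (inA S b * inH S l)) := fun w => rfl
  have h3 : ∀ z, e • (mulRight k (ι k l)).lTensor (CrossedProduct S) z =
      (mulRight k (ι k l)).lTensor _ (e • z) :=
    fun z => (lTensor_smul' _ _ _).symm
  simp only [comp_apply, mk_apply]
  rw [star_tmul, dia_apply, h1, h3, reg_bot_sec]
  induction w using TP.ta_toTA_induction with
  | add w w' h h' =>
    simp only [LinearMap.map_add, LinearMap.add_apply, smul_add, add_tmul, tmul_add, h, h']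
  | of m h =>
    rw [pushT_toTA]
    have h4 : (TP.toTA k s ∘ₗ TP.comp k H s).lTensor (CrossedProduct S)
        (e • upA S ((TP.toTA k m).lTensor A (S.pushPow m (h ⊗ₜ b)))) =
        e • upA S ((TP.toTA k s ∘ₗ TP.comp k H s ∘ₗ TP.toTA k m).lTensor A
          (S.pushPow m (h ⊗ₜ b))) := by
      rw [lTensor_smul']
      refine congrArg _ ?_
      exact LinearMap.congr_fun (f := (TP.toTA k s ∘ₗ TP.comp k H s).lTensor _ ∘ₗ upA S ∘ₗ
        (TP.toTA k m).lTensor A) (g := upA S ∘ₗ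
          (TP.toTA k s ∘ₗ TP.comp k H s ∘ₗ TP.toTA k m).lTensor A)
        (ext' fun _ _ => rfl) _
    rw [h4]
    by_cases hm : m = s
    · subst hm
      rw [bot_toTA, regroup_tmul, Bar.barPi, comp_apply, lTensor_tmul,
        Bar.sg_nil, lamA_mul, lTensor_tmul, mk_apply, Bar.nbul_tmul,
        actRₗ_apply, actR_tmul, pushT_toTA,
        show TP.comp k H m ∘ₗ TP.toTA k m = LinearMap.id from LinearMap.ext (TP.comp_toTA_same m),
        LinearMap.comp_id]
    · rw [show TP.comp k H s ∘ₗ TP.toTA k m = 0 from LinearMap.ext (TP.comp_toTA_of_ne hm),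
        LinearMap.comp_zero, LinearMap.lTensor_zero, LinearMap.zero_apply, LinearMap.map_zero,
        smul_zero, zero_tmul, bot_toTA_of_ne S hm, zero_tmul, tmul_zero, LinearMap.map_zero,
        LinearMap.map_zero]

/-- The projections of the entries of the bottom row. -/
def piX (s : ℕ) : X S 0 s →ₗ[k] X S 0 s := LinearMap.id - dX S 1 s 0 s ∘ₗ sigma S 0 s

theorem piX_apply (s : ℕ) (x : X S 0 s) :
    piX S s x = x - dX S 1 s 0 s (sigma S 0 s x) := rfl

theorem piX_prV (s : ℕ) (x : Env k (CrossedProduct S) (TensorAlgebra k H)) :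
    piX S s (prV S s x) = prV S s (pi0 S x) := by
  rw [piX_apply, prV, comp_apply, comp_apply, ← projX_sigmaRow, dX_projX_zero,
    envMap_bot_pi0, LinearMap.map_sub]

theorem dX_dX_zero (r s : ℕ) (x : X S (r + 2) s) :
    dX S (r + 1) s r s (dX S (r + 2) s (r + 1) s x) = 0 := by
  obtain ⟨x, rfl⟩ := projX_surjective S (r + 2) s x
  rw [dX_projX_zero, dX_projX_zero, dRow_dRow, LinearMap.map_zero]

theorem dX_sigma (r s : ℕ) (x : X S (r + 1) s) :
    dX S (r + 2) s (r + 1) s (sigma S (r + 1) s x) + sigma S r s (dX S (r + 1) s r s x) = x := by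
  obtain ⟨x, rfl⟩ := projX_surjective S (r + 1) s x
  rw [← projX_sigmaRow, dX_projX_zero, dX_projX_zero, ← projX_sigmaRow, ← LinearMap.map_add,
    dRow_sigmaRow]

theorem piX_dX (s : ℕ) (x : X S 1 s) : piX S s (dX S 1 s 0 s x) = 0 := by
  have h := congrArg (dX S 1 s 0 s) (dX_sigma S 0 s x)
  rw [LinearMap.map_add, dX_dX_zero, zero_add] at h
  rw [piX_apply, h, sub_self]

theorem isHom_dX (r s r' s' : ℕ) :
    IsHom (envStr k (CrossedProduct S) (Wbar S r s)) (envStr k _ _) (dX S r s r' s') :=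
  (envStr k _ _).isHom_ext _

theorem rowData : Perturb.RowData (dX S) (sigma S) (piX S)
    (fun _ _ => Set.range (envGen (k := k) (B := CrossedProduct S))) where
  off := dX_off S
  d0d0 := dX_dX_zero S
  con := dX_sigma S
  con0 s x := by rw [piX_apply, sub_sub_cancel]
  pi_d0 := piX_dX S
  recursion := by
    rintro r s r' s' hs hn _ ⟨w, rfl⟩
    exact dX_recursion S r s r' s' hs hn w
  pi_d1 s x := by
    obtain ⟨x, rfl⟩ := prV_surjective S (s + 1) x
    rw [dX_prV, piX_prV, piX_prV, dX_prV, piX_prV, pi0_D1_pi0]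
  pi_d1_pi_d1 s x := by
    obtain ⟨x, rfl⟩ := prV_surjective S (s + 2) x
    rw [dX_prV, piX_prV, dX_prV, piX_prV, pi0_D1_pi0_D1, LinearMap.map_zero]
  ext r s r' s' h := by
    refine generates_envGen.hom_ext (c := envStr k _ _) ?_ IsHom.zero fun v => ?_
    · exact IsHom.sum _ fun q _ => (isHom_dX S q.1 q.2 r' s').comp (isHom_dX S r s q.1 q.2)
    · rw [h _ ⟨v, rfl⟩, LinearMap.zero_apply]

/-! ### The contraction of the bottom row -/

/-- `(b # l) ⊗ 𝐡 ⊗ e' ↦ (b # 1) ⊗ (l ⊗ 𝐡) ⊗ e'`. -/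
def jXbar (s : ℕ) : X S 0 s →ₗ[k] X S 0 (s + 1) :=
  TensorProduct.map (inA S) ((((TP.cons k s).toLinearMap ∘ₗ (TP.barMk k H).rTensor _).rTensor _ ∘ₗ
    (assoc k _ _ _).symm.toLinearMap).rTensor _ ∘ₗ
      (assoc k H (Wbar S 0 s) (CrossedProduct S)).symm.toLinearMap) ∘ₗ
    (assoc k A H _).toLinearMap ∘ₗ (equiv S).symm.toLinearMap.rTensor _

theorem jXbar_prV (s : ℕ) (x : Env k (CrossedProduct S) (TensorAlgebra k H)) :
    jXbar S s (prV S s x) = prV S (s + 1) (jX S x) := by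
  refine LinearMap.congr_fun (f := jXbar S s ∘ₗ prV S s) (g := prV S (s + 1) ∘ₗ jX S)
    (eth_hom_ext S fun b l y => ?_) x
  refine LinearMap.congr_fun (f := (jXbar S s ∘ₗ prV S s) ∘ₗ
    TensorProduct.mk k _ _ (inA S b * inH S l)) (g := (prV S (s + 1) ∘ₗ jX S) ∘ₗ
    TensorProduct.mk k _ _ (inA S b * inH S l)) (ext' fun w e' => ?_) y
  simp only [comp_apply, mk_apply]
  have h1 : bot S (s + 1) (ι k l * w) =
      TP.cons k s (l ⊗ₜ TP.comp k H s w) ⊗ₜ TP.nil k A := by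
    rw [bot, comp_apply, TP.comp_succ, TP.uncons_ι_mul]
    rfl
  have h2 : bot S s w = TP.comp k H s w ⊗ₜ TP.nil k A := rfl
  rw [jX_tmul, prV_tmul, prV_tmul, h1, h2, projX_tmul, projX_tmul, TP.barPow_cons, ← equiv_tmul]
  rfl

theorem prV_jX_zero (x : Env k (CrossedProduct S) (TensorAlgebra k H)) :
    prV S 0 (jX S x) = 0 := by
  refine LinearMap.congr_fun (f := prV S 0 ∘ₗ jX S) (g := 0)
    (eth_hom_ext S fun b l y => ?_) x
  refine LinearMap.congr_fun (f := (prV S 0 ∘ₗ jX S) ∘ₗ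
    TensorProduct.mk k _ _ (inA S b * inH S l)) (g := 0) (ext' fun w e' => ?_) y
  simp only [comp_apply, mk_apply]
  rw [jX_tmul, prV_tmul, bot, comp_apply, TP.comp_zero, map_mul (TP.aug k H), TP.aug_ι,
    zero_mul, zero_smul, LinearMap.map_zero, zero_tmul, tmul_zero, LinearMap.map_zero]
  rfl

theorem prV_sec_jj_one (s : ℕ) (e : CrossedProduct S) :
    prV S (s + 1) (sec S (jj S (e ⊗ₜ 1))) = 0 := by
  refine LinearMap.congr_fun (f := prV S (s + 1) ∘ₗ sec S ∘ₗ jj S ∘ₗ (TensorProduct.mk k _ _).flip 1)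
    (g := 0) (crossed_hom_ext S fun b l => ?_) e
  simp only [comp_apply, flip_apply, mk_apply]
  have h1 : ι k l * 1 = 1 * ι k l := by rw [mul_one, one_mul]
  rw [jj_tmul, h1, sec_tmul, prV_tmul, ← TP.toTA_nil, bot_toTA_of_ne S (by omega), zero_tmul,
    tmul_zero, LinearMap.map_zero]
  rfl

/-- The augmentation of `X_*`. -/
def multX : X S 0 0 →ₗ[k] CrossedProduct S :=
  (regular k _).ext (Algebra.linearMap k _ ∘ₗ LinearMap.mul' k k ∘ₗ TensorProduct.map
    (PiTensorProduct.isEmptyEquiv (R := k) (s := fun _ : Fin 0 => TP.Bar k H) (Fin 0)).toLinearMap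
    (PiTensorProduct.isEmptyEquiv (R := k) (s := fun _ : Fin 0 => TP.Bar k A) (Fin 0)).toLinearMap)

theorem multX_tmul (e e' : CrossedProduct S) :
    multX S (e ⊗ₜ ((TP.nil k _ ⊗ₜ TP.nil k _) ⊗ₜ e')) = e * e' := by
  rw [multX, BimodStr.ext_tmul, comp_apply, comp_apply, map_tmul,
    coe_coe, coe_coe, isEmptyEquiv_nil, isEmptyEquiv_nil,
    LinearMap.mul'_apply, mul_one]
  change e * (algebraMap k _ 1 * e') = _
  rw [map_one, one_mul]

theorem multX_prV (x : Env k (CrossedProduct S) (TensorAlgebra k H)) :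
    multX S (prV S 0 x) = eps S x := by
  refine LinearMap.congr_fun (f := multX S ∘ₗ prV S 0) (g := eps S) (env_ext' fun e w e' => ?_) x
  rw [comp_apply, prV_tmul, bot, comp_apply, TP.comp_zero, LinearMap.map_smul,
    ← smul_tmul', tmul_smul, LinearMap.map_smul, LinearMap.map_smul, eps_tmul]
  refine congrArg _ ?_
  rw [flip_apply, mk_apply, projX_tmul, TP.barPow_nil, TP.barPow_nil,
    multX_tmul]

/-- The contracting homotopy of the bottom row. -/
abbrev kappa (s : ℕ) : X S 0 s →ₗ[k] X S 0 (s + 1) := jXbar S s ∘ₗ piX S s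

theorem piX_dX_kappa (s : ℕ) (x : Env k (CrossedProduct S) (TensorAlgebra k H)) :
    piX S s (dX S 0 (s + 1) 0 s (kappa S s (prV S s x))) =
      piX S s (prV S s x) - prV S s (jX S (pi0 S (D1 S x))) -
        prV S s (sec S (jj S (eps S x ⊗ₜ 1))) := by
  rw [comp_apply, piX_prV, jXbar_prV, dX_prV, piX_prV, pi0_D1_jX, LinearMap.map_sub,
    LinearMap.map_sub]

theorem piX_kappa_zero (x : X S 0 0) (hx : multX S x = 0) :
    piX S 0 x = piX S 0 (dX S 0 1 0 0 (kappa S 0 x)) := by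
  obtain ⟨x, rfl⟩ := prV_surjective S 0 x
  rw [multX_prV] at hx
  rw [piX_dX_kappa, prV_jX_zero, hx, zero_tmul, LinearMap.map_zero, LinearMap.map_zero,
    LinearMap.map_zero, sub_zero, sub_zero]

theorem piX_kappa (s : ℕ) (x : X S 0 (s + 1)) (hx : piX S s (dX S 0 (s + 1) 0 s x) = 0) :
    piX S (s + 1) x = piX S (s + 1) (dX S 0 (s + 2) 0 (s + 1) (kappa S (s + 1) x)) := by
  obtain ⟨x, rfl⟩ := prV_surjective S (s + 1) x
  rw [dX_prV, piX_prV] at hx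
  rw [piX_dX_kappa, ← jXbar_prV, hx, prV_sec_jj_one, LinearMap.map_zero, sub_zero, sub_zero]

/-! ### Uniqueness of the differentials -/

variable {S} in
theorem IsResolutionDifferential.unique {d d' : ∀ r s r' s' : ℕ, X S r s →ₗ[k] X S r' s'}
    (h : S.IsResolutionDifferential d) (h' : S.IsResolutionDifferential d') : d = d' := by
  have key : ∀ n r s r' s', r + s = n → d r s r' s' = d' r s r' s' := by
    intro n
    induction n using Nat.strong_induction_on with
    | _ n ihn =>
    intro r s r' s' hn
    obtain ⟨l, hl⟩ : ∃ l, l = s - s' := ⟨_, rfl⟩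
    induction l using Nat.strong_induction_on generalizing r' s' with
    | _ l ihl =>
    by_cases hoff : r + s = r' + s' + 1 ∧ s' ≤ s
    swap
    · rw [h.off _ _ _ _ hoff, h'.off _ _ _ _ hoff]
    refine generates_envGen.hom_ext (b := envStr k _ _) (c := envStr k _ _)
      (fun e x => ⟨h.left r s r' s' e x, h.right r s r' s' e x⟩)
      (fun e x => ⟨h'.left r s r' s' e x, h'.right r s r' s' e x⟩) fun w => ?_
    rcases hoff.2.eq_or_lt with rfl | hs
    · obtain rfl : r = r' + 1 := by omega
      obtain ⟨w, rfl⟩ := proj_surjective S _ _ w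
      rw [h.zero, h'.zero]
    rcases r' with _ | r'
    · obtain rfl : r = 0 := by omega
      obtain rfl : s = s' + 1 := by omega
      obtain ⟨w, rfl⟩ := proj_surjective S _ _ w
      refine LinearMap.congr_fun (f := d 0 (s' + 1) 0 s' ∘ₗ envGen ∘ₗ proj S 0 (s' + 1))
        (g := d' 0 (s' + 1) 0 s' ∘ₗ envGen ∘ₗ proj S 0 (s' + 1))
        (ext' fun x y => ?_) w
      obtain ⟨c, rfl⟩ := TP.zero_eq_smul_nil y
      rw [tmul_smul, LinearMap.map_smul, LinearMap.map_smul]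
      exact congrArg (c • ·) ((h.base s' x).trans (h'.base s' x).symm)
    · rw [h.recursion r s r' s' hs (by omega), h'.recursion r s r' s' hs (by omega)]
      refine congrArg _ (Finset.sum_congr rfl fun q hq => ?_)
      rw [Finset.mem_filter, mem_antidiagonal] at hq
      rw [ihn (q.1 + q.2) (by omega) q.1 q.2 r' s' rfl, ihl (s - q.2) (by omega) q.1 q.2 rfl]
  funext r s r' s'
  exact key _ r s r' s' rfl

section Hat

variable (M : Type*) [AddCommGroup M] [Module k M] [Module (CrossedProduct S) M]
  [Module (CrossedProduct S)ᵐᵒᵖ M]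
  [IsScalarTower k (CrossedProduct S) M] [IsScalarTower k (CrossedProduct S)ᵐᵒᵖ M]

variable {S M} in
theorem IsHatDifferential.unique
    {e e' : ∀ r' s' r s : ℕ, (Wbar S r' s' →ₗ[k] M) →ₗ[k] (Wbar S r s →ₗ[k] M)}
    (h : S.IsHatDifferential M e) (h' : S.IsHatDifferential M e') : e = e' := by
  funext r' s' r s
  by_cases hoff : r + s = r' + s' + 1 ∧ s' ≤ s
  swap
  · rw [h.off _ _ _ _ hoff, h'.off _ _ _ _ hoff]
  refine LinearMap.ext fun φ => LinearMap.ext fun w => ?_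
  obtain ⟨w, rfl⟩ := proj_surjective S _ _ w
  obtain ⟨l, rfl⟩ := Nat.exists_eq_add_of_le hoff.2
  rcases l with _ | _ | m
  · obtain rfl : r = r' + 1 := by omega
    exact (h.zero r' s' φ w).trans (h'.zero r' s' φ w).symm
  · obtain rfl : r = r' := by omega
    exact (h.one r s' φ w).trans (h'.one r s' φ w).symm
  · obtain rfl : r' = r + (m + 1) := by omega
    exact (h.higher m r s' φ w).trans (h'.higher m r s' φ w).symm

/-- The components of the differential of `X̂^*(E, M)`. -/
def dHat (r' s' r s : ℕ) : (Wbar S r' s' →ₗ[k] M) →ₗ[k] (Wbar S r s →ₗ[k] M) :=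
  LinearMap.lcomp k M (dGen S r s r' s') ∘ₗ bimodEvalₗ

theorem dHat_apply (r' s' r s : ℕ) (φ : Wbar S r' s' →ₗ[k] M) (w : Wbar S r s) :
    dHat S M r' s' r s φ w = bimodEval φ (dGen S r s r' s' w) := rfl

theorem bimodEval_projX {r s : ℕ} (φ : Wbar S r s →ₗ[k] M)
    (x : Env k (CrossedProduct S) (W S r s)) :
    bimodEval φ (projX S r s x) = bimodEval (φ ∘ₗ proj S r s) x :=
  LinearMap.congr_fun (f := bimodEval φ ∘ₗ projX S r s) (g := bimodEval (φ ∘ₗ proj S r s))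
    (env_ext' fun e w e' => by
      have h1 : projX S r s (e ⊗ₜ (w ⊗ₜ e')) = e ⊗ₜ (proj S r s w ⊗ₜ e') := rfl
      rw [comp_apply, h1, bimodEval_tmul, bimodEval_tmul, comp_apply]) x

theorem isHatDifferential_dHat : S.IsHatDifferential M (dHat S M) where
  zero r s φ w := by rw [dHat_apply, dGen_proj, envMap_pr_dU_zero, bimodEval_projX]
  one r s φ w := by rw [dHat_apply, dGen_proj, envMap_pr_dU_one, bimodEval_projX]
  higher m r s φ w := by rw [dHat_apply, dGen_proj, envMap_pr_dU_tail, bimodEval_projX]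
  off r' s' r s h := by
    refine LinearMap.ext fun φ => LinearMap.ext fun w => ?_
    have h1 := LinearMap.congr_fun (dX_off S r s r' s' h) (envGen w)
    rw [dX_envGen, LinearMap.zero_apply] at h1
    rw [dHat_apply, h1, LinearMap.map_zero]
    rfl

/-! ### The isomorphism of complexes -/

theorem theta_apply (n : ℕ) (φ : HatTot S M n) (x : XTot S n) :
    theta S M n φ x = ∑ p, bimodEval (φ p) (x p) := by
  simp only [theta, LinearMap.sum_apply]
  rfl

theorem theta_single (n : ℕ) (φ : HatTot S M n) (p : antidiagonal n)
    (y : X S p.1.1 p.1.2) : theta S M n φ (Pi.single p y) = bimodEval (φ p) y := by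
  rw [theta_apply, Finset.sum_eq_single p, Pi.single_eq_same]
  · intro q _ hq
    rw [Pi.single_eq_of_ne hq, LinearMap.map_zero]
  · intro hp
    exact absurd (Finset.mem_univ p) hp

variable [SMulCommClass (CrossedProduct S) (CrossedProduct S)ᵐᵒᵖ M]

theorem theta_injective (n : ℕ) : Function.Injective (theta S M n) := by
  intro φ ψ h
  funext p
  refine bimodEvalₗ_injective (B := CrossedProduct S) (LinearMap.ext fun y => ?_)
  have h1 := LinearMap.congr_fun h (Pi.single p y)
  rwa [theta_single, theta_single] at h1

theorem range_theta (n : ℕ) : LinearMap.range (theta S M n) = S.bimodHom M n := by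
  apply le_antisymm
  · rintro _ ⟨φ, rfl⟩ b x
    rw [theta_apply, theta_apply, theta_apply, Finset.smul_sum, Finset.smul_sum]
    exact ⟨Finset.sum_congr rfl fun p _ => ((moduleStr k _ M).isHom_ext (φ p) b (x p)).1,
      Finset.sum_congr rfl fun p _ => ((moduleStr k _ M).isHom_ext (φ p) b (x p)).2⟩
  · intro g hg
    have h1 : ∀ p : antidiagonal n, ∃ φ : Wbar S p.1.1 p.1.2 →ₗ[k] M,
        bimodEvalₗ φ = g ∘ₗ LinearMap.single k
          (fun p : antidiagonal n => X S p.1.1 p.1.2) p := by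
      intro p
      refine (mem_range_bimodEvalₗ _).2 fun b y => ?_
      have h2 := hg b (Pi.single p y)
      have h3 : (Pi.single p (envLeft b y) : XTot S n) =
          fun q => envLeft b ((Pi.single p y : XTot S n) q) := funext fun q =>
        (Pi.apply_single (fun (q : antidiagonal n) (z : X S q.1.1 q.1.2) =>
          (envLeft b z : X S q.1.1 q.1.2)) (fun _ => LinearMap.map_zero _) p y q).symm
      have h4 : (Pi.single p (envRight b y) : XTot S n) =
          fun q => envRight b ((Pi.single p y : XTot S n) q) := funext fun q =>
        (Pi.apply_single (fun (q : antidiagonal n) (z : X S q.1.1 q.1.2) =>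
          (envRight b z : X S q.1.1 q.1.2)) (fun _ => LinearMap.map_zero _) p y q).symm
      exact ⟨(congrArg g h3).trans h2.1, (congrArg g h4).trans h2.2⟩
    choose φ hφ using h1
    refine ⟨φ, LinearMap.pi_ext fun p y => ?_⟩
    rw [theta_single]
    exact LinearMap.congr_fun (hφ p) y

theorem theta_hatTot (n : ℕ) (φ : HatTot S M n) :
    theta S M (n + 1) (hatTot S M (dHat S M) n φ) = theta S M n φ ∘ₗ dTot S (dX S) n := by
  refine LinearMap.pi_ext fun p y => ?_
  rw [theta_single, comp_apply, theta_apply]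
  have h1 : hatTot S M (dHat S M) n φ p = ∑ q : antidiagonal n,
      dHat S M q.1.1 q.1.2 p.1.1 p.1.2 (φ q) := by
    simp only [hatTot, LinearMap.pi_apply, LinearMap.sum_apply]
    rfl
  rw [h1]
  change bimodEvalₗ _ y = _
  rw [map_sum bimodEvalₗ, LinearMap.sum_apply]
  refine Finset.sum_congr rfl fun q _ => ?_
  have h2 : dTot S (dX S) n (Pi.single p y) q = dX S p.1.1 p.1.2 q.1.1 q.1.2 y :=
    Perturb.tot_single (dX S) n p q y
  rw [h2]
  exact (LinearMap.congr_fun (bimodEval_comp_ext (φ q) (dGen S p.1.1 p.1.2 q.1.1 q.1.2)) y).symm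

theorem dTot_dTot (n : ℕ) : S.dTot (dX S) n ∘ₗ S.dTot (dX S) (n + 1) = 0 := (rowData S).tot_tot n

theorem hatTot_hatTot (n : ℕ) :
    S.hatTot M (dHat S M) (n + 1) ∘ₗ S.hatTot M (dHat S M) n = 0 := by
  refine LinearMap.ext fun φ => theta_injective S M _ ?_
  rw [comp_apply, theta_hatTot, theta_hatTot, LinearMap.comp_assoc, dTot_dTot,
    LinearMap.comp_zero, LinearMap.zero_apply, LinearMap.map_zero]

end Hat

end CrossedSystem

namespace BimodStr

variable {k B ι : Type*} [CommRing k] [Ring B] [Algebra k B]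

/-- The product of a family of bimodules. -/
def pi {P : ι → Type*} [∀ i, AddCommGroup (P i)] [∀ i, Module k (P i)]
    (b : ∀ i, BimodStr k B (P i)) : BimodStr k B (∀ i, P i) where
  l :=
    { toFun e := LinearMap.pi fun i => (b i).l e ∘ₗ LinearMap.proj i
      map_add' e e' := LinearMap.ext fun x => funext fun i =>
        LinearMap.congr_fun ((b i).l.map_add e e') (x i)
      map_smul' c e := LinearMap.ext fun x => funext fun i =>
        LinearMap.congr_fun ((b i).l.map_smul c e) (x i) }
  r :=
    { toFun e := LinearMap.pi fun i => (b i).r e ∘ₗ LinearMap.proj i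
      map_add' e e' := LinearMap.ext fun x => funext fun i =>
        LinearMap.congr_fun ((b i).r.map_add e e') (x i)
      map_smul' c e := LinearMap.ext fun x => funext fun i =>
        LinearMap.congr_fun ((b i).r.map_smul c e) (x i) }
  l_one x := funext fun i => (b i).l_one (x i)
  r_one x := funext fun i => (b i).r_one (x i)
  l_mul e e' x := funext fun i => (b i).l_mul e e' (x i)
  r_mul e e' x := funext fun i => (b i).r_mul e e' (x i)
  comm e e' x := funext fun i => (b i).comm e e' (x i)

theorem isHom_proj {P : ι → Type*} [∀ i, AddCommGroup (P i)] [∀ i, Module k (P i)]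
    (b : ∀ i, BimodStr k B (P i)) (i : ι) : IsHom (pi b) (b i) (LinearMap.proj i) :=
  fun _ _ => ⟨rfl, rfl⟩

theorem isHom_pi {P : ι → Type*} [∀ i, AddCommGroup (P i)] [∀ i, Module k (P i)]
    {b : ∀ i, BimodStr k B (P i)} {Q : Type*} [AddCommGroup Q] [Module k Q] {c : BimodStr k B Q}
    {f : ∀ i, Q →ₗ[k] P i} (h : ∀ i, IsHom c (b i) (f i)) : IsHom c (pi b) (LinearMap.pi f) :=
  fun e x => ⟨funext fun i => (h i e x).1, funext fun i => (h i e x).2⟩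

universe u v

theorem relFree_pi {k : Type u} {B : Type v} {ι : Type} [CommRing k] [Ring B] [Algebra k B]
    [Fintype ι] [DecidableEq ι] (V : ι → Type (max u v w)) [∀ i, AddCommGroup (V i)]
    [∀ i, Module k (V i)] :
    RelFree (pi fun i => envStr k B (V i)) := by
  have h1 : ∀ (i : ι) (e e' : B) (v : V i),
      (Pi.single i (e ⊗ₜ (v ⊗ₜ e')) : ∀ i, Env k B (V i)) =
      (pi fun i => envStr k B (V i)).l e ((pi fun i => envStr k B (V i)).r e'
        ((LinearMap.pi fun j => envGen ∘ₗ LinearMap.proj j :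
          (∀ i, V i) →ₗ[k] ∀ i, Env k B (V i)) (Pi.single i v))) := by
    intro i e e' v
    funext j
    change _ = (envStr k B (V j)).l e ((envStr k B (V j)).r e' (envGen ((Pi.single i v : ∀ i, V i) j)))
    rw [← env_tmul_eq]
    exact (Pi.apply_single (fun i (v : V i) => (e ⊗ₜ (v ⊗ₜ e') : Env k B (V i)))
      (fun _ => by rw [zero_tmul, tmul_zero]) i v j).symm
  refine ⟨∀ i, V i, inferInstance, inferInstance, LinearMap.pi fun i => envGen ∘ₗ LinearMap.proj i,
    ?_, fun N _ _ c φ => ⟨∑ i, c.ext (φ ∘ₗ LinearMap.single k V i) ∘ₗ LinearMap.proj i,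
      IsHom.sum _ fun i _ => (c.isHom_ext _).comp (isHom_proj _ i), fun v => ?_⟩⟩
  · rw [Generates, eq_top_iff]
    rintro x -
    rw [← LinearMap.sum_single_apply _ x]
    refine Submodule.sum_mem _ fun i _ => ?_
    generalize x i = y
    induction y using TensorProduct.induction_on with
    | zero => rw [Pi.single_zero]; exact zero_mem _
    | add y y' h h' => rw [Pi.single_add]; exact add_mem h h'
    | tmul e y =>
      induction y using TensorProduct.induction_on with
      | zero => rw [tmul_zero, Pi.single_zero]; exact zero_mem _
      | add y y' h h' => rw [tmul_add, Pi.single_add]; exact add_mem h h'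
      | tmul v e' => exact Submodule.subset_span ⟨e, e', Pi.single i v, h1 i e e' v⟩
  · rw [LinearMap.sum_apply]
    conv_rhs => rw [← LinearMap.sum_single_apply _ v, map_sum φ]
    refine Finset.sum_congr rfl fun i _ => ?_
    exact c.ext_envGen _ _

end BimodStr

namespace Perturb

theorem cmp_sgl {k : Type*} [CommRing k] {X : ℕ → ℕ → Type*} [∀ r s, AddCommGroup (X r s)]
    [∀ r s, Module k (X r s)] {n : ℕ} (r s : ℕ) (h : r + s = n) (y : X r s) :
    cmp (k := k) r s h (sgl (k := k) r s h y : Tot X n) = y := by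
  rw [sgl, cmp, LinearMap.proj_apply, LinearMap.coe_single, Pi.single_eq_same]

end Perturb

namespace CrossedSystem

open CrossedProduct BimodStr

variable {k A H : Type*} [CommRing k] [Ring A] [Algebra k A] [Ring H] [Bialgebra k H]
  (S : CrossedSystem k A H)

/-! ### The resolution -/

theorem eps_tl (w : TensorAlgebra k H) : eps S (tl S w) = -inH S (TP.deg1 k H w) := by
  rw [← map_neg (inH S)]
  refine LinearMap.congr_fun (f := eps S ∘ₗ tl S) (g := inH S ∘ₗ (-TP.deg1 k H))
    (TP.ta_hom_ext_snoc ?_ fun w l => ?_) w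
  · rw [comp_apply, comp_apply, tl_one, LinearMap.neg_apply, TP.deg1_one,
      neg_zero, LinearMap.map_zero, LinearMap.map_zero]
  · rw [comp_apply, comp_apply, tl_mul_ι, LinearMap.neg_apply,
      map_neg (eps S), map_neg (inH S), eps_tmul, one_mul, ← LinearMap.map_smul]
    refine congrArg (fun z => -inH S z) ?_
    induction w using TP.ta_toTA_induction with
    | add w w' h h' =>
      rw [map_add (TP.sgn k H), map_add (TP.aug k H), add_smul, add_mul, LinearMap.map_add, h, h']
    | of n w =>
      rcases n with _ | n
      · obtain ⟨c, rfl⟩ := TP.zero_eq_smul_nil w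
        rw [LinearMap.map_smul, TP.toTA_nil, smul_mul_assoc, one_mul, LinearMap.map_smul,
          TP.deg1_ι, map_smul (TP.sgn k H), map_one (TP.sgn k H), map_smul (TP.aug k H),
          map_one (TP.aug k H), smul_eq_mul, mul_one]
      · rw [← TP.toTA_snoc, TP.deg1_toTA_of_ne (by omega), TP.sgn_toTA, map_smul (TP.aug k H)]
        have h1 : (TP.aug k H).toLinearMap ∘ₗ TP.toTA k (n + 1) = 0 := TP.hom_ext_succ fun v w => by
          rw [comp_apply, TP.toTA_cons, toLinearMap_apply, map_mul (TP.aug k H),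
            TP.aug_ι, zero_mul]
          rfl
        have h2 : TP.aug k H (TP.toTA k (n + 1) w) = 0 := LinearMap.congr_fun h1 w
        rw [h2, smul_zero, zero_smul]

theorem eps_envL (y : CrossedProduct S ⊗[k] TensorAlgebra k H) : eps S (envL y) = augE S y := by
  refine LinearMap.congr_fun (f := eps S ∘ₗ envL) (g := augE S)
    (ext' fun e w => ?_) y
  have h1 : (envL (e ⊗ₜ w) : Env k (CrossedProduct S) (TensorAlgebra k H)) = e ⊗ₜ (w ⊗ₜ 1) := rfl
  rw [comp_apply, h1, eps_tmul, mul_one]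
  rfl

theorem eps_D1 (x : Env k (CrossedProduct S) (TensorAlgebra k H)) : eps S (D1 S x) = 0 := by
  refine LinearMap.congr_fun (f := eps S ∘ₗ D1 S) (g := 0) (env_ext' fun e w e' => ?_) x
  have h3 : ∀ y, eps S (envLeft e (envRight e' y)) = e * (eps S y * e') := fun y =>
    (((regular k _).isHom_ext _ e (envRight e' y)).1.trans
      (congrArg (e * ·) ((regular k _).isHom_ext _ e' y).2))
  rw [comp_apply, D1_tmul, h3, LinearMap.map_add, eps_tl, eps_envL, augE_mergeE, add_neg_cancel,
    zero_mul, mul_zero, LinearMap.zero_apply]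

theorem isHom_multX : IsHom (envStr k _ _) (regular k _) (multX S) := (regular k _).isHom_ext _

theorem delta0_nil (a : A) : delta0 S 0 0 (TP.nil k H ⊗ₜ TP.cons k 0 (a ⊗ₜ TP.nil k A)) =
    inA S a ⊗ₜ ((TP.nil k H ⊗ₜ TP.nil k A) ⊗ₜ 1) +
      (-1 : k) ^ (0 + 1) • (1 ⊗ₜ ((TP.nil k H ⊗ₜ TP.nil k A) ⊗ₜ inA S a)) := by
  have h1 : (TP.snoc k 0).symm (TP.cons k 0 (a ⊗ₜ TP.nil k A)) = TP.nil k A ⊗ₜ a := by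
    rw [LinearEquiv.symm_apply_eq]
    apply TP.toTA_injective
    rw [TP.toTA_cons, TP.toTA_snoc, TP.toTA_nil, mul_one, one_mul]
  rw [delta0, Finset.sum_range_zero, add_zero, LinearMap.add_apply, LinearMap.smul_apply]
  refine congrArg₂ (· + ·) ?_ (congrArg _ ?_)
  · simp only [comp_apply, lTensor_tmul, coe_coe,
      symm_apply_apply, assoc_symm_tmul, rTensor_tmul]
    rfl
  · simp only [comp_apply, lTensor_tmul, coe_coe, h1,
      assoc_symm_tmul]
    rfl

theorem multX_dX_zero (x : X S 1 0) : multX S (dX S 1 0 0 0 x) = 0 := by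
  refine LinearMap.congr_fun (f := multX S ∘ₗ dX S 1 0 0 0) (g := 0)
    (generates_envGen.hom_ext ((isHom_multX S).comp (isHom_dX S 1 0 0 0)) IsHom.zero fun w => ?_) x
  obtain ⟨w, rfl⟩ := proj_surjective S _ _ w
  rw [comp_apply, dX_zero, LinearMap.zero_apply]
  refine LinearMap.congr_fun (f := multX S ∘ₗ projX S 0 0 ∘ₗ delta0 S 0 0) (g := 0)
    (ext' fun h y => ?_) w
  obtain ⟨c, rfl⟩ := TP.zero_eq_smul_nil h
  rw [← smul_tmul', LinearMap.map_smul, LinearMap.zero_apply]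
  refine Eq.trans (congrArg _ ?_) (smul_zero c)
  refine LinearMap.congr_fun (f := (multX S ∘ₗ projX S 0 0 ∘ₗ delta0 S 0 0) ∘ₗ
    TensorProduct.mk k _ _ (TP.nil k H)) (g := 0) (TP.hom_ext_succ fun a y => ?_) y
  obtain ⟨c, rfl⟩ := TP.zero_eq_smul_nil y
  rw [tmul_smul, LinearEquiv.map_smul, LinearMap.map_smul, LinearMap.zero_apply]
  refine Eq.trans (congrArg _ ?_) (smul_zero c)
  rw [comp_apply, mk_apply, comp_apply, comp_apply,
    delta0_nil, LinearMap.map_add, LinearMap.map_add, LinearMap.map_smul, LinearMap.map_smul,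
    projX_tmul, projX_tmul, TP.barPow_nil, TP.barPow_nil, multX_tmul, multX_tmul, mul_one, one_mul,
    zero_add, pow_one, neg_one_smul, add_neg_cancel]

theorem multX_dX_one (x : X S 0 1) : multX S (dX S 0 1 0 0 x) = 0 := by
  obtain ⟨x, rfl⟩ := prV_surjective S 1 x
  rw [dX_prV, multX_prV, eps_D1]

/-- The augmentation of `X_*`. -/
def augTot : XTot S 0 →ₗ[k] CrossedProduct S := multX S ∘ₗ Perturb.cmp (k := k) 0 0 rfl

theorem augTot_dTot (x : XTot S 1) : augTot S (dTot S (dX S) 0 x) = 0 := by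
  refine LinearMap.congr_fun (f := augTot S ∘ₗ dTot S (dX S) 0) (g := 0)
    (LinearMap.pi_ext fun p y => ?_) x
  have h1 : ∀ (r s : ℕ) (h : r + s = 1) (y : X S r s), multX S (dX S r s 0 0 y) = 0 := by
    intro r s h y
    rcases r with _ | r
    · obtain rfl : s = 1 := by omega
      exact multX_dX_one S y
    · obtain rfl : r = 0 := by omega
      obtain rfl : s = 0 := by omega
      exact multX_dX_zero S y
  have h2 : dTot S (dX S) 0 (Pi.single p y)
      ⟨(0, 0), mem_antidiagonal.2 rfl⟩ = dX S p.1.1 p.1.2 0 0 y :=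
    Perturb.tot_single (dX S) 0 p _ y
  exact (congrArg (multX S) h2).trans
    (h1 _ _ (mem_antidiagonal.1 p.2) y)

/-- The bimodule structure of `X_n`. -/
def strTot (n : ℕ) : BimodStr k (CrossedProduct S) (XTot S n) :=
  BimodStr.pi fun p => envStr k (CrossedProduct S) (Wbar S p.1.1 p.1.2)

theorem isHom_dTot (n : ℕ) : IsHom (strTot S (n + 1)) (strTot S n) (dTot S (dX S) n) :=
  isHom_pi fun q => IsHom.sum _ fun p _ => (isHom_dX S p.1.1 p.1.2 q.1.1 q.1.2).comp
    (isHom_proj (fun p : antidiagonal (n + 1) =>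
      envStr k (CrossedProduct S) (Wbar S p.1.1 p.1.2)) p)

theorem isHom_augTot : IsHom (strTot S 0) (regular k _) (augTot S) := fun e x =>
  isHom_multX S e (Perturb.cmp (k := k) 0 0 rfl x)

/-- The cycles of `X_*`. -/
def cycTot : ∀ n, Submodule k (XTot S n)
  | 0 => LinearMap.ker (augTot S)
  | n + 1 => LinearMap.ker (dTot S (dX S) n)

theorem exists_split_cycTot (n : ℕ) : ∃ t : cycTot S n →ₗ[k] XTot S (n + 1),
    ∀ x, dTot S (dX S) n (t x) = x := by
  obtain ⟨ψ, hψ⟩ := (rowData S).exact (kappa S) (fun x => multX S x = 0) (piX_kappa_zero S)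
    (piX_kappa S) n (cycTot S n).subtype (by rintro n' rfl v; exact v.2)
    (by rintro rfl v; exact v.2)
  exact ⟨ψ, LinearMap.congr_fun hψ⟩

theorem augTot_sgl (b : CrossedProduct S) :
    augTot S ((Perturb.sgl (k := k) 0 0 rfl ∘ₗ
      (TensorProduct.mk k _ _).flip ((TP.nil k _ ⊗ₜ TP.nil k _) ⊗ₜ 1)) b) = b := by
  rw [augTot, comp_apply, comp_apply, Perturb.cmp_sgl, flip_apply,
    mk_apply, multX_tmul, mul_one]

/-- The resolution `X_*` of `E`. -/
def resX : SplitRes k (CrossedProduct S) (XTot S) where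
  str := strTot S
  d := dTot S (dX S)
  aug := augTot S
  cyc := cycTot S
  cyc_zero := rfl
  cyc_succ _ := rfl
  free n := relFree_pi _
  d_hom := isHom_dTot S
  aug_hom := isHom_augTot S
  d_mem n x := by
    rcases n with _ | n
    · exact augTot_dTot S x
    · exact LinearMap.congr_fun (dTot_dTot S n) x
  aug_split := ⟨Perturb.sgl (k := k) 0 0 rfl ∘ₗ
    (TensorProduct.mk k _ _).flip ((TP.nil k _ ⊗ₜ TP.nil k _) ⊗ₜ 1), augTot_sgl S⟩
  split := exists_split_cycTot S

theorem mem_bimodHom_iff (M : Type*) [AddCommGroup M] [Module k M]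
    [Module (CrossedProduct S) M] [Module (CrossedProduct S)ᵐᵒᵖ M]
    [SMulCommClass (CrossedProduct S) (CrossedProduct S)ᵐᵒᵖ M]
    [IsScalarTower k (CrossedProduct S) M] [IsScalarTower k (CrossedProduct S)ᵐᵒᵖ M] (n : ℕ)
    (g : XTot S n →ₗ[k] M) :
    g ∈ S.bimodHom M n ↔ IsHom (strTot S n) (moduleStr k (CrossedProduct S) M) g :=
  ⟨fun h e x => h e x, fun h e x => h e x⟩

theorem nonempty_hochschildCohomology_equiv (M : Type*) [AddCommGroup M] [Module k M]
    [Module (CrossedProduct S) M] [Module (CrossedProduct S)ᵐᵒᵖ M]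
    [SMulCommClass (CrossedProduct S) (CrossedProduct S)ᵐᵒᵖ M]
    [IsScalarTower k (CrossedProduct S) M] [IsScalarTower k (CrossedProduct S)ᵐᵒᵖ M] (n : ℕ) :
    Nonempty (HochschildCohomology k (CrossedProduct S) M n ≃ₗ[k]
      Cohomology (S.hatTot M (dHat S M)) n) := by
  refine SplitRes.nonempty_cohomology_equiv (barRes k (CrossedProduct S)) (resX S)
    (moduleStr k (CrossedProduct S) M) (hochschildD k (CrossedProduct S) M) (S.hatTot M (dHat S M))
    (fun n => bimodEvalₗ) (theta S M) (fun n => bimodEvalₗ_injective) (theta_injective S M)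
    (fun n g => mem_range_bimodEvalₗ g) (fun n g => ?_) (fun n φ => ?_) (theta_hatTot S M) n
  · rw [range_theta]
    exact mem_bimodHom_iff S M n g
  · exact (bimodEval_comp_ext φ (hochschildDelta k _ n)).symm

end CrossedSystem

end

theorem theorem2p2p1 {k A H : Type*} [CommRing k] [Ring A] [Algebra k A] [Ring H]
    [HopfAlgebra k H] (S : CrossedSystem k A H)
    (M : Type*) [AddCommGroup M] [Module k M] [Module (CrossedProduct S) M]
    [Module (CrossedProduct S)ᵐᵒᵖ M] [SMulCommClass (CrossedProduct S) (CrossedProduct S)ᵐᵒᵖ M]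
    [IsScalarTower k (CrossedProduct S) M] [IsScalarTower k (CrossedProduct S)ᵐᵒᵖ M] :
    (∃! d : ∀ r s r' s' : ℕ, S.X r s →ₗ[k] S.X r' s', S.IsResolutionDifferential d) ∧
    (∃! e : ∀ r' s' r s : ℕ, (S.Wbar r' s' →ₗ[k] M) →ₗ[k] (S.Wbar r s →ₗ[k] M),
      S.IsHatDifferential M e) ∧
    ∀ (d : ∀ r s r' s' : ℕ, S.X r s →ₗ[k] S.X r' s')
      (e : ∀ r' s' r s : ℕ, (S.Wbar r' s' →ₗ[k] M) →ₗ[k] (S.Wbar r s →ₗ[k] M)),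
      S.IsResolutionDifferential d → S.IsHatDifferential M e →
      -- `(X_*, d_*)` and `X̂^*(E, M)` are complexes
      (∀ n, S.dTot d n ∘ₗ S.dTot d (n + 1) = 0) ∧
      (∀ n, S.hatTot M e (n + 1) ∘ₗ S.hatTot M e n = 0) ∧
      -- `θ̂ : X̂^*(E, M) → Hom_{E^e}((X_*, d_*), M)` is an isomorphism of complexes
      (∀ n, Function.Injective (S.theta M n) ∧
        LinearMap.range (S.theta M n) = S.bimodHom M n) ∧
      (∀ n (φ : S.HatTot M n),
        S.theta M (n + 1) (S.hatTot M e n φ) = S.theta M n φ ∘ₗ S.dTot d n) ∧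
      -- the cohomology of `X̂^*(E, M)` is the Hochschild cohomology of `E`
      ∀ n, Nonempty (HochschildCohomology k (CrossedProduct S) M n ≃ₗ[k]
        Cohomology (S.hatTot M e) n) := by
  refine ⟨⟨S.dX, S.isResolutionDifferential_dX, fun d hd => hd.unique S.isResolutionDifferential_dX⟩,
    ⟨S.dHat M, S.isHatDifferential_dHat M, fun e he => he.unique (S.isHatDifferential_dHat M)⟩,
    fun d e hd he => ?_⟩
  obtain rfl := hd.unique S.isResolutionDifferential_dX
  obtain rfl := he.unique (S.isHatDifferential_dHat M)
  exact ⟨S.dTot_dTot, S.hatTot_hatTot M, fun n => ⟨S.theta_injective M n, S.range_theta M n⟩,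
    S.theta_hatTot M, S.nonempty_hochschildCohomology_equiv M⟩
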